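/- Let $H=(H,\Delta,\varepsilon,\Phi,S,\alpha,\beta)$ be a quasi-Hopf algebra over a field $k$ (with $S$ an anti-automorphism of the algebra $H$), and write $\Phi=X^1\otimes X^2\otimes X^3$, $\Phi^{-1}=x^1\otimes x^2\otimes x^3$, $\Delta(h)=h_1\otimes h_2$ (summations understood). Put $$p_R=p^1\otimes p^2=x^1\otimes x^2\beta S(x^3),\qquad q_R=q^1\otimes q^2=X^1\otimes S^{-1}(\alpha X^3)X^2,$$ $$p_L=\tilde p^1\otimes\tilde p^2=X^2S^{-1}(X^1\beta)\otimes X^3,\qquad q_L=\tilde q^1\otimes\tilde q^2=S(x^1)\alpha x^2\otimes x^3,$$ and let $f=f^1\otimes f^2$ be the Drinfeld twist, with inverse $f^{-1}=g^1\otimes g^2$: $$f=(S\otimes S)(\Delta^{\rm op}(x^1))\,\gamma\,\Delta(x^2\beta S(x^3)),\qquad f^{-1}=\Delta(S(x^1)\alpha x^2)\,\delta\,(S\otimes S)(\Delta^{\rm op}(x^3)),$$ where $\gamma=S(A^2)\alpha A^3\otimes S(A^1)\alpha A^4$ with $A^1\otimes A^2\otimes A^3\otimes A^4=(\Phi\otimes1)(\Delta\otimes{\rm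 id}\otimes{\rm id})(\Phi^{-1})$, and $\delta=B^1\beta S(B^4)\otimes B^2\beta S(B^3)$ with $B^1\otimes B^2\otimes B^3\otimes B^4=(\Delta\otimes{\rm id}\otimes{\rm id})(\Phi)(\Phi^{-1}\otimes1)$. A left Yetter-Drinfeld module over $H$ is a left $H$-module $M$ with a $k$-linear map $\lambda_M:M\to H\otimes M$, $\lambda_M(m)=m_{(-1)}\otimes m_{(0)}$, such that, for all $h\in H$, $m\in M$ (with $\Phi=Y^1\otimes Y^2\otimes Y^3$ a second copy of $\Phi$), $$X^1m_{(-1)}\otimes(X^2\cdot m_{(0)})_{(-1)}X^3\otimes(X^2\cdot m_{(0)})_{(0)}=X^1(Y^1\cdot m)_{(-1)_1}Y^2\otimes X^2(Y^1\cdot m)_{(-1)_2}Y^3\otimes X^3\cdot(Y^1\cdot m)_{(0)},$$ $$\varepsilon(m_{(-1)})m_{(0)}=m,\qquad h_1m_{(-1)}\otimes h_2\cdot m_{(0)}=(h_1\cdot m)_{(-1)}h_2\otimes(h_1\cdot m)_{(0)}.$$ Morphisms are the $k$-linear maps preserving action and coaction. The tensor product $M\otimes N$ has action $h\cdot(m\otimes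 n)=h_1\cdot m\otimes h_2\cdot n$ and coaction $$m\otimes n\mapsto X^1(x^1Y^1\cdot m)_{(-1)}x^2(Y^2\cdot n)_{(-1)}Y^3\otimes X^2\cdot(x^1Y^1\cdot m)_{(0)}\otimes X^3x^3\cdot(Y^2\cdot n)_{(0)},$$ and $c_{M,N}:M\otimes N\to N\otimes M$, $c_{M,N}(m\otimes n)=m_{(-1)}\cdot n\otimes m_{(0)}$, is the braiding. For finite-dimensional $M$ with dual bases $({}_im)$, $({}^im)$ the left dual $M^*$ and the right dual ${}^*M$ are ${\rm Hom}(M,k)$ with $(h\cdot m^*)(m)=m^*(S(h)\cdot m)$, $(h\cdot{}^*m)(m)={}^*m(S^{-1}(h)\cdot m)$ and coactions $$\lambda_{M^*}(m^*)=\langle m^*,f^2\cdot(g^1\cdot{}_im)_{(0)}\rangle\,S^{-1}(f^1(g^1\cdot{}_im)_{(-1)}g^2)\otimes{}^im,$$ $$\lambda_{{}^*M}({}^*m)=\langle{}^*m,S^{-1}(f^1)\cdot(S^{-1}(g^2)\cdot{}_im)_{(0)}\rangle\,g^1S((S^{-1}(g^2)\cdot{}_im)_{(-1)})f^2\otimes{}^im.$$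 Let $M,N$ be finite-dimensional left Yetter-Drinfeld modules over $H$, with dual bases $({}_im)$, $({}^im)$ of $M$, $M^*$ and $({}_jn)$, $({}^jn)$ of $N$, $N^*$. (1) $M^*\otimes N^*$ and $(M\otimes N)^*$ are Yetter-Drinfeld modules, and the map $\sigma^*_{M,N}:M^*\otimes N^*\to(M\otimes N)^*$ defined by $$\sigma^*_{M,N}(m^*\otimes n^*)(m\otimes n)=\langle m^*,f^2\tilde q^2_2X^3S^{-1}(\tilde q^1X^1(p^1\cdot n)_{(-1)}p^2)\cdot m\rangle\langle n^*,f^1\tilde q^2_1X^2\cdot(p^1\cdot n)_{(0)}\rangle$$ is an isomorphism of Yetter-Drinfeld modules, with inverse $$\sigma^{*-1}_{M,N}(\mu)=\langle\mu,(g^1\cdot{}_jn)_{(-1)}g^2\cdot{}_im\otimes(g^1\cdot{}_jn)_{(0)}\rangle\,{}^im\otimes{}^jn.$$ Moreover $c_{N^*,M^*}$ is bijective and $\sigma^*_{M,N}=\phi^*_{N,M}\circ c^{-1}_{N^*,M^*}$, where $\phi^*_{N,M}:N^*\otimes M^*\to(M\otimes N)^*$ is the canonical composition $$N^*\otimes M^*\to(N^*\otimes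 M^*)\otimes((M\otimes N)\otimes(M\otimes N)^*)\to((N^*\otimes M^*)\otimes(M\otimes N))\otimes(M\otimes N)^*$$ $$\to(N^*\otimes((M^*\otimes M)\otimes N))\otimes(M\otimes N)^*\to(N^*\otimes N)\otimes(M\otimes N)^*\to(M\otimes N)^*$$ built from ${\rm coev}_V(1)=\beta\cdot v_i\otimes v^i$ for $V=M\otimes N$, the associativity constraints $(u\otimes v)\otimes w\mapsto X^1\cdot u\otimes(X^2\cdot v\otimes X^3\cdot w)$ and their inverses, and ${\rm ev}_V(\varphi\otimes v)=\varphi(\alpha\cdot v)$ for $V=M$ and $V=N$. (2) ${}^*M\otimes{}^*N$ and ${}^*(M\otimes N)$ are Yetter-Drinfeld modules, and the map ${}^*\sigma_{M,N}:{}^*M\otimes{}^*N\to{}^*(M\otimes N)$ defined by $${}^*\sigma_{M,N}({}^*m\otimes{}^*n)(m\otimes n)=\langle{}^*m,S^{-1}(f^2q^1(x^1\tilde p^1S^{-1}(f^1)\cdot n)_{(-1)}x^2\tilde p^2_1)\cdot m\rangle\langle{}^*n,S^{-1}(x^3\tilde p^2_2)q^2\cdot(x^1\tilde p^1S^{-1}(f^1)\cdot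 n)_{(0)}\rangle$$ is an isomorphism of Yetter-Drinfeld modules, with inverse $${}^*\sigma^{-1}_{M,N}(\nu)=\langle\nu,(S^{-1}(g^2)\cdot{}_jn)_{(-1)}S^{-1}(g^1)\cdot{}_im\otimes(S^{-1}(g^2)\cdot{}_jn)_{(0)}\rangle\,{}^im\otimes{}^jn.$$ Moreover $c_{{}^*N,{}^*M}$ is bijective and ${}^*\sigma_{M,N}={}^*\phi_{N,M}\circ c^{-1}_{{}^*N,{}^*M}$, where ${}^*\phi_{N,M}:{}^*N\otimes{}^*M\to{}^*(M\otimes N)$ is the analogous canonical composition $${}^*N\otimes{}^*M\to({}^*(M\otimes N)\otimes(M\otimes N))\otimes({}^*N\otimes{}^*M)\to{}^*(M\otimes N)\otimes(M\otimes(N\otimes({}^*N\otimes{}^*M)))$$ $$\to{}^*(M\otimes N)\otimes(M\otimes((N\otimes{}^*N)\otimes{}^*M))\to{}^*(M\otimes N)\otimes(M\otimes{}^*M)\to{}^*(M\otimes N)$$ built from ${\rm coev}'_V(1)=v^i\otimes S^{-1}(\beta)\cdot v_i$ for $V=M\otimes N$, the associativity constraints and their inverses, and ${\rm ev}'_V(v\otimes\varphi)=\varphi(S^{-1}(\alpha)\cdot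 v)$ for $V=N$ and $V=M$. -/

import Mathlib

open scoped TensorProduct

noncomputable section

namespace QuasiHopf

/-! ### Multilinear expressions in tensor components -/

section Lifts

variable {k A B C D V : Type*} [CommSemiring k]
  [AddCommMonoid A] [Module k A] [AddCommMonoid B] [Module k B]
  [AddCommMonoid C] [Module k C] [AddCommMonoid D] [Module k D]
  [AddCommMonoid V] [Module k V]

/-- The linear map `a ⊗ b ↦ F a b` on `A ⊗ B` for a function `F` that is linear in each variable. -/
def lift2 (F : A → B → V)
    (h : (∀ b, IsLinearMap k fun a => F a b) ∧ (∀ a, IsLinearMap k fun b => F a b)) :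
    A ⊗[k] B →ₗ[k] V :=
  TensorProduct.lift (LinearMap.mk₂ k F (fun a a' b => (h.1 b).map_add a a')
    (fun c a b => (h.1 b).map_smul c a) (fun a b b' => (h.2 a).map_add b b')
    (fun c a b => (h.2 a).map_smul c b))

@[simp] theorem lift2_tmul (F : A → B → V)
    (h : (∀ b, IsLinearMap k fun a => F a b) ∧ (∀ a, IsLinearMap k fun b => F a b))
    (a : A) (b : B) : lift2 F h (a ⊗ₜ[k] b) = F a b := rfl

/-- The linear map `a ⊗ (b ⊗ c) ↦ F a b c` for a function `F` that is linear in each variable. -/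
def lift3 (F : A → B → C → V)
    (h : (∀ b c, IsLinearMap k fun a => F a b c) ∧ (∀ a c, IsLinearMap k fun b => F a b c) ∧
      (∀ a b, IsLinearMap k fun c => F a b c)) :
    A ⊗[k] (B ⊗[k] C) →ₗ[k] V :=
  lift2 (fun a t => lift2 (F a) ⟨h.2.1 a, h.2.2 a⟩ t)
    ⟨fun t => by
      constructor
      · intro a a'
        induction t using TensorProduct.induction_on with
        | zero => simp
        | tmul b c => simpa using (h.1 b c).map_add a a'
        | add s t hs ht => simp only [map_add, hs, ht]; abel
      · intro r a
        induction t using TensorProduct.induction_on with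
        | zero => simp
        | tmul b c => simpa using (h.1 b c).map_smul r a
        | add s t hs ht => simp only [map_add, hs, ht, smul_add],
     fun a => (lift2 (F a) ⟨h.2.1 a, h.2.2 a⟩).isLinear⟩

@[simp] theorem lift3_tmul (F : A → B → C → V)
    (h : (∀ b c, IsLinearMap k fun a => F a b c) ∧ (∀ a c, IsLinearMap k fun b => F a b c) ∧
      (∀ a b, IsLinearMap k fun c => F a b c)) (a : A) (b : B) (c : C) :
    lift3 F h (a ⊗ₜ[k] (b ⊗ₜ[k] c)) = F a b c := rfl

/-- The linear map `(a ⊗ b) ⊗ (c ⊗ d) ↦ F a b c d` for a function `F` that is linear in each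
variable. -/
def lift4 (F : A → B → C → D → V)
    (h : (∀ b c d, IsLinearMap k fun a => F a b c d) ∧
      (∀ a c d, IsLinearMap k fun b => F a b c d) ∧
      (∀ a b d, IsLinearMap k fun c => F a b c d) ∧
      (∀ a b c, IsLinearMap k fun d => F a b c d)) :
    (A ⊗[k] B) ⊗[k] (C ⊗[k] D) →ₗ[k] V :=
  lift2 (fun a t => lift3 (F a) ⟨h.2.1 a, h.2.2.1 a, h.2.2.2 a⟩ t)
    ⟨fun t => by
      constructor
      · intro a a'
        induction t using TensorProduct.induction_on with
        | zero => simp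
        | tmul b u =>
          induction u using TensorProduct.induction_on with
          | zero => simp
          | tmul c d => simpa using (h.1 b c d).map_add a a'
          | add s t hs ht => simp only [TensorProduct.tmul_add, map_add, hs, ht]; abel
        | add s t hs ht => simp only [map_add, hs, ht]; abel
      · intro r a
        induction t using TensorProduct.induction_on with
        | zero => simp
        | tmul b u =>
          induction u using TensorProduct.induction_on with
          | zero => simp
          | tmul c d => simpa using (h.1 b c d).map_smul r a
          | add s t hs ht => simp only [TensorProduct.tmul_add, map_add, hs, ht, smul_add]
        | add s t hs ht => simp only [map_add, hs, ht, smul_add],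
     fun a => (lift3 (F a) ⟨h.2.1 a, h.2.2.1 a, h.2.2.2 a⟩).isLinear⟩ ∘ₗ
    (TensorProduct.assoc k A B (C ⊗[k] D)).toLinearMap

@[simp] theorem lift4_tmul (F : A → B → C → D → V)
    (h : (∀ b c d, IsLinearMap k fun a => F a b c d) ∧
      (∀ a c d, IsLinearMap k fun b => F a b c d) ∧
      (∀ a b d, IsLinearMap k fun c => F a b c d) ∧
      (∀ a b c, IsLinearMap k fun d => F a b c d)) (a : A) (b : B) (c : C) (d : D) :
    lift4 F h ((a ⊗ₜ[k] b) ⊗ₜ[k] (c ⊗ₜ[k] d)) = F a b c d := rfl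

end Lifts

/-! ### Tensor powers of an algebra, and their actions -/

section Tensor

variable {k : Type*} [Field k]

section Algebras

variable {H : Type*} [Ring H] [Algebra k H] (Δ : H →ₐ[k] H ⊗[k] H)

/-- `id ⊗ Δ : H ⊗ H → H ⊗ (H ⊗ H)`. -/
def idΔ : H ⊗[k] H →ₐ[k] H ⊗[k] (H ⊗[k] H) :=
  Algebra.TensorProduct.map (AlgHom.id k H) Δ

/-- `Δ ⊗ id : H ⊗ H → H ⊗ (H ⊗ H)`. -/
def Δid : H ⊗[k] H →ₐ[k] H ⊗[k] (H ⊗[k] H) :=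
  (Algebra.TensorProduct.assoc k k k H H H).toAlgHom.comp
    (Algebra.TensorProduct.map Δ (AlgHom.id k H))

/-- `Δ ⊗ id ⊗ id : H ⊗ (H ⊗ H) → (H ⊗ H) ⊗ (H ⊗ H)`. -/
def Δidid : H ⊗[k] (H ⊗[k] H) →ₐ[k] (H ⊗[k] H) ⊗[k] (H ⊗[k] H) :=
  Algebra.TensorProduct.map Δ (AlgHom.id k (H ⊗[k] H))

/-- `id ⊗ Δ ⊗ id : H ⊗ (H ⊗ H) → (H ⊗ H) ⊗ (H ⊗ H)`, formed as
`a ⊗ (b ⊗ c) ↦ (a ⊗ b) ⊗ c ↦ (a ⊗ (b₁ ⊗ b₂)) ⊗ c ↦ ((a ⊗ b₁) ⊗ b₂) ⊗ c ↦ (a ⊗ b₁) ⊗ (b₂ ⊗ c)`. -/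
def idΔid : H ⊗[k] (H ⊗[k] H) →ₐ[k] (H ⊗[k] H) ⊗[k] (H ⊗[k] H) :=
  (Algebra.TensorProduct.assoc k k k (H ⊗[k] H) H H).toAlgHom.comp
    ((Algebra.TensorProduct.map
      ((Algebra.TensorProduct.assoc k k k H H H).symm.toAlgHom.comp (idΔ Δ)) (AlgHom.id k H)).comp
      (Algebra.TensorProduct.assoc k k k H H H).symm.toAlgHom)

/-- `id ⊗ id ⊗ Δ : H ⊗ (H ⊗ H) → (H ⊗ H) ⊗ (H ⊗ H)`. -/
def ididΔ : H ⊗[k] (H ⊗[k] H) →ₐ[k] (H ⊗[k] H) ⊗[k] (H ⊗[k] H) :=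
  (Algebra.TensorProduct.map (AlgHom.id k (H ⊗[k] H)) Δ).comp
    (Algebra.TensorProduct.assoc k k k H H H).symm.toAlgHom

variable (k H) in
/-- `X ↦ X ⊗ 1`, that is, `a ⊗ (b ⊗ c) ↦ (a ⊗ b) ⊗ (c ⊗ 1)`. -/
def tensorOne : H ⊗[k] (H ⊗[k] H) →ₐ[k] (H ⊗[k] H) ⊗[k] (H ⊗[k] H) :=
  (Algebra.TensorProduct.map (AlgHom.id k (H ⊗[k] H)) Algebra.TensorProduct.includeLeft).comp
    (Algebra.TensorProduct.assoc k k k H H H).symm.toAlgHom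

variable (k H) in
/-- `X ↦ 1 ⊗ X`, that is, `a ⊗ (b ⊗ c) ↦ (1 ⊗ a) ⊗ (b ⊗ c)`. -/
def oneTensor : H ⊗[k] (H ⊗[k] H) →ₐ[k] (H ⊗[k] H) ⊗[k] (H ⊗[k] H) :=
  Algebra.TensorProduct.map Algebra.TensorProduct.includeRight (AlgHom.id k (H ⊗[k] H))

end Algebras

/-- The action of `A ⊗ B` on `V ⊗ W`, `(a ⊗ b) · (v ⊗ w) = a · v ⊗ b · w`, for an `A`-module `V` and
a `B`-module `W` (module structures are given as algebra maps into endomorphism algebras). -/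
def extAct {A B V W : Type*} [Ring A] [Algebra k A] [Ring B] [Algebra k B]
    [AddCommGroup V] [Module k V] [AddCommGroup W] [Module k W]
    (ρ : A →ₐ[k] Module.End k V) (σ : B →ₐ[k] Module.End k W) :
    A ⊗[k] B →ₐ[k] Module.End k (V ⊗[k] W) :=
  (Module.endTensorEndAlgHom (R := k) (S := k) (A := k)).comp (Algebra.TensorProduct.map ρ σ)

/-- The module action as a linear map `A ⊗ V → V`, `a ⊗ v ↦ a · v`. -/
def actMap {A V : Type*} [Ring A] [Algebra k A] [AddCommGroup V] [Module k V]
    (ρ : A →ₐ[k] Module.End k V) : A ⊗[k] V →ₗ[k] V :=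
  TensorProduct.lift ρ.toLinearMap

end Tensor

/-! ### Quasi-Hopf algebras -/

/-- A quasi-Hopf algebra structure on a `k`-algebra `H`: a quasi-bialgebra `(H, Δ, ε, Φ)`,
with an antipode `(S, α, β)` whose `S` is an anti-automorphism of the algebra `H`. -/
structure QuasiHopfAlgebra (k H : Type*) [Field k] [Ring H] [Algebra k H] where
  /-- the coproduct -/
  Δ : H →ₐ[k] H ⊗[k] H
  /-- the counit -/
  ε : H →ₐ[k] k
  /-- the reassociator, an invertible element of `H ⊗ H ⊗ H` -/
  Φ : (H ⊗[k] (H ⊗[k] H))ˣ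
  quasi_coassoc : ∀ h : H, idΔ Δ (Δ h) = (Φ : H ⊗[k] (H ⊗[k] H)) * Δid Δ (Δ h) *
    ((Φ⁻¹ : (H ⊗[k] (H ⊗[k] H))ˣ) : H ⊗[k] (H ⊗[k] H))
  counit_right : ∀ h : H, TensorProduct.rid k H (ε.toLinearMap.lTensor H (Δ h)) = h
  counit_left : ∀ h : H, TensorProduct.lid k H (ε.toLinearMap.rTensor H (Δ h)) = h
  pentagon : oneTensor k H Φ * idΔid Δ Φ * tensorOne k H Φ = ididΔ Δ Φ * Δidid Δ Φ
  /-- `(id ⊗ ε ⊗ id)(Φ) = 1 ⊗ 1` -/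
  normalized : (((TensorProduct.lid k H).toLinearMap ∘ₗ ε.toLinearMap.rTensor H).lTensor H)
    (Φ : H ⊗[k] (H ⊗[k] H)) = 1
  /-- the bijective antipode -/
  S : H ≃ₗ[k] H
  α : H
  β : H
  antipode_one : S 1 = 1
  antipode_mul : ∀ a b : H, S (a * b) = S b * S a
  /-- `S(h₁) α h₂ = ε(h) α` -/
  antipode_left : ∀ h : H, lift2 (k := k) (fun a b : H => S a * α * b)
    (by constructor <;> intros <;> constructor <;> intros <;> simp [mul_add, add_mul]) (Δ h) =
      ε h • α
  /-- `h₁ β S(h₂) = ε(h) β` -/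
  antipode_right : ∀ h : H, lift2 (k := k) (fun a b : H => a * β * S b)
    (by constructor <;> intros <;> constructor <;> intros <;> simp [mul_add, add_mul]) (Δ h) =
      ε h • β
  /-- `X¹ β S(X²) α X³ = 1`, where `Φ = X¹ ⊗ X² ⊗ X³` -/
  antipode_Φ : lift3 (k := k) (fun X₁ X₂ X₃ : H => X₁ * β * S X₂ * α * X₃)
    (by refine ⟨?_, ?_, ?_⟩ <;> intros <;> constructor <;> intros <;> simp [mul_add, add_mul])
      (Φ : H ⊗[k] (H ⊗[k] H)) = 1
  /-- `S(x¹) α x² β S(x³) = 1`, where `Φ⁻¹ = x¹ ⊗ x² ⊗ x³` -/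
  antipode_Φ_inv : lift3 (k := k) (fun x₁ x₂ x₃ : H => S x₁ * α * x₂ * β * S x₃)
    (by refine ⟨?_, ?_, ?_⟩ <;> intros <;> constructor <;> intros <;> simp [mul_add, add_mul])
      ((Φ⁻¹ : (H ⊗[k] (H ⊗[k] H))ˣ) : H ⊗[k] (H ⊗[k] H)) = 1

namespace QuasiHopfAlgebra

variable {k H : Type*} [Field k] [Ring H] [Algebra k H] (Q : QuasiHopfAlgebra k H)

/-- `Φ = X¹ ⊗ X² ⊗ X³` as an element of `H ⊗ H ⊗ H`. -/
def Φe : H ⊗[k] (H ⊗[k] H) := (Q.Φ : H ⊗[k] (H ⊗[k] H))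

/-- `Φ⁻¹ = x¹ ⊗ x² ⊗ x³` as an element of `H ⊗ H ⊗ H`. -/
def Φi : H ⊗[k] (H ⊗[k] H) := ((Q.Φ⁻¹ : (H ⊗[k] (H ⊗[k] H))ˣ) : H ⊗[k] (H ⊗[k] H))

/-- `(S ⊗ S)(Δᵒᵖ(h)) = S(h₂) ⊗ S(h₁)`. -/
def SSΔop : H →ₗ[k] H ⊗[k] H :=
  TensorProduct.map Q.S.toLinearMap Q.S.toLinearMap ∘ₗ
    (TensorProduct.comm k H H).toLinearMap ∘ₗ Q.Δ.toLinearMap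

/-- `A¹ ⊗ A² ⊗ A³ ⊗ A⁴ = (Φ ⊗ 1)(Δ ⊗ id ⊗ id)(Φ⁻¹)`. -/
def elemA : (H ⊗[k] H) ⊗[k] (H ⊗[k] H) := tensorOne k H Q.Φe * Δidid Q.Δ Q.Φi

/-- `B¹ ⊗ B² ⊗ B³ ⊗ B⁴ = (Δ ⊗ id ⊗ id)(Φ)(Φ⁻¹ ⊗ 1)`. -/
def elemB : (H ⊗[k] H) ⊗[k] (H ⊗[k] H) := Δidid Q.Δ Q.Φe * tensorOne k H Q.Φi

/-- `γ = S(A²) α A³ ⊗ S(A¹) α A⁴`. -/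
def γ : H ⊗[k] H :=
  lift4 (k := k) (fun A₁ A₂ A₃ A₄ : H => (Q.S A₂ * Q.α * A₃) ⊗ₜ[k] (Q.S A₁ * Q.α * A₄))
    (by refine ⟨?_, ?_, ?_, ?_⟩ <;> intros <;> constructor <;> intros <;>
          simp [mul_add, add_mul, TensorProduct.tmul_add, TensorProduct.add_tmul,
            TensorProduct.smul_tmul'])
    Q.elemA

/-- `δ = B¹ β S(B⁴) ⊗ B² β S(B³)`. -/
def δ : H ⊗[k] H :=
  lift4 (k := k) (fun B₁ B₂ B₃ B₄ : H => (B₁ * Q.β * Q.S B₄) ⊗ₜ[k] (B₂ * Q.β * Q.S B₃))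
    (by refine ⟨?_, ?_, ?_, ?_⟩ <;> intros <;> constructor <;> intros <;>
          simp [mul_add, add_mul, TensorProduct.tmul_add, TensorProduct.add_tmul,
            TensorProduct.smul_tmul'])
    Q.elemB

/-- Drinfeld's twist `f = (S ⊗ S)(Δᵒᵖ(x¹)) γ Δ(x² β S(x³))`. -/
def f : H ⊗[k] H :=
  lift3 (k := k) (fun x₁ x₂ x₃ : H => Q.SSΔop x₁ * Q.γ * Q.Δ (x₂ * Q.β * Q.S x₃))
    (by refine ⟨?_, ?_, ?_⟩ <;> intros <;> constructor <;> intros <;>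
          simp [mul_add, add_mul])
    Q.Φi

/-- The inverse `f⁻¹ = g = Δ(S(x¹) α x²) δ (S ⊗ S)(Δᵒᵖ(x³))` of Drinfeld's twist. -/
def g : H ⊗[k] H :=
  lift3 (k := k) (fun x₁ x₂ x₃ : H => Q.Δ (Q.S x₁ * Q.α * x₂) * Q.δ * Q.SSΔop x₃)
    (by refine ⟨?_, ?_, ?_⟩ <;> intros <;> constructor <;> intros <;>
          simp [mul_add, add_mul])
    Q.Φi

/-- `p_R = x¹ ⊗ x² β S(x³)`. -/
def pR : H ⊗[k] H :=
  lift3 (k := k) (fun x₁ x₂ x₃ : H => x₁ ⊗ₜ[k] (x₂ * Q.β * Q.S x₃))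
    (by refine ⟨?_, ?_, ?_⟩ <;> intros <;> constructor <;> intros <;>
          simp [mul_add, add_mul, TensorProduct.tmul_add, TensorProduct.add_tmul,
            TensorProduct.smul_tmul'])
    Q.Φi

/-- `q_R = X¹ ⊗ S⁻¹(α X³) X²`. -/
def qR : H ⊗[k] H :=
  lift3 (k := k) (fun X₁ X₂ X₃ : H => X₁ ⊗ₜ[k] (Q.S.symm (Q.α * X₃) * X₂))
    (by refine ⟨?_, ?_, ?_⟩ <;> intros <;> constructor <;> intros <;>
          simp [mul_add, add_mul, TensorProduct.tmul_add, TensorProduct.add_tmul,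
            TensorProduct.smul_tmul'])
    Q.Φe

/-- `p_L = X² S⁻¹(X¹ β) ⊗ X³`. -/
def pL : H ⊗[k] H :=
  lift3 (k := k) (fun X₁ X₂ X₃ : H => (X₂ * Q.S.symm (X₁ * Q.β)) ⊗ₜ[k] X₃)
    (by refine ⟨?_, ?_, ?_⟩ <;> intros <;> constructor <;> intros <;>
          simp [mul_add, add_mul, TensorProduct.tmul_add, TensorProduct.add_tmul,
            TensorProduct.smul_tmul'])
    Q.Φe

/-- `q_L = S(x¹) α x² ⊗ x³`. -/
def qL : H ⊗[k] H :=
  lift3 (k := k) (fun x₁ x₂ x₃ : H => (Q.S x₁ * Q.α * x₂) ⊗ₜ[k] x₃)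
    (by refine ⟨?_, ?_, ?_⟩ <;> intros <;> constructor <;> intros <;>
          simp [mul_add, add_mul, TensorProduct.tmul_add, TensorProduct.add_tmul,
            TensorProduct.smul_tmul'])
    Q.Φi

/-- `a ⊗ b ↦ S⁻¹(b) ⊗ S⁻¹(a)`. -/
def flipSInv : H ⊗[k] H →ₗ[k] H ⊗[k] H :=
  TensorProduct.map Q.S.symm.toLinearMap Q.S.symm.toLinearMap ∘ₗ
    (TensorProduct.comm k H H).toLinearMap

theorem antipode_symm_one : Q.S.symm 1 = 1 := by
  rw [LinearEquiv.symm_apply_eq, Q.antipode_one]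

theorem antipode_symm_mul (a b : H) : Q.S.symm (a * b) = Q.S.symm b * Q.S.symm a := by
  rw [LinearEquiv.symm_apply_eq, Q.antipode_mul]
  simp

/-! ### The monoidal category of `H`-modules and its duals -/

section Modules

variable {U V W : Type*} [AddCommGroup U] [Module k U] [AddCommGroup V] [Module k V]
  [AddCommGroup W] [Module k W]

/-- The tensor product of two `H`-modules, `h · (v ⊗ w) = h₁ · v ⊗ h₂ · w`. -/
def tensorAct (ρ : H →ₐ[k] Module.End k V) (σ : H →ₐ[k] Module.End k W) :
    H →ₐ[k] Module.End k (V ⊗[k] W) :=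
  (extAct ρ σ).comp Q.Δ

/-- The left dual `V*` of an `H`-module, `(h · φ)(v) = φ(S(h) · v)`. -/
def leftDualAct (ρ : H →ₐ[k] Module.End k V) : H →ₐ[k] Module.End k (Module.Dual k V) :=
  AlgHom.ofLinearMap
    ((Module.Dual.transpose (R := k) (M := V) (M' := V)) ∘ₗ ρ.toLinearMap ∘ₗ Q.S.toLinearMap)
    (by ext φ v; simp [Q.antipode_one, Module.Dual.transpose_apply])
    (by intro a b; ext φ v; simp [Q.antipode_mul, Module.Dual.transpose_apply])

/-- The right dual `*V` of an `H`-module, `(h · φ)(v) = φ(S⁻¹(h) · v)`. -/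
def rightDualAct (ρ : H →ₐ[k] Module.End k V) : H →ₐ[k] Module.End k (Module.Dual k V) :=
  AlgHom.ofLinearMap
    ((Module.Dual.transpose (R := k) (M := V) (M' := V)) ∘ₗ ρ.toLinearMap ∘ₗ Q.S.symm.toLinearMap)
    (by ext φ v; simp [Q.antipode_symm_one, Module.Dual.transpose_apply])
    (by intro a b; ext φ v; simp [Q.antipode_symm_mul, Module.Dual.transpose_apply])

/-- The associativity constraint
`(u ⊗ v) ⊗ w ↦ X¹ · u ⊗ (X² · v ⊗ X³ · w)` of the category of `H`-modules. -/
def assocMap (ρ : H →ₐ[k] Module.End k U) (σ : H →ₐ[k] Module.End k V)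
    (τ : H →ₐ[k] Module.End k W) : (U ⊗[k] V) ⊗[k] W →ₗ[k] U ⊗[k] (V ⊗[k] W) :=
  extAct ρ (extAct σ τ) Q.Φe ∘ₗ (TensorProduct.assoc k U V W).toLinearMap

/-- The inverse `u ⊗ (v ⊗ w) ↦ (x¹ · u ⊗ x² · v) ⊗ x³ · w` of the associativity constraint. -/
def assocInv (ρ : H →ₐ[k] Module.End k U) (σ : H →ₐ[k] Module.End k V)
    (τ : H →ₐ[k] Module.End k W) : U ⊗[k] (V ⊗[k] W) →ₗ[k] (U ⊗[k] V) ⊗[k] W :=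
  (TensorProduct.assoc k U V W).symm.toLinearMap ∘ₗ extAct ρ (extAct σ τ) Q.Φi

/-- `ev_V : V* ⊗ V → k`, `φ ⊗ v ↦ φ(α · v)`. -/
def ev (ρ : H →ₐ[k] Module.End k V) : Module.Dual k V ⊗[k] V →ₗ[k] k :=
  contractLeft k V ∘ₗ (ρ Q.α).lTensor (Module.Dual k V)

/-- `ev'_V : V ⊗ *V → k`, `v ⊗ φ ↦ φ(S⁻¹(α) · v)`. -/
def ev' (ρ : H →ₐ[k] Module.End k V) : V ⊗[k] Module.Dual k V →ₗ[k] k :=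
  contractRight k V ∘ₗ (ρ (Q.S.symm Q.α)).rTensor (Module.Dual k V)

/-- `coev_V : k → V ⊗ V*`, `1 ↦ β · vᵢ ⊗ vⁱ`. -/
def coev [FiniteDimensional k V] (ρ : H →ₐ[k] Module.End k V) :
    k →ₗ[k] V ⊗[k] Module.Dual k V :=
  (ρ Q.β).rTensor (Module.Dual k V) ∘ₗ coevaluation k V

/-- `coev'_V : k → *V ⊗ V`, `1 ↦ vⁱ ⊗ S⁻¹(β) · vᵢ`. -/
def coev' [FiniteDimensional k V] (ρ : H →ₐ[k] Module.End k V) :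
    k →ₗ[k] Module.Dual k V ⊗[k] V :=
  (TensorProduct.comm k V (Module.Dual k V)).toLinearMap ∘ₗ
    (ρ (Q.S.symm Q.β)).rTensor (Module.Dual k V) ∘ₗ coevaluation k V

variable {M N : Type*} [AddCommGroup M] [Module k M] [FiniteDimensional k M]
  [AddCommGroup N] [Module k N] [FiniteDimensional k N]

/-- The canonical map `φ*_{N,M} : N* ⊗ M* → (M ⊗ N)*`: the composition
`N*⊗M* → (N*⊗M*)⊗((M⊗N)⊗(M⊗N)*) → ((N*⊗M*)⊗(M⊗N))⊗(M⊗N)* → (N*⊗(M*⊗(M⊗N)))⊗(M⊗N)*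
  → (N*⊗((M*⊗M)⊗N))⊗(M⊗N)* → (N*⊗N)⊗(M⊗N)* → (M⊗N)*`
of coevaluation, associativity constraints and evaluations. -/
def phiLeft (ρ : H →ₐ[k] Module.End k M) (σ : H →ₐ[k] Module.End k N) :
    Module.Dual k N ⊗[k] Module.Dual k M →ₗ[k] Module.Dual k (M ⊗[k] N) :=
  let W := Module.Dual k (M ⊗[k] N)
  let ρd := Q.leftDualAct ρ
  let σd := Q.leftDualAct σ
  let τ := Q.tensorAct ρ σ
  (TensorProduct.lid k W).toLinearMap ∘ₗ
  (Q.ev σ).rTensor W ∘ₗ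
  (((TensorProduct.lid k N).toLinearMap ∘ₗ (Q.ev ρ).rTensor N).lTensor
    (Module.Dual k N)).rTensor W ∘ₗ
  ((Q.assocInv ρd ρ σ).lTensor (Module.Dual k N)).rTensor W ∘ₗ
  (Q.assocMap σd ρd τ).rTensor W ∘ₗ
  Q.assocInv (Q.tensorAct σd ρd) τ (Q.leftDualAct τ) ∘ₗ
  (Q.coev τ).lTensor (Module.Dual k N ⊗[k] Module.Dual k M) ∘ₗ
  (TensorProduct.rid k (Module.Dual k N ⊗[k] Module.Dual k M)).symm.toLinearMap

/-- The canonical map `*φ_{N,M} : *N ⊗ *M → *(M ⊗ N)`: the composition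
`*N⊗*M → (*(M⊗N)⊗(M⊗N))⊗(*N⊗*M) → *(M⊗N)⊗((M⊗N)⊗(*N⊗*M)) → *(M⊗N)⊗(M⊗(N⊗(*N⊗*M)))
  → *(M⊗N)⊗(M⊗((N⊗*N)⊗*M)) → *(M⊗N)⊗(M⊗*M) → *(M⊗N)`
of coevaluation, associativity constraints and evaluations. -/
def phiRight (ρ : H →ₐ[k] Module.End k M) (σ : H →ₐ[k] Module.End k N) :
    Module.Dual k N ⊗[k] Module.Dual k M →ₗ[k] Module.Dual k (M ⊗[k] N) :=
  let W := Module.Dual k (M ⊗[k] N)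
  let ρd := Q.rightDualAct ρ
  let σd := Q.rightDualAct σ
  let τ := Q.tensorAct ρ σ
  (TensorProduct.rid k W).toLinearMap ∘ₗ
  (Q.ev' ρ).lTensor W ∘ₗ
  (((TensorProduct.lid k (Module.Dual k M)).toLinearMap ∘ₗ
    (Q.ev' σ).rTensor (Module.Dual k M)).lTensor M).lTensor W ∘ₗ
  ((Q.assocInv σ σd ρd).lTensor M).lTensor W ∘ₗ
  (Q.assocMap ρ σ (Q.tensorAct σd ρd)).lTensor W ∘ₗ
  Q.assocMap (Q.rightDualAct τ) τ (Q.tensorAct σd ρd) ∘ₗ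
  (Q.coev' τ).rTensor (Module.Dual k N ⊗[k] Module.Dual k M) ∘ₗ
  (TensorProduct.lid k (Module.Dual k N ⊗[k] Module.Dual k M)).symm.toLinearMap

end Modules

end QuasiHopfAlgebra

/-! ### Yetter-Drinfeld modules -/

/-- A left `H`-action and a `k`-linear map `λ : M → H ⊗ M`, `λ(m) = m₍₋₁₎ ⊗ m₍₀₎`, on a vector
space `M`. -/
structure ActCoact (k H M : Type*) [Field k] [Ring H] [Algebra k H] [AddCommGroup M]
    [Module k M] where
  /-- the left action of `H` -/
  act : H →ₐ[k] Module.End k M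
  /-- the map `λ : M → H ⊗ M` -/
  coact : M →ₗ[k] H ⊗[k] M

namespace ActCoact

variable {k H : Type*} [Field k] [Ring H] [Algebra k H]
variable {M N U : Type*} [AddCommGroup M] [Module k M] [AddCommGroup N] [Module k N]
  [AddCommGroup U] [Module k U]

/-- The map `M ⊗ U → U ⊗ M`, `m ⊗ u ↦ m₍₋₁₎ · u ⊗ m₍₀₎`, for an `H`-module `U`. -/
def braid (X : ActCoact k H M) (ρ : H →ₐ[k] Module.End k U) : M ⊗[k] U →ₗ[k] U ⊗[k] M :=
  (actMap ρ).rTensor M ∘ₗ (TensorProduct.rightComm k H M U).toLinearMap ∘ₗ X.coact.rTensor U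

/-- For `t = t¹ ⊗ t²`, the map `M → H ⊗ M`, `m ↦ (t¹ · m)₍₋₁₎ t² ⊗ (t¹ · m)₍₀₎`. -/
def twCoact (X : ActCoact k H M) (t : H ⊗[k] H) : M →ₗ[k] H ⊗[k] M :=
  X.braid (Algebra.lmul k H) ∘ₗ extAct X.act (Algebra.lmul k H) t ∘ₗ
    (TensorProduct.mk k M H).flip 1

/-- The axioms of a left Yetter-Drinfeld module over a quasi-Hopf algebra. -/
structure IsYetterDrinfeld (Q : QuasiHopfAlgebra k H) (X : ActCoact k H M) : Prop where
  /-- `X¹ m₍₋₁₎ ⊗ (X² · m₍₀₎)₍₋₁₎ X³ ⊗ (X² · m₍₀₎)₍₀₎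
    = X¹ (Y¹ · m)₍₋₁₎₁ Y² ⊗ X² (Y¹ · m)₍₋₁₎₂ Y³ ⊗ X³ · (Y¹ · m)₍₀₎`;
  on the right, `Y¹ · m ⊗ (Y² ⊗ Y³) ↦ (Y¹ · m)₍₋₁₎ · (Y² ⊗ Y³) ⊗ (Y¹ · m)₍₀₎` is formed first, where
  `H` acts on `H ⊗ H` by `h · (a ⊗ b) = h₁ a ⊗ h₂ b`. -/
  coact_coact : ∀ m : M,
    (X.braid (Algebra.lmul k H)).lTensor H
      (extAct (Algebra.lmul k H) (extAct X.act (Algebra.lmul k H)) Q.Φe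
        (TensorProduct.assoc k H M H (X.coact m ⊗ₜ[k] (1 : H)))) =
    extAct (Algebra.lmul k H) (extAct (Algebra.lmul k H) X.act) Q.Φe
      (TensorProduct.assoc k H H M
        (X.braid (Q.tensorAct (Algebra.lmul k H) (Algebra.lmul k H))
          (extAct X.act (extAct (Algebra.lmul k H) (Algebra.lmul k H)) Q.Φe
            (m ⊗ₜ[k] ((1 : H) ⊗ₜ[k] (1 : H))))))
  /-- `ε(m₍₋₁₎) m₍₀₎ = m` -/
  counit_coact : ∀ m : M, TensorProduct.lid k M (Q.ε.toLinearMap.rTensor M (X.coact m)) = m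
  /-- `h₁ m₍₋₁₎ ⊗ h₂ · m₍₀₎ = (h₁ · m)₍₋₁₎ h₂ ⊗ (h₁ · m)₍₀₎` -/
  act_coact : ∀ (h : H) (m : M),
    extAct (Algebra.lmul k H) X.act (Q.Δ h) (X.coact m) = X.twCoact (Q.Δ h) m

/-- Morphisms of Yetter-Drinfeld modules: linear maps preserving the action and the coaction. -/
structure IsHom (X : ActCoact k H M) (Y : ActCoact k H N) (F : M →ₗ[k] N) : Prop where
  map_act : ∀ (h : H) (m : M), F (X.act h m) = Y.act h (F m)
  map_coact : ∀ m : M, F.lTensor H (X.coact m) = Y.coact (F m)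

/-- The tensor product `M ⊗ N`, with action `h · (m ⊗ n) = h₁ · m ⊗ h₂ · n` and coaction
`m ⊗ n ↦ X¹ (x¹ Y¹ · m)₍₋₁₎ x² (Y² · n)₍₋₁₎ Y³ ⊗ X² · (x¹ Y¹ · m)₍₀₎ ⊗ X³ x³ · (Y² · n)₍₀₎`,
which is formed as the composition
`m ⊗ n ↦ Y¹·m ⊗ (Y²·n ⊗ Y³) ↦ Y¹·m ⊗ ((Y²·n)₍₋₁₎ Y³ ⊗ (Y²·n)₍₀₎)
  ↦ (x¹Y¹·m ⊗ x² (Y²·n)₍₋₁₎ Y³) ⊗ x³ · (Y²·n)₍₀₎ ↦ …`. -/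
def tensor (Q : QuasiHopfAlgebra k H) (X : ActCoact k H M) (Y : ActCoact k H N) :
    ActCoact k H (M ⊗[k] N) where
  act := Q.tensorAct X.act Y.act
  coact :=
    Q.assocMap (Algebra.lmul k H) X.act Y.act ∘ₗ
    (X.braid (Algebra.lmul k H)).rTensor N ∘ₗ
    Q.assocInv X.act (Algebra.lmul k H) Y.act ∘ₗ
    (Y.braid (Algebra.lmul k H)).lTensor M ∘ₗ
    Q.assocMap X.act Y.act (Algebra.lmul k H) ∘ₗ
    (TensorProduct.mk k (M ⊗[k] N) H).flip 1

/-- The linear map `M* → H ⊗ M*`, `φ ↦ ⟨φ, T(mᵢ)₍₀₎⟩ s(T(mᵢ)₍₋₁₎) ⊗ mⁱ`, for linear maps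
`T : M → H ⊗ M`, `T(m) = T(m)₍₋₁₎ ⊗ T(m)₍₀₎`, and `s : H → H`, and dual bases `(mᵢ)`, `(mⁱ)`. Here
`(dualTensorHomEquiv k M H).symm` sends `ψ : M → H` to `mⁱ ⊗ ψ(mᵢ)`. -/
def dualCoact [FiniteDimensional k M] (s : H →ₗ[k] H) (T : M →ₗ[k] H ⊗[k] M) :
    Module.Dual k M →ₗ[k] H ⊗[k] Module.Dual k M where
  toFun φ := TensorProduct.comm k (Module.Dual k M) H ((dualTensorHomEquiv k M H).symm
    (s ∘ₗ (TensorProduct.rid k H).toLinearMap ∘ₗ φ.lTensor H ∘ₗ T))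
  map_add' φ ψ := by
    rw [LinearMap.lTensor_add, LinearMap.add_comp, LinearMap.comp_add, LinearMap.comp_add, map_add,
      map_add]
  map_smul' c φ := by
    rw [LinearMap.lTensor_smul, LinearMap.smul_comp, LinearMap.comp_smul, LinearMap.comp_smul, map_smul,
      map_smul, RingHom.id_apply]

/-- The left dual `M*`: action `(h · φ)(m) = φ(S(h) · m)`, coaction
`φ ↦ ⟨φ, f² · (g¹ · mᵢ)₍₀₎⟩ S⁻¹(f¹ (g¹ · mᵢ)₍₋₁₎ g²) ⊗ mⁱ`. -/
def leftDual [FiniteDimensional k M] (Q : QuasiHopfAlgebra k H) (X : ActCoact k H M) :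
    ActCoact k H (Module.Dual k M) where
  act := Q.leftDualAct X.act
  coact := dualCoact Q.S.symm.toLinearMap
    (extAct (Algebra.lmul k H) X.act Q.f ∘ₗ X.twCoact Q.g)

/-- The right dual `*M`: action `(h · φ)(m) = φ(S⁻¹(h) · m)`, coaction
`φ ↦ ⟨φ, S⁻¹(f¹) · (S⁻¹(g²) · mᵢ)₍₀₎⟩ g¹ S((S⁻¹(g²) · mᵢ)₍₋₁₎) f² ⊗ mⁱ`. Here
`g¹ S(h) f² = S(S⁻¹(f²) h S⁻¹(g¹))`. -/
def rightDual [FiniteDimensional k M] (Q : QuasiHopfAlgebra k H) (X : ActCoact k H M) :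
    ActCoact k H (Module.Dual k M) where
  act := Q.rightDualAct X.act
  coact := dualCoact Q.S.toLinearMap
    (extAct (Algebra.lmul k H) X.act (Q.flipSInv Q.f) ∘ₗ X.twCoact (Q.flipSInv Q.g))

/-! ### The maps `σ*` and `*σ` -/

/-- For a linear map `t : N → H ⊗ N`, `t(n) = t(n)₍₋₁₎ ⊗ t(n)₍₀₎`, the map
`M ⊗ N → M ⊗ N`, `m ⊗ n ↦ t(n)₍₋₁₎ · m ⊗ t(n)₍₀₎`. -/
def insertAct (X : ActCoact k H M) (t : N →ₗ[k] H ⊗[k] N) : M ⊗[k] N →ₗ[k] M ⊗[k] N :=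
  lift2 (k := k) (fun m n => (X.act.toLinearMap.flip m).rTensor N (t n))
    (by constructor <;> intros <;> constructor <;> intros <;>
          simp [LinearMap.rTensor_add, LinearMap.rTensor_smul])

/-- `n ↦ f² q̃²₂ X³ S⁻¹(q̃¹ X¹ (p¹ · n)₍₋₁₎ p²) ⊗ f¹ q̃²₁ X² · (p¹ · n)₍₀₎`, where
`p_R = p¹ ⊗ p²` and `q_L = q̃¹ ⊗ q̃²`. In the definition
`w¹ ⊗ w² ⊗ w³ = (1 ⊗ f) (id ⊗ Δ)(q_L) Φ = q̃¹ X¹ ⊗ f¹ q̃²₁ X² ⊗ f² q̃²₂ X³`. -/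
def sigmaLeftInsert (Q : QuasiHopfAlgebra k H) (Y : ActCoact k H N) : N →ₗ[k] H ⊗[k] N :=
  lift3 (k := k)
    (fun w₁ w₂ w₃ : H =>
      TensorProduct.map (Algebra.lmul k H w₃ ∘ₗ Q.S.symm.toLinearMap ∘ₗ Algebra.lmul k H w₁)
        (Y.act w₂) ∘ₗ Y.twCoact Q.pR)
    (by
      refine ⟨?_, ?_, ?_⟩ <;> intros <;> constructor <;> intros <;>
        ext n <;>
        simp only [map_add, map_smul,
          LinearMap.add_comp, LinearMap.comp_add, LinearMap.smul_comp, LinearMap.comp_smul,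
          TensorProduct.map_add_left, TensorProduct.map_add_right,
          TensorProduct.map_smul_left, TensorProduct.map_smul_right])
    ((1 : H) ⊗ₜ[k] Q.f * idΔ Q.Δ Q.qL * Q.Φe)

/-- The map `σ*_{M,N} : M* ⊗ N* → (M ⊗ N)*`,
`σ*(φ ⊗ ψ)(m ⊗ n) = ⟨φ, f² q̃²₂ X³ S⁻¹(q̃¹ X¹ (p¹ · n)₍₋₁₎ p²) · m⟩ ⟨ψ, f¹ q̃²₁ X² · (p¹ · n)₍₀₎⟩`. -/
def sigmaLeft (Q : QuasiHopfAlgebra k H) (X : ActCoact k H M) (Y : ActCoact k H N) :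
    Module.Dual k M ⊗[k] Module.Dual k N →ₗ[k] Module.Dual k (M ⊗[k] N) :=
  (X.insertAct (Y.sigmaLeftInsert Q)).dualMap ∘ₗ TensorProduct.dualDistrib k M N

/-- `n ↦ S⁻¹(f² q¹ (x¹ p̃¹ S⁻¹(f¹) · n)₍₋₁₎ x² p̃²₁) ⊗ S⁻¹(x³ p̃²₂) q² · (x¹ p̃¹ S⁻¹(f¹) · n)₍₀₎`, where
`q_R = q¹ ⊗ q²` and `p_L = p̃¹ ⊗ p̃²`. In the definition
`w¹ ⊗ w² ⊗ w³ = Φ⁻¹ (id ⊗ Δ)(p_L) = x¹ p̃¹ ⊗ x² p̃²₁ ⊗ x³ p̃²₂`. -/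
def sigmaRightInsert (Q : QuasiHopfAlgebra k H) (Y : ActCoact k H N) : N →ₗ[k] H ⊗[k] N :=
  let R : N →ₗ[k] H ⊗[k] N :=
    lift3 (k := k)
      (fun w₁ w₂ w₃ : H =>
        (Y.act (Q.S.symm w₃)).lTensor H ∘ₗ extAct (Algebra.lmul k H) Y.act Q.qR ∘ₗ
          Y.twCoact (w₁ ⊗ₜ[k] w₂))
      (by
        refine ⟨?_, ?_, ?_⟩ <;> intros <;> constructor <;> intros <;>
          ext n <;>
          simp [twCoact, TensorProduct.add_tmul, TensorProduct.tmul_add, ← TensorProduct.smul_tmul',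
            LinearMap.lTensor_add, LinearMap.lTensor_smul])
      (Q.Φi * idΔ Q.Δ Q.pL)
  lift2 (k := k)
    (fun f₁ f₂ : H =>
      (Q.S.symm.toLinearMap ∘ₗ Algebra.lmul k H f₂).rTensor N ∘ₗ R ∘ₗ Y.act (Q.S.symm f₁))
    (by
      constructor <;> intros <;> constructor <;> intros <;>
        simp only [map_add, map_smul,
          LinearMap.add_comp, LinearMap.comp_add, LinearMap.smul_comp, LinearMap.comp_smul,
          LinearMap.rTensor_add, LinearMap.rTensor_smul])
    Q.f

/-- The map `*σ_{M,N} : *M ⊗ *N → *(M ⊗ N)`,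
`*σ(φ ⊗ ψ)(m ⊗ n) = ⟨φ, S⁻¹(f² q¹ (x¹ p̃¹ S⁻¹(f¹) · n)₍₋₁₎ x² p̃²₁) · m⟩
  ⟨ψ, S⁻¹(x³ p̃²₂) q² · (x¹ p̃¹ S⁻¹(f¹) · n)₍₀₎⟩`. -/
def sigmaRight (Q : QuasiHopfAlgebra k H) (X : ActCoact k H M) (Y : ActCoact k H N) :
    Module.Dual k M ⊗[k] Module.Dual k N →ₗ[k] Module.Dual k (M ⊗[k] N) :=
  (X.insertAct (Y.sigmaRightInsert Q)).dualMap ∘ₗ TensorProduct.dualDistrib k M N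

end ActCoact

end QuasiHopf

end

/-! The statement is the transpose of one fact about braidings. Let E be the endomorphism m ⊗ n ↦
(g¹·n)₍₋₁₎ g²·m ⊗ (g¹·n)₍₀₎ of M ⊗ N: the braiding of N with M applied after the action of g. Up to
the identification of M* ⊗ N* with (M ⊗ N)*, the map σ* is the transpose of an endomorphism K which
undoes the braiding, by means of an element `unbraid` built from p_R, q_L and Φ, and then acts by f;
so K is the inverse of E. On the dual side, c_{N*,M*} followed by the identification equals φ*
followed by the transpose of E (`dualDistrib_braid_dual`), once φ* is known to send ν ⊗ μ to m ⊗ n ↦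
μ(f¹·m) ν(f²·n). Hence c_{N*,M*} is bijective, σ* = φ* ∘ c⁻¹, and the inverse of σ* is the transpose
of E written in dual bases. Since φ* and the braiding are morphisms, so is σ*.

The properties of Drinfeld's twist come from uniqueness of antipodes. An antipode (S, α, β) makes
sense relative to any algebra map D : H → B, and two antipodes for the same D are intertwined by the
invertible element S₂(x¹) α₂ D(x²) β₁ S₁(x³) (`twist_mul_antipode`, `twist_mul_alpha`,
`twist_mul_twist`). The coproduct Δ has two antipodes: Δ ∘ S with Δ(α), Δ(β), and (S ⊗ S)Δᵒᵖ with γ,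
δ (`Δ_isAntipode`); the comparison elements are f and g. The compatibility of f with Φ (`f_reassoc`)
follows by a similar uniqueness argument from the analogous relation for γ, which is the image of
the pentagon under one linear map.

Left and right duals are treated together. `TwistDatum` lists what is used about (S, f, g); a second
instance is S⁻¹ with S⁻¹(f²) ⊗ S⁻¹(f¹) and S⁻¹(g²) ⊗ S⁻¹(g¹). The coaction is first twisted by F and
G, and the twisted braiding satisfies the hexagon with the reversed image of Φ under s in place of Φ
(`twist_hexagon`). Evaluating at vectors of M and applying s reverses products and tensor legs, and
so carries the axioms for the dual to these twisted relations; the same device shows that φ* is a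
morphism (`isHom_dualTensor`).

Coactions are handled through the braidings of M with arbitrary H-modules. By naturality everything
reduces to the module H and the vector 1, where the axioms say that the braiding satisfies a
hexagon, is trivial on the unit object and is H-linear. Tensor products then follow from the
pentagon.

Finally, φ* is computed explicitly: the nested evaluations contribute γ, the coevaluation
contributes p_R, and (S ⊗ S)Δᵒᵖ(p¹) γ Δ(p²) = f. The formula for *σ uses p_L and q_R instead of p_R
and q_L, and `Δ_pR_qL` shows that it describes the same kind of map K. -/

noncomputable section

namespace QuasiHopf

/-! ### Linear forms and embeddings on tensor powers of H. -/

section Sandwich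

variable {k B U V : Type*} [Field k] [Ring B] [Algebra k B]
  [AddCommGroup U] [Module k U] [AddCommGroup V] [Module k V]

/-- The linear map `u ⊗ v ↦ φ u * b * ψ v`. -/
def sandwich (φ : U →ₗ[k] B) (b : B) (ψ : V →ₗ[k] B) : U ⊗[k] V →ₗ[k] B :=
  LinearMap.mul' k B ∘ₗ TensorProduct.map (LinearMap.mulRight k b ∘ₗ φ) ψ

@[simp] theorem sandwich_tmul (φ : U →ₗ[k] B) (b : B) (ψ : V →ₗ[k] B) (u : U) (v : V) :
    sandwich φ b ψ (u ⊗ₜ[k] v) = φ u * b * ψ v := rfl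

end Sandwich

section TensorPowers

variable {k H : Type*} [Field k] [Ring H] [Algebra k H]

variable (k H) in
/-- `a ⊗ b ↦ a ⊗ (b ⊗ 1)`. -/
def ins12 : H ⊗[k] H →ₐ[k] H ⊗[k] (H ⊗[k] H) :=
  Algebra.TensorProduct.map (AlgHom.id k H) Algebra.TensorProduct.includeLeft

variable (k H) in
/-- `a ⊗ b ↦ a ⊗ (1 ⊗ b)`. -/
def ins13 : H ⊗[k] H →ₐ[k] H ⊗[k] (H ⊗[k] H) :=
  Algebra.TensorProduct.map (AlgHom.id k H) Algebra.TensorProduct.includeRight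

variable (k H) in
/-- `a ⊗ b ↦ 1 ⊗ (a ⊗ b)`. -/
def ins23 : H ⊗[k] H →ₐ[k] H ⊗[k] (H ⊗[k] H) :=
  Algebra.TensorProduct.includeRight

variable (k H) in
/-- `a ⊗ b ↦ (a ⊗ b) ⊗ (1 ⊗ 1)`. -/
def insL : H ⊗[k] H →ₐ[k] (H ⊗[k] H) ⊗[k] (H ⊗[k] H) :=
  Algebra.TensorProduct.includeLeft

variable (k H) in
/-- `a ⊗ b ↦ (1 ⊗ a) ⊗ (b ⊗ 1)`. -/
def insM : H ⊗[k] H →ₐ[k] (H ⊗[k] H) ⊗[k] (H ⊗[k] H) :=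
  Algebra.TensorProduct.map Algebra.TensorProduct.includeRight Algebra.TensorProduct.includeLeft

variable (k H) in
/-- `a ⊗ b ↦ (1 ⊗ 1) ⊗ (a ⊗ b)`. -/
def insR : H ⊗[k] H →ₐ[k] (H ⊗[k] H) ⊗[k] (H ⊗[k] H) :=
  Algebra.TensorProduct.includeRight

@[simp] theorem ins12_tmul (a b : H) : ins12 k H (a ⊗ₜ b) = a ⊗ₜ (b ⊗ₜ 1) := rfl
@[simp] theorem ins13_tmul (a b : H) : ins13 k H (a ⊗ₜ b) = a ⊗ₜ (1 ⊗ₜ b) := rfl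
@[simp] theorem ins23_apply (t : H ⊗[k] H) : ins23 k H t = 1 ⊗ₜ t := rfl
@[simp] theorem insL_apply (t : H ⊗[k] H) : insL k H t = t ⊗ₜ 1 := rfl
@[simp] theorem insM_tmul (a b : H) : insM k H (a ⊗ₜ b) = (1 ⊗ₜ a) ⊗ₜ (b ⊗ₜ 1) := rfl
@[simp] theorem insR_apply (t : H ⊗[k] H) : insR k H t = 1 ⊗ₜ t := rfl

@[simp] theorem tensorOne_tmul (a b c : H) :
    tensorOne k H (a ⊗ₜ (b ⊗ₜ c)) = (a ⊗ₜ b) ⊗ₜ (c ⊗ₜ 1) := rfl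

@[simp] theorem oneTensor_tmul (a : H) (t : H ⊗[k] H) :
    oneTensor k H (a ⊗ₜ t) = (1 ⊗ₜ a) ⊗ₜ t := rfl

variable (Δ : H →ₐ[k] H ⊗[k] H)

@[simp] theorem idΔ_tmul (a b : H) : idΔ Δ (a ⊗ₜ b) = a ⊗ₜ Δ b := rfl

/-- Δ(a) is not a pure tensor. Isolating it behind `ins12` lets later proofs generalise it to an
arbitrary element of H ⊗ H and use induction; `idΔid_tmul` does the same for a coproduct in the
middle leg. -/
theorem Δid_tmul (a b : H) : Δid Δ (a ⊗ₜ b) = ins12 k H (Δ a) * (1 ⊗ₜ (1 ⊗ₜ b)) := by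
  have (t : H ⊗[k] H) : TensorProduct.assoc k H H H (t ⊗ₜ b) =
      ins12 k H t * (1 ⊗ₜ (1 ⊗ₜ b)) := by
    induction t using TensorProduct.induction_on with
    | zero => simp
    | tmul x y => simp
    | add x y hx hy => simp only [TensorProduct.add_tmul, map_add, hx, hy, add_mul]
  exact this (Δ a)

@[simp] theorem Δidid_tmul (a : H) (t : H ⊗[k] H) : Δidid Δ (a ⊗ₜ t) = Δ a ⊗ₜ t := rfl

@[simp] theorem ididΔ_tmul (a b c : H) : ididΔ Δ (a ⊗ₜ (b ⊗ₜ c)) = (a ⊗ₜ b) ⊗ₜ Δ c := rfl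

theorem idΔid_tmul (a b c : H) :
    idΔid Δ (a ⊗ₜ (b ⊗ₜ c)) = ((a ⊗ₜ 1) ⊗ₜ (1 ⊗ₜ c)) * insM k H (Δ b) := by
  have (t : H ⊗[k] H) : TensorProduct.assoc k (H ⊗[k] H) H H
      ((TensorProduct.assoc k H H H).symm (a ⊗ₜ t) ⊗ₜ c) =
      ((a ⊗ₜ 1) ⊗ₜ (1 ⊗ₜ c)) * insM k H t := by
    induction t using TensorProduct.induction_on with
    | zero => simp
    | tmul x y => simp
    | add x y hx hy =>
      simp only [TensorProduct.add_tmul, TensorProduct.tmul_add, map_add, hx, hy, mul_add]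
  exact this (Δ b)

end TensorPowers

section Induction

variable {k H V : Type*} [Field k] [Ring H] [Algebra k H] [AddCommGroup V] [Module k V]

theorem ext2 {T T' : H ⊗[k] H →ₗ[k] V} (h : ∀ a b, T (a ⊗ₜ b) = T' (a ⊗ₜ b)) : T = T' :=
  TensorProduct.ext' h

theorem ext3 {T T' : H ⊗[k] (H ⊗[k] H) →ₗ[k] V}
    (h : ∀ a b c, T (a ⊗ₜ (b ⊗ₜ c)) = T' (a ⊗ₜ (b ⊗ₜ c))) : T = T' := by
  ext a b c; exact h a b c

theorem ext4 {T T' : (H ⊗[k] H) ⊗[k] (H ⊗[k] H) →ₗ[k] V}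
    (h : ∀ a b c d, T ((a ⊗ₜ b) ⊗ₜ (c ⊗ₜ d)) = T' ((a ⊗ₜ b) ⊗ₜ (c ⊗ₜ d))) : T = T' := by
  ext a b c d; exact h a b c d

/-- The quasi-Hopf elements are defined by multilinear lifts. These lemmas replace such a lift by a
composite of linear maps with the same values on pure tensors. -/
theorem lift2_eq {F : H → H → V} (h) {T : H ⊗[k] H →ₗ[k] V} (hT : ∀ a b, F a b = T (a ⊗ₜ b)) :
    lift2 F h = T := ext2 hT

theorem lift3_eq {F : H → H → H → V} (h) {T : H ⊗[k] (H ⊗[k] H) →ₗ[k] V}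
    (hT : ∀ a b c, F a b c = T (a ⊗ₜ (b ⊗ₜ c))) : lift3 F h = T := ext3 hT

theorem lift4_eq {F : H → H → H → H → V} (h) {T : (H ⊗[k] H) ⊗[k] (H ⊗[k] H) →ₗ[k] V}
    (hT : ∀ a b c d, F a b c d = T ((a ⊗ₜ b) ⊗ₜ (c ⊗ₜ d))) : lift4 F h = T := ext4 hT

theorem induction3 {p : H ⊗[k] (H ⊗[k] H) → Prop} (z : H ⊗[k] (H ⊗[k] H)) (h0 : p 0)
    (h1 : ∀ a b c, p (a ⊗ₜ (b ⊗ₜ c))) (h2 : ∀ x y, p x → p y → p (x + y)) : p z := by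
  induction z using TensorProduct.induction_on with
  | zero => exact h0
  | tmul a t =>
    induction t using TensorProduct.induction_on with
    | zero => simpa using h0
    | tmul b c => exact h1 a b c
    | add x y hx hy => rw [TensorProduct.tmul_add]; exact h2 _ _ hx hy
  | add x y hx hy => exact h2 _ _ hx hy

theorem induction4 {p : (H ⊗[k] H) ⊗[k] (H ⊗[k] H) → Prop} (z : (H ⊗[k] H) ⊗[k] (H ⊗[k] H))
    (h0 : p 0) (h1 : ∀ a b c d, p ((a ⊗ₜ b) ⊗ₜ (c ⊗ₜ d)))
    (h2 : ∀ x y, p x → p y → p (x + y)) : p z := by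
  induction z using TensorProduct.induction_on with
  | zero => exact h0
  | tmul s t =>
    induction s using TensorProduct.induction_on with
    | zero => simpa using h0
    | tmul a b =>
      induction t using TensorProduct.induction_on with
      | zero => simpa using h0
      | tmul c d => exact h1 a b c d
      | add x y hx hy => rw [TensorProduct.tmul_add]; exact h2 _ _ hx hy
    | add x y hx hy => rw [TensorProduct.add_tmul]; exact h2 _ _ hx hy
  | add x y hx hy => exact h2 _ _ hx hy

end Induction

/-! ### The pentagon solved in the group of units. -/

namespace QuasiHopfAlgebra

variable {k H : Type*} [Field k] [Ring H] [Algebra k H] (Q : QuasiHopfAlgebra k H)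

@[simp] theorem Φe_mul_Φi : Q.Φe * Q.Φi = 1 := Q.Φ.mul_inv
@[simp] theorem Φi_mul_Φe : Q.Φi * Q.Φe = 1 := Q.Φ.inv_mul

theorem idΔ_mul_Φe (h : H) : idΔ Q.Δ (Q.Δ h) * Q.Φe = Q.Φe * Δid Q.Δ (Q.Δ h) := by
  rw [Q.quasi_coassoc, mul_assoc]
  change _ * (Q.Φi * Q.Φe) = _
  rw [Φi_mul_Φe, mul_one]
  rfl

theorem Φi_mul_idΔ (h : H) : Q.Φi * idΔ Q.Δ (Q.Δ h) = Δid Q.Δ (Q.Δ h) * Q.Φi := by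
  have := congrArg (fun z => Q.Φi * z * Q.Φi) (Q.idΔ_mul_Φe h)
  simpa only [mul_assoc, Φe_mul_Φi, mul_one, ← mul_assoc Q.Φi Q.Φe, Φi_mul_Φe, one_mul] using this

/-- The image of the reassociator under an algebra map, as a unit. -/
def unitΦ {A : Type*} [Ring A] [Algebra k A] (E : H ⊗[k] (H ⊗[k] H) →ₐ[k] A) : Aˣ where
  val := E Q.Φe
  inv := E Q.Φi
  val_inv := by rw [← map_mul, Φe_mul_Φi, map_one]
  inv_val := by rw [← map_mul, Φi_mul_Φe, map_one]

theorem unitΦ_val {A : Type*} [Ring A] [Algebra k A] (E : H ⊗[k] (H ⊗[k] H) →ₐ[k] A) :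
    (Q.unitΦ E : A) = E Q.Φe := rfl

theorem unitΦ_inv {A : Type*} [Ring A] [Algebra k A] (E : H ⊗[k] (H ⊗[k] H) →ₐ[k] A) :
    ((Q.unitΦ E)⁻¹ : Aˣ) = E Q.Φi := rfl

/-- The pentagon in the group of units. -/
theorem pentagon_units :
    Q.unitΦ (oneTensor k H) * Q.unitΦ (idΔid Q.Δ) * Q.unitΦ (tensorOne k H) =
    Q.unitΦ (ididΔ Q.Δ) * Q.unitΦ (Δidid Q.Δ) :=
  Units.ext Q.pentagon

/-- This and the following variants solve the pentagon for the word needed later. A variant is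
chosen so that most of its factors are absorbed by the linear form it is fed to. -/
theorem pentagon_idΔid_one_Δidid :
    idΔid Q.Δ Q.Φe * tensorOne k H Q.Φe * Δidid Q.Δ Q.Φi =
    oneTensor k H Q.Φi * ididΔ Q.Δ Q.Φe := by
  have h : Q.unitΦ (idΔid Q.Δ) * Q.unitΦ (tensorOne k H) * (Q.unitΦ (Δidid Q.Δ))⁻¹ =
      (Q.unitΦ (oneTensor k H))⁻¹ * Q.unitΦ (ididΔ Q.Δ) := by
    -- The pentagon expresses the unit coming from `ididΔ` by the other four; what remains is an
    -- identity in a free group.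
    rw [eq_mul_inv_of_mul_eq Q.pentagon_units.symm]
    group
  simpa only [Units.val_mul, unitΦ_val, unitΦ_inv] using congrArg Units.val h

theorem pentagon_ididΔ_one_idΔid :
    ididΔ Q.Δ Q.Φi * oneTensor k H Q.Φe * idΔid Q.Δ Q.Φe =
    Δidid Q.Δ Q.Φe * tensorOne k H Q.Φi := by
  have h : (Q.unitΦ (ididΔ Q.Δ))⁻¹ * Q.unitΦ (oneTensor k H) * Q.unitΦ (idΔid Q.Δ) =
      Q.unitΦ (Δidid Q.Δ) * (Q.unitΦ (tensorOne k H))⁻¹ := by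
    rw [eq_mul_inv_of_mul_eq Q.pentagon_units.symm]
    group
  simpa only [Units.val_mul, unitΦ_val, unitΦ_inv] using congrArg Units.val h

theorem pentagon_ididΔ_one :
    ididΔ Q.Δ Q.Φi * oneTensor k H Q.Φe =
    Δidid Q.Δ Q.Φe * tensorOne k H Q.Φi * idΔid Q.Δ Q.Φi := by
  have h : (Q.unitΦ (ididΔ Q.Δ))⁻¹ * Q.unitΦ (oneTensor k H) =
      Q.unitΦ (Δidid Q.Δ) * (Q.unitΦ (tensorOne k H))⁻¹ * (Q.unitΦ (idΔid Q.Δ))⁻¹ := by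
    rw [eq_mul_inv_of_mul_eq Q.pentagon_units.symm]
    group
  simpa only [Units.val_mul, unitΦ_val, unitΦ_inv] using congrArg Units.val h

theorem pentagon_Δidid_eq :
    Δidid Q.Δ Q.Φe =
    ididΔ Q.Δ Q.Φi * oneTensor k H Q.Φe * idΔid Q.Δ Q.Φe * tensorOne k H Q.Φe := by
  have h : Q.unitΦ (Δidid Q.Δ) =
      (Q.unitΦ (ididΔ Q.Δ))⁻¹ * Q.unitΦ (oneTensor k H) * Q.unitΦ (idΔid Q.Δ) * Q.unitΦ (tensorOne k H) := by
    rw [eq_mul_inv_of_mul_eq Q.pentagon_units.symm]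
    group
  simpa only [Units.val_mul, unitΦ_val, unitΦ_inv] using congrArg Units.val h

theorem pentagon_idΔid_one :
    idΔid Q.Δ Q.Φe * tensorOne k H Q.Φe =
    oneTensor k H Q.Φi * ididΔ Q.Δ Q.Φe * Δidid Q.Δ Q.Φe := by
  have h : Q.unitΦ (idΔid Q.Δ) * Q.unitΦ (tensorOne k H) =
      (Q.unitΦ (oneTensor k H))⁻¹ * Q.unitΦ (ididΔ Q.Δ) * Q.unitΦ (Δidid Q.Δ) := by
    rw [eq_mul_inv_of_mul_eq Q.pentagon_units.symm]
    group
  simpa only [Units.val_mul, unitΦ_val, unitΦ_inv] using congrArg Units.val h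

theorem pentagon_idΔid_inv :
    idΔid Q.Δ Q.Φi =
    tensorOne k H Q.Φe * Δidid Q.Δ Q.Φi * ididΔ Q.Δ Q.Φi * oneTensor k H Q.Φe := by
  have h : (Q.unitΦ (idΔid Q.Δ))⁻¹ =
      Q.unitΦ (tensorOne k H) * (Q.unitΦ (Δidid Q.Δ))⁻¹ * (Q.unitΦ (ididΔ Q.Δ))⁻¹ * Q.unitΦ (oneTensor k H) := by
    rw [eq_mul_inv_of_mul_eq Q.pentagon_units.symm]
    group
  simpa only [Units.val_mul, unitΦ_val, unitΦ_inv] using congrArg Units.val h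

theorem pentagon_one_Δidid :
    tensorOne k H Q.Φe * Δidid Q.Δ Q.Φi =
    idΔid Q.Δ Q.Φi * oneTensor k H Q.Φi * ididΔ Q.Δ Q.Φe := by
  have h : Q.unitΦ (tensorOne k H) * (Q.unitΦ (Δidid Q.Δ))⁻¹ =
      (Q.unitΦ (idΔid Q.Δ))⁻¹ * (Q.unitΦ (oneTensor k H))⁻¹ * Q.unitΦ (ididΔ Q.Δ) := by
    rw [eq_mul_inv_of_mul_eq Q.pentagon_units.symm]
    group
  simpa only [Units.val_mul, unitΦ_val, unitΦ_inv] using congrArg Units.val h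

theorem pentagon_one_idΔid_inv :
    tensorOne k H Q.Φi * idΔid Q.Δ Q.Φi =
    Δidid Q.Δ Q.Φi * ididΔ Q.Δ Q.Φi * oneTensor k H Q.Φe := by
  have h : (Q.unitΦ (tensorOne k H))⁻¹ * (Q.unitΦ (idΔid Q.Δ))⁻¹ =
      (Q.unitΦ (Δidid Q.Δ))⁻¹ * (Q.unitΦ (ididΔ Q.Δ))⁻¹ * Q.unitΦ (oneTensor k H) := by
    rw [eq_mul_inv_of_mul_eq Q.pentagon_units.symm]
    group
  simpa only [Units.val_mul, unitΦ_val, unitΦ_inv] using congrArg Units.val h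

theorem pentagon_idΔid_inv_one :
    idΔid Q.Δ Q.Φi * oneTensor k H Q.Φi =
    tensorOne k H Q.Φe * Δidid Q.Δ Q.Φi * ididΔ Q.Δ Q.Φi := by
  have h : (Q.unitΦ (idΔid Q.Δ))⁻¹ * (Q.unitΦ (oneTensor k H))⁻¹ =
      Q.unitΦ (tensorOne k H) * (Q.unitΦ (Δidid Q.Δ))⁻¹ * (Q.unitΦ (ididΔ Q.Δ))⁻¹ := by
    rw [eq_mul_inv_of_mul_eq Q.pentagon_units.symm]
    group
  simpa only [Units.val_mul, unitΦ_val, unitΦ_inv] using congrArg Units.val h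

theorem pentagon_one_ididΔ :
    oneTensor k H Q.Φi * ididΔ Q.Δ Q.Φe =
    idΔid Q.Δ Q.Φe * tensorOne k H Q.Φe * Δidid Q.Δ Q.Φi := by
  have h : (Q.unitΦ (oneTensor k H))⁻¹ * Q.unitΦ (ididΔ Q.Δ) =
      Q.unitΦ (idΔid Q.Δ) * Q.unitΦ (tensorOne k H) * (Q.unitΦ (Δidid Q.Δ))⁻¹ := by
    rw [eq_mul_inv_of_mul_eq Q.pentagon_units.symm]
    group
  simpa only [Units.val_mul, unitΦ_val, unitΦ_inv] using congrArg Units.val h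

theorem pentagon_ididΔ_Δidid_one :
    ididΔ Q.Δ Q.Φe * Δidid Q.Δ Q.Φe * tensorOne k H Q.Φi =
    oneTensor k H Q.Φe * idΔid Q.Δ Q.Φe := by
  have h : Q.unitΦ (ididΔ Q.Δ) * Q.unitΦ (Δidid Q.Δ) * (Q.unitΦ (tensorOne k H))⁻¹ =
      Q.unitΦ (oneTensor k H) * Q.unitΦ (idΔid Q.Δ) := by
    rw [eq_mul_inv_of_mul_eq Q.pentagon_units.symm]
    group
  simpa only [Units.val_mul, unitΦ_val, unitΦ_inv] using congrArg Units.val h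

theorem pentagon_one_ididΔ_Δidid :
    oneTensor k H Q.Φi * ididΔ Q.Δ Q.Φe * Δidid Q.Δ Q.Φe =
    idΔid Q.Δ Q.Φe * tensorOne k H Q.Φe := by
  have h : (Q.unitΦ (oneTensor k H))⁻¹ * Q.unitΦ (ididΔ Q.Δ) * Q.unitΦ (Δidid Q.Δ) =
      Q.unitΦ (idΔid Q.Δ) * Q.unitΦ (tensorOne k H) := by
    rw [eq_mul_inv_of_mul_eq Q.pentagon_units.symm]
    group
  simpa only [Units.val_mul, unitΦ_val, unitΦ_inv] using congrArg Units.val h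

end QuasiHopfAlgebra

end QuasiHopf

namespace QuasiHopf

namespace QuasiHopfAlgebra

variable {k H : Type*} [Field k] [Ring H] [Algebra k H] (Q : QuasiHopfAlgebra k H)

/-! ### Counits in tensor slots -/

/-- `a ⊗ b ↦ ε(a) b`. -/
def εL : H ⊗[k] H →ₐ[k] H :=
  (Algebra.TensorProduct.lid k H).toAlgHom.comp
    (Algebra.TensorProduct.map Q.ε (AlgHom.id k H))

/-- `a ⊗ b ↦ ε(b) a`. -/
def εR : H ⊗[k] H →ₐ[k] H :=
  (Algebra.TensorProduct.rid k k H).toAlgHom.comp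
    (Algebra.TensorProduct.map (AlgHom.id k H) Q.ε)

/-- `a ⊗ t ↦ ε(a) t`. -/
def ε1 : H ⊗[k] (H ⊗[k] H) →ₐ[k] H ⊗[k] H :=
  (Algebra.TensorProduct.lid k (H ⊗[k] H)).toAlgHom.comp
    (Algebra.TensorProduct.map Q.ε (AlgHom.id k (H ⊗[k] H)))

/-- `a ⊗ (b ⊗ c) ↦ a ⊗ ε(b) c`. -/
def ε2 : H ⊗[k] (H ⊗[k] H) →ₐ[k] H ⊗[k] H := Algebra.TensorProduct.map (AlgHom.id k H) Q.εL

/-- `a ⊗ (b ⊗ c) ↦ a ⊗ ε(c) b`. -/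
def ε3 : H ⊗[k] (H ⊗[k] H) →ₐ[k] H ⊗[k] H := Algebra.TensorProduct.map (AlgHom.id k H) Q.εR

@[simp] theorem εL_tmul (a b : H) : Q.εL (a ⊗ₜ b) = Q.ε a • b := rfl
@[simp] theorem εR_tmul (a b : H) : Q.εR (a ⊗ₜ b) = Q.ε b • a := rfl
@[simp] theorem ε1_tmul (a : H) (t : H ⊗[k] H) : Q.ε1 (a ⊗ₜ t) = Q.ε a • t := rfl
@[simp] theorem ε2_tmul (a : H) (t : H ⊗[k] H) : Q.ε2 (a ⊗ₜ t) = a ⊗ₜ Q.εL t := rfl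
@[simp] theorem ε3_tmul (a : H) (t : H ⊗[k] H) : Q.ε3 (a ⊗ₜ t) = a ⊗ₜ Q.εR t := rfl

@[simp] theorem εL_Δ (h : H) : Q.εL (Q.Δ h) = h := Q.counit_left h
@[simp] theorem εR_Δ (h : H) : Q.εR (Q.Δ h) = h := Q.counit_right h

@[simp] theorem ε2_Φe : Q.ε2 Q.Φe = 1 := Q.normalized

theorem map_Φi_eq_one {A : Type*} [Ring A] [Algebra k A] (E : H ⊗[k] (H ⊗[k] H) →ₐ[k] A)
    (h : E Q.Φe = 1) : E Q.Φi = 1 := by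
  have := congrArg E Q.Φe_mul_Φi
  rwa [map_mul, h, one_mul, map_one] at this

@[simp] theorem ε2_Φi : Q.ε2 Q.Φi = 1 := Q.map_Φi_eq_one _ Q.ε2_Φe

/-- `(a ⊗ b) ⊗ t ↦ ε(b) a ⊗ t`. -/
def ε2of4 : (H ⊗[k] H) ⊗[k] (H ⊗[k] H) →ₐ[k] H ⊗[k] (H ⊗[k] H) :=
  Algebra.TensorProduct.map Q.εR (AlgHom.id k (H ⊗[k] H))

/-- `(a ⊗ b) ⊗ (c ⊗ d) ↦ a ⊗ (b ⊗ ε(c) d)`. -/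
def ε3of4 : (H ⊗[k] H) ⊗[k] (H ⊗[k] H) →ₐ[k] H ⊗[k] (H ⊗[k] H) :=
  (Algebra.TensorProduct.assoc k k k H H H).toAlgHom.comp
    (Algebra.TensorProduct.map (AlgHom.id k (H ⊗[k] H)) Q.εL)

@[simp] theorem ε2of4_tmul (s t : H ⊗[k] H) : Q.ε2of4 (s ⊗ₜ t) = Q.εR s ⊗ₜ t := rfl
@[simp] theorem ε3of4_tmul (a b : H) (t : H ⊗[k] H) :
    Q.ε3of4 ((a ⊗ₜ b) ⊗ₜ t) = a ⊗ₜ (b ⊗ₜ Q.εL t) := rfl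

theorem ε2of4_insM (t : H ⊗[k] H) : Q.ε2of4 (insM k H t) = 1 ⊗ₜ (Q.εL t ⊗ₜ 1) := by
  induction t using TensorProduct.induction_on with
  | zero => simp
  | tmul a b => simp [← TensorProduct.smul_tmul', TensorProduct.tmul_smul]
  | add x y hx hy => simp only [map_add, hx, hy, TensorProduct.tmul_add, TensorProduct.add_tmul]

theorem ε3of4_insM (t : H ⊗[k] H) : Q.ε3of4 (insM k H t) = 1 ⊗ₜ (Q.εR t ⊗ₜ 1) := by
  induction t using TensorProduct.induction_on with
  | zero => simp
  | tmul a b => simp [← TensorProduct.smul_tmul', TensorProduct.tmul_smul]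
  | add x y hx hy => simp only [map_add, hx, hy, TensorProduct.tmul_add, TensorProduct.add_tmul]

theorem oneTensor_mul_idΔid_mul_tensorOne :
    oneTensor k H Q.Φe * idΔid Q.Δ Q.Φe * tensorOne k H Q.Φe =
      ididΔ Q.Δ Q.Φe * Δidid Q.Δ Q.Φe := Q.pentagon

-- Applying ε to the second leg of the pentagon turns two factors into 1 by normalization and leaves
-- (1 ⊗ `ε1`(Φ)) Φ = Φ. Cancelling Φ and applying ε to the first leg gives the claim.
@[simp] theorem ε1_Φe : Q.ε1 Q.Φe = 1 := by
  have h1 : Q.ε2of4.toLinearMap ∘ₗ (oneTensor k H).toLinearMap =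
      (ins23 k H).toLinearMap ∘ₗ Q.ε1.toLinearMap := ext3 fun a b c => by
    simp [← TensorProduct.smul_tmul']
  have h2 : Q.ε2of4.toLinearMap ∘ₗ (idΔid Q.Δ).toLinearMap = LinearMap.id := ext3 fun a b c => by
    simp [idΔid_tmul, ε2of4_insM]
  have h3 : Q.ε2of4.toLinearMap ∘ₗ (tensorOne k H).toLinearMap =
      (ins12 k H).toLinearMap ∘ₗ Q.ε2.toLinearMap := ext3 fun a b c => by
    simp [← TensorProduct.smul_tmul', TensorProduct.tmul_smul]
  have h4 : Q.ε2of4.toLinearMap ∘ₗ (ididΔ Q.Δ).toLinearMap =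
      (idΔ Q.Δ).toLinearMap ∘ₗ Q.ε2.toLinearMap := ext3 fun a b c => by
    simp [← TensorProduct.smul_tmul', TensorProduct.tmul_smul]
  have h5 : Q.ε2of4.toLinearMap ∘ₗ (Δidid Q.Δ).toLinearMap = LinearMap.id := ext3 fun a b c => by
    simp
  have h := congrArg Q.ε2of4 Q.oneTensor_mul_idΔid_mul_tensorOne
  rw [map_mul, map_mul, map_mul] at h
  have e1 := LinearMap.congr_fun h1 Q.Φe
  have e2 := LinearMap.congr_fun h2 Q.Φe
  have e3 := LinearMap.congr_fun h3 Q.Φe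
  have e4 := LinearMap.congr_fun h4 Q.Φe
  have e5 := LinearMap.congr_fun h5 Q.Φe
  simp only [LinearMap.comp_apply, AlgHom.toLinearMap_apply, LinearMap.id_apply, ε2_Φe,
    map_one] at e1 e2 e3 e4 e5
  rw [e1, e2, e3, e4, e5, mul_one, one_mul] at h
  have h' := congrArg (fun z => Q.ε1 (z * Q.Φi)) h
  simpa only [mul_assoc, Φe_mul_Φi, mul_one, map_one, ins23_apply, ε1_tmul, one_smul] using h'

-- Same argument with ε on the third leg of the pentagon, which leaves Φ (`ε3`(Φ) ⊗ 1) = Φ.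
@[simp] theorem ε3_Φe : Q.ε3 Q.Φe = 1 := by
  have h1 : Q.ε3of4.toLinearMap ∘ₗ (oneTensor k H).toLinearMap =
      (ins23 k H).toLinearMap ∘ₗ Q.ε2.toLinearMap := ext3 fun a b c => by
    simp
  have h2 : Q.ε3of4.toLinearMap ∘ₗ (idΔid Q.Δ).toLinearMap = LinearMap.id := ext3 fun a b c => by
    simp [idΔid_tmul, ε3of4_insM]
  have h3 : Q.ε3of4.toLinearMap ∘ₗ (tensorOne k H).toLinearMap =
      (ins12 k H).toLinearMap ∘ₗ Q.ε3.toLinearMap := ext3 fun a b c => by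
    simp [TensorProduct.tmul_smul]
  have h4 : Q.ε3of4.toLinearMap ∘ₗ (ididΔ Q.Δ).toLinearMap = LinearMap.id :=
    ext3 fun a b c => by simp
  have h5 : Q.ε3of4.toLinearMap ∘ₗ (Δidid Q.Δ).toLinearMap =
      (Δid Q.Δ).toLinearMap ∘ₗ Q.ε2.toLinearMap := ext3 fun a b c => rfl
  have h := congrArg Q.ε3of4 Q.oneTensor_mul_idΔid_mul_tensorOne
  rw [map_mul, map_mul, map_mul] at h
  have e1 := LinearMap.congr_fun h1 Q.Φe
  have e2 := LinearMap.congr_fun h2 Q.Φe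
  have e3 := LinearMap.congr_fun h3 Q.Φe
  have e4 := LinearMap.congr_fun h4 Q.Φe
  have e5 := LinearMap.congr_fun h5 Q.Φe
  simp only [LinearMap.comp_apply, AlgHom.toLinearMap_apply, LinearMap.id_apply, ε2_Φe,
    map_one] at e1 e2 e3 e4 e5
  rw [e1, e2, e3, e4, e5, mul_one, one_mul] at h
  have h6 : Q.ε3.toLinearMap ∘ₗ (ins12 k H).toLinearMap = LinearMap.id :=
    ext2 fun a b => by simp
  have h' := congrArg (fun z => Q.ε3 (Q.Φi * z)) h
  simp only [← mul_assoc, Φi_mul_Φe, one_mul, map_one] at h'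
  exact (LinearMap.congr_fun h6 (Q.ε3 Q.Φe)).symm.trans h'

@[simp] theorem ε1_Φi : Q.ε1 Q.Φi = 1 := Q.map_Φi_eq_one _ Q.ε1_Φe
@[simp] theorem ε3_Φi : Q.ε3 Q.Φi = 1 := Q.map_Φi_eq_one _ Q.ε3_Φe

/-! ### Linear maps absorbing coproducts -/

section Absorb

variable {A V : Type*} [Ring A] [Algebra k A] [AddCommGroup V] [Module k V]

/-- `T (ins(Δ(h)) z) = ε(h) T(z)`. -/
def AbsorbsLeft (T : A →ₗ[k] V) (ins : H ⊗[k] H →ₐ[k] A) : Prop :=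
  ∀ h z, T (ins (Q.Δ h) * z) = Q.ε h • T z

/-- `T (z ins(Δ(h))) = ε(h) T(z)`. -/
def AbsorbsRight (T : A →ₗ[k] V) (ins : H ⊗[k] H →ₐ[k] A) : Prop :=
  ∀ h z, T (z * ins (Q.Δ h)) = Q.ε h • T z

variable {Q} {T : A →ₗ[k] V} {ins : H ⊗[k] H →ₐ[k] A}

theorem AbsorbsLeft.slot {C : Type*} [Ring C] [Algebra k C] (hT : Q.AbsorbsLeft T ins)
    (E : C →ₐ[k] A) (y : C) (h : H) (c : C) (hy : E y = ins (Q.Δ h)) (z : A) :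
    T (E (y * c) * z) = Q.ε h • T (E c * z) := by
  rw [map_mul E, hy, mul_assoc, hT]

/-- If E places the coproduct of its first leg where T absorbs coproducts, then T sees only the
counit of that leg. For y = Φ or Φ⁻¹ that counit is 1, so the whole factor E(y) disappears; this is
how factors of the pentagon are removed. -/
theorem AbsorbsLeft.one (hT : Q.AbsorbsLeft T ins) (E : H ⊗[k] (H ⊗[k] H) →ₐ[k] A)
    (hE : ∀ h, E (h ⊗ₜ 1) = ins (Q.Δ h)) (y : H ⊗[k] (H ⊗[k] H)) (z : A) :
    T (E y * z) = T (E (ins23 k H (Q.ε1 y)) * z) := by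
  induction y using induction3 with
  | h0 => simp
  | h1 a b c =>
    have : a ⊗ₜ[k] (b ⊗ₜ[k] c) = (a ⊗ₜ 1) * (1 ⊗ₜ (b ⊗ₜ c)) := by simp
    rw [this, hT.slot E _ a _ (hE a)]
    simp
  | h2 x y hx hy => simp only [map_add, add_mul, hx, hy]

theorem AbsorbsLeft.two (hT : Q.AbsorbsLeft T ins) (E : H ⊗[k] (H ⊗[k] H) →ₐ[k] A)
    (hE : ∀ h, E (1 ⊗ₜ (h ⊗ₜ 1)) = ins (Q.Δ h)) (y : H ⊗[k] (H ⊗[k] H)) (z : A) :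
    T (E y * z) = T (E (ins13 k H (Q.ε2 y)) * z) := by
  induction y using induction3 with
  | h0 => simp
  | h1 a b c =>
    have : a ⊗ₜ[k] (b ⊗ₜ[k] c) = (1 ⊗ₜ (b ⊗ₜ 1)) * (a ⊗ₜ (1 ⊗ₜ c)) := by simp
    rw [this, hT.slot E _ b _ (hE b)]
    simp
  | h2 x y hx hy => simp only [map_add, add_mul, hx, hy]

theorem AbsorbsLeft.three (hT : Q.AbsorbsLeft T ins) (E : H ⊗[k] (H ⊗[k] H) →ₐ[k] A)
    (hE : ∀ h, E (1 ⊗ₜ (1 ⊗ₜ h)) = ins (Q.Δ h)) (y : H ⊗[k] (H ⊗[k] H)) (z : A) :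
    T (E y * z) = T (E (ins12 k H (Q.ε3 y)) * z) := by
  induction y using induction3 with
  | h0 => simp
  | h1 a b c =>
    have : a ⊗ₜ[k] (b ⊗ₜ[k] c) = (1 ⊗ₜ (1 ⊗ₜ c)) * (a ⊗ₜ (b ⊗ₜ 1)) := by simp
    rw [this, hT.slot E _ c _ (hE c)]
    simp [TensorProduct.tmul_smul]
  | h2 x y hx hy => simp only [map_add, add_mul, hx, hy]

theorem AbsorbsRight.slot {C : Type*} [Ring C] [Algebra k C] (hT : Q.AbsorbsRight T ins)
    (E : C →ₐ[k] A) (y : C) (h : H) (c : C) (hy : E y = ins (Q.Δ h)) (z : A) :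
    T (z * E (c * y)) = Q.ε h • T (z * E c) := by
  rw [map_mul E, hy, ← mul_assoc, hT]

theorem AbsorbsRight.one (hT : Q.AbsorbsRight T ins) (E : H ⊗[k] (H ⊗[k] H) →ₐ[k] A)
    (hE : ∀ h, E (h ⊗ₜ 1) = ins (Q.Δ h)) (y : H ⊗[k] (H ⊗[k] H)) (z : A) :
    T (z * E y) = T (z * E (ins23 k H (Q.ε1 y))) := by
  induction y using induction3 with
  | h0 => simp
  | h1 a b c =>
    have : a ⊗ₜ[k] (b ⊗ₜ[k] c) = (1 ⊗ₜ (b ⊗ₜ c)) * (a ⊗ₜ 1) := by simp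
    rw [this, hT.slot E _ a _ (hE a)]
    simp
  | h2 x y hx hy => simp only [map_add, mul_add, hx, hy]

theorem AbsorbsRight.two (hT : Q.AbsorbsRight T ins) (E : H ⊗[k] (H ⊗[k] H) →ₐ[k] A)
    (hE : ∀ h, E (1 ⊗ₜ (h ⊗ₜ 1)) = ins (Q.Δ h)) (y : H ⊗[k] (H ⊗[k] H)) (z : A) :
    T (z * E y) = T (z * E (ins13 k H (Q.ε2 y))) := by
  induction y using induction3 with
  | h0 => simp
  | h1 a b c =>
    have : a ⊗ₜ[k] (b ⊗ₜ[k] c) = (a ⊗ₜ (1 ⊗ₜ c)) * (1 ⊗ₜ (b ⊗ₜ 1)) := by simp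
    rw [this, hT.slot E _ b _ (hE b)]
    simp
  | h2 x y hx hy => simp only [map_add, mul_add, hx, hy]

theorem AbsorbsRight.three (hT : Q.AbsorbsRight T ins) (E : H ⊗[k] (H ⊗[k] H) →ₐ[k] A)
    (hE : ∀ h, E (1 ⊗ₜ (1 ⊗ₜ h)) = ins (Q.Δ h)) (y : H ⊗[k] (H ⊗[k] H)) (z : A) :
    T (z * E y) = T (z * E (ins12 k H (Q.ε3 y))) := by
  induction y using induction3 with
  | h0 => simp
  | h1 a b c =>
    have : a ⊗ₜ[k] (b ⊗ₜ[k] c) = (a ⊗ₜ (b ⊗ₜ 1)) * (1 ⊗ₜ (1 ⊗ₜ c)) := by simp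
    rw [this, hT.slot E _ c _ (hE c)]
    simp [TensorProduct.tmul_smul]
  | h2 x y hx hy => simp only [map_add, mul_add, hx, hy]

theorem Δidid_slot (h : H) : Δidid Q.Δ (h ⊗ₜ 1) = insL k H (Q.Δ h) := rfl

theorem ididΔ_slot (h : H) : ididΔ Q.Δ (1 ⊗ₜ (1 ⊗ₜ h)) = insR k H (Q.Δ h) := rfl

theorem idΔid_slot (h : H) : idΔid Q.Δ (1 ⊗ₜ (h ⊗ₜ 1)) = insM k H (Q.Δ h) := by
  rw [idΔid_tmul]
  exact one_mul _

variable {T : (H ⊗[k] H) ⊗[k] (H ⊗[k] H) →ₗ[k] V}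

theorem AbsorbsLeft.Δidid_Φe (hT : Q.AbsorbsLeft T (insL k H)) (z) :
    T (Δidid Q.Δ Q.Φe * z) = T z := by
  rw [hT.one _ Δidid_slot, ε1_Φe, map_one, map_one, one_mul]

theorem AbsorbsLeft.Δidid_Φi (hT : Q.AbsorbsLeft T (insL k H)) (z) :
    T (Δidid Q.Δ Q.Φi * z) = T z := by
  rw [hT.one _ Δidid_slot, ε1_Φi, map_one, map_one, one_mul]

theorem AbsorbsLeft.idΔid_Φe (hT : Q.AbsorbsLeft T (insM k H)) (z) :
    T (idΔid Q.Δ Q.Φe * z) = T z := by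
  rw [hT.two _ idΔid_slot, ε2_Φe, map_one, map_one, one_mul]

theorem AbsorbsLeft.idΔid_Φi (hT : Q.AbsorbsLeft T (insM k H)) (z) :
    T (idΔid Q.Δ Q.Φi * z) = T z := by
  rw [hT.two _ idΔid_slot, ε2_Φi, map_one, map_one, one_mul]

theorem AbsorbsLeft.ididΔ_Φi (hT : Q.AbsorbsLeft T (insR k H)) (z) :
    T (ididΔ Q.Δ Q.Φi * z) = T z := by
  rw [hT.three _ ididΔ_slot, ε3_Φi, map_one, map_one, one_mul]

theorem AbsorbsRight.Δidid_Φe (hT : Q.AbsorbsRight T (insL k H)) (z) :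
    T (z * Δidid Q.Δ Q.Φe) = T z := by
  rw [hT.one _ Δidid_slot, ε1_Φe, map_one, map_one, mul_one]

theorem AbsorbsRight.Δidid_Φi (hT : Q.AbsorbsRight T (insL k H)) (z) :
    T (z * Δidid Q.Δ Q.Φi) = T z := by
  rw [hT.one _ Δidid_slot, ε1_Φi, map_one, map_one, mul_one]

theorem AbsorbsRight.idΔid_Φe (hT : Q.AbsorbsRight T (insM k H)) (z) :
    T (z * idΔid Q.Δ Q.Φe) = T z := by
  rw [hT.two _ idΔid_slot, ε2_Φe, map_one, map_one, mul_one]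

theorem AbsorbsRight.idΔid_Φi (hT : Q.AbsorbsRight T (insM k H)) (z) :
    T (z * idΔid Q.Δ Q.Φi) = T z := by
  rw [hT.two _ idΔid_slot, ε2_Φi, map_one, map_one, mul_one]

theorem AbsorbsRight.ididΔ_Φe (hT : Q.AbsorbsRight T (insR k H)) (z) :
    T (z * ididΔ Q.Δ Q.Φe) = T z := by
  rw [hT.three _ ididΔ_slot, ε3_Φe, map_one, map_one, mul_one]

theorem AbsorbsRight.ididΔ_Φi (hT : Q.AbsorbsRight T (insR k H)) (z) :
    T (z * ididΔ Q.Δ Q.Φi) = T z := by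
  rw [hT.three _ ididΔ_slot, ε3_Φi, map_one, map_one, mul_one]

end Absorb

end QuasiHopfAlgebra

end QuasiHopf

namespace QuasiHopf

namespace QuasiHopfAlgebra

variable {k H : Type*} [Field k] [Ring H] [Algebra k H] {Q : QuasiHopfAlgebra k H}

section Absorb2

variable {A V : Type*} [Ring A] [Algebra k A] [AddCommGroup V] [Module k V]
  {T : A →ₗ[k] V} {ins : H ⊗[k] H →ₐ[k] A}

/-- The two-leg version, used with E = `Δid` or `idΔ` on quasi-coassociativity: of the iterated
coproduct of h only h itself survives. -/
theorem AbsorbsLeft.fst (hT : Q.AbsorbsLeft T ins) (E : H ⊗[k] H →ₐ[k] A)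
    (hE : ∀ h, E (h ⊗ₜ 1) = ins (Q.Δ h)) (y : H ⊗[k] H) (z : A) :
    T (E y * z) = T (E (1 ⊗ₜ Q.εL y) * z) := by
  induction y using TensorProduct.induction_on with
  | zero => simp
  | tmul a b =>
    have : a ⊗ₜ[k] b = (a ⊗ₜ 1) * (1 ⊗ₜ b) := by simp
    rw [this, hT.slot E _ a _ (hE a)]
    simp
  | add x y hx hy => simp only [map_add, TensorProduct.tmul_add, add_mul, hx, hy]

theorem AbsorbsRight.snd (hT : Q.AbsorbsRight T ins) (E : H ⊗[k] H →ₐ[k] A)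
    (hE : ∀ h, E (1 ⊗ₜ h) = ins (Q.Δ h)) (y : H ⊗[k] H) (z : A) :
    T (z * E y) = T (z * E (Q.εR y ⊗ₜ 1)) := by
  induction y using TensorProduct.induction_on with
  | zero => simp
  | tmul a b =>
    have : a ⊗ₜ[k] b = (a ⊗ₜ 1) * (1 ⊗ₜ b) := by simp
    rw [this, hT.slot E _ b _ (hE b)]
    simp [← TensorProduct.smul_tmul']
  | add x y hx hy => simp only [map_add, TensorProduct.add_tmul, mul_add, hx, hy]

theorem Δid_slot (h : H) : Δid Q.Δ (h ⊗ₜ 1) = ins12 k H (Q.Δ h) := by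
  rw [Δid_tmul]
  exact mul_one _

theorem Δid_one_tmul (h : H) : Δid Q.Δ (1 ⊗ₜ h) = 1 ⊗ₜ (1 ⊗ₜ h) := by
  simp [Δid_tmul]

end Absorb2

/-! ### Antipodes relative to an algebra map. -/

variable {B : Type*} [Ring B] [Algebra k B]

/-- Antipode data `(S, α, β)` relative to an algebra map `D : H → B`. -/
structure IsAntipode (Q : QuasiHopfAlgebra k H) (D : H →ₐ[k] B) (S : H →ₗ[k] B) (α β : B) :
    Prop where
  map_one : S 1 = 1
  map_mul : ∀ a b, S (a * b) = S b * S a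
  /-- `S(h₁) α D(h₂) = ε(h) α` -/
  left : ∀ h, sandwich S α D.toLinearMap (Q.Δ h) = Q.ε h • α
  /-- `D(h₁) β S(h₂) = ε(h) β` -/
  right : ∀ h, sandwich D.toLinearMap β S (Q.Δ h) = Q.ε h • β
  /-- `D(X¹) β S(X²) α D(X³) = 1` -/
  zig : sandwich D.toLinearMap β (sandwich S α D.toLinearMap) Q.Φe = 1
  /-- `S(x¹) α D(x²) β S(x³) = 1` -/
  zag : sandwich S α (sandwich D.toLinearMap β S) Q.Φi = 1

namespace IsAntipode

variable {D : H →ₐ[k] B} {S : H →ₗ[k] B} {α β : B} (hS : Q.IsAntipode D S α β)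
  {V : Type*} [AddCommGroup V] [Module k V]

include hS

theorem collapse_left (T : H ⊗[k] H →ₗ[k] V) (L : B →ₗ[k] V)
    (h : ∀ u v, T (u ⊗ₜ v) = L (S u * α * D v)) (x : H) : T (Q.Δ x) = Q.ε x • L α := by
  rw [← map_smul, ← hS.left x]
  exact LinearMap.congr_fun (ext2 (T' := L ∘ₗ sandwich S α D.toLinearMap) h) _

theorem collapse_right (T : H ⊗[k] H →ₗ[k] V) (L : B →ₗ[k] V)
    (h : ∀ u v, T (u ⊗ₜ v) = L (D u * β * S v)) (x : H) : T (Q.Δ x) = Q.ε x • L β := by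
  rw [← map_smul, ← hS.right x]
  exact LinearMap.congr_fun (ext2 (T' := L ∘ₗ sandwich D.toLinearMap β S) h) _

/-- A form absorbs coproducts as soon as it depends on the two relevant legs only through S(u) α
D(v); the map L carries the rest of the expression, with z frozen. -/
theorem absorbsLeft_aux {A : Type*} [Ring A] [Algebra k A] {T : A →ₗ[k] V}
    {ins : H ⊗[k] H →ₐ[k] A} {z : A}
    (h : ∃ L : B →ₗ[k] V, ∀ u v, T (ins (u ⊗ₜ v) * z) = L (S u * α * D v)) (x : H) :
    T (ins (Q.Δ x) * z) = Q.ε x • T z := by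
  obtain ⟨L, hL⟩ := h
  have h1 := hS.collapse_left (T ∘ₗ LinearMap.mulRight k z ∘ₗ ins.toLinearMap) L hL x
  -- Taking u = v = 1 identifies L(α) with T(z).
  have h2 := hL 1 1
  rw [← Algebra.TensorProduct.one_def, _root_.map_one ins, one_mul, hS.map_one, one_mul,
    _root_.map_one D, mul_one] at h2
  rw [h2]
  exact h1

theorem absorbsRight_aux {A : Type*} [Ring A] [Algebra k A] {T : A →ₗ[k] V}
    {ins : H ⊗[k] H →ₐ[k] A} {z : A}
    (h : ∃ L : B →ₗ[k] V, ∀ u v, T (z * ins (u ⊗ₜ v)) = L (D u * β * S v)) (x : H) :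
    T (z * ins (Q.Δ x)) = Q.ε x • T z := by
  obtain ⟨L, hL⟩ := h
  have h1 := hS.collapse_right (T ∘ₗ LinearMap.mulLeft k z ∘ₗ ins.toLinearMap) L hL x
  have h2 := hL 1 1
  rw [← Algebra.TensorProduct.one_def, _root_.map_one ins, mul_one, hS.map_one, mul_one,
    _root_.map_one D, one_mul] at h2
  rw [h2]
  exact h1

theorem absorbsLeft3 {T : H ⊗[k] (H ⊗[k] H) →ₗ[k] V} {ins : H ⊗[k] H →ₐ[k] H ⊗[k] (H ⊗[k] H)}
    (h : ∀ a b c, ∃ L : B →ₗ[k] V, ∀ u v,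
      T (ins (u ⊗ₜ v) * (a ⊗ₜ (b ⊗ₜ c))) = L (S u * α * D v)) : Q.AbsorbsLeft T ins := by
  intro x z
  induction z using induction3 with
  | h0 => simp
  | h1 a b c => exact hS.absorbsLeft_aux (h a b c) x
  | h2 y z hy hz => rw [mul_add, map_add, map_add, hy, hz, smul_add]

theorem absorbsRight3 {T : H ⊗[k] (H ⊗[k] H) →ₗ[k] V} {ins : H ⊗[k] H →ₐ[k] H ⊗[k] (H ⊗[k] H)}
    (h : ∀ a b c, ∃ L : B →ₗ[k] V, ∀ u v,
      T ((a ⊗ₜ (b ⊗ₜ c)) * ins (u ⊗ₜ v)) = L (D u * β * S v)) : Q.AbsorbsRight T ins := by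
  intro x z
  induction z using induction3 with
  | h0 => simp
  | h1 a b c => exact hS.absorbsRight_aux (h a b c) x
  | h2 y z hy hz => rw [add_mul, map_add, map_add, hy, hz, smul_add]

theorem absorbsLeft4 {T : (H ⊗[k] H) ⊗[k] (H ⊗[k] H) →ₗ[k] V}
    {ins : H ⊗[k] H →ₐ[k] (H ⊗[k] H) ⊗[k] (H ⊗[k] H)}
    (h : ∀ a b c d, ∃ L : B →ₗ[k] V, ∀ u v,
      T (ins (u ⊗ₜ v) * ((a ⊗ₜ b) ⊗ₜ (c ⊗ₜ d))) = L (S u * α * D v)) : Q.AbsorbsLeft T ins := by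
  intro x z
  induction z using induction4 with
  | h0 => simp
  | h1 a b c d => exact hS.absorbsLeft_aux (h a b c d) x
  | h2 y z hy hz => rw [mul_add, map_add, map_add, hy, hz, smul_add]

theorem absorbsRight4 {T : (H ⊗[k] H) ⊗[k] (H ⊗[k] H) →ₗ[k] V}
    {ins : H ⊗[k] H →ₐ[k] (H ⊗[k] H) ⊗[k] (H ⊗[k] H)}
    (h : ∀ a b c d, ∃ L : B →ₗ[k] V, ∀ u v,
      T (((a ⊗ₜ b) ⊗ₜ (c ⊗ₜ d)) * ins (u ⊗ₜ v)) = L (D u * β * S v)) :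
    Q.AbsorbsRight T ins := by
  intro x z
  induction z using induction4 with
  | h0 => simp
  | h1 a b c d => exact hS.absorbsRight_aux (h a b c d) x
  | h2 y z hy hz => rw [add_mul, map_add, map_add, hy, hz, smul_add]

end IsAntipode

/-! ### Uniqueness of antipodes -/

/-- The element `S₂(x¹) α₂ D(x²) β₁ S₁(x³)` comparing two antipodes. -/
def antipodeTwist (Q : QuasiHopfAlgebra k H) (D : H →ₐ[k] B) (S₂ : H →ₗ[k] B) (α₂ β₁ : B)
    (S₁ : H →ₗ[k] B) : B :=
  sandwich S₂ α₂ (sandwich D.toLinearMap β₁ S₁) Q.Φi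

namespace IsAntipode

variable {D : H →ₐ[k] B} {S₁ S₂ : H →ₗ[k] B} {α₁ β₁ α₂ β₂ : B}
  (h₁ : Q.IsAntipode D S₁ α₁ β₁) (h₂ : Q.IsAntipode D S₂ α₂ β₂)

include h₁ h₂

/-- Apply S₂(a) α₂ D(b) β₁ S₁(c) to quasi-coassociativity for Φ⁻¹. On one side D(b) β₁ S₁(c) absorbs
the inner coproduct and leaves S₂(h) on the left; on the other S₂(a) α₂ D(b) absorbs it and leaves
S₁(h) on the right. -/
theorem twist_mul_antipode (h : H) :
    Q.antipodeTwist D S₂ α₂ β₁ S₁ * S₁ h = S₂ h * Q.antipodeTwist D S₂ α₂ β₁ S₁ := by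
  set T := sandwich S₂ α₂ (sandwich D.toLinearMap β₁ S₁) with hTdef
  have hl : Q.AbsorbsLeft T (ins12 k H) := h₂.absorbsLeft3 fun a b c =>
    ⟨LinearMap.mulLeft k (S₂ a) ∘ₗ LinearMap.mulRight k (D b * β₁ * S₁ c), fun u v => by
      simp [hTdef, h₂.map_mul, mul_assoc]⟩
  have hr : Q.AbsorbsRight T (ins23 k H) := h₁.absorbsRight3 fun a b c =>
    ⟨LinearMap.mulLeft k (S₂ a * α₂ * D b) ∘ₗ LinearMap.mulRight k (S₁ c), fun u v => by
      simp [hTdef, h₁.map_mul, mul_assoc]⟩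
  have e := congrArg T (Q.Φi_mul_idΔ h)
  rw [hr.snd (idΔ Q.Δ) (fun _ => rfl), hl.fst (Δid Q.Δ) Δid_slot, εR_Δ, εL_Δ, Δid_one_tmul,
    idΔ_tmul] at e
  have e1 : ∀ z, T (z * (h ⊗ₜ Q.Δ 1)) = S₂ h * T z := fun z => by
    induction z using induction3 with
    | h0 => simp
    | h1 a b c => simp [hTdef, h₂.map_mul, mul_assoc, Algebra.TensorProduct.one_def]
    | h2 y z hy hz => simp only [add_mul, map_add, hy, hz, mul_add]
  have e2 : ∀ z, T ((1 ⊗ₜ (1 ⊗ₜ h)) * z) = T z * S₁ h := fun z => by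
    induction z using induction3 with
    | h0 => simp
    | h1 a b c => simp [hTdef, h₁.map_mul, mul_assoc]
    | h2 y z hy hz => simp only [add_mul, map_add, hy, hz, mul_add]
  rw [e1, e2] at e
  exact e.symm

/-- Evaluate S₂(a) α₂ D(b) β₁ S₁(c) α₁ D(d) on a form of the pentagon. The factors containing a
coproduct are absorbed; one side reduces to α₂ times the identity `zig` of the first antipode, the
other to the comparison element times α₁. -/
theorem twist_mul_alpha : Q.antipodeTwist D S₂ α₂ β₁ S₁ * α₁ = α₂ := by
  set R := sandwich (sandwich S₂ α₂ D.toLinearMap) β₁ (sandwich S₁ α₁ D.toLinearMap) with hR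
  have hL : Q.AbsorbsLeft R (insL k H) := h₂.absorbsLeft4 fun a b c d =>
    ⟨LinearMap.mulLeft k (S₂ a) ∘ₗ LinearMap.mulRight k (D b * β₁ * (S₁ c * α₁ * D d)),
      fun u v => by simp [hR, h₂.map_mul, mul_assoc, Algebra.TensorProduct.one_def]⟩
  have hR' : Q.AbsorbsLeft R (insR k H) := h₁.absorbsLeft4 fun a b c d =>
    ⟨LinearMap.mulLeft k (S₂ a * α₂ * D b * β₁ * S₁ c) ∘ₗ LinearMap.mulRight k (D d),
      fun u v => by simp [hR, h₁.map_mul, mul_assoc, Algebra.TensorProduct.one_def]⟩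
  have hM : Q.AbsorbsRight R (insM k H) := h₁.absorbsRight4 fun a b c d =>
    ⟨LinearMap.mulLeft k (S₂ a * α₂ * D b) ∘ₗ LinearMap.mulRight k (S₁ c * α₁ * D d),
      fun u v => by simp [hR, h₁.map_mul, mul_assoc]⟩
  have e := congrArg R Q.pentagon_ididΔ_one_idΔid
  rw [hM.idΔid_Φe, hR'.ididΔ_Φi, hL.Δidid_Φe] at e
  have e1 : ∀ z, R (oneTensor k H z) =
      α₂ * sandwich D.toLinearMap β₁ (sandwich S₁ α₁ D.toLinearMap) z := fun z => by
    induction z using induction3 with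
    | h0 => simp
    | h1 a b c => simp [hR, h₂.map_one, mul_assoc]
    | h2 y z hy hz => simp only [map_add, hy, hz, mul_add]
  have e2 : ∀ z, R (tensorOne k H z) =
      sandwich S₂ α₂ (sandwich D.toLinearMap β₁ S₁) z * α₁ := fun z => by
    induction z using induction3 with
    | h0 => simp
    | h1 a b c => simp [hR, mul_assoc]
    | h2 y z hy hz => simp only [map_add, hy, hz, add_mul]
  rw [e1, e2, h₁.zig, mul_one] at e
  exact e.symm

/-- The mirror image, with D(a) β₁ S₁(b) α₁ D(c) β₂ S₂(d): the pentagon compares β₁ times the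
comparison element with `zig` times β₂. -/
theorem beta_mul_twist : β₁ * Q.antipodeTwist D S₁ α₁ β₂ S₂ = β₂ := by
  set R := sandwich (sandwich D.toLinearMap β₁ S₁) α₁ (sandwich D.toLinearMap β₂ S₂) with hR
  have hL : Q.AbsorbsRight R (insL k H) := h₁.absorbsRight4 fun a b c d =>
    ⟨LinearMap.mulLeft k (D a) ∘ₗ LinearMap.mulRight k (S₁ b * α₁ * (D c * β₂ * S₂ d)),
      fun u v => by simp [hR, h₁.map_mul, mul_assoc, Algebra.TensorProduct.one_def]⟩
  have hR' : Q.AbsorbsRight R (insR k H) := h₂.absorbsRight4 fun a b c d =>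
    ⟨LinearMap.mulLeft k (D a * β₁ * S₁ b * α₁ * D c) ∘ₗ LinearMap.mulRight k (S₂ d),
      fun u v => by simp [hR, h₂.map_mul, mul_assoc, Algebra.TensorProduct.one_def]⟩
  have hM : Q.AbsorbsLeft R (insM k H) := h₁.absorbsLeft4 fun a b c d =>
    ⟨LinearMap.mulLeft k (D a * β₁ * S₁ b) ∘ₗ LinearMap.mulRight k (D c * β₂ * S₂ d),
      fun u v => by simp [hR, h₁.map_mul, mul_assoc]⟩
  have e := congrArg R Q.pentagon_one_ididΔ
  rw [mul_assoc, hM.idΔid_Φe, hR'.ididΔ_Φe, hL.Δidid_Φi] at e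
  have e1 : ∀ z, R (oneTensor k H z) =
      β₁ * sandwich S₁ α₁ (sandwich D.toLinearMap β₂ S₂) z := fun z => by
    induction z using induction3 with
    | h0 => simp
    | h1 a b c => simp [hR, mul_assoc]
    | h2 y z hy hz => simp only [map_add, hy, hz, mul_add]
  have e2 : ∀ z, R (tensorOne k H z) =
      sandwich D.toLinearMap β₁ (sandwich S₁ α₁ D.toLinearMap) z * β₂ := fun z => by
    induction z using induction3 with
    | h0 => simp
    | h1 a b c => simp [hR, h₂.map_one, mul_assoc]
    | h2 y z hy hz => simp only [map_add, hy, hz, add_mul]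
  rw [e1, e2, h₁.zig, one_mul] at e
  exact e

/-- Push the left factor through S₁(x¹) and then into α₁. The second comparison element becomes
S₂(x¹) α₂ D(x²) β₂ S₂(x³), which is 1. -/
theorem twist_mul_twist :
    Q.antipodeTwist D S₂ α₂ β₁ S₁ * Q.antipodeTwist D S₁ α₁ β₂ S₂ = 1 := by
  rw [← h₂.zag]
  have e : ∀ z, Q.antipodeTwist D S₂ α₂ β₁ S₁ *
      sandwich S₁ α₁ (sandwich D.toLinearMap β₂ S₂) z =
      sandwich S₂ α₂ (sandwich D.toLinearMap β₂ S₂) z := fun z => by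
    induction z using induction3 with
    | h0 => simp
    | h1 a b c =>
      simp only [sandwich_tmul, ← mul_assoc, h₁.twist_mul_antipode h₂]
      rw [mul_assoc (S₂ a), h₁.twist_mul_alpha h₂]
    | h2 y z hy hz => simp only [map_add, hy, hz, mul_add]
  exact e _

end IsAntipode

/-- The antipode of a quasi-Hopf algebra. -/
theorem isAntipode (Q : QuasiHopfAlgebra k H) :
    Q.IsAntipode (AlgHom.id k H) Q.S.toLinearMap Q.α Q.β where
  map_one := Q.antipode_one
  map_mul := Q.antipode_mul
  left h := by
    refine Eq.trans ?_ (Q.antipode_left h)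
    exact LinearMap.congr_fun (lift2_eq _ fun a b => rfl).symm _
  right h := by
    refine Eq.trans ?_ (Q.antipode_right h)
    exact LinearMap.congr_fun (lift2_eq _ fun a b => rfl).symm _
  zig := (LinearMap.congr_fun (ext3 fun a b c => by simp [mul_assoc]) Q.Φe).trans Q.antipode_Φ
  zag := (LinearMap.congr_fun (ext3 fun a b c => by simp [mul_assoc]) Q.Φi).trans Q.antipode_Φ_inv

/-- Algebra maps preserve antipode data. -/
theorem IsAntipode.map {D : H →ₐ[k] B} {S : H →ₗ[k] B} {α β : B} (hS : Q.IsAntipode D S α β)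
    {C : Type*} [Ring C] [Algebra k C] (F : B →ₐ[k] C) :
    Q.IsAntipode (F.comp D) (F.toLinearMap ∘ₗ S) (F α) (F β) where
  map_one := by simp [hS.map_one]
  map_mul a b := by simp [hS.map_mul]
  left h := by
    rw [← map_smul, ← hS.left]
    exact LinearMap.congr_fun (ext2 (T' := F.toLinearMap ∘ₗ sandwich S α D.toLinearMap)
      fun a b => by simp) (Q.Δ h)
  right h := by
    rw [← map_smul, ← hS.right]
    exact LinearMap.congr_fun (ext2 (T' := F.toLinearMap ∘ₗ sandwich D.toLinearMap β S)
      fun a b => by simp) (Q.Δ h)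
  zig := by
    rw [← _root_.map_one F, ← hS.zig]
    exact LinearMap.congr_fun (ext3 (T' := F.toLinearMap ∘ₗ
      sandwich D.toLinearMap β (sandwich S α D.toLinearMap)) fun a b c => by simp) Q.Φe
  zag := by
    rw [← _root_.map_one F, ← hS.zag]
    exact LinearMap.congr_fun (ext3 (T' := F.toLinearMap ∘ₗ
      sandwich S α (sandwich D.toLinearMap β S)) fun a b c => by simp) Q.Φi

end QuasiHopfAlgebra

end QuasiHopf

namespace QuasiHopf

namespace QuasiHopfAlgebra

variable {k H : Type*} [Field k] [Ring H] [Algebra k H] (Q : QuasiHopfAlgebra k H)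

/-! ### Antipodes on tensor squares -/

/-- `a ⊗ b ↦ S(b) ⊗ S(a)`. -/
def flipS : H ⊗[k] H →ₗ[k] H ⊗[k] H :=
  TensorProduct.map Q.S.toLinearMap Q.S.toLinearMap ∘ₗ (TensorProduct.comm k H H).toLinearMap

@[simp] theorem flipS_tmul (a b : H) : Q.flipS (a ⊗ₜ b) = Q.S b ⊗ₜ Q.S a := rfl

theorem SSΔop_apply (h : H) : Q.SSΔop h = Q.flipS (Q.Δ h) := rfl

theorem flipS_mul (s t : H ⊗[k] H) : Q.flipS (s * t) = Q.flipS t * Q.flipS s := by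
  induction s using TensorProduct.induction_on with
  | zero => simp
  | tmul a b =>
    induction t using TensorProduct.induction_on with
    | zero => simp
    | tmul c d => simp [Q.antipode_mul]
    | add x y hx hy => simp only [mul_add, map_add, hx, hy, add_mul]
  | add x y hx hy => simp only [mul_add, map_add, hx, hy, add_mul]

theorem flipS_one : Q.flipS 1 = 1 := by
  rw [Algebra.TensorProduct.one_def, flipS_tmul, Q.antipode_one]

theorem SSΔop_mul (a b : H) : Q.SSΔop (a * b) = Q.SSΔop b * Q.SSΔop a := by
  simp only [SSΔop_apply, map_mul, flipS_mul]

theorem SSΔop_one : Q.SSΔop 1 = 1 := by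
  rw [SSΔop_apply, map_one, flipS_one]

section SandwichMul

variable {A C B : Type*} [Ring A] [Algebra k A] [Ring C] [Algebra k C] [Ring B] [Algebra k B]

theorem sandwich_mul_tmul {φ : A →ₗ[k] B} {ψ : C →ₗ[k] B} (hφ : ∀ a b, φ (a * b) = φ b * φ a)
    (hψ : ∀ a b, ψ (a * b) = ψ a * ψ b) (b : B) (z : A ⊗[k] C) (x : A) (y : C) :
    sandwich φ b ψ (z * (x ⊗ₜ y)) = φ x * sandwich φ b ψ z * ψ y := by
  induction z using TensorProduct.induction_on with
  | zero => simp
  | tmul u v => simp [hφ, hψ, mul_assoc]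
  | add u v hu hv => simp only [mul_add, map_add, hu, hv, add_mul]

theorem sandwich_tmul_mul {φ : A →ₗ[k] B} {ψ : C →ₗ[k] B} (hφ : ∀ a b, φ (a * b) = φ a * φ b)
    (hψ : ∀ a b, ψ (a * b) = ψ b * ψ a) (b : B) (z : A ⊗[k] C) (x : A) (y : C) :
    sandwich φ b ψ ((x ⊗ₜ y) * z) = φ x * sandwich φ b ψ z * ψ y := by
  induction z using TensorProduct.induction_on with
  | zero => simp
  | tmul u v => simp [hφ, hψ, mul_assoc]
  | add u v hu hv => simp only [mul_add, map_add, hu, hv, add_mul]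

end SandwichMul

/-! ### The linear maps behind `γ`, `δ`, `p_R`, `q_L` -/

/-- `A₁ ⊗ A₂ ⊗ A₃ ⊗ A₄ ↦ S(A₂) α A₃ ⊗ S(A₁) α A₄`. -/
def γForm : (H ⊗[k] H) ⊗[k] (H ⊗[k] H) →ₗ[k] H ⊗[k] H :=
  sandwich Q.flipS (Q.α ⊗ₜ Q.α) LinearMap.id

/-- `B₁ ⊗ B₂ ⊗ B₃ ⊗ B₄ ↦ B₁ β S(B₄) ⊗ B₂ β S(B₃)`. -/
def δForm : (H ⊗[k] H) ⊗[k] (H ⊗[k] H) →ₗ[k] H ⊗[k] H :=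
  sandwich LinearMap.id (Q.β ⊗ₜ Q.β) Q.flipS

/-- `a ⊗ b ⊗ c ↦ S(a) α b ⊗ c`. -/
def qForm : H ⊗[k] (H ⊗[k] H) →ₗ[k] H ⊗[k] H :=
  sandwich ((Algebra.TensorProduct.includeLeft (R := k) (S := k) (A := H) (B := H)).toLinearMap ∘ₗ
    Q.S.toLinearMap) (Q.α ⊗ₜ 1) LinearMap.id

/-- `a ⊗ b ⊗ c ↦ a ⊗ b β S(c)`. -/
def pForm : H ⊗[k] (H ⊗[k] H) →ₗ[k] H ⊗[k] H :=
  sandwich LinearMap.id (1 ⊗ₜ Q.β)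
    ((Algebra.TensorProduct.includeRight (R := k) (A := H) (B := H)).toLinearMap ∘ₗ
    Q.S.toLinearMap) ∘ₗ (TensorProduct.assoc k H H H).symm.toLinearMap

theorem γForm_tmul (s t : H ⊗[k] H) : Q.γForm (s ⊗ₜ t) = Q.flipS s * (Q.α ⊗ₜ Q.α) * t := rfl
theorem δForm_tmul (s t : H ⊗[k] H) : Q.δForm (s ⊗ₜ t) = s * (Q.β ⊗ₜ Q.β) * Q.flipS t := rfl
theorem qForm_tmul (a : H) (t : H ⊗[k] H) :
    Q.qForm (a ⊗ₜ t) = (Q.S a ⊗ₜ 1) * (Q.α ⊗ₜ 1) * t := rfl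
theorem pForm_tmul (a b c : H) : Q.pForm (a ⊗ₜ (b ⊗ₜ c)) = a ⊗ₜ (b * Q.β * Q.S c) := by
  simp [pForm]

theorem γ_def : Q.γ = Q.γForm (tensorOne k H Q.Φe * Δidid Q.Δ Q.Φi) :=
  LinearMap.congr_fun (lift4_eq _ fun a b c d => by simp [γForm_tmul]) _

theorem δ_def : Q.δ = Q.δForm (Δidid Q.Δ Q.Φe * tensorOne k H Q.Φi) :=
  LinearMap.congr_fun (lift4_eq _ fun a b c d => by simp [δForm_tmul]) _

theorem qL_def : Q.qL = Q.qForm Q.Φi :=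
  LinearMap.congr_fun (lift3_eq _ fun a b c => by simp [qForm_tmul]) _

theorem pR_def : Q.pR = Q.pForm Q.Φi :=
  LinearMap.congr_fun (lift3_eq _ fun a b c => by simp [pForm_tmul]) _

theorem γForm_mul (z : (H ⊗[k] H) ⊗[k] (H ⊗[k] H)) (s t : H ⊗[k] H) :
    Q.γForm (z * (s ⊗ₜ t)) = Q.flipS s * Q.γForm z * t :=
  sandwich_mul_tmul Q.flipS_mul (fun _ _ => rfl) _ _ _ _

theorem δForm_mul (z : (H ⊗[k] H) ⊗[k] (H ⊗[k] H)) (s t : H ⊗[k] H) :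
    Q.δForm ((s ⊗ₜ t) * z) = s * Q.δForm z * Q.flipS t :=
  sandwich_tmul_mul (fun _ _ => rfl) Q.flipS_mul _ _ _ _

/-- `γ = (S(X²) ⊗ S(X¹)) (α ⊗ α) ...` computed with `(1 ⊗ Φ⁻¹)(id ⊗ id ⊗ Δ)(Φ)`. -/
theorem γ_eq : Q.γ = Q.γForm (oneTensor k H Q.Φi * ididΔ Q.Δ Q.Φe) := by
  have h : Q.AbsorbsLeft Q.γForm (insM k H) := Q.isAntipode.absorbsLeft4 fun a b c d =>
    ⟨(TensorProduct.mk k H H).flip (Q.S a * Q.α * d) ∘ₗ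
      LinearMap.mulLeft k (Q.S b) ∘ₗ LinearMap.mulRight k c,
      fun u v => by simp [γForm_tmul, Q.antipode_mul, mul_assoc]⟩
  rw [γ_def, ← h.idΔid_Φe, ← mul_assoc, pentagon_idΔid_one_Δidid]

/-- The middle part B² β S(B³) absorbs right factors Δ(h) in legs two and three, so `idΔid` of Φ may
be inserted for free; the pentagon then turns one expression for δ into the other. -/
theorem δ_eq : Q.δ = Q.δForm (ididΔ Q.Δ Q.Φi * oneTensor k H Q.Φe) := by
  have h : Q.AbsorbsRight Q.δForm (insM k H) := Q.isAntipode.absorbsRight4 fun a b c d =>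
    ⟨TensorProduct.mk k H H (a * Q.β * Q.S d) ∘ₗ
      LinearMap.mulLeft k b ∘ₗ LinearMap.mulRight k (Q.S c),
      fun u v => by simp [δForm_tmul, Q.antipode_mul, mul_assoc]⟩
  rw [δ_def, ← h.idΔid_Φe (ididΔ Q.Δ Q.Φi * oneTensor k H Q.Φe), pentagon_ididΔ_one_idΔid]

/-- `(a ⊗ b) ⊗ c ↦ φ(a ⊗ b) x ψ(c)` as a map on `a ⊗ (b ⊗ c)`. -/
def sandwich₂₁ (φ : H ⊗[k] H →ₗ[k] H ⊗[k] H) (x : H ⊗[k] H) (ψ : H →ₗ[k] H ⊗[k] H) :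
    H ⊗[k] (H ⊗[k] H) →ₗ[k] H ⊗[k] H :=
  sandwich φ x ψ ∘ₗ (TensorProduct.assoc k H H H).symm.toLinearMap

@[simp] theorem sandwich₂₁_tmul (φ : H ⊗[k] H →ₗ[k] H ⊗[k] H) (x : H ⊗[k] H)
    (ψ : H →ₗ[k] H ⊗[k] H) (a b c : H) :
    sandwich₂₁ φ x ψ (a ⊗ₜ (b ⊗ₜ c)) = φ (a ⊗ₜ b) * x * ψ c := rfl

theorem γForm_oneTensor (z : H ⊗[k] (H ⊗[k] H)) :
    Q.γForm (oneTensor k H z) = (1 ⊗ₜ Q.α) * Q.qForm z := by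
  induction z using induction3 with
  | h0 => simp
  | h1 a b c => simp [γForm_tmul, qForm_tmul, Q.antipode_one]
  | h2 x y hx hy => simp only [map_add, hx, hy, mul_add]

theorem δForm_tensorOne (z : H ⊗[k] (H ⊗[k] H)) :
    Q.δForm (tensorOne k H z) = Q.pForm z * (Q.β ⊗ₜ 1) := by
  induction z using induction3 with
  | h0 => simp
  | h1 a b c => simp [δForm_tmul, pForm_tmul, Q.antipode_one]
  | h2 x y hx hy => simp only [map_add, hx, hy, add_mul]

/-- `γ = (S(X²) ⊗ S(X¹)) (1 ⊗ α) q_L Δ(X³)` -/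
theorem γ_eq_qL : Q.γ = sandwich₂₁ Q.flipS ((1 ⊗ₜ Q.α) * Q.qL) Q.Δ.toLinearMap Q.Φe := by
  have h (z) : Q.γForm (oneTensor k H Q.Φi * ididΔ Q.Δ z) =
      sandwich₂₁ Q.flipS ((1 ⊗ₜ Q.α) * Q.qL) Q.Δ.toLinearMap z := by
    induction z using induction3 with
    | h0 => simp
    | h1 a b c => rw [ididΔ_tmul, γForm_mul, γForm_oneTensor, ← qL_def]; rfl
    | h2 x y hx hy => simp only [map_add, hx, hy, mul_add]
  rw [γ_eq, h]

/-- `δ = Δ(X¹) p_R (β ⊗ 1) (S(X³) ⊗ S(X²))` -/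
theorem δ_eq_pR : Q.δ = sandwich Q.Δ.toLinearMap (Q.pR * (Q.β ⊗ₜ 1)) Q.flipS Q.Φe := by
  have h (z) : Q.δForm (Δidid Q.Δ z * tensorOne k H Q.Φi) =
      sandwich Q.Δ.toLinearMap (Q.pR * (Q.β ⊗ₜ 1)) Q.flipS z := by
    induction z using TensorProduct.induction_on with
    | zero => simp
    | tmul a t => rw [Δidid_tmul, δForm_mul, δForm_tensorOne, ← pR_def]; rfl
    | add x y hx hy => simp only [map_add, hx, hy, add_mul]
  rw [δ_def, h]

/-- `(S(x²) ⊗ S(x¹)) γ Δ(x³) = (1 ⊗ α) q_L` -/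
theorem flipS_γ_Δ : sandwich₂₁ Q.flipS Q.γ Q.Δ.toLinearMap Q.Φi = (1 ⊗ₜ Q.α) * Q.qL := by
  have h (z) : Q.γForm (oneTensor k H Q.Φi * ididΔ Q.Δ Q.Φe * ididΔ Q.Δ z) =
      sandwich₂₁ Q.flipS Q.γ Q.Δ.toLinearMap z := by
    induction z using induction3 with
    | h0 => simp
    | h1 a b c => rw [ididΔ_tmul, γForm_mul, ← γ_eq]; rfl
    | h2 x y hx hy => simp only [map_add, hx, hy, mul_add]
  rw [← h, mul_assoc, ← map_mul, Φe_mul_Φi, map_one, mul_one, γForm_oneTensor, qL_def]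

/-- `S(a₂) ⊗ S(a₁)` on the outside: `S(X¹)₂ ... `; that is,
`(S ⊗ S)(Δᵒᵖ(X¹)) γ (X² ⊗ X³) = S(X²) α X³ ⊗ S(X¹) α`. -/
theorem SSΔop_γ : sandwich Q.SSΔop Q.γ LinearMap.id Q.Φe = Q.γForm (tensorOne k H Q.Φe) := by
  have h (z) : Q.γForm (tensorOne k H Q.Φe * Δidid Q.Δ Q.Φi * Δidid Q.Δ z) =
      sandwich Q.SSΔop Q.γ LinearMap.id z := by
    induction z using TensorProduct.induction_on with
    | zero => simp
    | tmul a t => rw [Δidid_tmul, γForm_mul, ← γ_def]; rfl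
    | add x y hx hy => simp only [map_add, hx, hy, mul_add]
  rw [← h, mul_assoc, ← map_mul, Φi_mul_Φe, map_one, mul_one]

/-- `(X¹ ⊗ X²) δ (S ⊗ S)(Δᵒᵖ(X³)) = β S(X³) ⊗ X¹ β S(X²)` -/
theorem δ_SSΔop : sandwich₂₁ LinearMap.id Q.δ Q.SSΔop Q.Φe = Q.δForm (oneTensor k H Q.Φe) := by
  have h (z) : Q.δForm (ididΔ Q.Δ z * (ididΔ Q.Δ Q.Φi * oneTensor k H Q.Φe)) =
      sandwich₂₁ LinearMap.id Q.δ Q.SSΔop z := by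
    induction z using induction3 with
    | h0 => simp
    | h1 a b c => rw [ididΔ_tmul, δForm_mul, ← δ_eq]; rfl
    | h2 x y hx hy => simp only [map_add, hx, hy, add_mul]
  rw [← h, ← mul_assoc, ← map_mul, Φe_mul_Φi, map_one, one_mul]

/-! ### Naturality of `q_L` and `p_R` -/

/-- `a ↦ S(a) ⊗ 1`. -/
def Sl : H →ₗ[k] H ⊗[k] H :=
  (Algebra.TensorProduct.includeLeft (R := k) (S := k) (A := H) (B := H)).toLinearMap ∘ₗ
    Q.S.toLinearMap

/-- `a ↦ 1 ⊗ S(a)`. -/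
def Sr : H →ₗ[k] H ⊗[k] H :=
  (Algebra.TensorProduct.includeRight (R := k) (A := H) (B := H)).toLinearMap ∘ₗ
    Q.S.toLinearMap

@[simp] theorem Sl_apply (a : H) : Q.Sl a = Q.S a ⊗ₜ 1 := rfl
@[simp] theorem Sr_apply (a : H) : Q.Sr a = 1 ⊗ₜ Q.S a := rfl

theorem qForm_absorbs : Q.AbsorbsLeft Q.qForm (ins12 k H) :=
  Q.isAntipode.absorbsLeft3 fun a b c =>
    ⟨(TensorProduct.mk k H H).flip c ∘ₗ LinearMap.mulLeft k (Q.S a) ∘ₗ LinearMap.mulRight k b,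
      fun u v => by simp [qForm_tmul, Q.antipode_mul, mul_assoc]⟩

theorem pForm_absorbs : Q.AbsorbsRight Q.pForm (ins23 k H) :=
  Q.isAntipode.absorbsRight3 fun a b c =>
    ⟨TensorProduct.mk k H H a ∘ₗ LinearMap.mulLeft k b ∘ₗ LinearMap.mulRight k (Q.S c),
      fun u v => by simp [pForm_tmul, Q.antipode_mul, mul_assoc]⟩

theorem qForm_mul_idΔ (z : H ⊗[k] (H ⊗[k] H)) (y : H ⊗[k] H) :
    Q.qForm (z * idΔ Q.Δ y) = sandwich Q.Sl (Q.qForm z) Q.Δ.toLinearMap y := by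
  induction y using TensorProduct.induction_on with
  | zero => simp
  | tmul a b =>
    exact sandwich_mul_tmul (ψ := LinearMap.id)
      (fun a b => by simp [Q.antipode_mul]) (fun _ _ => rfl) _ _ _ _
  | add x y hx hy => simp only [map_add, hx, hy, mul_add]

theorem qForm_one_mul (z : H ⊗[k] (H ⊗[k] H)) (h : H) :
    Q.qForm ((1 ⊗ₜ (1 ⊗ₜ h)) * z) = (1 ⊗ₜ h) * Q.qForm z := by
  induction z using induction3 with
  | h0 => simp
  | h1 a b c => simp [qForm_tmul, mul_assoc]
  | h2 x y hx hy => simp only [map_add, hx, hy, mul_add]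

/-- `(S(h₁) ⊗ 1) q_L Δ(h₂) = (1 ⊗ h) q_L` -/
theorem qL_nat (h : H) :
    sandwich Q.Sl Q.qL Q.Δ.toLinearMap (Q.Δ h) = (1 ⊗ₜ h) * Q.qL := by
  rw [qL_def, ← qForm_mul_idΔ, Φi_mul_idΔ, Q.qForm_absorbs.fst _ Δid_slot, εL_Δ, Δid_one_tmul,
    qForm_one_mul]

theorem pForm_Δid_mul (z : H ⊗[k] (H ⊗[k] H)) (y : H ⊗[k] H) :
    Q.pForm (Δid Q.Δ y * z) = sandwich Q.Δ.toLinearMap (Q.pForm z) Q.Sr y := by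
  induction y using TensorProduct.induction_on with
  | zero => simp
  | tmul a b =>
    have h : ∀ t : H ⊗[k] H, Q.pForm (ins12 k H t * (1 ⊗ₜ (1 ⊗ₜ b)) * z) =
        t * Q.pForm z * (1 ⊗ₜ Q.S b) := fun t => by
      induction z using induction3 with
      | h0 => simp
      | h1 x y w =>
        induction t using TensorProduct.induction_on with
        | zero => simp
        | tmul u v => simp [pForm_tmul, Q.antipode_mul, mul_assoc]
        | add s t hs ht => simp only [map_add, hs, ht, add_mul]
      | h2 x y hx hy => simp only [map_add, hx, hy, mul_add, add_mul]
    rw [Δid_tmul, h]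
    rfl
  | add x y hx hy => simp only [map_add, hx, hy, add_mul]

theorem pForm_mul_one (z : H ⊗[k] (H ⊗[k] H)) (h : H) :
    Q.pForm (z * (h ⊗ₜ 1)) = Q.pForm z * (h ⊗ₜ 1) := by
  induction z using induction3 with
  | h0 => simp
  | h1 a b c => simp [pForm_tmul, Algebra.TensorProduct.one_def]
  | h2 x y hx hy => simp only [map_add, hx, hy, add_mul]

/-- `Δ(h₁) p_R (1 ⊗ S(h₂)) = p_R (h ⊗ 1)` -/
theorem pR_nat (h : H) :
    sandwich Q.Δ.toLinearMap Q.pR Q.Sr (Q.Δ h) = Q.pR * (h ⊗ₜ 1) := by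
  rw [pR_def, ← pForm_Δid_mul, ← Φi_mul_idΔ, Q.pForm_absorbs.snd _ (fun _ => rfl), εR_Δ,
    idΔ_tmul, map_one, pForm_mul_one]

end QuasiHopfAlgebra

end QuasiHopf

namespace QuasiHopf

namespace QuasiHopfAlgebra

variable {k H : Type*} [Field k] [Ring H] [Algebra k H] (Q : QuasiHopfAlgebra k H)

/-! ### Zigzag identities -/

/-- `a ⊗ b ⊗ c ⊗ d ↦ S(a) α b β S(c) ⊗ d`. -/
def zigzag₁ : (H ⊗[k] H) ⊗[k] (H ⊗[k] H) →ₗ[k] H ⊗[k] H :=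
  lift4 (k := k) (fun a b c d : H => (Q.S a * Q.α * b * Q.β * Q.S c) ⊗ₜ[k] d)
    (by refine ⟨?_, ?_, ?_, ?_⟩ <;> intros <;> constructor <;> intros <;>
          simp [mul_add, add_mul, TensorProduct.tmul_add, TensorProduct.add_tmul,
            TensorProduct.smul_tmul'])

/-- `a ⊗ b ⊗ c ⊗ d ↦ a β S(b) α c ⊗ d`. -/
def zigzag₂ : (H ⊗[k] H) ⊗[k] (H ⊗[k] H) →ₗ[k] H ⊗[k] H :=
  lift4 (k := k) (fun a b c d : H => (a * Q.β * Q.S b * Q.α * c) ⊗ₜ[k] d)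
    (by refine ⟨?_, ?_, ?_, ?_⟩ <;> intros <;> constructor <;> intros <;>
          simp [mul_add, add_mul, TensorProduct.tmul_add, TensorProduct.add_tmul,
            TensorProduct.smul_tmul'])

/-- `a ⊗ b ⊗ c ⊗ d ↦ a ⊗ S(b) α c β S(d)`. -/
def zigzag₃ : (H ⊗[k] H) ⊗[k] (H ⊗[k] H) →ₗ[k] H ⊗[k] H :=
  lift4 (k := k) (fun a b c d : H => a ⊗ₜ[k] (Q.S b * Q.α * c * Q.β * Q.S d))
    (by refine ⟨?_, ?_, ?_, ?_⟩ <;> intros <;> constructor <;> intros <;>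
          simp [mul_add, add_mul, TensorProduct.tmul_add, TensorProduct.add_tmul,
            TensorProduct.smul_tmul'])

@[simp] theorem zigzag₁_tmul (a b c d : H) : Q.zigzag₁ ((a ⊗ₜ b) ⊗ₜ (c ⊗ₜ d)) =
    (Q.S a * Q.α * b * Q.β * Q.S c) ⊗ₜ d := rfl
@[simp] theorem zigzag₂_tmul (a b c d : H) : Q.zigzag₂ ((a ⊗ₜ b) ⊗ₜ (c ⊗ₜ d)) =
    (a * Q.β * Q.S b * Q.α * c) ⊗ₜ d := rfl
@[simp] theorem zigzag₃_tmul (a b c d : H) : Q.zigzag₃ ((a ⊗ₜ b) ⊗ₜ (c ⊗ₜ d)) =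
    a ⊗ₜ (Q.S b * Q.α * c * Q.β * Q.S d) := rfl

/-- The pentagon rewrites the argument as a product of three factors. Two of them are absorbed by
S(a) α b and by b β S(c), and the third gives S(x¹) α x² β S(x³) = 1 in the first three legs.
`zigzag₂_eq_one` and `zigzag₃_eq_one` hold likewise, the former through X¹ β S(X²) α X³ = 1 and the
latter in the last three legs. -/
theorem zigzag₁_eq_one : Q.zigzag₁ (ididΔ Q.Δ Q.Φi * oneTensor k H Q.Φe) = 1 := by
  have hl : Q.AbsorbsLeft Q.zigzag₁ (insL k H) := Q.isAntipode.absorbsLeft4 fun a b c d =>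
    ⟨(TensorProduct.mk k H H).flip d ∘ₗ LinearMap.mulLeft k (Q.S a) ∘ₗ
      LinearMap.mulRight k (b * Q.β * Q.S c),
      fun u v => by simp [Q.antipode_mul, mul_assoc, Algebra.TensorProduct.one_def]⟩
  have hr : Q.AbsorbsRight Q.zigzag₁ (insM k H) := Q.isAntipode.absorbsRight4 fun a b c d =>
    ⟨(TensorProduct.mk k H H).flip d ∘ₗ LinearMap.mulLeft k (Q.S a * Q.α * b) ∘ₗ
      LinearMap.mulRight k (Q.S c),
      fun u v => by simp [Q.antipode_mul, mul_assoc]⟩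
  have h (z) : Q.zigzag₁ (tensorOne k H z) = sandwich Q.S.toLinearMap Q.α
      (sandwich LinearMap.id Q.β Q.S.toLinearMap) z ⊗ₜ 1 := by
    induction z using induction3 with
    | h0 => simp
    | h1 a b c => simp [mul_assoc]
    | h2 x y hx hy => simp only [map_add, hx, hy, TensorProduct.add_tmul]
  rw [pentagon_ididΔ_one, hr.idΔid_Φi, hl.Δidid_Φe, h]
  exact congrArg (· ⊗ₜ[k] (1 : H)) Q.isAntipode.zag

theorem zigzag₂_eq_one : Q.zigzag₂ (oneTensor k H Q.Φi * ididΔ Q.Δ Q.Φe) = 1 := by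
  have hl : Q.AbsorbsLeft Q.zigzag₂ (insM k H) := Q.isAntipode.absorbsLeft4 fun a b c d =>
    ⟨(TensorProduct.mk k H H).flip d ∘ₗ LinearMap.mulLeft k (a * Q.β * Q.S b) ∘ₗ
      LinearMap.mulRight k c,
      fun u v => by simp [Q.antipode_mul, mul_assoc]⟩
  have hr : Q.AbsorbsRight Q.zigzag₂ (insL k H) := Q.isAntipode.absorbsRight4 fun a b c d =>
    ⟨(TensorProduct.mk k H H).flip d ∘ₗ LinearMap.mulLeft k a ∘ₗ
      LinearMap.mulRight k (Q.S b * Q.α * c),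
      fun u v => by simp [Q.antipode_mul, mul_assoc, Algebra.TensorProduct.one_def]⟩
  have h (z) : Q.zigzag₂ (tensorOne k H z) = sandwich LinearMap.id Q.β
      (sandwich Q.S.toLinearMap Q.α LinearMap.id) z ⊗ₜ 1 := by
    induction z using induction3 with
    | h0 => simp
    | h1 a b c => simp [mul_assoc]
    | h2 x y hx hy => simp only [map_add, hx, hy, TensorProduct.add_tmul]
  rw [pentagon_one_ididΔ, hr.Δidid_Φi, hl.idΔid_Φe, h]
  exact congrArg (· ⊗ₜ[k] (1 : H)) Q.isAntipode.zig

theorem zigzag₃_eq_one : Q.zigzag₃ (tensorOne k H Q.Φe * Δidid Q.Δ Q.Φi) = 1 := by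
  have hl : Q.AbsorbsLeft Q.zigzag₃ (insM k H) := Q.isAntipode.absorbsLeft4 fun a b c d =>
    ⟨TensorProduct.mk k H H a ∘ₗ LinearMap.mulLeft k (Q.S b) ∘ₗ
      LinearMap.mulRight k (c * Q.β * Q.S d),
      fun u v => by simp [Q.antipode_mul, mul_assoc]⟩
  have hr : Q.AbsorbsRight Q.zigzag₃ (insR k H) := Q.isAntipode.absorbsRight4 fun a b c d =>
    ⟨TensorProduct.mk k H H a ∘ₗ LinearMap.mulLeft k (Q.S b * Q.α * c) ∘ₗ
      LinearMap.mulRight k (Q.S d),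
      fun u v => by simp [Q.antipode_mul, mul_assoc, Algebra.TensorProduct.one_def]⟩
  have h (z) : Q.zigzag₃ (oneTensor k H z) = 1 ⊗ₜ sandwich Q.S.toLinearMap Q.α
      (sandwich LinearMap.id Q.β Q.S.toLinearMap) z := by
    induction z using induction3 with
    | h0 => simp
    | h1 a b c => simp [mul_assoc]
    | h2 x y hx hy => simp only [map_add, hx, hy, TensorProduct.tmul_add]
  rw [pentagon_one_Δidid, hr.ididΔ_Φe, hl.idΔid_Φi, h]
  exact congrArg ((1 : H) ⊗ₜ[k] ·) Q.isAntipode.zag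

/-! ### The antipode of the coproduct -/

/-- `(S ⊗ S)(Δᵒᵖ(h₁)) γ Δ(h₂) = ε(h) γ` -/
theorem SSΔop_γ_Δ (h : H) :
    sandwich Q.SSΔop Q.γ Q.Δ.toLinearMap (Q.Δ h) = Q.ε h • Q.γ := by
  -- G(Φ) = γ, and right multiplication by (Δ ⊗ id)Δ(h) produces the left-hand side.
  -- Quasi-coassociativity moves this factor to the left as (id ⊗ Δ)Δ(h); there the naturality of
  -- q_L replaces the inner coproduct by one factor h₂, and S(h₁) α h₂ collapses.
  set G := sandwich₂₁ Q.flipS ((1 ⊗ₜ Q.α) * Q.qL) Q.Δ.toLinearMap with hG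
  have h1 (y z) : G (z * Δid Q.Δ y) = sandwich Q.SSΔop (G z) Q.Δ.toLinearMap y := by
    induction y using TensorProduct.induction_on with
    | zero => simp
    | tmul a b =>
      have h2 : ∀ t : H ⊗[k] H, G (z * (ins12 k H t * (1 ⊗ₜ (1 ⊗ₜ b)))) =
          Q.flipS t * G z * Q.Δ b := fun t => by
        induction z using induction3 with
        | h0 => simp
        | h1 x y w =>
          induction t using TensorProduct.induction_on with
          | zero => simp
          | tmul u v => simp [hG, Q.antipode_mul, ← mul_assoc]
          | add s t hs ht => simp only [map_add, hs, ht, mul_add, add_mul]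
        | h2 x y hx hy => simp only [map_add, hx, hy, mul_add, add_mul]
      rw [Δid_tmul, h2]
      rfl
    | add x y hx hy => simp only [map_add, hx, hy, mul_add]
  have h3 (z) : G (idΔ Q.Δ (Q.Δ h) * z) = Q.ε h • G z := by
    induction z using induction3 with
    | h0 => simp
    | h1 x₁ x₂ x₃ =>
      have h4 (a : H) (t : H ⊗[k] H) : G ((a ⊗ₜ t) * (x₁ ⊗ₜ (x₂ ⊗ₜ x₃))) =
          Q.flipS (x₁ ⊗ₜ x₂) * (1 ⊗ₜ (Q.S a * Q.α)) *
            sandwich Q.Sl Q.qL Q.Δ.toLinearMap t * Q.Δ x₃ := by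
        induction t using TensorProduct.induction_on with
        | zero => simp
        | tmul u v => simp [hG, Q.antipode_mul, ← mul_assoc]
        | add s t hs ht => simp only [TensorProduct.tmul_add, map_add, hs, ht, mul_add, add_mul]
      refine (Q.isAntipode.collapse_left (G ∘ₗ LinearMap.mulRight k (x₁ ⊗ₜ (x₂ ⊗ₜ x₃)) ∘ₗ
        (idΔ Q.Δ).toLinearMap) (LinearMap.mulLeft k (Q.flipS (x₁ ⊗ₜ x₂)) ∘ₗ
          LinearMap.mulRight k (Q.qL * Q.Δ x₃) ∘ₗ TensorProduct.mk k H H 1) (fun u v => ?_) h).trans ?_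
      · change G ((u ⊗ₜ Q.Δ v) * _) = _
        rw [h4, qL_nat]
        simp [← mul_assoc]
      · simp [hG, mul_assoc]
    | h2 x y hx hy => simp only [map_add, hx, hy, mul_add, smul_add]
  rw [γ_eq_qL, ← hG, ← h1, ← idΔ_mul_Φe, h3]

/-- `Δ(h₁) δ (S ⊗ S)(Δᵒᵖ(h₂)) = ε(h) δ` -/
theorem Δ_δ_SSΔop (h : H) :
    sandwich Q.Δ.toLinearMap Q.δ Q.SSΔop (Q.Δ h) = Q.ε h • Q.δ := by
  set G := sandwich Q.Δ.toLinearMap (Q.pR * (Q.β ⊗ₜ 1)) Q.flipS with hG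
  have h1 (y z) : G (idΔ Q.Δ y * z) = sandwich Q.Δ.toLinearMap (G z) Q.SSΔop y := by
    induction y using TensorProduct.induction_on with
    | zero => simp
    | tmul a b =>
      exact sandwich_tmul_mul (fun a b => map_mul Q.Δ a b) Q.flipS_mul _ _ _ _
    | add x y hx hy => simp only [map_add, hx, hy, add_mul]
  have h3 (z) : G (z * Δid Q.Δ (Q.Δ h)) = Q.ε h • G z := by
    induction z using induction3 with
    | h0 => simp
    | h1 x₁ x₂ x₃ =>
      have h4 (b : H) (t : H ⊗[k] H) :
          G ((x₁ ⊗ₜ (x₂ ⊗ₜ x₃)) * (ins12 k H t * (1 ⊗ₜ (1 ⊗ₜ b)))) =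
          Q.Δ x₁ * sandwich Q.Δ.toLinearMap Q.pR Q.Sr t * ((Q.β * Q.S b) ⊗ₜ 1) *
            Q.flipS (x₂ ⊗ₜ x₃) := by
        induction t using TensorProduct.induction_on with
        | zero => simp
        | tmul u v => simp [hG, Q.antipode_mul, mul_assoc]
        | add s t hs ht => simp only [map_add, hs, ht, mul_add, add_mul]
      refine (Q.isAntipode.collapse_right (G ∘ₗ LinearMap.mulLeft k (x₁ ⊗ₜ (x₂ ⊗ₜ x₃)) ∘ₗ
        (Δid Q.Δ).toLinearMap) (LinearMap.mulLeft k (Q.Δ x₁ * Q.pR) ∘ₗ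
          LinearMap.mulRight k (Q.flipS (x₂ ⊗ₜ x₃)) ∘ₗ (TensorProduct.mk k H H).flip 1)
          (fun u v => ?_) h).trans ?_
      · simp [Δid_tmul, h4, pR_nat, mul_assoc]
      · simp [hG, mul_assoc]
    | h2 x y hx hy => simp only [map_add, hx, hy, add_mul, smul_add]
  rw [δ_eq_pR, ← hG, ← h1, idΔ_mul_Φe, h3]

end QuasiHopfAlgebra

end QuasiHopf

/-! ### The remaining antipode identities for the coproduct. -/

namespace QuasiHopf

namespace QuasiHopfAlgebra

variable {k H : Type*} [Field k] [Ring H] [Algebra k H] (Q : QuasiHopfAlgebra k H)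

section Absorb3

variable {Q} {A V : Type*} [Ring A] [Algebra k A] [AddCommGroup V] [Module k V]
  {T : A →ₗ[k] V} {ins : H ⊗[k] H →ₐ[k] A}

theorem AbsorbsLeft.snd (hT : Q.AbsorbsLeft T ins) (E : H ⊗[k] H →ₐ[k] A)
    (hE : ∀ h, E (1 ⊗ₜ h) = ins (Q.Δ h)) (y : H ⊗[k] H) (z : A) :
    T (E y * z) = T (E (Q.εR y ⊗ₜ 1) * z) := by
  induction y using TensorProduct.induction_on with
  | zero => simp
  | tmul a b =>
    have : a ⊗ₜ[k] b = (1 ⊗ₜ b) * (a ⊗ₜ 1) := by simp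
    rw [this, hT.slot E _ b _ (hE b)]
    simp [← TensorProduct.smul_tmul']
  | add x y hx hy => simp only [map_add, TensorProduct.add_tmul, add_mul, hx, hy]

theorem AbsorbsRight.fst (hT : Q.AbsorbsRight T ins) (E : H ⊗[k] H →ₐ[k] A)
    (hE : ∀ h, E (h ⊗ₜ 1) = ins (Q.Δ h)) (y : H ⊗[k] H) (z : A) :
    T (z * E y) = T (z * E (1 ⊗ₜ Q.εL y)) := by
  induction y using TensorProduct.induction_on with
  | zero => simp
  | tmul a b =>
    have : a ⊗ₜ[k] b = (1 ⊗ₜ b) * (a ⊗ₜ 1) := by simp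
    rw [this, hT.slot E _ a _ (hE a)]
    simp
  | add x y hx hy => simp only [map_add, TensorProduct.tmul_add, mul_add, hx, hy]

end Absorb3

/-- `a ⊗ b ⊗ c ↦ S(c) ⊗ a β S(b)`. -/
def κForm : H ⊗[k] (H ⊗[k] H) →ₗ[k] H ⊗[k] H :=
  lift3 (k := k) (fun a b c : H => Q.S c ⊗ₜ[k] (a * Q.β * Q.S b))
    (by refine ⟨?_, ?_, ?_⟩ <;> intros <;> constructor <;> intros <;>
          simp [mul_add, add_mul, TensorProduct.tmul_add, TensorProduct.add_tmul,
            TensorProduct.smul_tmul'])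

/-- `a ⊗ b ⊗ c ↦ S(b) α c ⊗ S(a)`. -/
def κ'Form : H ⊗[k] (H ⊗[k] H) →ₗ[k] H ⊗[k] H :=
  lift3 (k := k) (fun a b c : H => (Q.S b * Q.α * c) ⊗ₜ[k] Q.S a)
    (by refine ⟨?_, ?_, ?_⟩ <;> intros <;> constructor <;> intros <;>
          simp [mul_add, add_mul, TensorProduct.tmul_add, TensorProduct.add_tmul,
            TensorProduct.smul_tmul'])

@[simp] theorem κForm_tmul (a b c : H) :
    Q.κForm (a ⊗ₜ (b ⊗ₜ c)) = Q.S c ⊗ₜ[k] (a * Q.β * Q.S b) := rfl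
@[simp] theorem κ'Form_tmul (a b c : H) :
    Q.κ'Form (a ⊗ₜ (b ⊗ₜ c)) = (Q.S b * Q.α * c) ⊗ₜ[k] Q.S a := rfl

theorem δForm_oneTensor (z) : Q.δForm (oneTensor k H z) = (Q.β ⊗ₜ 1) * Q.κForm z := by
  induction z using induction3 with
  | h0 => simp
  | h1 a b c => simp [δForm_tmul]
  | h2 x y hx hy => simp only [map_add, hx, hy, mul_add]

theorem γForm_tensorOne (z) : Q.γForm (tensorOne k H z) = Q.κ'Form z * (1 ⊗ₜ Q.α) := by
  induction z using induction3 with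
  | h0 => simp
  | h1 a b c => simp [γForm_tmul]
  | h2 x y hx hy => simp only [map_add, hx, hy, add_mul]

theorem κForm_idΔ_mul (z) (u v : H) :
    Q.κForm (idΔ Q.Δ (u ⊗ₜ v) * z) = (1 ⊗ₜ u) * Q.κForm z * Q.SSΔop v := by
  rw [idΔ_tmul, SSΔop_apply]
  generalize Q.Δ v = t
  induction z using induction3 with
  | h0 => simp
  | h1 a b c =>
    induction t using TensorProduct.induction_on with
    | zero => simp
    | tmul x y => simp [Q.antipode_mul, mul_assoc]
    | add s t hs ht => simp only [TensorProduct.tmul_add, map_add, hs, ht, mul_add, add_mul]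
  | h2 x y hx hy => simp only [map_add, hx, hy, mul_add, add_mul]

/-- `(1 ⊗ h₁) κ (S ⊗ S)(Δᵒᵖ(h₂)) = (S(h) ⊗ 1) κ` for `κ = S(X³) ⊗ X¹ β S(X²)` -/
theorem κ_nat (h : H) :
    sandwich (TensorProduct.mk k H H 1) (Q.κForm Q.Φe) Q.SSΔop (Q.Δ h) =
      (Q.S h ⊗ₜ 1) * Q.κForm Q.Φe := by
  have hr : Q.AbsorbsRight Q.κForm (ins12 k H) := Q.isAntipode.absorbsRight3 fun a b c =>
    ⟨TensorProduct.mk k H H (Q.S c) ∘ₗ LinearMap.mulLeft k a ∘ₗ LinearMap.mulRight k (Q.S b),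
      fun u v => by simp [Q.antipode_mul, mul_assoc]⟩
  have e1 (y) : Q.κForm (idΔ Q.Δ y * Q.Φe) =
      sandwich (TensorProduct.mk k H H 1) (Q.κForm Q.Φe) Q.SSΔop y := by
    induction y using TensorProduct.induction_on with
    | zero => simp
    | tmul u v => rw [κForm_idΔ_mul]; rfl
    | add x y hx hy => simp only [map_add, hx, hy, add_mul]
  have e2 (z) : Q.κForm (z * (1 ⊗ₜ (1 ⊗ₜ h))) = (Q.S h ⊗ₜ 1) * Q.κForm z := by
    induction z using induction3 with
    | h0 => simp
    | h1 a b c => simp [Q.antipode_mul]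
    | h2 x y hx hy => simp only [map_add, hx, hy, mul_add, add_mul]
  rw [← e1, idΔ_mul_Φe, hr.fst _ Δid_slot, εL_Δ, Δid_one_tmul, e2]

theorem κ'Form_mul_Δid (z) (u v : H) :
    Q.κ'Form (z * Δid Q.Δ (u ⊗ₜ v)) = Q.SSΔop u * Q.κ'Form z * (v ⊗ₜ 1) := by
  rw [Δid_tmul, SSΔop_apply]
  generalize Q.Δ u = t
  induction z using induction3 with
  | h0 => simp
  | h1 a b c =>
    induction t using TensorProduct.induction_on with
    | zero => simp
    | tmul x y => simp [Q.antipode_mul, mul_assoc]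
    | add s t hs ht => simp only [map_add, hs, ht, mul_add, add_mul]
  | h2 x y hx hy => simp only [map_add, hx, hy, mul_add, add_mul]

/-- `(S ⊗ S)(Δᵒᵖ(h₁)) κ' (h₂ ⊗ 1) = κ' (1 ⊗ S(h))` for `κ' = S(X²) α X³ ⊗ S(X¹)` -/
theorem κ'_nat (h : H) :
    sandwich Q.SSΔop (Q.κ'Form Q.Φe) ((TensorProduct.mk k H H).flip 1) (Q.Δ h) =
      Q.κ'Form Q.Φe * (1 ⊗ₜ Q.S h) := by
  have hl : Q.AbsorbsLeft Q.κ'Form (ins23 k H) := Q.isAntipode.absorbsLeft3 fun a b c =>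
    ⟨(TensorProduct.mk k H H).flip (Q.S a) ∘ₗ LinearMap.mulLeft k (Q.S b) ∘ₗ
      LinearMap.mulRight k c, fun u v => by simp [Q.antipode_mul, mul_assoc]⟩
  have e1 (y) : Q.κ'Form (Q.Φe * Δid Q.Δ y) =
      sandwich Q.SSΔop (Q.κ'Form Q.Φe) ((TensorProduct.mk k H H).flip 1) y := by
    induction y using TensorProduct.induction_on with
    | zero => simp
    | tmul u v => rw [κ'Form_mul_Δid]; rfl
    | add x y hx hy => simp only [map_add, hx, hy, mul_add]
  have e2 (z) : Q.κ'Form ((h ⊗ₜ 1) * z) = Q.κ'Form z * (1 ⊗ₜ Q.S h) := by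
    induction z using induction3 with
    | h0 => simp
    | h1 a b c => simp [Q.antipode_mul]
    | h2 x y hx hy => simp only [map_add, hx, hy, mul_add, add_mul]
  rw [← e1, ← idΔ_mul_Φe, hl.snd (idΔ Q.Δ) (fun _ => rfl), εR_Δ, idΔ_tmul, map_one, e2]

/-- `(1 ⊗ X¹) κ (S ⊗ S)(Δᵒᵖ(X²)) γ Δ(X³) = q_L` -/
theorem κ_γ : sandwich (TensorProduct.mk k H H 1) (Q.κForm Q.Φe)
    (sandwich Q.SSΔop Q.γ Q.Δ.toLinearMap) Q.Φe = Q.qL := by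
  let T : (H ⊗[k] H) ⊗[k] (H ⊗[k] H) →ₗ[k] H ⊗[k] H :=
    lift4 (k := k) (fun a b c d : H => (Q.S c ⊗ₜ[k] (a * Q.β * Q.S b)) * Q.γ * Q.Δ d)
      (by refine ⟨?_, ?_, ?_, ?_⟩ <;> intros <;> constructor <;> intros <;>
          simp [mul_add, add_mul, TensorProduct.tmul_add, TensorProduct.add_tmul,
            ← TensorProduct.smul_tmul'])
  have hT (a b c d : H) : T ((a ⊗ₜ b) ⊗ₜ (c ⊗ₜ d)) =
    (Q.S c ⊗ₜ[k] (a * Q.β * Q.S b)) * Q.γ * Q.Δ d := rfl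
  have hr : Q.AbsorbsRight T (insL k H) := Q.isAntipode.absorbsRight4 fun a b c d =>
    ⟨LinearMap.mulRight k (Q.γ * Q.Δ d) ∘ₗ TensorProduct.mk k H H (Q.S c) ∘ₗ
      LinearMap.mulLeft k a ∘ₗ LinearMap.mulRight k (Q.S b),
      fun u v => by simp [hT, Q.antipode_mul, mul_assoc, Algebra.TensorProduct.one_def]⟩
  have e1 (y) : T (idΔid Q.Δ y * tensorOne k H Q.Φe) =
      sandwich (TensorProduct.mk k H H 1) (Q.κForm Q.Φe)
        (sandwich Q.SSΔop Q.γ Q.Δ.toLinearMap) y := by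
    generalize Q.Φe = x
    induction y using induction3 with
    | h0 => simp
    | h1 y₁ y₂ y₃ =>
      rw [idΔid_tmul, sandwich_tmul, sandwich_tmul, SSΔop_apply]
      generalize Q.Δ y₂ = t
      induction x using induction3 with
      | h0 => simp
      | h1 a b c =>
        induction t using TensorProduct.induction_on with
        | zero => simp
        | tmul u v => simp [hT, Q.antipode_mul, ← mul_assoc]
        | add s t hs ht => simp only [map_add, hs, ht, mul_add, add_mul]
      | h2 x y hx hy => simp only [map_add, hx, hy, mul_add, add_mul]
    | h2 x y hx hy => simp only [map_add, hx, hy, add_mul]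
  have e2 (x Y₁ Y₂) (t : H ⊗[k] H) : T (oneTensor k H x * ((Y₁ ⊗ₜ Y₂) ⊗ₜ t)) =
      sandwich Q.Sl ((1 ⊗ₜ (Y₁ * Q.β * Q.S Y₂)) *
        sandwich₂₁ Q.flipS Q.γ Q.Δ.toLinearMap x) Q.Δ.toLinearMap t := by
    induction t using TensorProduct.induction_on with
    | zero => simp
    | tmul u v =>
      rw [sandwich_tmul]
      induction x using induction3 with
      | h0 => simp
      | h1 a b c => simp [hT, Q.antipode_mul, ← mul_assoc]
      | h2 x y hx hy => simp only [map_add, hx, hy, mul_add, add_mul]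
    | add s t hs ht => simp only [TensorProduct.tmul_add, map_add, hs, ht, mul_add]
  have e3 (Y) : T (oneTensor k H Q.Φi * ididΔ Q.Δ Y) =
      (1 ⊗ₜ sandwich LinearMap.id Q.β (sandwich Q.S.toLinearMap Q.α LinearMap.id) Y) * Q.qL := by
    induction Y using induction3 with
    | h0 => simp
    | h1 a b c =>
      have e4 (t : H ⊗[k] H) : sandwich Q.Sl ((1 ⊗ₜ (a * Q.β * Q.S b)) * ((1 ⊗ₜ Q.α) * Q.qL))
          Q.Δ.toLinearMap t = (1 ⊗ₜ (a * Q.β * Q.S b * Q.α)) *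
            sandwich Q.Sl Q.qL Q.Δ.toLinearMap t := by
        induction t using TensorProduct.induction_on with
        | zero => simp
        | tmul u v => simp [← mul_assoc]
        | add s t hs ht => simp only [map_add, hs, ht, mul_add]
      rw [ididΔ_tmul, e2, flipS_γ_Δ, e4, qL_nat]
      simp [← mul_assoc]
    | h2 x y hx hy => simp only [map_add, hx, hy, mul_add, TensorProduct.tmul_add, add_mul]
  -- The pentagon trades two factors for three. The form a β S(b) absorbs the last one; `flipS_γ_Δ`
  -- and the naturality of q_L reduce the rest to X¹ β S(X²) α X³ = 1, standing in the second leg in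
  -- front of q_L.
  rw [← e1, pentagon_idΔid_one, hr.Δidid_Φe, e3]
  refine (congrArg (fun t => ((1 : H) ⊗ₜ[k] t) * Q.qL) Q.isAntipode.zig).trans ?_
  exact one_mul _

/-- `(X¹ β S(X²) ⊗ 1) q_L Δ(X³) = 1` -/
theorem qL_zigzag (z : H ⊗[k] (H ⊗[k] H)) :
    sandwich₂₁ ((TensorProduct.mk k H H).flip 1 ∘ₗ sandwich LinearMap.id Q.β Q.S.toLinearMap)
      Q.qL Q.Δ.toLinearMap z = Q.zigzag₂ (oneTensor k H Q.Φi * ididΔ Q.Δ z) := by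
  rw [qL_def]
  induction z using induction3 with
  | h0 => simp
  | h1 a b c =>
    rw [ididΔ_tmul, sandwich₂₁_tmul, AlgHom.toLinearMap_apply]
    generalize Q.Δ c = t
    generalize Q.Φi = x
    induction x using induction3 with
    | h0 => simp
    | h1 x₁ x₂ x₃ =>
      induction t using TensorProduct.induction_on with
      | zero => simp
      | tmul u v => simp [qForm_tmul, Q.antipode_mul, ← mul_assoc]
      | add s t hs ht => simp only [TensorProduct.tmul_add, map_add, hs, ht, mul_add]
    | h2 x y hx hy => simp only [map_add, hx, hy, mul_add, add_mul]
  | h2 x y hx hy => simp only [map_add, hx, hy, mul_add]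

/-- Expand (Δ ⊗ id ⊗ id)(Φ) into four factors by the pentagon. The first is absorbed by (S ⊗ S)Δᵒᵖ,
γ, Δ; the last turns δ into (β ⊗ 1)κ with κ = S(X³) ⊗ X¹ β S(X²). Naturality of κ and `κ_γ` convert
the middle into q_L, and a zigzag identity finishes. -/
theorem Δ_zig : sandwich Q.Δ.toLinearMap Q.δ (sandwich Q.SSΔop Q.γ Q.Δ.toLinearMap) Q.Φe = 1 := by
  set T : (H ⊗[k] H) ⊗[k] (H ⊗[k] H) →ₗ[k] H ⊗[k] H :=
    sandwich LinearMap.id Q.δ (sandwich Q.SSΔop Q.γ Q.Δ.toLinearMap) with hT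
  have e0 (z) : T (Δidid Q.Δ z) =
      sandwich Q.Δ.toLinearMap Q.δ (sandwich Q.SSΔop Q.γ Q.Δ.toLinearMap) z := by
    induction z using TensorProduct.induction_on with
    | zero => simp
    | tmul a t => rfl
    | add x y hx hy => simp only [map_add, hx, hy]
  have hl : Q.AbsorbsLeft T (insR k H) := fun h z => by
    induction z using induction4 with
    | h0 => simp
    | h1 a b c d =>
      have e : T ∘ₗ LinearMap.mulRight k ((a ⊗ₜ b) ⊗ₜ (c ⊗ₜ d)) ∘ₗ (insR k H).toLinearMap =
          LinearMap.mulLeft k ((a ⊗ₜ b) * Q.δ * Q.SSΔop c) ∘ₗ LinearMap.mulRight k (Q.Δ d) ∘ₗ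
            sandwich Q.SSΔop Q.γ Q.Δ.toLinearMap := ext2 fun u v => by
        simp [hT, SSΔop_mul, mul_assoc]
      refine (LinearMap.congr_fun e (Q.Δ h)).trans ?_
      simp [SSΔop_γ_Δ, hT, mul_assoc]
    | h2 x y hx hy => rw [mul_add, map_add, map_add, hx, hy, smul_add]
  set T₂ : (H ⊗[k] H) ⊗[k] (H ⊗[k] H) →ₗ[k] H ⊗[k] H :=
    sandwich LinearMap.id ((Q.β ⊗ₜ 1) * Q.κForm Q.Φe) (sandwich Q.SSΔop Q.γ Q.Δ.toLinearMap)
    with hT₂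
  have e1 (w y) : T (w * tensorOne k H y) = sandwich LinearMap.id
      (sandwich₂₁ LinearMap.id Q.δ Q.SSΔop y) (sandwich Q.SSΔop Q.γ Q.Δ.toLinearMap) w := by
    induction w using induction4 with
    | h0 => simp
    | h1 a b c d =>
      rw [sandwich_tmul]
      induction y using induction3 with
      | h0 => simp
      | h1 u v w => simp [hT, SSΔop_mul, ← mul_assoc]
      | h2 x y hx hy => simp only [map_add, hx, hy, mul_add, add_mul]
    | h2 x y hx hy => simp only [map_add, hx, hy, add_mul]
  have e2 (z y) : T₂ (oneTensor k H z * idΔid Q.Δ y) = sandwich₂₁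
      ((TensorProduct.mk k H H).flip 1 ∘ₗ sandwich LinearMap.id Q.β Q.S.toLinearMap)
      (sandwich (TensorProduct.mk k H H 1) (Q.κForm Q.Φe)
        (sandwich Q.SSΔop Q.γ Q.Δ.toLinearMap) z) Q.Δ.toLinearMap y := by
    induction y using induction3 with
    | h0 => simp
    | h1 y₁ y₂ y₃ =>
      rw [idΔid_tmul, sandwich₂₁_tmul]
      induction z using induction3 with
      | h0 => simp
      | h1 a b c =>
        have e3 (t : H ⊗[k] H) : T₂ (oneTensor k H (a ⊗ₜ (b ⊗ₜ c)) *
            (((y₁ ⊗ₜ 1) ⊗ₜ (1 ⊗ₜ y₃)) * insM k H t)) =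
            ((y₁ * Q.β) ⊗ₜ a) * sandwich (TensorProduct.mk k H H 1) (Q.κForm Q.Φe) Q.SSΔop t *
              Q.SSΔop b * Q.γ * Q.Δ c * Q.Δ y₃ := by
          induction t using TensorProduct.induction_on with
          | zero => simp
          | tmul u v => simp [hT₂, SSΔop_mul, ← mul_assoc]
          | add s t hs ht => simp only [map_add, hs, ht, mul_add, add_mul]
        rw [e3, κ_nat]
        simp [← mul_assoc]
      | h2 x y hx hy => simp only [map_add, hx, hy, mul_add, add_mul]
    | h2 x y hx hy => simp only [map_add, hx, hy, mul_add]
  rw [← e0, pentagon_Δidid_eq, mul_assoc, mul_assoc, hl.ididΔ_Φi, ← mul_assoc, e1, δ_SSΔop,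
    δForm_oneTensor, ← hT₂, e2, κ_γ, qL_zigzag, zigzag₂_eq_one]

end QuasiHopfAlgebra

end QuasiHopf

namespace QuasiHopf

namespace QuasiHopfAlgebra

variable {k H : Type*} [Field k] [Ring H] [Algebra k H] (Q : QuasiHopfAlgebra k H)

/-- `(1 ⊗ S(x¹) α x²) κ (S ⊗ S)(Δᵒᵖ(x³)) = 1` -/
theorem κ_zigzag : sandwich₂₁ (TensorProduct.mk k H H 1 ∘ₗ
    sandwich Q.S.toLinearMap Q.α LinearMap.id) (Q.κForm Q.Φe) Q.SSΔop Q.Φi = 1 := by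
  let R : H ⊗[k] H →ₗ[k] H ⊗[k] H := (TensorProduct.comm k H H).toLinearMap ∘ₗ
    Q.S.toLinearMap.lTensor H
  have e (x) : R (Q.zigzag₁ (ididΔ Q.Δ x * oneTensor k H Q.Φe)) = sandwich₂₁
      (TensorProduct.mk k H H 1 ∘ₗ sandwich Q.S.toLinearMap Q.α LinearMap.id)
      (Q.κForm Q.Φe) Q.SSΔop x := by
    generalize Q.Φe = y
    induction x using induction3 with
    | h0 => simp
    | h1 x₁ x₂ x₃ =>
      rw [ididΔ_tmul, sandwich₂₁_tmul, SSΔop_apply]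
      generalize Q.Δ x₃ = t
      induction y using induction3 with
      | h0 => simp
      | h1 a b c =>
        induction t using TensorProduct.induction_on with
        | zero => simp
        | tmul u v => simp [R, Q.antipode_mul, mul_assoc]
        | add s t hs ht => simp only [TensorProduct.tmul_add, map_add, hs, ht, mul_add, add_mul]
      | h2 x y hx hy => simp only [map_add, hx, hy, mul_add, add_mul]
    | h2 x y hx hy => simp only [map_add, hx, hy, add_mul]
  rw [← e, zigzag₁_eq_one]
  simp [R, Algebra.TensorProduct.one_def, Q.antipode_one]

/-- `(S ⊗ S)(Δᵒᵖ(x¹)) κ' (x² β S(x³) ⊗ 1) = 1` -/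
theorem κ'_zigzag : sandwich Q.SSΔop (Q.κ'Form Q.Φe) ((TensorProduct.mk k H H).flip 1 ∘ₗ
    sandwich LinearMap.id Q.β Q.S.toLinearMap) Q.Φi = 1 := by
  let R : H ⊗[k] H →ₗ[k] H ⊗[k] H := (TensorProduct.comm k H H).toLinearMap ∘ₗ
    Q.S.toLinearMap.rTensor H
  have e (x) : R (Q.zigzag₃ (tensorOne k H Q.Φe * Δidid Q.Δ x)) = sandwich Q.SSΔop
      (Q.κ'Form Q.Φe) ((TensorProduct.mk k H H).flip 1 ∘ₗ
        sandwich LinearMap.id Q.β Q.S.toLinearMap) x := by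
    generalize Q.Φe = y
    induction x using induction3 with
    | h0 => simp
    | h1 x₁ x₂ x₃ =>
      rw [Δidid_tmul, sandwich_tmul, SSΔop_apply]
      generalize Q.Δ x₁ = t
      induction y using induction3 with
      | h0 => simp
      | h1 a b c =>
        induction t using TensorProduct.induction_on with
        | zero => simp
        | tmul u v => simp [R, Q.antipode_mul, mul_assoc]
        | add s t hs ht => simp only [TensorProduct.add_tmul, map_add, hs, ht, mul_add, add_mul]
      | h2 x y hx hy => simp only [map_add, hx, hy, mul_add, add_mul]
    | h2 x y hx hy => simp only [map_add, hx, hy, mul_add]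
  rw [← e, zigzag₃_eq_one]
  simp [R, Algebra.TensorProduct.one_def, Q.antipode_one]

/-- Expand (id ⊗ Δ ⊗ id)(Φ⁻¹) into four factors. The outer two turn γ into κ'(1 ⊗ α) and δ into (β ⊗
1)κ; by naturality of κ' and κ the inner two separate into the product of `κ'_zigzag` and
`κ_zigzag`. -/
theorem Δ_zag : sandwich Q.SSΔop Q.γ (sandwich Q.Δ.toLinearMap Q.δ Q.SSΔop) Q.Φi = 1 := by
  let F (x : H ⊗[k] H) (y : H ⊗[k] H) : (H ⊗[k] H) ⊗[k] (H ⊗[k] H) →ₗ[k] H ⊗[k] H :=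
    lift4 (k := k) (fun a b c d : H => Q.SSΔop a * x * (b ⊗ₜ c) * y * Q.SSΔop d)
      (by refine ⟨?_, ?_, ?_, ?_⟩ <;> intros <;> constructor <;> intros <;>
          simp [mul_add, add_mul, TensorProduct.tmul_add, TensorProduct.add_tmul,
            ← TensorProduct.smul_tmul'])
  have hF (x y a b c d) : F x y ((a ⊗ₜ b) ⊗ₜ (c ⊗ₜ d)) =
    Q.SSΔop a * x * (b ⊗ₜ c) * y * Q.SSΔop d := rfl
  have e0 (z) : F Q.γ Q.δ (idΔid Q.Δ z) =
      sandwich Q.SSΔop Q.γ (sandwich Q.Δ.toLinearMap Q.δ Q.SSΔop) z := by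
    induction z using induction3 with
    | h0 => simp
    | h1 a b c =>
      rw [idΔid_tmul, sandwich_tmul, sandwich_tmul, AlgHom.toLinearMap_apply]
      generalize Q.Δ b = t
      induction t using TensorProduct.induction_on with
      | zero => simp
      | tmul u v => simp [hF, mul_assoc]
      | add s t hs ht => simp only [map_add, hs, ht, mul_add, add_mul]
    | h2 x y hx hy => simp only [map_add, hx, hy]
  have e1 (x y z w) : F x y (tensorOne k H z * w) =
      F (sandwich Q.SSΔop x LinearMap.id z) y w := by
    induction w using induction4 with
    | h0 => simp
    | h1 a b c d =>
      rw [hF]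
      induction z using induction3 with
      | h0 => simp
      | h1 u v w =>
        simp only [tensorOne_tmul, hF, SSΔop_mul, sandwich_tmul,
          Algebra.TensorProduct.tmul_mul_tmul, one_mul, LinearMap.id_apply]
        simp only [← Algebra.TensorProduct.tmul_mul_tmul, mul_assoc]
      | h2 x y hx hy => simp only [map_add, hx, hy, mul_add, add_mul]
    | h2 x y hx hy => simp only [map_add, hx, hy, mul_add]
  have e2 (x y z w) : F x y (w * oneTensor k H z) =
      F x (sandwich₂₁ LinearMap.id y Q.SSΔop z) w := by
    induction w using induction4 with
    | h0 => simp
    | h1 a b c d =>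
      rw [hF]
      induction z using induction3 with
      | h0 => simp
      | h1 u v w =>
        simp only [oneTensor_tmul, hF, SSΔop_mul, sandwich₂₁_tmul,
          Algebra.TensorProduct.tmul_mul_tmul, mul_one, LinearMap.id_apply]
        simp only [← Algebra.TensorProduct.tmul_mul_tmul, mul_assoc]
      | h2 x y hx hy => simp only [map_add, hx, hy, mul_add, add_mul]
    | h2 x y hx hy => simp only [map_add, hx, hy, add_mul]
  have e3 (x y) : F (Q.κ'Form Q.Φe * (1 ⊗ₜ Q.α)) ((Q.β ⊗ₜ 1) * Q.κForm Q.Φe)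
      (Δidid Q.Δ x * ididΔ Q.Δ y) =
      sandwich Q.SSΔop (Q.κ'Form Q.Φe) ((TensorProduct.mk k H H).flip 1 ∘ₗ
        sandwich LinearMap.id Q.β Q.S.toLinearMap) y *
      sandwich₂₁ (TensorProduct.mk k H H 1 ∘ₗ sandwich Q.S.toLinearMap Q.α LinearMap.id)
        (Q.κForm Q.Φe) Q.SSΔop x := by
    induction y using induction3 with
    | h0 => simp
    | h1 y₁ y₂ y₃ =>
      induction x using induction3 with
      | h0 => simp
      | h1 x₁ x₂ x₃ =>
        have e4 (s t : H ⊗[k] H) : F (Q.κ'Form Q.Φe * (1 ⊗ₜ Q.α)) ((Q.β ⊗ₜ 1) * Q.κForm Q.Φe)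
            ((s ⊗ₜ (x₂ ⊗ₜ x₃)) * ((y₁ ⊗ₜ y₂) ⊗ₜ t)) = Q.SSΔop y₁ *
            sandwich Q.SSΔop (Q.κ'Form Q.Φe) ((TensorProduct.mk k H H).flip 1) s *
            ((y₂ * Q.β) ⊗ₜ (Q.α * x₂)) *
            sandwich (TensorProduct.mk k H H 1) (Q.κForm Q.Φe) Q.SSΔop t * Q.SSΔop x₃ := by
          induction s using TensorProduct.induction_on with
          | zero => simp
          | tmul a b =>
            induction t using TensorProduct.induction_on with
            | zero => simp
            | tmul u v =>
              simp only [Algebra.TensorProduct.tmul_mul_tmul, hF, SSΔop_mul, sandwich_tmul,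
                LinearMap.flip_apply, TensorProduct.mk_apply]
              simp only [mul_assoc]
              congr 3
              simp only [← mul_assoc, Algebra.TensorProduct.tmul_mul_tmul, one_mul, mul_one]
            | add s t hs ht =>
              simp only [TensorProduct.tmul_add, map_add, hs, ht, mul_add, add_mul]
          | add s t hs ht => simp only [TensorProduct.add_tmul, map_add, hs, ht, mul_add, add_mul]
        rw [Δidid_tmul, ididΔ_tmul, e4, κ_nat, κ'_nat]
        simp only [sandwich_tmul, sandwich₂₁_tmul, LinearMap.comp_apply, LinearMap.flip_apply,
          TensorProduct.mk_apply, LinearMap.id_apply, LinearEquiv.coe_coe, mul_assoc]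
        congr 2
        simp only [← mul_assoc, Algebra.TensorProduct.tmul_mul_tmul, one_mul, mul_one]
      | h2 x y hx hy => simp only [map_add, hx, hy, mul_add, add_mul]
    | h2 x y hx hy => simp only [map_add, hx, hy, mul_add, add_mul]
  rw [← e0, pentagon_idΔid_inv, mul_assoc, mul_assoc, e1, ← mul_assoc, e2, SSΔop_γ, δ_SSΔop,
    γForm_tensorOne, δForm_oneTensor, e3, κ_zigzag, κ'_zigzag, one_mul]

/-- With `ΔS_isAntipode` this gives two antipodes for the algebra map Δ. Their comparison elements
are f and g, so the relations for the twist below are instances of the uniqueness of antipodes. -/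
theorem Δ_isAntipode : Q.IsAntipode Q.Δ Q.SSΔop Q.γ Q.δ where
  map_one := Q.SSΔop_one
  map_mul := Q.SSΔop_mul
  left := Q.SSΔop_γ_Δ
  right := Q.Δ_δ_SSΔop
  zig := Q.Δ_zig
  zag := Q.Δ_zag

theorem ΔS_isAntipode :
    Q.IsAntipode Q.Δ (Q.Δ.toLinearMap ∘ₗ Q.S.toLinearMap) (Q.Δ Q.α) (Q.Δ Q.β) :=
  Q.isAntipode.map Q.Δ

/-! ### Drinfeld's twist -/

theorem f_def : Q.f = Q.antipodeTwist Q.Δ Q.SSΔop Q.γ (Q.Δ Q.β)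
    (Q.Δ.toLinearMap ∘ₗ Q.S.toLinearMap) :=
  LinearMap.congr_fun (lift3_eq _ fun a b c => by simp [mul_assoc]) _

theorem g_def : Q.g = Q.antipodeTwist Q.Δ (Q.Δ.toLinearMap ∘ₗ Q.S.toLinearMap) (Q.Δ Q.α) Q.δ
    Q.SSΔop :=
  LinearMap.congr_fun (lift3_eq _ fun a b c => by simp [mul_assoc]) _

theorem f_mul_g : Q.f * Q.g = 1 := by
  rw [f_def, g_def]; exact Q.ΔS_isAntipode.twist_mul_twist Q.Δ_isAntipode

theorem g_mul_f : Q.g * Q.f = 1 := by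
  rw [f_def, g_def]; exact Q.Δ_isAntipode.twist_mul_twist Q.ΔS_isAntipode

theorem f_mul_ΔS (h : H) : Q.f * Q.Δ (Q.S h) = Q.SSΔop h * Q.f := by
  rw [f_def]; exact Q.ΔS_isAntipode.twist_mul_antipode Q.Δ_isAntipode h

theorem g_mul_SSΔop (h : H) : Q.g * Q.SSΔop h = Q.Δ (Q.S h) * Q.g := by
  rw [g_def]; exact Q.Δ_isAntipode.twist_mul_antipode Q.ΔS_isAntipode h

theorem f_mul_Δα : Q.f * Q.Δ Q.α = Q.γ := by
  rw [f_def]; exact Q.ΔS_isAntipode.twist_mul_alpha Q.Δ_isAntipode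

theorem Δβ_mul_g : Q.Δ Q.β * Q.g = Q.δ := by
  rw [g_def]; exact Q.ΔS_isAntipode.beta_mul_twist Q.Δ_isAntipode

end QuasiHopfAlgebra

end QuasiHopf

namespace QuasiHopf

namespace QuasiHopfAlgebra

variable {k H : Type*} [Field k] [Ring H] [Algebra k H] (Q : QuasiHopfAlgebra k H)

/-! ### The twist relation for the reassociator -/

/-- `a ⊗ b ⊗ c ⊗ d ↦ S(a) α b ⊗ (c ⊗ d)`. -/
def qForm₄ : (H ⊗[k] H) ⊗[k] (H ⊗[k] H) →ₗ[k] H ⊗[k] (H ⊗[k] H) :=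
  (sandwich Q.S.toLinearMap Q.α LinearMap.id).rTensor (H ⊗[k] H)

@[simp] theorem qForm₄_tmul (a b : H) (t : H ⊗[k] H) :
    Q.qForm₄ ((a ⊗ₜ b) ⊗ₜ t) = (Q.S a * Q.α * b) ⊗ₜ t := rfl

theorem qForm₄_ididΔ_mul (x y : H ⊗[k] (H ⊗[k] H)) :
    Q.qForm₄ (ididΔ Q.Δ x * oneTensor k H y) = idΔ Q.Δ (Q.qForm x) * y := by
  induction x using induction3 with
  | h0 => simp
  | h1 a b c =>
    induction y using induction3 with
    | h0 => simp
    | h1 u v w => simp [qForm_tmul, ← mul_assoc]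
    | h2 x y hx hy => simp only [map_add, hx, hy, mul_add]
  | h2 x y hx hy => simp only [map_add, hx, hy, add_mul]

theorem qForm₄_tensorOne_mul (x : H ⊗[k] (H ⊗[k] H)) (a b c : H) :
    Q.qForm₄ (tensorOne k H x * idΔid Q.Δ (a ⊗ₜ (b ⊗ₜ c))) =
      (Q.S a ⊗ₜ 1) * ins12 k H (Q.qForm x) * Δid Q.Δ (b ⊗ₜ c) := by
  rw [idΔid_tmul, Δid_tmul]
  generalize Q.Δ b = t
  induction x using induction3 with
  | h0 => simp
  | h1 x₁ x₂ x₃ =>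
    induction t using TensorProduct.induction_on with
    | zero => simp
    | tmul u v => simp [qForm_tmul, Q.antipode_mul, ← mul_assoc]
    | add s t hs ht => simp only [map_add, hs, ht, mul_add, add_mul]
  | h2 x y hx hy => simp only [map_add, hx, hy, add_mul, mul_add]

/-- `a ⊗ b ⊗ c ↦ (S(a) ⊗ 1) q_L Δ(b) ⊗ c`. -/
def qqForm : H ⊗[k] (H ⊗[k] H) →ₗ[k] H ⊗[k] (H ⊗[k] H) :=
  sandwich ((Algebra.TensorProduct.includeLeft (R := k) (S := k) (A := H)
    (B := H ⊗[k] H)).toLinearMap ∘ₗ Q.S.toLinearMap) (ins12 k H Q.qL) (Δid Q.Δ).toLinearMap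

theorem qqForm_tmul (a : H) (t : H ⊗[k] H) : Q.qqForm (a ⊗ₜ t) =
    (Q.S a ⊗ₜ 1) * ins12 k H Q.qL * Δid Q.Δ t := rfl

theorem ins12_mul_comm (t : H ⊗[k] H) (c : H) :
    ins12 k H t * (1 ⊗ₜ (1 ⊗ₜ c)) = (1 ⊗ₜ (1 ⊗ₜ c)) * ins12 k H t := by
  induction t using TensorProduct.induction_on with
  | zero => simp
  | tmul a b => simp
  | add s t hs ht => simp only [map_add, hs, ht, mul_add, add_mul]

/-- `S(x¹) q¹ x²₁ ⊗ q² x²₂ ⊗ x³ = (id ⊗ Δ)(q_L) Φ` -/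
theorem qqForm_Φi : Q.qqForm Q.Φi = idΔ Q.Δ Q.qL * Q.Φe := by
  have hl : Q.AbsorbsLeft Q.qForm₄ (insL k H) := Q.isAntipode.absorbsLeft4 fun a b c d =>
    ⟨(TensorProduct.mk k H (H ⊗[k] H)).flip (c ⊗ₜ d) ∘ₗ LinearMap.mulLeft k (Q.S a) ∘ₗ
      LinearMap.mulRight k b, fun u v => by
        simp [Q.antipode_mul, mul_assoc, Algebra.TensorProduct.one_def]⟩
  have e (y) : Q.qqForm y = Q.qForm₄ (tensorOne k H Q.Φi * idΔid Q.Δ y) := by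
    induction y using induction3 with
    | h0 => simp
    | h1 a b c => rw [qForm₄_tensorOne_mul, qqForm_tmul, qL_def]
    | h2 x y hx hy => simp only [map_add, hx, hy, mul_add]
  rw [e, pentagon_one_idΔid_inv, mul_assoc, hl.Δidid_Φi, qForm₄_ididΔ_mul, qL_def]

/-- `(1 ⊗ q_L)(id ⊗ Δ)(q_L) Φ`. -/
def qq : H ⊗[k] (H ⊗[k] H) := (1 ⊗ₜ Q.qL) * (idΔ Q.Δ Q.qL * Q.Φe)

/-- `a ⊗ b ⊗ c ⊗ d ↦ (S(b) ⊗ S(a) ⊗ 1) w (Δ ⊗ id)(c ⊗ d)`. -/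
def flipSΔ (w : H ⊗[k] (H ⊗[k] H)) : (H ⊗[k] H) ⊗[k] (H ⊗[k] H) →ₗ[k] H ⊗[k] (H ⊗[k] H) :=
  sandwich ((ins12 k H).toLinearMap ∘ₗ Q.flipS) w (Δid Q.Δ).toLinearMap

theorem flipSΔ_tmul (w) (s t : H ⊗[k] H) : Q.flipSΔ w (s ⊗ₜ t) =
    ins12 k H (Q.flipS s) * w * Δid Q.Δ t := rfl

theorem flipSΔ_mul (w z) (s t : H ⊗[k] H) : Q.flipSΔ w (z * (s ⊗ₜ t)) =
    ins12 k H (Q.flipS s) * Q.flipSΔ w z * Δid Q.Δ t :=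
  sandwich_mul_tmul (fun a b => by simp [flipS_mul]) (fun a b => by simp) _ _ _ _

/-- `(f ⊗ 1)(Δ ⊗ id)(q_L) = (S(X²) ⊗ S(X¹) ⊗ 1)(1 ⊗ q_L)(id ⊗ Δ)(q_L) Φ (Δ ⊗ id)(Δ(X³))` -/
theorem f_mul_Δ_qL : ins12 k H Q.f * Δid Q.Δ Q.qL =
    sandwich ((ins12 k H).toLinearMap ∘ₗ Q.flipS) Q.qq
      ((Δid Q.Δ).toLinearMap ∘ₗ Q.Δ.toLinearMap)
        ((TensorProduct.assoc k H H H).symm Q.Φe) := by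
  set ψ := Q.flipSΔ (ins12 k H ((1 ⊗ₜ Q.α) * Q.qL)) with hψ
  have e1 (x) : ins12 k H Q.f * Δid Q.Δ (Q.qForm x) = ψ (tensorOne k H Q.Φe * Δidid Q.Δ x) := by
    induction x using induction3 with
    | h0 => simp
    | h1 a b c =>
      have e2 (z) : ψ (tensorOne k H z) =
          ins12 k H (sandwich₂₁ Q.flipS ((1 ⊗ₜ Q.α) * Q.qL) Q.Δ.toLinearMap z) := by
        induction z using induction3 with
        | h0 => simp
        | h1 z₁ z₂ z₃ => simp [hψ, flipSΔ_tmul, Δid_slot]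
        | h2 x y hx hy => simp only [map_add, hx, hy]
      have e3 : Q.qForm (a ⊗ₜ (b ⊗ₜ c)) = (Q.S a * Q.α * b) ⊗ₜ c := by simp [qForm_tmul]
      rw [Δidid_tmul, hψ, flipSΔ_mul, ← hψ, e2, ← γ_eq_qL, e3, Δid_tmul, Δid_tmul, ← mul_assoc,
        ← mul_assoc, ← map_mul, ← map_mul, ← map_mul, map_mul Q.Δ,
        map_mul Q.Δ, ← mul_assoc, ← mul_assoc, f_mul_ΔS, mul_assoc (Q.SSΔop a), f_mul_Δα]
      rfl
    | h2 x y hx hy => simp only [map_add, hx, hy, mul_add]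
  have e4 (x w) : ψ (idΔid Q.Δ x * w) =
      Q.flipSΔ ((1 ⊗ₜ Q.qForm x) * ins12 k H Q.qL) w := by
    induction w using induction4 with
    | h0 => simp
    | h1 w₁ w₂ w₃ w₄ =>
      rw [flipSΔ_tmul]
      induction x using induction3 with
      | h0 => simp
      | h1 a b c =>
        have e5 (t : H ⊗[k] H) : ψ (((a ⊗ₜ 1) ⊗ₜ (1 ⊗ₜ c)) * insM k H t *
            ((w₁ ⊗ₜ w₂) ⊗ₜ (w₃ ⊗ₜ w₄))) = ins12 k H (Q.flipS (w₁ ⊗ₜ w₂)) *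
            (1 ⊗ₜ ((Q.S a * Q.α) ⊗ₜ c)) *
            ins12 k H (sandwich Q.Sl Q.qL Q.Δ.toLinearMap t) * Δid Q.Δ (w₃ ⊗ₜ w₄) := by
          induction t using TensorProduct.induction_on with
          | zero => simp
          | tmul u v =>
            have e6 : (v * w₃) ⊗ₜ[k] (c * w₄) = (v ⊗ₜ c) * (w₃ ⊗ₜ w₄ : H ⊗[k] H) := by simp
            have e8 : (1 ⊗ₜ ((Q.S a * Q.α) ⊗ₜ c) : H ⊗[k] (H ⊗[k] H)) =
                ins12 k H (1 ⊗ₜ (Q.S a * Q.α)) * (1 ⊗ₜ (1 ⊗ₜ c)) := by simp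
            have e9 : (Q.S w₂ * Q.S u) ⊗ₜ[k] (Q.S w₁ * Q.S a) * (1 ⊗ₜ Q.α * Q.qL) * Q.Δ v =
                Q.flipS (w₁ ⊗ₜ w₂) * (1 ⊗ₜ (Q.S a * Q.α)) * (Q.S u ⊗ₜ 1 * Q.qL * Q.Δ v) := by
              simp [← mul_assoc]
            simp only [insM_tmul, Algebra.TensorProduct.tmul_mul_tmul, one_mul, mul_one, hψ,
              flipSΔ_tmul, flipS_tmul, Q.antipode_mul]
            rw [e6, map_mul (Δid Q.Δ), Δid_tmul Q.Δ v, ← mul_assoc, ← mul_assoc, ← map_mul, ← map_mul, e9, e8, ← mul_assoc (ins12 k H _),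
              map_mul (ins12 k H), mul_assoc (ins12 k H _) (ins12 k H _), ins12_mul_comm,
              ← map_mul, ← mul_assoc, sandwich_tmul, Sl_apply, AlgHom.toLinearMap_apply,
              flipS_tmul]
          | add s t hs ht => simp only [map_add, hs, ht, mul_add, add_mul]
        rw [idΔid_tmul, e5, qL_nat]
        simp [qForm_tmul, ← mul_assoc]
      | h2 x y hx hy => simp only [map_add, hx, hy, TensorProduct.tmul_add, mul_add, add_mul]
    | h2 x y hx hy => simp only [map_add, hx, hy, mul_add]
  have e7 (y Y) : Q.flipSΔ ((1 ⊗ₜ Q.qL) * ins12 k H Q.qL) (oneTensor k H y * ididΔ Q.Δ Y) =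
      sandwich ((ins12 k H).toLinearMap ∘ₗ Q.flipS) ((1 ⊗ₜ Q.qL) * Q.qqForm y)
      ((Δid Q.Δ).toLinearMap ∘ₗ Q.Δ.toLinearMap)
        ((TensorProduct.assoc k H H H).symm Y) := by
    induction Y using induction3 with
    | h0 => simp
    | h1 A B C =>
      rw [ididΔ_tmul, flipSΔ_mul]
      change _ = ins12 k H (Q.flipS (A ⊗ₜ B)) * ((1 ⊗ₜ Q.qL) * Q.qqForm y) * Δid Q.Δ (Q.Δ C)
      congr 2
      induction y using induction3 with
      | h0 => simp
      | h1 a b c => simp [flipSΔ_tmul, qqForm_tmul, Q.antipode_one, ← mul_assoc,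
        ← Algebra.TensorProduct.one_def]
      | h2 x y hx hy => simp only [map_add, hx, hy, mul_add]
    | h2 x y hx hy => simp only [map_add, hx, hy, mul_add]
  -- By e1 the left-hand side is a value of ψ, the relations f Δ(S(a)) = (S ⊗ S)Δᵒᵖ(a) f and f Δ(α)
  -- = γ having removed f. The pentagon reorders its argument, e4 absorbs the middle coproduct by
  -- naturality of q_L, and e7 recognises the result.
  rw [qq, ← qqForm_Φi, ← e7, qL_def, e1, pentagon_one_Δidid, mul_assoc, e4, ← qL_def]

end QuasiHopfAlgebra

end QuasiHopf

namespace QuasiHopf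

/-- `a ⊗ b ⊗ c ↦ s(c) ⊗ s(b) ⊗ s(a)`. -/
def rev₃ {k H : Type*} [Field k] [Ring H] [Algebra k H] (s : H →ₗ[k] H) :
    H ⊗[k] (H ⊗[k] H) →ₗ[k] H ⊗[k] (H ⊗[k] H) :=
  lift3 (k := k) (fun a b c : H => s c ⊗ₜ[k] (s b ⊗ₜ[k] s a))
    (by refine ⟨?_, ?_, ?_⟩ <;> intros <;> constructor <;> intros <;>
          simp [TensorProduct.tmul_add, TensorProduct.add_tmul, TensorProduct.tmul_smul,
            ← TensorProduct.smul_tmul'])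

@[simp] theorem rev₃_tmul {k H : Type*} [Field k] [Ring H] [Algebra k H] (s : H →ₗ[k] H)
    (a b c : H) : rev₃ s (a ⊗ₜ (b ⊗ₜ c)) = s c ⊗ₜ (s b ⊗ₜ s a) := rfl

theorem rev₃_mul {k H : Type*} [Field k] [Ring H] [Algebra k H] {s : H →ₗ[k] H}
    (hs : ∀ a b, s (a * b) = s b * s a) (x y : H ⊗[k] (H ⊗[k] H)) :
    rev₃ s (x * y) = rev₃ s y * rev₃ s x := by
  induction x using induction3 with
  | h0 => simp
  | h1 a b c =>
    induction y using induction3 with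
    | h0 => simp
    | h1 u v w => simp [hs]
    | h2 x y hx hy => simp only [map_add, hx, hy, mul_add, add_mul]
  | h2 x y hx hy => simp only [map_add, hx, hy, mul_add, add_mul]

namespace QuasiHopfAlgebra

variable {k H : Type*} [Field k] [Ring H] [Algebra k H] (Q : QuasiHopfAlgebra k H)

/-- `a ⊗ b ⊗ c ⊗ d ↦ (S(c) ⊗ S(b) ⊗ S(a)) w (Δ ⊗ id)(Δ(d))`. -/
def revΔ (w : H ⊗[k] (H ⊗[k] H)) : (H ⊗[k] H) ⊗[k] (H ⊗[k] H) →ₗ[k] H ⊗[k] (H ⊗[k] H) :=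
  sandwich (rev₃ Q.S.toLinearMap) w ((Δid Q.Δ).toLinearMap ∘ₗ Q.Δ.toLinearMap) ∘ₗ
    (TensorProduct.assoc k H (H ⊗[k] H) H).symm.toLinearMap ∘ₗ
    (TensorProduct.assoc k H H H).symm.toLinearMap.lTensor H ∘ₗ
    (TensorProduct.assoc k H H (H ⊗[k] H)).toLinearMap

@[simp] theorem revΔ_tmul (w) (a b c d : H) : Q.revΔ w ((a ⊗ₜ b) ⊗ₜ (c ⊗ₜ d)) =
    (Q.S c ⊗ₜ (Q.S b ⊗ₜ Q.S a)) * w * Δid Q.Δ (Q.Δ d) := rfl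

theorem revΔ_mul (w z) (s : H ⊗[k] H) (b c : H) : Q.revΔ w (z * (s ⊗ₜ (b ⊗ₜ c))) =
    (Q.S b ⊗ₜ Q.flipS s) * Q.revΔ w z * Δid Q.Δ (Q.Δ c) := by
  induction z using induction4 with
  | h0 => simp
  | h1 x y z w =>
    induction s using TensorProduct.induction_on with
    | zero => simp
    | tmul u v => simp [Q.antipode_mul, ← mul_assoc]
    | add s t hs ht =>
      simp only [TensorProduct.add_tmul, TensorProduct.tmul_add, map_add, hs, ht, mul_add, add_mul]
  | h2 x y hx hy => simp only [map_add, hx, hy, mul_add, add_mul]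

/-- `(1 ⊗ f)(id ⊗ Δ)(γ) Φ` as a combination of two reassociators -/
theorem one_f_mul_Δγ : (1 ⊗ₜ Q.f) * idΔ Q.Δ Q.γ * Q.Φe =
    Q.revΔ ((1 ⊗ₜ (1 ⊗ₜ Q.α)) * Q.qq) (ididΔ Q.Δ Q.Φe * Δidid Q.Δ Q.Φe) := by
  have e1 (y) : (1 ⊗ₜ sandwich₂₁ Q.flipS ((1 ⊗ₜ Q.α) * Q.qL) Q.Δ.toLinearMap y) *
      idΔ Q.Δ Q.qL * Q.Φe = Q.revΔ ((1 ⊗ₜ (1 ⊗ₜ Q.α)) * Q.qq) (ididΔ Q.Δ y) := by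
    induction y using induction3 with
    | h0 => simp
    | h1 a b c =>
      have e2 (t : H ⊗[k] H) : Q.revΔ ((1 ⊗ₜ (1 ⊗ₜ Q.α)) * Q.qq) ((a ⊗ₜ b) ⊗ₜ t) =
          (1 ⊗ₜ (Q.flipS (a ⊗ₜ b) * ((1 ⊗ₜ Q.α) * Q.qL))) *
            idΔ Q.Δ (sandwich Q.Sl Q.qL Q.Δ.toLinearMap t) * Q.Φe := by
        induction t using TensorProduct.induction_on with
        | zero => simp
        | tmul u v =>
          have e3 : (Q.S u ⊗ₜ[k] (Q.S b ⊗ₜ[k] Q.S a)) =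
            (1 ⊗ₜ (Q.S b ⊗ₜ[k] Q.S a)) * (Q.S u ⊗ₜ (1 ⊗ₜ 1) : H ⊗[k] (H ⊗[k] H)) := by simp
          have e4 (t : H ⊗[k] H) : (Q.S u ⊗ₜ (1 ⊗ₜ 1) : H ⊗[k] (H ⊗[k] H)) * (1 ⊗ₜ t) =
            (1 ⊗ₜ t) * (Q.S u ⊗ₜ (1 ⊗ₜ 1)) := by simp [← Algebra.TensorProduct.one_def]
          rw [revΔ_tmul, qq, mul_assoc _ _ (Δid Q.Δ (Q.Δ v)), mul_assoc _ _ (Δid Q.Δ (Q.Δ v)),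
            mul_assoc _ _ (Δid Q.Δ (Q.Δ v)), mul_assoc _ _ (Δid Q.Δ (Q.Δ v)), ← idΔ_mul_Φe, e3,
            mul_assoc, ← mul_assoc (Q.S u ⊗ₜ[k] _), e4, mul_assoc, ← mul_assoc (Q.S u ⊗ₜ[k] _), e4]
          simp only [sandwich_tmul, Sl_apply, map_mul, idΔ_tmul, AlgHom.toLinearMap_apply,
            flipS_tmul, map_one, Algebra.TensorProduct.one_def, ← mul_assoc]
          simp
        | add s t hs ht =>
          simp only [TensorProduct.tmul_add, map_add, hs, ht, mul_add,
            add_mul]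
      rw [ididΔ_tmul, e2, qL_nat, map_mul, idΔ_tmul]
      simp [← mul_assoc]
    | h2 x y hx hy => simp only [TensorProduct.tmul_add, map_add, hx, hy, add_mul]
  have e5 (z) : (1 ⊗ₜ Q.f) *
      idΔ Q.Δ (sandwich₂₁ Q.flipS ((1 ⊗ₜ Q.α) * Q.qL) Q.Δ.toLinearMap z) * Q.Φe =
      Q.revΔ ((1 ⊗ₜ (1 ⊗ₜ Q.α)) * Q.qq) (ididΔ Q.Δ Q.Φe * Δidid Q.Δ z) := by
    induction z using induction3 with
    | h0 => simp
    | h1 a b c =>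
      rw [Δidid_tmul, revΔ_mul, ← e1, ← γ_eq_qL, mul_assoc (Q.S b ⊗ₜ[k] _),
        mul_assoc (_ * idΔ Q.Δ Q.qL) Q.Φe, ← idΔ_mul_Φe, sandwich₂₁_tmul]
      simp only [map_mul, flipS_tmul, idΔ_tmul, ← mul_assoc, AlgHom.toLinearMap_apply]
      simp only [Algebra.TensorProduct.tmul_mul_tmul, one_mul, mul_one, f_mul_ΔS]
      rw [mul_assoc (Q.SSΔop a), f_mul_Δα]
      simp [SSΔop_apply]
    | h2 x y hx hy => simp only [map_add, hx, hy, mul_add, add_mul]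
  rw [← e5, ← γ_eq_qL]

/-- `(S ⊗ S ⊗ S)(Φ³²¹)(f ⊗ 1)(Δ ⊗ id)(γ)` as a combination of three reassociators -/
theorem rev_mul_f_mul_Δγ : rev₃ Q.S.toLinearMap Q.Φe * ins12 k H Q.f * Δid Q.Δ Q.γ =
    Q.revΔ ((1 ⊗ₜ (1 ⊗ₜ Q.α)) * Q.qq)
      (oneTensor k H Q.Φe * idΔid Q.Δ Q.Φe * tensorOne k H Q.Φe) := by
  set θ := sandwich ((ins12 k H).toLinearMap ∘ₗ Q.flipS) Q.qq
      ((Δid Q.Δ).toLinearMap ∘ₗ Q.Δ.toLinearMap) ∘ₗ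
        (TensorProduct.assoc k H H H).symm.toLinearMap with hθ
  have hθ' (a b c : H) : θ (a ⊗ₜ (b ⊗ₜ c)) =
    (Q.S b ⊗ₜ (Q.S a ⊗ₜ 1)) * Q.qq * Δid Q.Δ (Q.Δ c) := rfl
  have e1 (x z) : rev₃ Q.S.toLinearMap x * ins12 k H Q.f *
      Δid Q.Δ (sandwich₂₁ Q.flipS ((1 ⊗ₜ Q.α) * Q.qL) Q.Δ.toLinearMap z) =
      Q.revΔ ((1 ⊗ₜ (1 ⊗ₜ Q.α)) * Q.qq)
        (oneTensor k H Q.Φe * idΔid Q.Δ z * tensorOne k H x) := by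
    induction z using induction3 with
    | h0 => simp
    | h1 a b c =>
      have e2 (y) (t : H ⊗[k] H) : Q.revΔ ((1 ⊗ₜ (1 ⊗ₜ Q.α)) * Q.qq)
          (oneTensor k H y * (((a ⊗ₜ 1) ⊗ₜ (1 ⊗ₜ c)) * insM k H t) * tensorOne k H x) =
          rev₃ Q.S.toLinearMap x * ins12 k H (Q.flipS t) * (1 ⊗ₜ (1 ⊗ₜ (Q.S a * Q.α))) * θ y *
            Δid Q.Δ (Q.Δ c) := by
        induction y using induction3 with
        | h0 => simp
        | h1 y₁ y₂ y₃ =>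
          induction x using induction3 with
          | h0 => simp
          | h1 x₁ x₂ x₃ =>
            induction t using TensorProduct.induction_on with
            | zero => simp
            | tmul u v => simp [hθ', Q.antipode_mul, ← mul_assoc]
            | add s t hs ht => simp only [map_add, hs, ht, mul_add, add_mul]
          | h2 x y hx hy => simp only [map_add, hx, hy, mul_add, add_mul]
        | h2 x y hx hy => simp only [map_add, hx, hy, mul_add, add_mul]
      have e3 : θ Q.Φe = ins12 k H Q.f * Δid Q.Δ Q.qL := Q.f_mul_Δ_qL.symm
      have e4 : Q.S b ⊗ₜ[k] Q.S a * (1 ⊗ₜ Q.α * Q.qL) * Q.Δ c =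
        Q.S b ⊗ₜ (Q.S a * Q.α) * Q.qL * Q.Δ c := by simp [← mul_assoc]
      rw [idΔid_tmul, e2, e3, sandwich₂₁_tmul, flipS_tmul, AlgHom.toLinearMap_apply, e4,
        map_mul, map_mul, Δid_tmul Q.Δ (Q.S b), ← SSΔop_apply]
      rw [← mul_assoc, mul_assoc (_ * _) (1 ⊗ₜ[k] _), ← mul_assoc (1 ⊗ₜ[k] _), ← ins12_mul_comm]
      simp only [← mul_assoc]
      rw [mul_assoc (rev₃ _ _) (ins12 k H Q.f), ← map_mul, f_mul_ΔS, map_mul, ← mul_assoc]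
    | h2 x y hx hy => simp only [map_add, hx, hy, mul_add, add_mul]
  rw [← e1, ← γ_eq_qL]

/-- `(1 ⊗ f)(id ⊗ Δ)(γ) Φ = (S ⊗ S ⊗ S)(Φ³²¹)(f ⊗ 1)(Δ ⊗ id)(γ)` -/
theorem γ_reassoc : (1 ⊗ₜ Q.f) * idΔ Q.Δ Q.γ * Q.Φe =
    rev₃ Q.S.toLinearMap Q.Φe * ins12 k H Q.f * Δid Q.Δ Q.γ := by
  rw [one_f_mul_Δγ, rev_mul_f_mul_Δγ]
  -- Both sides have been written as the same linear map applied to the two sides of the pentagon.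
  exact congrArg _ Q.pentagon.symm

end QuasiHopfAlgebra

end QuasiHopf

namespace QuasiHopf

/-- `a ⊗ b ↦ s(b) ⊗ s(a)`. -/
def rev₂ {k H : Type*} [Field k] [Ring H] [Algebra k H] (s : H →ₗ[k] H) :
    H ⊗[k] H →ₗ[k] H ⊗[k] H :=
  TensorProduct.map s s ∘ₗ (TensorProduct.comm k H H).toLinearMap

@[simp] theorem rev₂_tmul {k H : Type*} [Field k] [Ring H] [Algebra k H] (s : H →ₗ[k] H)
    (a b : H) : rev₂ s (a ⊗ₜ b) = s b ⊗ₜ s a := rfl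

theorem rev₂_mul {k H : Type*} [Field k] [Ring H] [Algebra k H] {s : H →ₗ[k] H}
    (hs : ∀ a b, s (a * b) = s b * s a) (x y : H ⊗[k] H) :
    rev₂ s (x * y) = rev₂ s y * rev₂ s x := by
  induction x using TensorProduct.induction_on with
  | zero => simp
  | tmul a b =>
    induction y using TensorProduct.induction_on with
    | zero => simp
    | tmul c d => simp [hs]
    | add x y hx hy => simp only [mul_add, map_add, hx, hy, add_mul]
  | add x y hx hy => simp only [mul_add, map_add, hx, hy, add_mul]

namespace QuasiHopfAlgebra

variable {k H : Type*} [Field k] [Ring H] [Algebra k H] (Q : QuasiHopfAlgebra k H)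

/-- An element x that intertwines D ∘ S with T is determined by x D(α): multiply x by D(S(x¹) α x² β
S(x³)) = 1 and move x through the first factor. -/
theorem twist_unique {B : Type*} [Ring B] [Algebra k B] (D : H →ₐ[k] B) (T : H →ₗ[k] B) (x a : B)
    (h1 : ∀ h, x * D (Q.S h) = T h * x) (h2 : x * D Q.α = a) :
    x = sandwich T a (sandwich D.toLinearMap (D Q.β)
      (D.toLinearMap ∘ₗ Q.S.toLinearMap)) Q.Φi := by
  have e (z) : x * D (sandwich Q.S.toLinearMap Q.α
      (sandwich (AlgHom.id k H).toLinearMap Q.β Q.S.toLinearMap) z) =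
      sandwich T a (sandwich D.toLinearMap (D Q.β)
        (D.toLinearMap ∘ₗ Q.S.toLinearMap)) z := by
    induction z using induction3 with
    | h0 => simp
    | h1 a b c => simp [← mul_assoc, h1, ← h2]
    | h2 x y hx hy => simp only [map_add, hx, hy, mul_add]
  rw [← e, Q.isAntipode.zag, map_one, mul_one]

/-- The relation f Δ(S(h)) = (S ⊗ S)Δᵒᵖ(h) f in the last two legs. Since S reverses the legs, id ⊗ Δ
on one side faces Δ ⊗ id on the other. -/
theorem one_f_mul_idΔ_flipS (t : H ⊗[k] H) : (1 ⊗ₜ Q.f) * idΔ Q.Δ (Q.flipS t) =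
    rev₃ Q.S.toLinearMap (Δid Q.Δ t) * (1 ⊗ₜ Q.f) := by
  induction t using TensorProduct.induction_on with
  | zero => simp
  | tmul a b =>
    have e (t : H ⊗[k] H) : rev₃ Q.S.toLinearMap (ins12 k H t * (1 ⊗ₜ (1 ⊗ₜ b))) =
        Q.S b ⊗ₜ Q.flipS t := by
      induction t using TensorProduct.induction_on with
      | zero => simp
      | tmul u v => simp
      | add x y hx hy => simp only [map_add, hx, hy, TensorProduct.tmul_add, add_mul]
    rw [Δid_tmul, e, flipS_tmul, idΔ_tmul, ← SSΔop_apply]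
    simp [f_mul_ΔS]
  | add x y hx hy => simp only [map_add, hx, hy, mul_add, add_mul]

theorem f_one_mul_Δid_flipS (t : H ⊗[k] H) : ins12 k H Q.f * Δid Q.Δ (Q.flipS t) =
    rev₃ Q.S.toLinearMap (idΔ Q.Δ t) * ins12 k H Q.f := by
  induction t using TensorProduct.induction_on with
  | zero => simp
  | tmul a b =>
    have e (t : H ⊗[k] H) : rev₃ Q.S.toLinearMap (a ⊗ₜ t) =
        ins12 k H (Q.flipS t) * (1 ⊗ₜ (1 ⊗ₜ Q.S a)) := by
      induction t using TensorProduct.induction_on with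
      | zero => simp
      | tmul u v => simp
      | add x y hx hy => simp only [map_add, hx, hy, TensorProduct.tmul_add, add_mul]
    rw [flipS_tmul, Δid_tmul, idΔ_tmul, e, ← mul_assoc, ← map_mul, f_mul_ΔS, mul_assoc,
      ← ins12_mul_comm, map_mul, mul_assoc, SSΔop_apply]
  | add x y hx hy => simp only [map_add, hx, hy, mul_add, add_mul]

/-- `(1 ⊗ f)(id ⊗ Δ)(f) Φ = (S ⊗ S ⊗ S)(Φ³²¹)(f ⊗ 1)(Δ ⊗ id)(f)` -/
theorem f_reassoc : (1 ⊗ₜ Q.f) * idΔ Q.Δ Q.f * Q.Φe =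
    rev₃ Q.S.toLinearMap Q.Φe * ins12 k H Q.f * Δid Q.Δ Q.f := by
  -- Both sides intertwine (Δ ⊗ id)Δ ∘ S with its reversed counterpart, and `γ_reassoc` shows that
  -- they agree after multiplication by the image of α; by `twist_unique` they coincide.
  refine (Q.twist_unique ((Δid Q.Δ).comp Q.Δ) (rev₃ Q.S.toLinearMap ∘ₗ (Δid Q.Δ).toLinearMap ∘ₗ
    Q.Δ.toLinearMap) _ _ (fun h => ?_) rfl).trans (Q.twist_unique ((Δid Q.Δ).comp Q.Δ)
      (rev₃ Q.S.toLinearMap ∘ₗ (Δid Q.Δ).toLinearMap ∘ₗ Q.Δ.toLinearMap) _ _ (fun h => ?_) ?_).symm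
  · simp only [AlgHom.comp_apply, LinearMap.comp_apply, AlgHom.toLinearMap_apply]
    rw [mul_assoc, ← idΔ_mul_Φe, ← mul_assoc, mul_assoc (1 ⊗ₜ[k] Q.f), ← map_mul, f_mul_ΔS,
      map_mul, SSΔop_apply, ← mul_assoc (1 ⊗ₜ[k] Q.f), one_f_mul_idΔ_flipS]
    simp only [mul_assoc]
  · simp only [AlgHom.comp_apply, LinearMap.comp_apply, AlgHom.toLinearMap_apply]
    rw [mul_assoc, ← map_mul, f_mul_ΔS, map_mul, SSΔop_apply, mul_assoc, ← mul_assoc (ins12 k H _),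
      f_one_mul_Δid_flipS, ← mul_assoc, ← mul_assoc, ← rev₃_mul Q.antipode_mul, idΔ_mul_Φe,
      rev₃_mul Q.antipode_mul]
    simp only [mul_assoc]
  · simp only [AlgHom.comp_apply]
    rw [mul_assoc, ← map_mul, f_mul_Δα, ← γ_reassoc, mul_assoc _ Q.Φe, ← idΔ_mul_Φe]
    simp only [← mul_assoc]
    rw [mul_assoc (1 ⊗ₜ[k] Q.f) (idΔ Q.Δ Q.f), ← map_mul, f_mul_Δα]

/-! ### Counits -/

/-- ε applied to S(x¹) α x² β S(x³) = 1 exhibits ε(α) as a factor of 1. -/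
theorem ε_α_ne_zero : Q.ε Q.α ≠ 0 := by
  intro h0
  have e (z) : Q.ε (sandwich Q.S.toLinearMap Q.α
      (sandwich (AlgHom.id k H).toLinearMap Q.β Q.S.toLinearMap) z) = 0 := by
    induction z using induction3 with
    | h0 => simp
    | h1 a b c => simp [h0]
    | h2 x y hx hy => simp only [map_add, hx, hy, add_zero]
  have := e Q.Φi
  rw [Q.isAntipode.zag, map_one] at this
  exact one_ne_zero this

/-- ε applied to S(h₁) α h₂ = ε(h) α gives ε(α) ε(S(h)) = ε(h) ε(α), and ε(α) can be cancelled. -/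
theorem ε_S (h : H) : Q.ε (Q.S h) = Q.ε h := by
  have e (t) : Q.ε (sandwich Q.S.toLinearMap Q.α (AlgHom.id k H).toLinearMap t) =
      Q.ε Q.α * Q.ε (Q.S (Q.εR t)) := by
    induction t using TensorProduct.induction_on with
    | zero => simp
    | tmul a b => simp; ring
    | add x y hx hy => simp only [map_add, hx, hy, mul_add]
  have h1 := e (Q.Δ h)
  rw [Q.isAntipode.left, εR_Δ, map_smul, smul_eq_mul, mul_comm] at h1
  exact (mul_left_cancel₀ Q.ε_α_ne_zero h1).symm

theorem ε_S_symm (h : H) : Q.ε (Q.S.symm h) = Q.ε h := by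
  rw [← ε_S, LinearEquiv.apply_symm_apply]

/-- The normalization ε(α) = ε(β) = 1 is not assumed. The scalars are carried along, and this
relation is what makes them cancel. -/
theorem ε_β_mul_ε_α : Q.ε Q.β * Q.ε Q.α = 1 := by
  have e (z) : Q.ε (sandwich (AlgHom.id k H).toLinearMap Q.β
      (sandwich Q.S.toLinearMap Q.α (AlgHom.id k H).toLinearMap) z) =
      Q.ε Q.β * Q.ε Q.α * Q.ε (Q.εR (Q.ε3 z)) := by
    induction z using induction3 with
    | h0 => simp
    | h1 a b c => simp [ε_S]; ring
    | h2 x y hx hy => simp only [map_add, hx, hy, mul_add]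
  have := e Q.Φe
  rw [Q.isAntipode.zig, map_one, ε3_Φe, map_one, map_one, mul_one] at this
  exact this.symm

theorem εL_flipS (t : H ⊗[k] H) : Q.εL (Q.flipS t) = Q.S (Q.εR t) := by
  induction t using TensorProduct.induction_on with
  | zero => simp
  | tmul a b => simp [ε_S]
  | add x y hx hy => simp only [map_add, hx, hy]

theorem εR_flipS (t : H ⊗[k] H) : Q.εR (Q.flipS t) = Q.S (Q.εL t) := by
  induction t using TensorProduct.induction_on with
  | zero => simp
  | tmul a b => simp [ε_S]
  | add x y hx hy => simp only [map_add, hx, hy]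

/-- Applying ε to S(A²) α A³ applies it to the two middle legs of A¹ ⊗ A² ⊗ A³ ⊗ A⁴. Under these
counits both factors defining this element become 1, so only ε(α) and the α of the second leg
survive. -/
theorem εL_γ : Q.εL Q.γ = Q.ε Q.α • Q.α := by
  let P : (H ⊗[k] H) ⊗[k] (H ⊗[k] H) →ₐ[k] H ⊗[k] H := Algebra.TensorProduct.map Q.εR Q.εL
  have hP (s t : H ⊗[k] H) : P (s ⊗ₜ t) = Q.εR s ⊗ₜ Q.εL t := rfl
  have e1 (z) : Q.εL (Q.γForm z) = Q.ε Q.α •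
      sandwich Q.S.toLinearMap Q.α LinearMap.id (P z) := by
    induction z using induction4 with
    | h0 => simp
    | h1 a b c d =>
      simp [γForm_tmul, hP, ε_S, smul_smul]
      ring_nf
    | h2 x y hx hy => simp only [map_add, hx, hy, smul_add]
  have e2 (z) : P (tensorOne k H z) = Q.εR (Q.ε3 z) ⊗ₜ 1 := by
    induction z using induction3 with
    | h0 => simp
    | h1 a b c => simp [hP, TensorProduct.tmul_smul, ← TensorProduct.smul_tmul', smul_smul]
    | h2 x y hx hy => simp only [map_add, hx, hy, TensorProduct.add_tmul]
  have e3 (z) : P (Δidid Q.Δ z) = Q.ε2 z := by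
    induction z using TensorProduct.induction_on with
    | zero => simp
    | tmul a t => simp [hP]
    | add x y hx hy => simp only [map_add, hx, hy]
  rw [γ_def, e1, map_mul, e2, e3, ε3_Φe, ε2_Φi, map_one, mul_one, sandwich_tmul]
  simp [Q.antipode_one]

theorem εR_γ : Q.εR Q.γ = Q.ε Q.α • Q.α := by
  let P : (H ⊗[k] H) ⊗[k] (H ⊗[k] H) →ₐ[k] H ⊗[k] H := Algebra.TensorProduct.map Q.εL Q.εR
  have hP (s t : H ⊗[k] H) : P (s ⊗ₜ t) = Q.εL s ⊗ₜ Q.εR t := rfl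
  have e1 (z) : Q.εR (Q.γForm z) = Q.ε Q.α •
      sandwich Q.S.toLinearMap Q.α LinearMap.id (P z) := by
    induction z using induction4 with
    | h0 => simp
    | h1 a b c d =>
      simp [γForm_tmul, hP, ε_S, smul_smul]
      ring_nf
    | h2 x y hx hy => simp only [map_add, hx, hy, smul_add]
  have e2 (z) : P (tensorOne k H z) = Q.ε1 z := by
    induction z using induction3 with
    | h0 => simp
    | h1 a b c => simp [hP, ← TensorProduct.smul_tmul']
    | h2 x y hx hy => simp only [map_add, hx, hy]
  have e3 (z) : P (Δidid Q.Δ z) = Q.ε3 z := by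
    induction z using TensorProduct.induction_on with
    | zero => simp
    | tmul a t => simp [hP]
    | add x y hx hy => simp only [map_add, hx, hy]
  rw [γ_def, e1, map_mul, e2, e3, ε1_Φe, ε3_Φi, mul_one, Algebra.TensorProduct.one_def,
    sandwich_tmul]
  simp [Q.antipode_one]

/-- A counit E in either leg sends Δ to the identity and (S ⊗ S)Δᵒᵖ to S, so it sends f to ε(α)
times S(x¹) α x² β S(x³) = 1. -/
theorem map_f_eq (E : H ⊗[k] H →ₐ[k] H) (hE : ∀ h, E (Q.Δ h) = h)
    (hS : ∀ h, E (Q.SSΔop h) = Q.S h) (hγ : E Q.γ = Q.ε Q.α • Q.α) :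
    E Q.f = Q.ε Q.α • 1 := by
  have e (z) : E (sandwich Q.SSΔop Q.γ (sandwich Q.Δ.toLinearMap (Q.Δ Q.β)
      (Q.Δ.toLinearMap ∘ₗ Q.S.toLinearMap)) z) = Q.ε Q.α •
      sandwich Q.S.toLinearMap Q.α
        (sandwich (AlgHom.id k H).toLinearMap Q.β Q.S.toLinearMap) z := by
    induction z using induction3 with
    | h0 => simp
    | h1 a b c => simp [hE, hS, hγ]
    | h2 x y hx hy => simp only [map_add, hx, hy, smul_add]
  rw [f_def, antipodeTwist, e, Q.isAntipode.zag]

theorem εL_f : Q.εL Q.f = Q.ε Q.α • 1 :=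
  Q.map_f_eq _ Q.εL_Δ (fun h => by rw [SSΔop_apply, εL_flipS, εR_Δ]) Q.εL_γ

theorem εR_f : Q.εR Q.f = Q.ε Q.α • 1 :=
  Q.map_f_eq _ Q.εR_Δ (fun h => by rw [SSΔop_apply, εR_flipS, εL_Δ]) Q.εR_γ

theorem ε_α_smul_εL_g : Q.ε Q.α • Q.εL Q.g = 1 := by
  have := congrArg Q.εL Q.f_mul_g
  rwa [map_mul, εL_f, map_one, smul_mul_assoc, one_mul] at this

theorem ε_α_smul_εR_g : Q.ε Q.α • Q.εR Q.g = 1 := by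
  have := congrArg Q.εR Q.f_mul_g
  rwa [map_mul, εR_f, map_one, smul_mul_assoc, one_mul] at this

/-- `f¹ β S(f²) = ε(β) S(α)` -/
theorem f_β_S : sandwich LinearMap.id Q.β Q.S.toLinearMap Q.f = Q.ε Q.β • Q.S Q.α := by
  set T := sandwich (B := H) LinearMap.id Q.β Q.S.toLinearMap with hT
  -- The right factor Δ(x² β S(x³)) of f is absorbed by a β S(b), which leaves ε(β) T(γ); the latter
  -- is then read off from `zigzag₃_eq_one`.
  have e1 (w : H ⊗[k] H) (h : H) : T (w * Q.Δ h) = Q.ε h • T w := by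
    induction w using TensorProduct.induction_on with
    | zero => simp
    | tmul a b =>
      have := Q.isAntipode.collapse_right (T ∘ₗ LinearMap.mulLeft k (a ⊗ₜ b))
        (LinearMap.mulLeft k a ∘ₗ LinearMap.mulRight k (Q.S b))
        (fun u v => by simp [hT, Q.antipode_mul, mul_assoc]) h
      simpa [hT, mul_assoc] using this
    | add x y hx hy => simp only [add_mul, map_add, hx, hy, smul_add]
  have e2 (z) : T (sandwich Q.SSΔop Q.γ (sandwich Q.Δ.toLinearMap (Q.Δ Q.β)
      (Q.Δ.toLinearMap ∘ₗ Q.S.toLinearMap)) z) =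
      Q.ε Q.β • T (Q.SSΔop (Q.εR (Q.ε3 z)) * Q.γ) := by
    induction z using induction3 with
    | h0 => simp
    | h1 a b c =>
      have : Q.SSΔop a * Q.γ * (Q.Δ b * Q.Δ Q.β * Q.Δ (Q.S c)) =
        Q.SSΔop a * Q.γ * Q.Δ (b * Q.β * Q.S c) := by simp
      simp only [sandwich_tmul, LinearMap.comp_apply, AlgHom.toLinearMap_apply,
        LinearEquiv.coe_coe, this, e1]
      simp [ε_S, smul_smul]
      ring_nf
    | h2 x y hx hy => simp only [map_add, hx, hy, smul_add, add_mul]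
  have e3 (z) : T (Q.γForm z) = lift2 (k := k) (fun a d : H => d * Q.S Q.α * Q.S (Q.S a))
      (by constructor <;> intros <;> constructor <;> intros <;> simp [mul_add, add_mul])
      (Q.zigzag₃ z) := by
    induction z using induction4 with
    | h0 => simp
    | h1 a b c d => simp [hT, γForm_tmul, Q.antipode_mul, mul_assoc]
    | h2 x y hx hy => simp only [map_add, hx, hy]
  rw [f_def, antipodeTwist, e2, ε3_Φi, map_one, SSΔop_one, one_mul, γ_def, e3, zigzag₃_eq_one,
    Algebra.TensorProduct.one_def, lift2_tmul]
  simp [Q.antipode_one]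

end QuasiHopfAlgebra

end QuasiHopf

namespace QuasiHopf

namespace QuasiHopfAlgebra

variable {k H : Type*} [Field k] [Ring H] [Algebra k H] (Q : QuasiHopfAlgebra k H)

/-! ### Relations between `p_R`, `p_L`, `q_L`, `q_R` and the twist -/

/-- `a ⊗ b ⊗ c ⊗ d ↦ a ⊗ (b ⊗ c β S(d))`. -/
def pForm₄ : (H ⊗[k] H) ⊗[k] (H ⊗[k] H) →ₗ[k] H ⊗[k] (H ⊗[k] H) :=
  (TensorProduct.assoc k H H H).toLinearMap ∘ₗ
    (sandwich LinearMap.id Q.β Q.S.toLinearMap).lTensor (H ⊗[k] H)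

@[simp] theorem pForm₄_tmul (a b c d : H) :
    Q.pForm₄ ((a ⊗ₜ b) ⊗ₜ (c ⊗ₜ d)) = a ⊗ₜ (b ⊗ₜ (c * Q.β * Q.S d)) := rfl

/-- `X¹ ⊗ Δ(X²) p_R (1 ⊗ S(X³)) = Φ (Δ ⊗ id)(p_R)`, where `X¹ ⊗ X² ⊗ X³ = Φ⁻¹` -/
theorem Φe_mul_Δ_pR : Q.Φe * Δid Q.Δ Q.pR =
    (sandwich Q.Δ.toLinearMap Q.pR Q.Sr).lTensor H Q.Φi := by
  have hr : Q.AbsorbsRight Q.pForm₄ (insR k H) := Q.isAntipode.absorbsRight4 fun a b c d =>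
    ⟨TensorProduct.mk k H (H ⊗[k] H) a ∘ₗ TensorProduct.mk k H H b ∘ₗ LinearMap.mulLeft k c ∘ₗ
      LinearMap.mulRight k (Q.S d), fun u v => by simp [Q.antipode_mul, mul_assoc]⟩
  have e1 (X x) : X * Δid Q.Δ (Q.pForm x) = Q.pForm₄ (tensorOne k H X * Δidid Q.Δ x) := by
    induction x using induction3 with
    | h0 => simp
    | h1 a b c =>
      rw [Δidid_tmul, pForm_tmul, Δid_tmul]
      generalize Q.Δ a = t
      induction X using induction3 with
      | h0 => simp
      | h1 u v w =>
        induction t using TensorProduct.induction_on with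
        | zero => simp
        | tmul x y => simp [mul_assoc]
        | add s t hs ht => simp only [map_add, hs, ht, mul_add, add_mul, TensorProduct.add_tmul]
      | h2 x y hx hy => simp only [map_add, hx, hy, add_mul]
    | h2 x y hx hy => simp only [map_add, hx, hy, mul_add]
  have e2 (x y) : Q.pForm₄ (idΔid Q.Δ x * oneTensor k H y) =
      (sandwich Q.Δ.toLinearMap (Q.pForm y) Q.Sr).lTensor H x := by
    induction x using induction3 with
    | h0 => simp
    | h1 a b c =>
      rw [idΔid_tmul, LinearMap.lTensor_tmul, sandwich_tmul, AlgHom.toLinearMap_apply]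
      generalize Q.Δ b = t
      induction y using induction3 with
      | h0 => simp
      | h1 u v w =>
        induction t using TensorProduct.induction_on with
        | zero => simp
        | tmul x y => simp [pForm_tmul, Q.antipode_mul, mul_assoc]
        | add s t hs ht => simp only [map_add, hs, ht, mul_add, add_mul, TensorProduct.tmul_add]
      | h2 x y hx hy => simp only [map_add, hx, hy, mul_add, add_mul, TensorProduct.tmul_add]
    | h2 x y hx hy => simp only [map_add, hx, hy, add_mul]
  rw [pR_def, ← e2, e1, pentagon_idΔid_inv_one, hr.ididΔ_Φi]

/-- `Φ (Δ ⊗ id)(p_R) (p_R ⊗ 1) = (id ⊗ Δ)(Δ(x¹) p_R) (1 ⊗ g¹ S(x³) ⊗ g² S(x²))` -/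
theorem Φe_mul_Δ_pR_mul_pR : Q.Φe * Δid Q.Δ Q.pR * ins12 k H Q.pR =
    sandwich ((idΔ Q.Δ).toLinearMap ∘ₗ Q.Δ.toLinearMap) (idΔ Q.Δ Q.pR * (1 ⊗ₜ Q.g))
      ((ins23 k H).toLinearMap ∘ₗ Q.flipS) Q.Φi := by
  let ζ : (H ⊗[k] H) ⊗[k] (H ⊗[k] H) →ₗ[k] H ⊗[k] (H ⊗[k] H) :=
    (sandwich Q.Δ.toLinearMap (Q.pR * (Q.β ⊗ₜ 1)) Q.flipS).lTensor H ∘ₗ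
      (TensorProduct.assoc k H H (H ⊗[k] H)).toLinearMap
  have hζ (a b : H) (t : H ⊗[k] H) : ζ ((a ⊗ₜ b) ⊗ₜ t) =
    a ⊗ₜ (Q.Δ b * (Q.pR * (Q.β ⊗ₜ 1)) * Q.flipS t) := rfl
  have e1 (y) : idΔ Q.Δ (Q.pForm y) * (1 ⊗ₜ Q.g) =
      (sandwich Q.Δ.toLinearMap Q.δ Q.SSΔop).lTensor H y := by
    induction y using induction3 with
    | h0 => simp
    | h1 a b c =>
      rw [pForm_tmul, idΔ_tmul, Algebra.TensorProduct.tmul_mul_tmul, mul_one, map_mul, mul_assoc,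
        ← g_mul_SSΔop, map_mul, ← mul_assoc, mul_assoc (Q.Δ b), Δβ_mul_g]
      rfl
    | h2 x y hx hy => simp only [map_add, hx, hy, add_mul]
  have e2 (x y z) : sandwich ((idΔ Q.Δ).toLinearMap ∘ₗ Q.Δ.toLinearMap)
      ((sandwich Q.Δ.toLinearMap (sandwich Q.Δ.toLinearMap (Q.pR * (Q.β ⊗ₜ 1)) Q.flipS z)
        Q.SSΔop).lTensor H y) ((ins23 k H).toLinearMap ∘ₗ Q.flipS) x =
      ζ (Δidid Q.Δ x * ididΔ Q.Δ y * oneTensor k H z) := by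
    induction x using induction3 with
    | h0 => simp
    | h1 x₁ x₂ x₃ =>
      rw [Δidid_tmul, sandwich_tmul]
      simp only [LinearMap.comp_apply, AlgHom.toLinearMap_apply]
      generalize Q.Δ x₁ = t
      induction t using TensorProduct.induction_on with
      | zero => simp
      | tmul u v =>
        induction y using induction3 with
        | h0 => simp
        | h1 y₁ y₂ y₃ =>
          rw [ididΔ_tmul, LinearMap.lTensor_tmul, sandwich_tmul]
          induction z using induction3 with
          | h0 => simp
          | h1 z₁ z₂ z₃ =>
            rw [oneTensor_tmul]
            rw [Algebra.TensorProduct.tmul_mul_tmul (u ⊗ₜ[k] v),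
              Algebra.TensorProduct.tmul_mul_tmul (u ⊗ₜ[k] v * _),
              Algebra.TensorProduct.tmul_mul_tmul u, Algebra.TensorProduct.tmul_mul_tmul (u * y₁),
              hζ, flipS_mul, flipS_mul, map_mul Q.Δ, map_mul Q.Δ]
            simp [SSΔop_apply, ← mul_assoc]
          | h2 x y hx hy =>
            simp only [map_add, hx, hy, mul_add, add_mul, TensorProduct.tmul_add] at *
        | h2 x y hx hy => simp only [map_add, hx, hy, mul_add, add_mul]
      | add s t hs ht => simp only [map_add, hs, ht, add_mul, TensorProduct.add_tmul]
    | h2 x y hx hy => simp only [map_add, hx, hy, add_mul]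
  have e3 (x y) : ζ (tensorOne k H x * idΔid Q.Δ y) =
      (sandwich Q.Δ.toLinearMap Q.pR Q.Sr).lTensor H x * ins12 k H (Q.pForm y) := by
    induction y using induction3 with
    | h0 => simp
    | h1 a b c =>
      induction x using induction3 with
      | h0 => simp
      | h1 u v w =>
        have e4 (t : H ⊗[k] H) : ζ (tensorOne k H (u ⊗ₜ (v ⊗ₜ w)) *
            (((a ⊗ₜ 1) ⊗ₜ (1 ⊗ₜ c)) * insM k H t)) = (u * a) ⊗ₜ (Q.Δ v *
            sandwich Q.Δ.toLinearMap Q.pR Q.Sr t * ((Q.β * Q.S c) ⊗ₜ Q.S w)) := by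
          induction t using TensorProduct.induction_on with
          | zero => simp
          | tmul x y => simp [hζ, Q.antipode_mul, mul_assoc]
          | add s t hs ht => simp only [map_add, hs, ht, mul_add, add_mul, TensorProduct.tmul_add]
        rw [idΔid_tmul, e4, pR_nat, pForm_tmul]
        simp [mul_assoc]
      | h2 x y hx hy => simp only [map_add, hx, hy, add_mul]
    | h2 x y hx hy => simp only [map_add, hx, hy, mul_add]
  have e5 := e2 Q.Φi Q.Φi Q.Φe
  rw [← δ_eq_pR, ← e1, ← pR_def, ← pentagon_one_idΔid_inv, e3, ← pR_def, ← Φe_mul_Δ_pR] at e5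
  exact e5.symm

/-- `f Δ(q¹) p_R (1 ⊗ S(q²)) = S(X²) α X³ ⊗ S(X¹)`, where `q¹ ⊗ q² = q_L` -/
theorem f_mul_Δ_qL_pR : Q.f * sandwich Q.Δ.toLinearMap Q.pR Q.Sr Q.qL = Q.κ'Form Q.Φe := by
  let ω : (H ⊗[k] H) ⊗[k] (H ⊗[k] H) →ₗ[k] H ⊗[k] H :=
    lift4 (k := k) (fun a b c d : H => Q.SSΔop a * Q.γ * (b ⊗ₜ[k] (c * Q.β * Q.S d)))
      (by refine ⟨?_, ?_, ?_, ?_⟩ <;> intros <;> constructor <;> intros <;>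
          simp [mul_add, add_mul, TensorProduct.tmul_add, TensorProduct.add_tmul,
            ← TensorProduct.smul_tmul'])
  have hω (a b c d : H) : ω ((a ⊗ₜ b) ⊗ₜ (c ⊗ₜ d)) =
    Q.SSΔop a * Q.γ * (b ⊗ₜ[k] (c * Q.β * Q.S d)) := rfl
  have hr : Q.AbsorbsRight ω (insR k H) := Q.isAntipode.absorbsRight4 fun a b c d =>
    ⟨LinearMap.mulLeft k (Q.SSΔop a * Q.γ) ∘ₗ TensorProduct.mk k H H b ∘ₗ LinearMap.mulLeft k c ∘ₗ
      LinearMap.mulRight k (Q.S d), fun u v => by simp [hω, Q.antipode_mul, mul_assoc]⟩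
  have e1 (x y) : Q.f * sandwich Q.Δ.toLinearMap (Q.pForm y) Q.Sr (Q.qForm x) =
      ω (idΔid Q.Δ x * oneTensor k H y) := by
    induction x using induction3 with
    | h0 => simp
    | h1 a b c =>
      have e2 : Q.qForm (a ⊗ₜ (b ⊗ₜ c)) = (Q.S a * Q.α * b) ⊗ₜ c := by simp [qForm_tmul]
      rw [e2, sandwich_tmul, AlgHom.toLinearMap_apply, map_mul, map_mul, ← mul_assoc, ← mul_assoc,
        ← mul_assoc, ← mul_assoc, f_mul_ΔS, mul_assoc (Q.SSΔop a), f_mul_Δα, idΔid_tmul]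
      generalize Q.Δ b = t
      induction y using induction3 with
      | h0 => simp
      | h1 u v w =>
        induction t using TensorProduct.induction_on with
        | zero => simp
        | tmul x y => simp [hω, pForm_tmul, Q.antipode_mul, mul_assoc]
        | add s t hs ht => simp only [map_add, hs, ht, mul_add, add_mul]
      | h2 x y hx hy => simp only [map_add, hx, hy, mul_add, add_mul]
    | h2 x y hx hy => simp only [map_add, hx, hy, mul_add, add_mul]
  have e3 (X x) : ω (tensorOne k H X * Δidid Q.Δ x) = lift3 (k := k) (fun a b c : H =>
      sandwich Q.SSΔop (sandwich Q.SSΔop Q.γ LinearMap.id X) ((TensorProduct.mk k H H).flip 1)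
        (Q.Δ a) * ((1 : H) ⊗ₜ[k] (b * Q.β * Q.S c)))
      (by refine ⟨?_, ?_, ?_⟩ <;> intros <;> constructor <;> intros <;>
          simp [mul_add, add_mul, TensorProduct.tmul_add]) x := by
    induction x using induction3 with
    | h0 => simp
    | h1 a b c =>
      rw [Δidid_tmul, lift3_tmul]
      generalize Q.Δ a = t
      induction t using TensorProduct.induction_on with
      | zero => simp
      | tmul u v =>
        rw [sandwich_tmul]
        induction X using induction3 with
        | h0 => simp
        | h1 x y z => simp [hω, SSΔop_mul, mul_assoc]
        | h2 x y hx hy => simp only [map_add, hx, hy, mul_add, add_mul]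
      | add s t hs ht => simp only [map_add, hs, ht, mul_add, add_mul, TensorProduct.add_tmul]
    | h2 x y hx hy => simp only [map_add, hx, hy, mul_add]
  have e4 (x) : ω (tensorOne k H Q.Φe * Δidid Q.Δ x) = Q.κ'Form Q.Φe * (1 ⊗ₜ
      sandwich Q.S.toLinearMap Q.α
        (sandwich (AlgHom.id k H).toLinearMap Q.β Q.S.toLinearMap) x) := by
    rw [e3, SSΔop_γ, γForm_tensorOne]
    induction x using induction3 with
    | h0 => simp
    | h1 a b c =>
      have e5 (t) : sandwich Q.SSΔop (Q.κ'Form Q.Φe * (1 ⊗ₜ Q.α))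
          ((TensorProduct.mk k H H).flip 1) t = sandwich Q.SSΔop (Q.κ'Form Q.Φe)
          ((TensorProduct.mk k H H).flip 1) t * (1 ⊗ₜ Q.α) := by
        induction t using TensorProduct.induction_on with
        | zero => simp
        | tmul u v => simp [mul_assoc]
        | add s t hs ht => simp only [map_add, hs, ht, add_mul]
      rw [lift3_tmul, e5, κ'_nat]
      simp [mul_assoc]
    | h2 x y hx hy => simp only [map_add, hx, hy, mul_add, TensorProduct.tmul_add]
  -- The pentagon moves the coproducts to positions where one is absorbed. `SSΔop_γ` and the
  -- naturality of κ' then extract κ', and the factor left in the second leg is S(x¹) α x² β S(x³) =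
  -- 1.
  rw [pR_def, qL_def, e1, pentagon_idΔid_inv_one, hr.ididΔ_Φi, e4, Q.isAntipode.zag]
  exact mul_one _

/-- `a ⊗ b ⊗ c ↦ b S⁻¹(a β) ⊗ c`. -/
def pLForm : H ⊗[k] (H ⊗[k] H) →ₗ[k] H ⊗[k] H :=
  lift3 (k := k) (fun a b c : H => (b * Q.S.symm (a * Q.β)) ⊗ₜ[k] c)
    (by refine ⟨?_, ?_, ?_⟩ <;> intros <;> constructor <;> intros <;>
          simp [mul_add, add_mul, TensorProduct.tmul_add, TensorProduct.add_tmul,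
            TensorProduct.smul_tmul'])

@[simp] theorem pLForm_tmul (a b c : H) :
    Q.pLForm (a ⊗ₜ (b ⊗ₜ c)) = (b * Q.S.symm (a * Q.β)) ⊗ₜ[k] c := rfl

theorem pL_def : Q.pL = Q.pLForm Q.Φe := rfl

/-- `a ⊗ b ↦ Δ(b) p_L (S⁻¹(a) ⊗ 1)`. -/
def pLTwist : H ⊗[k] H →ₗ[k] H ⊗[k] H :=
  sandwich Q.Δ.toLinearMap Q.pL ((TensorProduct.mk k H H).flip 1 ∘ₗ Q.S.symm.toLinearMap) ∘ₗ
    (TensorProduct.comm k H H).toLinearMap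

@[simp] theorem pLTwist_tmul (a b : H) :
    Q.pLTwist (a ⊗ₜ b) = Q.Δ b * Q.pL * (Q.S.symm a ⊗ₜ 1) := rfl

/-- `f Δ(F²) p_L (S⁻¹(F¹) ⊗ 1) = S(X²) α X³ ⊗ S(X¹)`, where `F¹ ⊗ F² = f` -/
theorem f_mul_pLTwist_f : Q.f * Q.pLTwist Q.f = Q.κ'Form Q.Φe := by
  have e1 (v w : H ⊗[k] H) (X) : v * (sandwich Q.Δ.toLinearMap (Q.pLForm X)
      ((TensorProduct.mk k H H).flip 1 ∘ₗ Q.S.symm.toLinearMap) ∘ₗ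
      (TensorProduct.comm k H H).toLinearMap) w = Q.pLForm ((1 ⊗ₜ v) * idΔ Q.Δ w * X) := by
    induction w using TensorProduct.induction_on with
    | zero => simp
    | tmul a b =>
      simp only [LinearMap.comp_apply, LinearEquiv.coe_coe, TensorProduct.comm_tmul, sandwich_tmul,
        AlgHom.toLinearMap_apply, idΔ_tmul, Algebra.TensorProduct.tmul_mul_tmul, one_mul,
        ← mul_assoc]
      generalize v * Q.Δ b = t
      induction X using induction3 with
      | h0 => simp
      | h1 x y z =>
        induction t using TensorProduct.induction_on with
        | zero => simp
        | tmul u v => simp [Q.antipode_symm_mul, mul_assoc]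
        | add s t hs ht => simp only [map_add, hs, ht, TensorProduct.tmul_add, add_mul]
      | h2 x y hx hy => simp only [map_add, hx, hy, mul_add, add_mul]
    | add x y hx hy => simp only [map_add, hx, hy, mul_add, add_mul]
  have e2 (v w : H ⊗[k] H) (X) : Q.pLForm (rev₃ Q.S.toLinearMap X * ins12 k H v * Δid Q.Δ w) =
      lift3 (k := k) (fun a b c : H => (Q.S b * Q.S.symm (sandwich LinearMap.id Q.β
        Q.S.toLinearMap v) * c) ⊗ₜ[k] (Q.S a * Q.εL w))
      (by refine ⟨?_, ?_, ?_⟩ <;> intros <;> constructor <;> intros <;>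
          simp [mul_add, add_mul, TensorProduct.tmul_add, TensorProduct.add_tmul,
            TensorProduct.smul_tmul']) X := by
    induction X using induction3 with
    | h0 => simp
    | h1 a b c =>
      induction w using TensorProduct.induction_on with
      | zero => simp
      | tmul x y =>
        rw [Δid_tmul, lift3_tmul]
        induction v using TensorProduct.induction_on with
        | zero => simp
        | tmul u v =>
          refine (Q.isAntipode.collapse_right (Q.pLForm ∘ₗ LinearMap.mulLeft k
            (rev₃ Q.S.toLinearMap (a ⊗ₜ (b ⊗ₜ c)) * ins12 k H (u ⊗ₜ v)) ∘ₗ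
            LinearMap.mulRight k (1 ⊗ₜ (1 ⊗ₜ y)) ∘ₗ (ins12 k H).toLinearMap)
            ((TensorProduct.mk k H H).flip (Q.S a * y) ∘ₗ LinearMap.mulLeft k (Q.S b * v) ∘ₗ
              LinearMap.mulRight k (Q.S.symm u * c) ∘ₗ Q.S.symm.toLinearMap) (fun p q => ?_)
              x).trans ?_
          · simp [Q.antipode_symm_mul, mul_assoc]
          · simp [Q.antipode_symm_mul, mul_assoc, TensorProduct.tmul_smul]
        | add s t hs ht =>
          simp only [map_add, hs, ht, mul_add, add_mul, TensorProduct.add_tmul]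
      | add x y hx hy =>
        simp only [map_add, hx, hy, mul_add]
        simp only [lift3_tmul, TensorProduct.tmul_add]
    | h2 x y hx hy => simp only [map_add, hx, hy, add_mul]
  -- Here the compatibility of f with Φ enters. After it, one copy of f appears only as f¹ β S(f²) =
  -- ε(β) S(α) and the other only through its counit ε(α).
  have e3 := e1 Q.f Q.f Q.Φe
  rw [f_reassoc, e2, f_β_S, εL_f] at e3
  refine e3.trans ?_
  generalize Q.Φe = X
  induction X using induction3 with
  | h0 => simp
  | h1 a b c =>
    simp only [lift3_tmul, map_smul, LinearEquiv.symm_apply_apply, mul_smul_comm, smul_mul_assoc,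
      TensorProduct.tmul_smul, ← TensorProduct.smul_tmul', smul_smul, mul_one, κ'Form_tmul]
    rw [mul_comm, ε_β_mul_ε_α, one_smul]
  | h2 x y hx hy => simp only [map_add, hx, hy]

/-- `Δ(q¹) p_R (1 ⊗ S(q²)) = Δ(f²) p_L (S⁻¹(f¹) ⊗ 1)`, where `q¹ ⊗ q² = q_L` -/
theorem Δ_qL_pR_eq : sandwich Q.Δ.toLinearMap Q.pR Q.Sr Q.qL = Q.pLTwist Q.f := by
  -- f is invertible, and both sides become κ' after left multiplication by f.
  rw [← one_mul (sandwich _ _ _ _), ← one_mul (Q.pLTwist Q.f), ← g_mul_f, mul_assoc, mul_assoc,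
    f_mul_Δ_qL_pR, f_mul_pLTwist_f]

/-- `a ⊗ b ⊗ c ↦ a ⊗ S⁻¹(α c) b`. -/
def qRForm : H ⊗[k] (H ⊗[k] H) →ₗ[k] H ⊗[k] H :=
  lift3 (k := k) (fun a b c : H => a ⊗ₜ[k] (Q.S.symm (Q.α * c) * b))
    (by refine ⟨?_, ?_, ?_⟩ <;> intros <;> constructor <;> intros <;>
          simp [mul_add, add_mul, TensorProduct.tmul_add, TensorProduct.add_tmul,
            TensorProduct.smul_tmul'])

@[simp] theorem qRForm_tmul (a b c : H) :
    Q.qRForm (a ⊗ₜ (b ⊗ₜ c)) = a ⊗ₜ[k] (Q.S.symm (Q.α * c) * b) := rfl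

theorem qR_def : Q.qR = Q.qRForm Q.Φe := rfl

/-- `a ⊗ b ↦ (1 ⊗ S⁻¹(b)) q_R Δ(a)`. -/
def qRConj : H ⊗[k] H →ₗ[k] H ⊗[k] H :=
  sandwich (TensorProduct.mk k H H 1 ∘ₗ Q.S.symm.toLinearMap) Q.qR Q.Δ.toLinearMap ∘ₗ
    (TensorProduct.comm k H H).toLinearMap

@[simp] theorem qRConj_tmul (a b : H) :
    Q.qRConj (a ⊗ₜ b) = (1 ⊗ₜ Q.S.symm b) * Q.qR * Q.Δ a := rfl

theorem qRForm_mul_Δid (z) (y : H ⊗[k] H) : Q.qRForm (z * Δid Q.Δ y) =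
    (sandwich (TensorProduct.mk k H H 1 ∘ₗ Q.S.symm.toLinearMap) (Q.qRForm z) Q.Δ.toLinearMap ∘ₗ
    (TensorProduct.comm k H H).toLinearMap) y := by
  induction y using TensorProduct.induction_on with
  | zero => simp
  | tmul a b =>
    simp only [LinearMap.comp_apply, LinearEquiv.coe_coe, TensorProduct.comm_tmul, sandwich_tmul,
        AlgHom.toLinearMap_apply, Δid_tmul]
    generalize Q.Δ a = t
    induction z using induction3 with
    | h0 => simp
    | h1 x y z =>
      induction t using TensorProduct.induction_on with
      | zero => simp
      | tmul u v => simp [Q.antipode_symm_mul, mul_assoc]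
      | add s t hs ht => simp only [map_add, hs, ht, mul_add, add_mul]
    | h2 x y hx hy => simp only [map_add, hx, hy, mul_add, add_mul]
  | add x y hx hy => simp only [map_add, hx, hy, mul_add]

/-- `(1 ⊗ S⁻¹(h₂)) q_R Δ(h₁) = (h ⊗ 1) q_R` -/
theorem qR_nat (h : H) : Q.qRConj (Q.Δ h) = (h ⊗ₜ 1) * Q.qR := by
  have hl : Q.AbsorbsLeft Q.qRForm (ins23 k H) := Q.isAntipode.absorbsLeft3 fun a b c =>
    ⟨TensorProduct.mk k H H a ∘ₗ LinearMap.mulLeft k (Q.S.symm c) ∘ₗ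
      LinearMap.mulRight k b ∘ₗ Q.S.symm.toLinearMap, fun u v => by
        simp [Q.antipode_symm_mul, mul_assoc]⟩
  have e2 (z) : Q.qRForm ((h ⊗ₜ 1) * z) = (h ⊗ₜ 1) * Q.qRForm z := by
    induction z using induction3 with
    | h0 => simp
    | h1 a b c => simp [Algebra.TensorProduct.one_def]
    | h2 x y hx hy => simp only [map_add, hx, hy, mul_add]
  rw [qRConj, qR_def, ← qRForm_mul_Δid, ← idΔ_mul_Φe, hl.snd (idΔ Q.Δ) (fun _ => rfl), εR_Δ,
    idΔ_tmul, map_one, e2]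

/-- `(1 ⊗ S⁻¹(p²)) q_R Δ(p¹) = 1` -/
theorem qRConj_pR : Q.qRConj Q.pR = 1 := by
  have e (z x) : Q.qRForm (z * Δid Q.Δ (Q.pForm x)) = Q.S.symm.toLinearMap.lTensor H
      (Q.zigzag₃ (tensorOne k H z * Δidid Q.Δ x)) := by
    induction x using induction3 with
    | h0 => simp
    | h1 a b c =>
      rw [pForm_tmul, Δid_tmul, Δidid_tmul]
      generalize Q.Δ a = t
      induction z using induction3 with
      | h0 => simp
      | h1 x y z =>
        induction t using TensorProduct.induction_on with
        | zero => simp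
        | tmul u v => simp [Q.antipode_symm_mul, mul_assoc]
        | add s t hs ht => simp only [map_add, hs, ht, mul_add, add_mul, TensorProduct.add_tmul]
      | h2 x y hx hy => simp only [map_add, hx, hy, add_mul]
    | h2 x y hx hy => simp only [map_add, hx, hy, mul_add]
  rw [qRConj, qR_def, ← qRForm_mul_Δid, pR_def, e, zigzag₃_eq_one, Algebra.TensorProduct.one_def,
    LinearMap.lTensor_tmul, LinearEquiv.coe_coe, antipode_symm_one]

end QuasiHopfAlgebra

end QuasiHopf

/-! ### Twist data: a common formalism for S and S⁻¹. -/

namespace QuasiHopf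

variable {k H : Type*} [Field k] [Ring H] [Algebra k H]

/-- An anti-automorphism `s` of a quasi-bialgebra together with an invertible element `F` for which
`s` is an isomorphism from the opposite coopposite quasi-bialgebra to the twist by `F`. -/
structure TwistDatum (Q : QuasiHopfAlgebra k H) where
  s : H ≃ₗ[k] H
  F : H ⊗[k] H
  G : H ⊗[k] H
  s_one : s 1 = 1
  s_mul : ∀ a b, s (a * b) = s b * s a
  ε_s : ∀ h, Q.ε (s h) = Q.ε h
  F_mul_G : F * G = 1
  G_mul_F : G * F = 1
  F_mul_Δ : ∀ h, F * Q.Δ (s h) = rev₂ s.toLinearMap (Q.Δ h) * F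
  reassoc : (1 ⊗ₜ F) * idΔ Q.Δ F * Q.Φe =
    rev₃ s.toLinearMap Q.Φe * ins12 k H F * Δid Q.Δ F
  ε_F_G : Q.εL F * Q.εR G = 1

namespace QuasiHopfAlgebra

variable (Q : QuasiHopfAlgebra k H)

/-- The antipode and Drinfeld's twist. -/
def leftTwist : TwistDatum Q where
  s := Q.S
  F := Q.f
  G := Q.g
  s_one := Q.antipode_one
  s_mul := Q.antipode_mul
  ε_s := Q.ε_S
  F_mul_G := Q.f_mul_g
  G_mul_F := Q.g_mul_f
  F_mul_Δ := Q.f_mul_ΔS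
  reassoc := Q.f_reassoc
  ε_F_G := by rw [εL_f, smul_mul_assoc, one_mul, ε_α_smul_εR_g]

theorem flipSInv_eq : Q.flipSInv = rev₂ Q.S.symm.toLinearMap := rfl

theorem flipSInv_mul (x y : H ⊗[k] H) : Q.flipSInv (x * y) = Q.flipSInv y * Q.flipSInv x :=
  rev₂_mul Q.antipode_symm_mul x y

theorem flipSInv_one : Q.flipSInv 1 = 1 := by
  rw [flipSInv_eq, Algebra.TensorProduct.one_def, rev₂_tmul]
  simp [Q.antipode_symm_one]

@[simp] theorem flipSInv_tmul (a b : H) : Q.flipSInv (a ⊗ₜ b) = Q.S.symm b ⊗ₜ Q.S.symm a := rfl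

theorem flipSInv_flipS (t : H ⊗[k] H) : Q.flipSInv (Q.flipS t) = t := by
  induction t using TensorProduct.induction_on with
  | zero => simp
  | tmul a b => simp
  | add x y hx hy => simp only [map_add, hx, hy]

theorem flipSInv_f_mul_Δ (h : H) :
    Q.flipSInv Q.f * Q.Δ (Q.S.symm h) = Q.flipSInv (Q.Δ h) * Q.flipSInv Q.f := by
  have := congrArg Q.flipSInv (Q.f_mul_ΔS (Q.S.symm h))
  rw [flipSInv_mul, flipSInv_mul, SSΔop_apply, flipSInv_flipS, LinearEquiv.apply_symm_apply] at this
  exact this.symm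

theorem flipSInv_f_mul_g : Q.flipSInv Q.f * Q.flipSInv Q.g = 1 := by
  rw [← flipSInv_mul, g_mul_f, flipSInv_one]

theorem flipSInv_g_mul_f : Q.flipSInv Q.g * Q.flipSInv Q.f = 1 := by
  rw [← flipSInv_mul, f_mul_g, flipSInv_one]

theorem rev₃_one_tmul (s : H →ₗ[k] H) (hs : s 1 = 1) (t : H ⊗[k] H) :
    rev₃ s (1 ⊗ₜ t) = ins12 k H (rev₂ s t) := by
  induction t using TensorProduct.induction_on with
  | zero => simp
  | tmul a b => simp [hs]
  | add x y hx hy => simp only [map_add, TensorProduct.tmul_add, hx, hy]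

theorem rev₃_ins12 (s : H →ₗ[k] H) (hs : s 1 = 1) (t : H ⊗[k] H) :
    rev₃ s (ins12 k H t) = 1 ⊗ₜ rev₂ s t := by
  induction t using TensorProduct.induction_on with
  | zero => simp
  | tmul a b => simp [hs]
  | add x y hx hy => simp only [map_add, TensorProduct.tmul_add, hx, hy]

theorem rev₃_symm_rev₃ (x) : rev₃ Q.S.symm.toLinearMap (rev₃ Q.S.toLinearMap x) = x := by
  induction x using induction3 with
  | h0 => simp
  | h1 a b c => simp
  | h2 x y hx hy => simp only [map_add, hx, hy]

theorem rev₃_idΔ_mul (t : H ⊗[k] H) : ins12 k H (Q.flipSInv Q.f) * Δid Q.Δ (Q.flipSInv t) =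
    rev₃ Q.S.symm.toLinearMap (idΔ Q.Δ t) * ins12 k H (Q.flipSInv Q.f) := by
  induction t using TensorProduct.induction_on with
  | zero => simp
  | tmul a b =>
    have e : idΔ Q.Δ (a ⊗ₜ b) = (a ⊗ₜ 1) * (1 ⊗ₜ Q.Δ b) := by simp
    rw [e, rev₃_mul Q.antipode_symm_mul, rev₃_one_tmul _ Q.antipode_symm_one,
      Algebra.TensorProduct.one_def, rev₃_tmul, flipSInv_tmul, Δid_tmul, ← mul_assoc, ← map_mul,
      flipSInv_f_mul_Δ, map_mul, mul_assoc, ins12_mul_comm, mul_assoc]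
    simp [Q.antipode_symm_one, flipSInv_eq]
  | add x y hx hy => simp only [map_add, hx, hy, mul_add, add_mul]

theorem rev₃_Δid_mul (t : H ⊗[k] H) : (1 ⊗ₜ Q.flipSInv Q.f) * idΔ Q.Δ (Q.flipSInv t) =
    rev₃ Q.S.symm.toLinearMap (Δid Q.Δ t) * (1 ⊗ₜ Q.flipSInv Q.f) := by
  induction t using TensorProduct.induction_on with
  | zero => simp
  | tmul a b =>
    rw [Δid_tmul, rev₃_mul Q.antipode_symm_mul, rev₃_ins12 _ Q.antipode_symm_one,
      flipSInv_tmul, idΔ_tmul, Algebra.TensorProduct.tmul_mul_tmul, flipSInv_f_mul_Δ]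
    simp [Q.antipode_symm_one, flipSInv_eq, ← Algebra.TensorProduct.one_def]
  | add x y hx hy => simp only [map_add, hx, hy, mul_add, add_mul]

/-- The inverse of the antipode and the corresponding twist. -/
def rightTwist : TwistDatum Q where
  s := Q.S.symm
  F := Q.flipSInv Q.f
  G := Q.flipSInv Q.g
  s_one := Q.antipode_symm_one
  s_mul := Q.antipode_symm_mul
  ε_s := Q.ε_S_symm
  F_mul_G := Q.flipSInv_f_mul_g
  G_mul_F := Q.flipSInv_g_mul_f
  F_mul_Δ := Q.flipSInv_f_mul_Δ
  reassoc := by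
    -- Applying S⁻¹ and reversing the legs is anti-multiplicative, so it interchanges the roles of
    -- the two sides of the relation for f.
    have h := congrArg (rev₃ Q.S.symm.toLinearMap) Q.f_reassoc
    simp only [rev₃_mul Q.antipode_symm_mul] at h
    rw [rev₃_symm_rev₃, rev₃_one_tmul _ Q.antipode_symm_one, rev₃_ins12 _ Q.antipode_symm_one,
      ← flipSInv_eq, ← rev₃_idΔ_mul, ← mul_assoc (rev₃ _ (Δid _ _)), ← rev₃_Δid_mul] at h
    rw [← h, ← mul_assoc]
  ε_F_G := by
    have e1 (t : H ⊗[k] H) : Q.εL (Q.flipSInv t) = Q.S.symm (Q.εR t) := by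
      induction t using TensorProduct.induction_on with
      | zero => simp
      | tmul a b => simp [ε_S_symm]
      | add x y hx hy => simp only [map_add, hx, hy]
    have e2 (t : H ⊗[k] H) : Q.εR (Q.flipSInv t) = Q.S.symm (Q.εL t) := by
      induction t using TensorProduct.induction_on with
      | zero => simp
      | tmul a b => simp [ε_S_symm]
      | add x y hx hy => simp only [map_add, hx, hy]
    rw [e1, e2, εR_f, ← antipode_symm_mul, mul_smul_comm, mul_one, ε_α_smul_εL_g,
      antipode_symm_one]

end QuasiHopfAlgebra

end QuasiHopf

/-! ### Braidings with arbitrary H-modules. -/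

namespace QuasiHopf

variable {k H : Type*} [Field k] [Ring H] [Algebra k H]

section Intertwiners

variable {A B U U' V V' W W' : Type*} [Ring A] [Algebra k A] [Ring B] [Algebra k B]
  [AddCommGroup U] [Module k U] [AddCommGroup U'] [Module k U']
  [AddCommGroup V] [Module k V] [AddCommGroup V'] [Module k V']
  [AddCommGroup W] [Module k W] [AddCommGroup W'] [Module k W']

@[simp] theorem extAct_tmul (ρ : A →ₐ[k] Module.End k U) (σ : B →ₐ[k] Module.End k V) (a : A) (b : B)
    (u : U) (v : V) : extAct ρ σ (a ⊗ₜ b) (u ⊗ₜ v) = ρ a u ⊗ₜ σ b v := rfl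

theorem extAct_tmul_eq (ρ : A →ₐ[k] Module.End k U) (σ : B →ₐ[k] Module.End k V) (a : A) (b : B) :
    extAct ρ σ (a ⊗ₜ b) = TensorProduct.map (ρ a) (σ b) := rfl

@[simp] theorem actMap_tmul (ρ : A →ₐ[k] Module.End k U) (a : A) (u : U) :
    actMap ρ (a ⊗ₜ u) = ρ a u := rfl

/-- Linear maps commuting with the actions of an algebra. -/
def Intertwines (ρ : A →ₐ[k] Module.End k U) (ρ' : A →ₐ[k] Module.End k U') (T : U →ₗ[k] U') : Prop :=
  ∀ a u, T (ρ a u) = ρ' a (T u)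

theorem Intertwines.id (ρ : A →ₐ[k] Module.End k U) : Intertwines ρ ρ LinearMap.id :=
  fun _ _ => rfl

theorem Intertwines.map {ρ : A →ₐ[k] Module.End k U} {ρ' : A →ₐ[k] Module.End k U'}
    {σ : B →ₐ[k] Module.End k V} {σ' : B →ₐ[k] Module.End k V'} {T : U →ₗ[k] U'} {R : V →ₗ[k] V'}
    (hT : Intertwines ρ ρ' T) (hR : Intertwines σ σ' R) :
    Intertwines (extAct ρ σ) (extAct ρ' σ') (TensorProduct.map T R) := by
  intro z x
  induction z using TensorProduct.induction_on with
  | zero => simp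
  | add z w hz hw => simp only [map_add, LinearMap.add_apply, hz, hw]
  | tmul a b =>
    induction x using TensorProduct.induction_on with
    | zero => simp
    | tmul u v => simp [hT a u, hR b v]
    | add x y hx hy => simp only [map_add, hx, hy]

theorem Intertwines.lTensor (ρ : A →ₐ[k] Module.End k U)
    {σ : B →ₐ[k] Module.End k V} {σ' : B →ₐ[k] Module.End k V'} {R : V →ₗ[k] V'}
    (hR : Intertwines σ σ' R) : Intertwines (extAct ρ σ) (extAct ρ σ') (R.lTensor U) :=
  (Intertwines.id ρ).map hR

theorem Intertwines.rTensor {ρ : A →ₐ[k] Module.End k U} {ρ' : A →ₐ[k] Module.End k U'}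
    {T : U →ₗ[k] U'} (hT : Intertwines ρ ρ' T) (σ : B →ₐ[k] Module.End k V) :
    Intertwines (extAct ρ σ) (extAct ρ' σ) (T.rTensor V) :=
  hT.map (Intertwines.id σ)

/-- The intertwiner `A → U`, `a ↦ a · u`. -/
theorem intertwines_orbit (ρ : A →ₐ[k] Module.End k U) (u : U) :
    Intertwines (Algebra.lmul k A) ρ (ρ.toLinearMap.flip u) :=
  fun a b => by simp

theorem assoc_extAct {C : Type*} [Ring C] [Algebra k C] (ρ : A →ₐ[k] Module.End k U) (σ : B →ₐ[k] Module.End k V)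
    (τ : C →ₐ[k] Module.End k W) (z : (A ⊗[k] B) ⊗[k] C) (x : (U ⊗[k] V) ⊗[k] W) :
    TensorProduct.assoc k U V W (extAct (extAct ρ σ) τ z x) =
      extAct ρ (extAct σ τ) (TensorProduct.assoc k A B C z) (TensorProduct.assoc k U V W x) := by
  induction z using TensorProduct.induction_on with
  | zero => simp
  | add z w hz hw => simp only [map_add, LinearMap.add_apply, hz, hw]
  | tmul t c =>
    induction t using TensorProduct.induction_on with
    | zero => simp
    | add z w hz hw => simp only [TensorProduct.add_tmul, map_add, LinearMap.add_apply, hz, hw]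
    | tmul a b =>
      induction x using TensorProduct.induction_on with
      | zero => simp
      | add x y hx hy => simp only [map_add, hx, hy]
      | tmul s w =>
        induction s using TensorProduct.induction_on with
        | zero => simp
        | add x y hx hy => simp only [TensorProduct.add_tmul, map_add, hx, hy]
        | tmul u v => simp

end Intertwiners

namespace ActCoact

variable {M U U' V W W' : Type*} [AddCommGroup M] [Module k M]
  [AddCommGroup U] [Module k U] [AddCommGroup U'] [Module k U']
  [AddCommGroup V] [Module k V] [AddCommGroup W] [Module k W] [AddCommGroup W'] [Module k W']
  (X : ActCoact k H M)

theorem braid_tmul (ρ : H →ₐ[k] Module.End k U) (m : M) (u : U) :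
    X.braid ρ (m ⊗ₜ u) = (ρ.toLinearMap.flip u).rTensor M (X.coact m) := by
  simp only [braid, LinearMap.comp_apply, LinearMap.rTensor_tmul, LinearEquiv.coe_coe]
  induction X.coact m using TensorProduct.induction_on with
  | zero => simp
  | tmul a m => simp
  | add x y hx hy => simp only [TensorProduct.add_tmul, map_add, hx, hy]

theorem braid_lmul_one (m : M) : X.braid (Algebra.lmul k H) (m ⊗ₜ 1) = X.coact m := by
  rw [braid_tmul]
  have : (Algebra.lmul k H).toLinearMap.flip 1 = LinearMap.id := by ext; simp
  rw [this, LinearMap.rTensor_id, LinearMap.id_apply]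

/-- Every vector u of an H-module is the image of 1 under the intertwiner H → U, h ↦ h·u. Naturality
therefore reduces statements about the braiding with U to the coaction, which is the braiding with H
at 1. -/
theorem braid_nat {ρ : H →ₐ[k] Module.End k U} {ρ' : H →ₐ[k] Module.End k U'} {T : U →ₗ[k] U'}
    (hT : Intertwines ρ ρ' T) (x : M ⊗[k] U) :
    T.rTensor M (X.braid ρ x) = X.braid ρ' (T.lTensor M x) := by
  induction x using TensorProduct.induction_on with
  | zero => simp
  | add x y hx hy => simp only [map_add, hx, hy]
  | tmul m u =>
    rw [LinearMap.lTensor_tmul, braid_tmul, braid_tmul, ← LinearMap.comp_apply,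
      ← LinearMap.rTensor_comp]
    congr 2
    ext h
    simp [hT h u]

/-- The braiding `M ⊗ (U ⊗ W) → U ⊗ (M ⊗ W)` of the first two factors. -/
def braid₁₂ (ρ : H →ₐ[k] Module.End k U) (W : Type*) [AddCommGroup W] [Module k W] :
    M ⊗[k] (U ⊗[k] W) →ₗ[k] U ⊗[k] (M ⊗[k] W) :=
  (TensorProduct.assoc k U M W).toLinearMap ∘ₗ (X.braid ρ).rTensor W ∘ₗ
    (TensorProduct.assoc k M U W).symm.toLinearMap

theorem braid₁₂_tmul (ρ : H →ₐ[k] Module.End k U) (m : M) (u : U) (w : W) :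
    X.braid₁₂ ρ W (m ⊗ₜ (u ⊗ₜ w)) = TensorProduct.assoc k U M W (X.braid ρ (m ⊗ₜ u) ⊗ₜ w) := rfl

theorem assoc_braid (ρ : H →ₐ[k] Module.End k U) (x : (M ⊗[k] U) ⊗[k] W) :
    TensorProduct.assoc k U M W ((X.braid ρ).rTensor W x) =
      X.braid₁₂ ρ W (TensorProduct.assoc k M U W x) := by
  simp [braid₁₂]

theorem braid₁₂_nat {ρ : H →ₐ[k] Module.End k U} {ρ' : H →ₐ[k] Module.End k U'} {T : U →ₗ[k] U'}
    (hT : Intertwines ρ ρ' T) (R : W →ₗ[k] W') (x : M ⊗[k] (U ⊗[k] W)) :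
    TensorProduct.map T (R.lTensor M) (X.braid₁₂ ρ W x) =
      X.braid₁₂ ρ' W' ((TensorProduct.map T R).lTensor M x) := by
  have key (y : (M ⊗[k] U) ⊗[k] W) :
      TensorProduct.map T (R.lTensor M) (TensorProduct.assoc k U M W ((X.braid ρ).rTensor W y)) =
      X.braid₁₂ ρ' W' ((TensorProduct.map T R).lTensor M (TensorProduct.assoc k M U W y)) := by
    induction y using TensorProduct.induction_on with
    | zero => simp
    | add x y hx hy => simp only [map_add, hx, hy]
    | tmul s w =>
      have e1 (t : U ⊗[k] M) : TensorProduct.map T (R.lTensor M) (TensorProduct.assoc k U M W (t ⊗ₜ w)) =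
          TensorProduct.assoc k U' M W' (T.rTensor M t ⊗ₜ R w) := by
        induction t using TensorProduct.induction_on with
        | zero => simp
        | add x y hx hy => simp only [TensorProduct.add_tmul, map_add, hx, hy]
        | tmul u m => simp
      rw [LinearMap.rTensor_tmul, e1, braid_nat X hT]
      induction s using TensorProduct.induction_on with
      | zero => simp
      | add x y hx hy => simp only [TensorProduct.add_tmul, map_add, hx, hy]
      | tmul u m => simp [braid₁₂_tmul]
  have := key ((TensorProduct.assoc k M U W).symm x)
  rwa [LinearEquiv.apply_symm_apply] at this

variable {Q : QuasiHopfAlgebra k H}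

/-- The braiding intertwines the diagonal actions of `H`. -/
theorem IsYetterDrinfeld.extAct_braid {X : ActCoact k H M} (hX : X.IsYetterDrinfeld Q)
    (ρ : H →ₐ[k] Module.End k U) (h : H) (x : M ⊗[k] U) :
    extAct ρ X.act (Q.Δ h) (X.braid ρ x) = X.braid ρ (extAct X.act ρ (Q.Δ h) x) := by
  induction x using TensorProduct.induction_on with
  | zero => simp
  | add x y hx hy => simp only [map_add, hx, hy]
  | tmul m u =>
    have e := hX.act_coact h m
    have hT := intertwines_orbit ρ u
    -- Reduction along the orbit map of u to the vector m ⊗ 1, where the claim is the third axiom.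
    have e1 : m ⊗ₜ[k] u = (ρ.toLinearMap.flip u).lTensor M (m ⊗ₜ 1) := by simp
    rw [e1, ← X.braid_nat hT, ← hT.lTensor X.act, ← X.braid_nat hT, ← hT.rTensor X.act,
      braid_lmul_one, e]
    rfl

theorem IsYetterDrinfeld.extAct_braid₁₂ {A : Type*} [Ring A] [Algebra k A] {X : ActCoact k H M}
    (hX : X.IsYetterDrinfeld Q) (ρ : H →ₐ[k] Module.End k U) (σ : A →ₐ[k] Module.End k W) (h : H)
    (a : A) (x : M ⊗[k] (U ⊗[k] W)) :
    extAct ρ (extAct X.act σ) (TensorProduct.assoc k H H A (Q.Δ h ⊗ₜ a)) (X.braid₁₂ ρ W x) =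
      X.braid₁₂ ρ W (extAct X.act (extAct ρ σ) (TensorProduct.assoc k H H A (Q.Δ h ⊗ₜ a)) x) := by
  obtain ⟨y, rfl⟩ := (TensorProduct.assoc k M U W).surjective x
  rw [← assoc_extAct, ← assoc_braid, ← assoc_braid, ← assoc_extAct]
  congr 1
  induction y using TensorProduct.induction_on with
  | zero => simp
  | add x y hx hy => simp only [map_add, hx, hy]
  | tmul s w => simp only [LinearMap.rTensor_tmul, extAct_tmul, hX.extAct_braid]

theorem IsYetterDrinfeld.Δid_braid₁₂ {X : ActCoact k H M} (hX : X.IsYetterDrinfeld Q)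
    (ρ : H →ₐ[k] Module.End k U) (σ : H →ₐ[k] Module.End k W) (t : H ⊗[k] H)
    (x : M ⊗[k] (U ⊗[k] W)) :
    extAct ρ (extAct X.act σ) (Δid Q.Δ t) (X.braid₁₂ ρ W x) =
      X.braid₁₂ ρ W (extAct X.act (extAct ρ σ) (Δid Q.Δ t) x) := by
  induction t using TensorProduct.induction_on with
  | zero => simp
  | add x y hx hy => simp only [map_add, LinearMap.add_apply, hx, hy]
  | tmul h a => exact hX.extAct_braid₁₂ ρ σ h a x

theorem IsYetterDrinfeld.idΔ_braid₂₃ {X : ActCoact k H M} (hX : X.IsYetterDrinfeld Q)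
    (ρ : H →ₐ[k] Module.End k U) (σ : H →ₐ[k] Module.End k W) (t : H ⊗[k] H)
    (x : W ⊗[k] (M ⊗[k] U)) :
    extAct σ (extAct ρ X.act) (idΔ Q.Δ t) ((X.braid ρ).lTensor W x) =
      (X.braid ρ).lTensor W (extAct σ (extAct X.act ρ) (idΔ Q.Δ t) x) := by
  induction t using TensorProduct.induction_on with
  | zero => simp
  | add x y hx hy => simp only [map_add, LinearMap.add_apply, hx, hy]
  | tmul h a =>
    induction x using TensorProduct.induction_on with
    | zero => simp
    | add x y hx hy => simp only [map_add, hx, hy]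
    | tmul w s => simp [hX.extAct_braid]

/-- The braiding with a tensor product of two modules. -/
theorem IsYetterDrinfeld.hexagon {X : ActCoact k H M} (hX : X.IsYetterDrinfeld Q)
    (ρ : H →ₐ[k] Module.End k U) (σ : H →ₐ[k] Module.End k W) (x : M ⊗[k] (U ⊗[k] W)) :
    (X.braid σ).lTensor U (extAct ρ (extAct X.act σ) Q.Φe (X.braid₁₂ ρ W x)) =
      extAct ρ (extAct σ X.act) Q.Φe (TensorProduct.assoc k U W M
        (X.braid (Q.tensorAct ρ σ) (extAct X.act (extAct ρ σ) Q.Φe x))) := by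
  induction x using TensorProduct.induction_on with
  | zero => simp
  | add x y hx hy => simp only [map_add, hx, hy]
  | tmul m s =>
    induction s using TensorProduct.induction_on with
    | zero => simp
    | add x y hx hy => simp only [TensorProduct.tmul_add, map_add, hx, hy]
    | tmul u w =>
      -- With T and R the orbit maps of u and w, naturality reduces the hexagon to m ⊗ 1 ⊗ 1, where
      -- it is the first axiom.
      set T := ρ.toLinearMap.flip u
      set R := σ.toLinearMap.flip w
      have hT := intertwines_orbit ρ u
      have hR := intertwines_orbit σ w
      have e1 : m ⊗ₜ[k] (u ⊗ₜ[k] w) =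
          (TensorProduct.map T R).lTensor M (m ⊗ₜ ((1 : H) ⊗ₜ[k] (1 : H))) := by simp [T, R]
      have hTR : Intertwines (Q.tensorAct (Algebra.lmul k H) (Algebra.lmul k H)) (Q.tensorAct ρ σ)
        (TensorProduct.map T R) := fun h x => (hT.map hR) (Q.Δ h) x
      have e2 (y : H ⊗[k] (M ⊗[k] H)) :
          (X.braid σ).lTensor U (TensorProduct.map T (R.lTensor M) y) =
          TensorProduct.map T (R.rTensor M) ((X.braid (Algebra.lmul k H)).lTensor H y) := by
        induction y using TensorProduct.induction_on with
        | zero => simp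
        | add x y hx hy => simp only [map_add, hx, hy]
        | tmul a t => simp [X.braid_nat hR, T, R]
      have e3 (y : (H ⊗[k] H) ⊗[k] M) : TensorProduct.assoc k U W M
          ((TensorProduct.map T R).rTensor M y) =
          TensorProduct.map T (R.rTensor M) (TensorProduct.assoc k H H M y) := by
        induction y using TensorProduct.induction_on with
        | zero => simp
        | add x y hx hy => simp only [map_add, hx, hy]
        | tmul s m =>
          induction s using TensorProduct.induction_on with
          | zero => simp
          | add x y hx hy => simp only [TensorProduct.add_tmul, map_add, hx, hy]
          | tmul a b => simp
      have h := hX.coact_coact m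
      rw [e1, ← X.braid₁₂_nat hT, ← hT.map (hR.lTensor X.act), e2,
        ← (hT.map hR).lTensor X.act, ← X.braid_nat hTR, e3, ← hT.map (hR.rTensor X.act), ← h,
        braid₁₂_tmul, braid_lmul_one]

/-- Converse of the preceding reductions: the axioms need only be checked as a hexagon, a counit
condition and H-linearity for the braiding with H. This is how the tensor product is treated. -/
theorem isYetterDrinfeld_of_hexagon
    (h₁ : ∀ m : M, (X.braid (Algebra.lmul k H)).lTensor H
      (extAct (Algebra.lmul k H) (extAct X.act (Algebra.lmul k H)) Q.Φe
        (X.braid₁₂ (Algebra.lmul k H) H (m ⊗ₜ (1 ⊗ₜ 1)))) =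
      extAct (Algebra.lmul k H) (extAct (Algebra.lmul k H) X.act) Q.Φe
        (TensorProduct.assoc k H H M
        (X.braid (Q.tensorAct (Algebra.lmul k H) (Algebra.lmul k H))
          (extAct X.act (extAct (Algebra.lmul k H) (Algebra.lmul k H)) Q.Φe (m ⊗ₜ (1 ⊗ₜ 1))))))
    (h₂ : ∀ m : M, TensorProduct.lid k M (Q.ε.toLinearMap.rTensor M (X.coact m)) = m)
    (h₃ : ∀ (h : H) (m : M), extAct (Algebra.lmul k H) X.act (Q.Δ h)
      (X.braid (Algebra.lmul k H) (m ⊗ₜ 1)) =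
      X.braid (Algebra.lmul k H) (extAct X.act (Algebra.lmul k H) (Q.Δ h) (m ⊗ₜ 1))) :
    X.IsYetterDrinfeld Q where
  coact_coact m := by rw [← h₁, braid₁₂_tmul, braid_lmul_one]
  counit_coact := h₂
  act_coact h m := by rw [← braid_lmul_one, h₃]; rfl

end ActCoact

end QuasiHopf

/-! ### Associativity constraints and braidings on four factors. -/

namespace QuasiHopf

variable {k H : Type*} [Field k] [Ring H] [Algebra k H]

section FourFactors

variable {U V W Z : Type*} [AddCommGroup U] [Module k U] [AddCommGroup V] [Module k V]
  [AddCommGroup W] [Module k W] [AddCommGroup Z] [Module k Z]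

theorem act_act {A : Type*} [Ring A] [Algebra k A] (ρ : A →ₐ[k] Module.End k U) (a b : A) (u : U) :
    ρ a (ρ b u) = ρ (a * b) u := by simp

theorem act_one {A : Type*} [Ring A] [Algebra k A] (ρ : A →ₐ[k] Module.End k U) (u : U) :
    ρ 1 u = u := by simp

/-- The action of `(H ⊗ H) ⊗ (H ⊗ H)` on a tensor product of four modules. -/
def act₄ (ρ : H →ₐ[k] Module.End k U) (σ : H →ₐ[k] Module.End k V) (τ : H →ₐ[k] Module.End k W)
    (υ : H →ₐ[k] Module.End k Z) :
    (H ⊗[k] H) ⊗[k] (H ⊗[k] H) →ₐ[k] Module.End k (U ⊗[k] (V ⊗[k] (W ⊗[k] Z))) :=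
  (extAct ρ (extAct σ (extAct τ υ))).comp (Algebra.TensorProduct.assoc k k k H H (H ⊗[k] H)).toAlgHom

variable (ρ : H →ₐ[k] Module.End k U) (σ : H →ₐ[k] Module.End k V) (τ : H →ₐ[k] Module.End k W)
  (υ : H →ₐ[k] Module.End k Z)

@[simp] theorem act₄_tmul (a b c d : H) (u : U) (v : V) (w : W) (z : Z) :
    act₄ ρ σ τ υ ((a ⊗ₜ b) ⊗ₜ (c ⊗ₜ d)) (u ⊗ₜ (v ⊗ₜ (w ⊗ₜ z))) =
      ρ a u ⊗ₜ (σ b v ⊗ₜ (τ c w ⊗ₜ υ d z)) := rfl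

theorem act₄_apply (z : (H ⊗[k] H) ⊗[k] (H ⊗[k] H)) (x : U ⊗[k] (V ⊗[k] (W ⊗[k] Z))) :
    act₄ ρ σ τ υ z x =
      extAct ρ (extAct σ (extAct τ υ)) (TensorProduct.assoc k H H (H ⊗[k] H) z) x := rfl

variable (k U V W Z) in
/-- `(u ⊗ (v ⊗ w)) ⊗ z ↦ u ⊗ (v ⊗ (w ⊗ z))`. -/
def assoc₃₁ : (U ⊗[k] (V ⊗[k] W)) ⊗[k] Z →ₗ[k] U ⊗[k] (V ⊗[k] (W ⊗[k] Z)) :=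
  (TensorProduct.assoc k V W Z).toLinearMap.lTensor U ∘ₗ
    (TensorProduct.assoc k U (V ⊗[k] W) Z).toLinearMap

@[simp] theorem assoc₃₁_tmul (u : U) (v : V) (w : W) (z : Z) :
    assoc₃₁ k U V W Z ((u ⊗ₜ (v ⊗ₜ w)) ⊗ₜ z) = u ⊗ₜ (v ⊗ₜ (w ⊗ₜ z)) := rfl

theorem assoc₃₁_assoc_tmul (s : U ⊗[k] V) (w : W) (z : Z) :
    assoc₃₁ k U V W Z (TensorProduct.assoc k U V W (s ⊗ₜ w) ⊗ₜ z) =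
      TensorProduct.assoc k U V (W ⊗[k] Z) (s ⊗ₜ (w ⊗ₜ z)) := by
  induction s using TensorProduct.induction_on with
  | zero => simp
  | tmul u v => simp
  | add x y hx hy => simp only [TensorProduct.add_tmul, map_add, hx, hy]

/-- This lemma and the next four translate the constraints on four factors: each way of letting Φ
act on three of the factors, possibly after grouping two of them, is the action of the corresponding
image of Φ in the fourth tensor power. The pentagon can then be used as an identity of elements. -/
theorem act₄_tensorOne (t : H ⊗[k] (H ⊗[k] H)) (x : (U ⊗[k] (V ⊗[k] W)) ⊗[k] Z) :
    act₄ ρ σ τ υ (tensorOne k H t) (assoc₃₁ k U V W Z x) =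
      assoc₃₁ k U V W Z ((extAct ρ (extAct σ τ) t).rTensor Z x) := by
  induction x using TensorProduct.induction_on with
  | zero => simp
  | add x y hx hy => simp only [map_add, hx, hy]
  | tmul x z =>
    induction t using induction3 with
    | h0 => simp
    | h2 x y hx hy =>
      rw [map_add, map_add, LinearMap.add_apply, hx, hy]
      simp only [LinearMap.rTensor_tmul, map_add, LinearMap.add_apply, TensorProduct.add_tmul]
    | h1 a b c =>
      induction x using TensorProduct.induction_on with
      | zero => simp
      | add x y hx hy => simp only [TensorProduct.add_tmul, map_add, hx, hy]
      | tmul u s =>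
        induction s using TensorProduct.induction_on with
        | zero => simp
        | add x y hx hy =>
          simp only [TensorProduct.tmul_add, TensorProduct.add_tmul, map_add, hx, hy]
        | tmul v w => simp

theorem act₄_oneTensor (t : H ⊗[k] (H ⊗[k] H)) (x : U ⊗[k] (V ⊗[k] (W ⊗[k] Z))) :
    act₄ ρ σ τ υ (oneTensor k H t) x = (extAct σ (extAct τ υ) t).lTensor U x := by
  induction t using TensorProduct.induction_on with
  | zero => simp
  | add x y hx hy => simp only [map_add, LinearMap.add_apply, LinearMap.lTensor_add, hx, hy]
  | tmul a t =>
    rw [oneTensor_tmul, act₄_apply, TensorProduct.assoc_tmul, extAct_tmul_eq]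
    simp only [map_one, LinearMap.lTensor]
    rfl

variable (Q : QuasiHopfAlgebra k H)

theorem act₄_ididΔ (t : H ⊗[k] (H ⊗[k] H)) (x : U ⊗[k] (V ⊗[k] (W ⊗[k] Z))) :
    act₄ ρ σ τ υ (ididΔ Q.Δ t) x = extAct ρ (extAct σ (Q.tensorAct τ υ)) t x := by
  induction t using induction3 with
  | h0 => simp
  | h2 x y hx hy => simp only [map_add, LinearMap.add_apply, hx, hy]
  | h1 a b c => rfl

theorem act₄_Δidid (t : H ⊗[k] (H ⊗[k] H)) (x : (U ⊗[k] V) ⊗[k] (W ⊗[k] Z)) :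
    act₄ ρ σ τ υ (Δidid Q.Δ t) (TensorProduct.assoc k U V (W ⊗[k] Z) x) =
      TensorProduct.assoc k U V (W ⊗[k] Z)
        (extAct (Q.tensorAct ρ σ) (extAct τ υ) t x) := by
  have : extAct (Q.tensorAct ρ σ) (extAct τ υ) t = extAct (extAct ρ σ) (extAct τ υ) (Δidid Q.Δ t) := by
    induction t using TensorProduct.induction_on with
    | zero => simp
    | add x y hx hy => simp only [map_add, hx, hy]
    | tmul a t => rfl
  rw [this, assoc_extAct, act₄_apply]

theorem act₄_idΔid (t : H ⊗[k] (H ⊗[k] H)) (x : U ⊗[k] ((V ⊗[k] W) ⊗[k] Z)) :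
    act₄ ρ σ τ υ (idΔid Q.Δ t) ((TensorProduct.assoc k V W Z).toLinearMap.lTensor U x) =
      (TensorProduct.assoc k V W Z).toLinearMap.lTensor U
        (extAct ρ (extAct (Q.tensorAct σ τ) υ) t x) := by
  induction t using induction3 with
  | h0 => simp
  | h2 x y hx hy => simp only [map_add, LinearMap.add_apply, hx, hy]
  | h1 a b c =>
    have key (s : H ⊗[k] H) : act₄ ρ σ τ υ (((a ⊗ₜ 1) ⊗ₜ (1 ⊗ₜ c)) * insM k H s)
        ((TensorProduct.assoc k V W Z).toLinearMap.lTensor U x) =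
        (TensorProduct.assoc k V W Z).toLinearMap.lTensor U
          (extAct ρ (extAct (extAct σ τ) υ) (a ⊗ₜ (s ⊗ₜ c)) x) := by
      induction s using TensorProduct.induction_on with
      | zero => simp
      | add x y hx hy => simp only [map_add, mul_add, TensorProduct.add_tmul, TensorProduct.tmul_add, LinearMap.add_apply, hx, hy]
      | tmul e f =>
        simp only [insM_tmul, Algebra.TensorProduct.tmul_mul_tmul, one_mul, mul_one]
        induction x using TensorProduct.induction_on with
        | zero => simp
        | add x y hx hy => simp only [map_add, hx, hy]
        | tmul u s =>
          induction s using TensorProduct.induction_on with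
          | zero => simp
          | add x y hx hy => simp only [TensorProduct.tmul_add, map_add, hx, hy]
          | tmul s z =>
            induction s using TensorProduct.induction_on with
            | zero => simp
            | add x y hx hy =>
              simp only [TensorProduct.tmul_add, TensorProduct.add_tmul, map_add, hx, hy]
            | tmul v w => simp
    rw [idΔid_tmul, key]
    rfl

theorem act₄_idΔid_tmul (a b c : H) (u : U) (y : V ⊗[k] (W ⊗[k] Z)) :
    act₄ ρ σ τ υ (idΔid Q.Δ (a ⊗ₜ (b ⊗ₜ c))) (u ⊗ₜ y) =
      ρ a u ⊗ₜ extAct σ (extAct τ υ) (TensorProduct.assoc k H H H (Q.Δ b ⊗ₜ c)) y := by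
  rw [idΔid_tmul]
  induction Q.Δ b using TensorProduct.induction_on with
  | zero => simp
  | add x y hx hy =>
    simp only [map_add, mul_add, TensorProduct.add_tmul, TensorProduct.tmul_add,
      LinearMap.add_apply, hx, hy]
  | tmul e f =>
    simp only [insM_tmul, Algebra.TensorProduct.tmul_mul_tmul, one_mul, mul_one]
    rfl

end FourFactors

namespace ActCoact

variable {M N U V W Z : Type*} [AddCommGroup M] [Module k M] [AddCommGroup N] [Module k N]
  [AddCommGroup U] [Module k U] [AddCommGroup V] [Module k V] [AddCommGroup W] [Module k W]
  [AddCommGroup Z] [Module k Z]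
  (X : ActCoact k H M) (Y : ActCoact k H N) {Q : QuasiHopfAlgebra k H}

theorem assoc₃₁_braid₁₂ (ρ : H →ₐ[k] Module.End k U) (x : M ⊗[k] (U ⊗[k] W)) (z : Z) :
    assoc₃₁ k U M W Z (X.braid₁₂ ρ W x ⊗ₜ z) =
      X.braid₁₂ ρ (W ⊗[k] Z) (assoc₃₁ k M U W Z (x ⊗ₜ z)) := by
  induction x using TensorProduct.induction_on with
  | zero => simp
  | add x y hx hy => simp only [TensorProduct.add_tmul, map_add, hx, hy]
  | tmul m s =>
    induction s using TensorProduct.induction_on with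
    | zero => simp
    | add x y hx hy => simp only [TensorProduct.tmul_add, TensorProduct.add_tmul, map_add, hx, hy]
    | tmul u w => rw [braid₁₂_tmul, assoc₃₁_assoc_tmul, assoc₃₁_tmul, braid₁₂_tmul]

theorem assoc₃₁_braid₂₃ (ρ : H →ₐ[k] Module.End k U) (x : W ⊗[k] (M ⊗[k] U)) (z : Z) :
    assoc₃₁ k W U M Z ((X.braid ρ).lTensor W x ⊗ₜ z) =
      (X.braid₁₂ ρ Z).lTensor W (assoc₃₁ k W M U Z (x ⊗ₜ z)) := by
  induction x using TensorProduct.induction_on with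
  | zero => simp
  | add x y hx hy => simp only [TensorProduct.add_tmul, map_add, hx, hy]
  | tmul w s =>
    rw [LinearMap.lTensor_tmul]
    simp only [assoc₃₁, LinearMap.comp_apply, LinearEquiv.coe_coe, TensorProduct.assoc_tmul,
      LinearMap.lTensor_tmul, ← assoc_braid, LinearMap.rTensor_tmul]

/-- A braiding of two neighbouring factors commutes with elements whose legs there form a coproduct.
The next two lemmas are the same fact in the other positions. -/
theorem IsYetterDrinfeld.Δidid_braid₁₂ {X : ActCoact k H M} (hX : X.IsYetterDrinfeld Q)
    (ρ : H →ₐ[k] Module.End k U) (σ : H →ₐ[k] Module.End k V) (τ : H →ₐ[k] Module.End k W)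
    (t : H ⊗[k] (H ⊗[k] H)) (x : M ⊗[k] (U ⊗[k] (V ⊗[k] W))) :
    act₄ ρ X.act σ τ (Δidid Q.Δ t) (X.braid₁₂ ρ (V ⊗[k] W) x) =
      X.braid₁₂ ρ (V ⊗[k] W) (act₄ X.act ρ σ τ (Δidid Q.Δ t) x) := by
  induction t using TensorProduct.induction_on with
  | zero => simp
  | add x y hx hy => simp only [map_add, LinearMap.add_apply, hx, hy]
  | tmul h a => exact hX.extAct_braid₁₂ ρ (extAct σ τ) h a x

theorem IsYetterDrinfeld.idΔid_braid₂₃ {X : ActCoact k H M} (hX : X.IsYetterDrinfeld Q)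
    (ρ : H →ₐ[k] Module.End k U) (σ : H →ₐ[k] Module.End k V) (τ : H →ₐ[k] Module.End k W)
    (t : H ⊗[k] (H ⊗[k] H)) (x : V ⊗[k] (M ⊗[k] (U ⊗[k] W))) :
    act₄ σ ρ X.act τ (idΔid Q.Δ t) ((X.braid₁₂ ρ W).lTensor V x) =
      (X.braid₁₂ ρ W).lTensor V (act₄ σ X.act ρ τ (idΔid Q.Δ t) x) := by
  induction t using induction3 with
  | h0 => simp
  | h2 x y hx hy => simp only [map_add, LinearMap.add_apply, hx, hy]
  | h1 a b c =>
    induction x using TensorProduct.induction_on with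
    | zero => simp
    | add x y hx hy => simp only [map_add, hx, hy]
    | tmul v y =>
      rw [LinearMap.lTensor_tmul, act₄_idΔid_tmul, hX.extAct_braid₁₂, act₄_idΔid_tmul,
        LinearMap.lTensor_tmul]

theorem IsYetterDrinfeld.ididΔ_braid₃₄ {X : ActCoact k H M} (hX : X.IsYetterDrinfeld Q)
    (ρ : H →ₐ[k] Module.End k U) (σ : H →ₐ[k] Module.End k V) (τ : H →ₐ[k] Module.End k W)
    (t : H ⊗[k] (H ⊗[k] H)) (x : V ⊗[k] (W ⊗[k] (M ⊗[k] U))) :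
    act₄ σ τ ρ X.act (ididΔ Q.Δ t) (((X.braid ρ).lTensor W).lTensor V x) =
      ((X.braid ρ).lTensor W).lTensor V (act₄ σ τ X.act ρ (ididΔ Q.Δ t) x) := by
  rw [act₄_ididΔ, act₄_ididΔ]
  have hT : Intertwines (Q.tensorAct X.act ρ) (Q.tensorAct ρ X.act) (X.braid ρ) :=
    fun h y => (hX.extAct_braid ρ h y).symm
  exact ((hT.lTensor τ).lTensor σ t x).symm

theorem braid₁₂_braid₃₄ (ρ : H →ₐ[k] Module.End k U) (σ : H →ₐ[k] Module.End k V)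
    (x : M ⊗[k] (U ⊗[k] (N ⊗[k] V))) :
    ((Y.braid σ).lTensor M).lTensor U (X.braid₁₂ ρ (N ⊗[k] V) x) =
      X.braid₁₂ ρ (V ⊗[k] N) (((Y.braid σ).lTensor U).lTensor M x) :=
  X.braid₁₂_nat (Intertwines.id ρ) (Y.braid σ) x

/-- The braiding of `M ⊗ N` with `U` in terms of the braidings of `M` and of `N` with `U`. -/
theorem tensor_braid (ρ : H →ₐ[k] Module.End k U) (x : (M ⊗[k] N) ⊗[k] U) :
    (X.tensor Q Y).braid ρ x =
      extAct ρ (extAct X.act Y.act) Q.Φe (X.braid₁₂ ρ N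
        (extAct X.act (extAct ρ Y.act) Q.Φi ((Y.braid ρ).lTensor M
          (extAct X.act (extAct Y.act ρ) Q.Φe (TensorProduct.assoc k M N U x))))) := by
  induction x using TensorProduct.induction_on with
  | zero => simp
  | add x y hx hy => simp only [map_add, hx, hy]
  | tmul p u =>
    have hT := intertwines_orbit ρ u
    set T := ρ.toLinearMap.flip u
    have e0 : TensorProduct.assoc k M N U (p ⊗ₜ u) =
        (T.lTensor N).lTensor M (TensorProduct.assoc k M N H (p ⊗ₜ 1)) := by
      induction p using TensorProduct.induction_on with
      | zero => simp
      | add x y hx hy => simp only [TensorProduct.add_tmul, map_add, hx, hy]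
      | tmul m n => simp [T]
    have e1 (y : M ⊗[k] (N ⊗[k] H)) : (Y.braid ρ).lTensor M ((T.lTensor N).lTensor M y) =
        (T.rTensor N).lTensor M ((Y.braid (Algebra.lmul k H)).lTensor M y) := by
      rw [← LinearMap.comp_apply, ← LinearMap.comp_apply, ← LinearMap.lTensor_comp,
        ← LinearMap.lTensor_comp]
      exact congrArg (fun F => LinearMap.lTensor M F y)
        (LinearMap.ext fun y => (Y.braid_nat hT y).symm)
    have e2 := X.braid₁₂_nat hT (LinearMap.id : N →ₗ[k] N)
    rw [LinearMap.lTensor_id] at e2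
    rw [e0, ← (hT.lTensor Y.act).lTensor X.act, e1, ← (hT.rTensor Y.act).lTensor X.act]
    rw [LinearMap.rTensor, ← e2, ← hT.map (Intertwines.id (extAct X.act Y.act)), braid_tmul]
    rfl

end ActCoact

end QuasiHopf

/-! ### The hexagon for a tensor product. -/

namespace QuasiHopf

variable {k H : Type*} [Field k] [Ring H] [Algebra k H]

namespace ActCoact

variable {M N U V W : Type*} [AddCommGroup M] [Module k M] [AddCommGroup N] [Module k N]
  [AddCommGroup U] [Module k U] [AddCommGroup V] [Module k V] [AddCommGroup W] [Module k W]
  {X : ActCoact k H M} {Y : ActCoact k H N} {Q : QuasiHopfAlgebra k H}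

/-- Inserting a fourth factor into `tensor_braid`. -/
theorem tensor_braid₁₂ (ρ : H →ₐ[k] Module.End k V) (σ : H →ₐ[k] Module.End k W)
    (x : (M ⊗[k] N) ⊗[k] (V ⊗[k] W)) :
    (TensorProduct.assoc k M N W).toLinearMap.lTensor V ((X.tensor Q Y).braid₁₂ ρ W x) =
      act₄ ρ X.act Y.act σ (tensorOne k H Q.Φe) (X.braid₁₂ ρ (N ⊗[k] W)
        (act₄ X.act ρ Y.act σ (tensorOne k H Q.Φi) ((Y.braid₁₂ ρ W).lTensor M
          (act₄ X.act Y.act ρ σ (tensorOne k H Q.Φe)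
            (TensorProduct.assoc k M N (V ⊗[k] W) x))))) := by
  have e1 (u : V ⊗[k] (M ⊗[k] N)) (w : W) : (TensorProduct.assoc k M N W).toLinearMap.lTensor V
      (TensorProduct.assoc k V (M ⊗[k] N) W (u ⊗ₜ w)) = assoc₃₁ k V M N W (u ⊗ₜ w) := rfl
  have e2 (p : (M ⊗[k] N)) (v : V) (w : W) : TensorProduct.assoc k M N (V ⊗[k] W) (p ⊗ₜ (v ⊗ₜ w)) =
      assoc₃₁ k M N V W (TensorProduct.assoc k M N V (p ⊗ₜ v) ⊗ₜ w) := by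
    rw [assoc₃₁_assoc_tmul]
  induction x using TensorProduct.induction_on with
  | zero => simp
  | add x y hx hy => simp only [map_add, hx, hy]
  | tmul p s =>
    induction s using TensorProduct.induction_on with
    | zero => simp
    | add x y hx hy => simp only [TensorProduct.tmul_add, map_add, hx, hy]
    | tmul v w =>
      rw [braid₁₂_tmul, e1, e2, act₄_tensorOne, LinearMap.rTensor_tmul, ← assoc₃₁_braid₂₃,
        act₄_tensorOne, LinearMap.rTensor_tmul, ← assoc₃₁_braid₁₂, act₄_tensorOne,
        LinearMap.rTensor_tmul, tensor_braid]

/-- Inserting a zeroth factor into `tensor_braid`. -/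
theorem tensor_braid₂₃ (ρ : H →ₐ[k] Module.End k V) (σ : H →ₐ[k] Module.End k W)
    (x : V ⊗[k] ((M ⊗[k] N) ⊗[k] W)) :
    ((X.tensor Q Y).braid σ).lTensor V x =
      act₄ ρ σ X.act Y.act (oneTensor k H Q.Φe) ((X.braid₁₂ σ N).lTensor V
        (act₄ ρ X.act σ Y.act (oneTensor k H Q.Φi) (((Y.braid σ).lTensor M).lTensor V
          (act₄ ρ X.act Y.act σ (oneTensor k H Q.Φe)
            ((TensorProduct.assoc k M N W).toLinearMap.lTensor V x))))) := by
  simp only [act₄_oneTensor]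
  induction x using TensorProduct.induction_on with
  | zero => simp
  | add x y hx hy => simp only [map_add, hx, hy]
  | tmul v x => simp only [LinearMap.lTensor_tmul, tensor_braid, LinearEquiv.coe_coe]

/-- The braiding of `M` with `V ⊗ W` in terms of the braidings with `V` and with `W`. -/
theorem IsYetterDrinfeld.braid_tensor (hX : X.IsYetterDrinfeld Q)
    (ρ : H →ₐ[k] Module.End k V) (σ : H →ₐ[k] Module.End k W) (x : M ⊗[k] (V ⊗[k] W)) :
    TensorProduct.assoc k V W M (X.braid (Q.tensorAct ρ σ) x) =
      extAct ρ (extAct σ X.act) Q.Φi ((X.braid σ).lTensor V (extAct ρ (extAct X.act σ) Q.Φe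
        (X.braid₁₂ ρ W (extAct X.act (extAct ρ σ) Q.Φi x)))) := by
  rw [hX.hexagon, act_act, act_act, Q.Φe_mul_Φi, Q.Φi_mul_Φe, act_one, act_one]

theorem IsYetterDrinfeld.braid_tensor₂ (hY : Y.IsYetterDrinfeld Q) (τ : H →ₐ[k] Module.End k U)
    (ρ : H →ₐ[k] Module.End k V) (σ : H →ₐ[k] Module.End k W) (x : U ⊗[k] (N ⊗[k] (V ⊗[k] W))) :
    (TensorProduct.assoc k V W N).toLinearMap.lTensor U ((Y.braid (Q.tensorAct ρ σ)).lTensor U x) =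
      act₄ τ ρ σ Y.act (oneTensor k H Q.Φi) (((Y.braid σ).lTensor V).lTensor U
        (act₄ τ ρ Y.act σ (oneTensor k H Q.Φe)
          ((Y.braid₁₂ ρ W).lTensor U (act₄ τ Y.act ρ σ (oneTensor k H Q.Φi) x)))) := by
  simp only [act₄_oneTensor]
  induction x using TensorProduct.induction_on with
  | zero => simp
  | add x y hx hy => simp only [map_add, hx, hy]
  | tmul v x => simp only [LinearMap.lTensor_tmul, hY.braid_tensor, LinearEquiv.coe_coe]

theorem IsYetterDrinfeld.braid₁₂_tensor (hX : X.IsYetterDrinfeld Q) (τ : H →ₐ[k] Module.End k U)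
    (ρ : H →ₐ[k] Module.End k V) (σ : H →ₐ[k] Module.End k W) (x : M ⊗[k] ((V ⊗[k] W) ⊗[k] U)) :
    TensorProduct.assoc k V W (M ⊗[k] U) (X.braid₁₂ (Q.tensorAct ρ σ) U x) =
      act₄ ρ σ X.act τ (tensorOne k H Q.Φi) ((X.braid₁₂ σ U).lTensor V
        (act₄ ρ X.act σ τ (tensorOne k H Q.Φe)
          (X.braid₁₂ ρ (W ⊗[k] U) (act₄ X.act ρ σ τ (tensorOne k H Q.Φi)
            ((TensorProduct.assoc k V W U).toLinearMap.lTensor M x))))) := by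
  induction x using TensorProduct.induction_on with
  | zero => simp
  | add x y hx hy => simp only [map_add, hx, hy]
  | tmul m s =>
    induction s using TensorProduct.induction_on with
    | zero => simp
    | add x y hx hy => simp only [TensorProduct.tmul_add, map_add, hx, hy]
    | tmul s u =>
      have e1 : (TensorProduct.assoc k V W U).toLinearMap.lTensor M (m ⊗ₜ (s ⊗ₜ u)) =
          assoc₃₁ k M V W U ((m ⊗ₜ s) ⊗ₜ u) := rfl
      have e2 (t : (V ⊗[k] W) ⊗[k] M) :
          TensorProduct.assoc k V W (M ⊗[k] U) (TensorProduct.assoc k (V ⊗[k] W) M U (t ⊗ₜ u)) =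
          assoc₃₁ k V W M U (TensorProduct.assoc k V W M t ⊗ₜ u) := by
        induction t using TensorProduct.induction_on with
        | zero => simp
        | add x y hx hy => simp only [TensorProduct.add_tmul, map_add, hx, hy]
        | tmul s m => rw [assoc₃₁_assoc_tmul]; rfl
      rw [e1, braid₁₂_tmul, e2, hX.braid_tensor, act₄_tensorOne, LinearMap.rTensor_tmul,
        ← assoc₃₁_braid₁₂, act₄_tensorOne, LinearMap.rTensor_tmul, ← assoc₃₁_braid₂₃,
        act₄_tensorOne, LinearMap.rTensor_tmul]

/-- Each side expands into four elementary braidings, of M and N with V and W, separated by images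
of Φ and Φ⁻¹ acting on four factors. The pentagon shortens the words between the braidings, images
of coproducts slide through them, and two commuting braidings are exchanged until both sides agree.
-/
theorem IsYetterDrinfeld.tensor_hexagon (hX : X.IsYetterDrinfeld Q) (hY : Y.IsYetterDrinfeld Q)
    (ρ : H →ₐ[k] Module.End k V) (σ : H →ₐ[k] Module.End k W)
    (x : (M ⊗[k] N) ⊗[k] (V ⊗[k] W)) :
    ((X.tensor Q Y).braid σ).lTensor V
      (extAct ρ (extAct (X.tensor Q Y).act σ) Q.Φe ((X.tensor Q Y).braid₁₂ ρ W x)) =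
      extAct ρ (extAct σ (X.tensor Q Y).act) Q.Φe (TensorProduct.assoc k V W (M ⊗[k] N)
        ((X.tensor Q Y).braid (Q.tensorAct ρ σ)
          (extAct (X.tensor Q Y).act (extAct ρ σ) Q.Φe x))) := by
  change ((X.tensor Q Y).braid σ).lTensor V
      (extAct ρ (extAct (Q.tensorAct X.act Y.act) σ) Q.Φe ((X.tensor Q Y).braid₁₂ ρ W x)) =
      extAct ρ (extAct σ (Q.tensorAct X.act Y.act)) Q.Φe (TensorProduct.assoc k V W (M ⊗[k] N)
        ((X.tensor Q Y).braid (Q.tensorAct ρ σ)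
          (extAct (Q.tensorAct X.act Y.act) (extAct ρ σ) Q.Φe x)))
  rw [tensor_braid₂₃ ρ σ, ← act₄_idΔid, tensor_braid₁₂ ρ σ, ← act₄_ididΔ, tensor_braid,
    ← act₄_Δidid, hX.braid₁₂_tensor Y.act, ← act₄_ididΔ, ← act₄_idΔid,
    hY.braid_tensor₂ X.act, ← act₄_Δidid]
  set y := TensorProduct.assoc k M N (V ⊗[k] W) x
  -- The identities p1 to p6 are forms of the pentagon. They replace the words between consecutive
  -- braidings by words whose factors can slide past an adjacent braiding.
  have p1 : oneTensor k H Q.Φe * (idΔid Q.Δ Q.Φe * tensorOne k H Q.Φe) =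
      ididΔ Q.Δ Q.Φe * Δidid Q.Δ Q.Φe := by rw [← mul_assoc]; exact Q.pentagon
  have p2 : ididΔ Q.Δ Q.Φe * (Δidid Q.Δ Q.Φe * tensorOne k H Q.Φi) =
      oneTensor k H Q.Φe * idΔid Q.Δ Q.Φe := by
    rw [← mul_assoc, Q.pentagon_ididΔ_Δidid_one]
  have p3 : tensorOne k H Q.Φi * (idΔid Q.Δ Q.Φi * oneTensor k H Q.Φi) =
      Δidid Q.Δ Q.Φi * ididΔ Q.Δ Q.Φi := by
    rw [← mul_assoc, Q.pentagon_one_idΔid_inv, mul_assoc, ← map_mul, Q.Φe_mul_Φi, map_one, mul_one]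
  have p4 : oneTensor k H Q.Φi * (ididΔ Q.Δ Q.Φe * Δidid Q.Δ Q.Φe) =
      idΔid Q.Δ Q.Φe * tensorOne k H Q.Φe := by
    rw [← mul_assoc, Q.pentagon_one_ididΔ_Δidid]
  have p5 : idΔid Q.Δ Q.Φe * (tensorOne k H Q.Φe * Δidid Q.Δ Q.Φi) =
      oneTensor k H Q.Φi * ididΔ Q.Δ Q.Φe := by
    rw [← mul_assoc, Q.pentagon_idΔid_one_Δidid]
  have p6 : ididΔ Q.Δ Q.Φi * (oneTensor k H Q.Φe * idΔid Q.Δ Q.Φe) =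
      Δidid Q.Δ Q.Φe * tensorOne k H Q.Φi := by
    rw [← mul_assoc, Q.pentagon_ididΔ_one_idΔid]
  simp only [act_act]
  rw [p1, p2, p3, p4, ← act_act (act₄ ρ X.act Y.act σ) (ididΔ Q.Δ Q.Φe),
    ← hY.ididΔ_braid₃₄, hX.Δidid_braid₁₂, ← act_act (act₄ ρ σ X.act Y.act) _ (idΔid Q.Δ Q.Φe),
    hX.idΔid_braid₂₃, ← act_act (act₄ X.act ρ σ Y.act), ← hX.Δidid_braid₁₂ _ _ _ Q.Φi,
    ← act_act (act₄ X.act Y.act ρ σ) (idΔid Q.Δ Q.Φe), ← hY.idΔid_braid₂₃, hY.ididΔ_braid₃₄ _ _ _ Q.Φi,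
    braid₁₂_braid₃₄]
  simp only [act_act]
  rw [p5, p6]

end ActCoact

end QuasiHopf

/-! ### Tensor products and the braiding as a morphism. -/

namespace QuasiHopf

variable {k H : Type*} [Field k] [Ring H] [Algebra k H]

section

variable {U V W : Type*} [AddCommGroup U] [Module k U] [AddCommGroup V] [Module k V]
  [AddCommGroup W] [Module k W] (Q : QuasiHopfAlgebra k H)

theorem extAct_tensorAct_right (ρ : H →ₐ[k] Module.End k U) (σ : H →ₐ[k] Module.End k V)
    (τ : H →ₐ[k] Module.End k W) (t : H ⊗[k] H) :
    extAct ρ (Q.tensorAct σ τ) t = extAct ρ (extAct σ τ) (idΔ Q.Δ t) := by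
  induction t using TensorProduct.induction_on with
  | zero => simp
  | add x y hx hy => simp only [map_add, hx, hy]
  | tmul a b => rfl

theorem assoc_extAct_tensorAct_left (ρ : H →ₐ[k] Module.End k U) (σ : H →ₐ[k] Module.End k V)
    (τ : H →ₐ[k] Module.End k W) (t : H ⊗[k] H) (x : (U ⊗[k] V) ⊗[k] W) :
    TensorProduct.assoc k U V W (extAct (Q.tensorAct ρ σ) τ t x) =
      extAct ρ (extAct σ τ) (Δid Q.Δ t) (TensorProduct.assoc k U V W x) := by
  induction t using TensorProduct.induction_on with
  | zero => simp
  | add x y hx hy => simp only [map_add, LinearMap.add_apply, hx, hy]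
  | tmul a b => exact assoc_extAct ρ σ τ (Q.Δ a ⊗ₜ b) x

/-- The trivial action of `H` on `k`. -/
def QuasiHopfAlgebra.trivialAct : H →ₐ[k] Module.End k k := (Algebra.lmul k k).comp Q.ε

theorem QuasiHopfAlgebra.trivialAct_apply (h : H) (c : k) : Q.trivialAct h c = Q.ε h • c := rfl

/-- When one of the three modules is the unit object, Φ acts through the counit of that leg, which
is 1. The next two lemmas treat the other legs. -/
theorem extAct_trivialAct₃ (ρ : H →ₐ[k] Module.End k U) (σ : H →ₐ[k] Module.End k V) (x : U ⊗[k] (V ⊗[k] k)) :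
    extAct ρ (extAct σ Q.trivialAct) Q.Φe x = x := by
  have key (z : H ⊗[k] (H ⊗[k] H)) (u : U) (v : V) (c : k) :
      extAct ρ (extAct σ Q.trivialAct) z (u ⊗ₜ (v ⊗ₜ c)) =
      TensorProduct.assoc k U V k (extAct ρ σ (Q.ε3 z) (u ⊗ₜ v) ⊗ₜ c) := by
    induction z using induction3 with
    | h0 => simp
    | h2 x y hx hy => simp only [map_add, LinearMap.add_apply, TensorProduct.add_tmul, hx, hy]
    | h1 a b e =>
      simp only [extAct_tmul, Q.trivialAct_apply, QuasiHopfAlgebra.ε3_tmul,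
        QuasiHopfAlgebra.εR_tmul, map_smul, LinearMap.smul_apply, TensorProduct.tmul_smul,
        ← TensorProduct.smul_tmul', TensorProduct.assoc_tmul]
  induction x using TensorProduct.induction_on with
  | zero => simp
  | add x y hx hy => simp only [map_add, hx, hy]
  | tmul u s =>
    induction s using TensorProduct.induction_on with
    | zero => simp
    | add x y hx hy => simp only [TensorProduct.tmul_add, map_add, hx, hy]
    | tmul v c => rw [key, Q.ε3_Φe, act_one, TensorProduct.assoc_tmul]

theorem extAct_trivialAct₂ (ρ : H →ₐ[k] Module.End k U) (σ : H →ₐ[k] Module.End k V) (x : U ⊗[k] (k ⊗[k] V)) :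
    extAct ρ (extAct Q.trivialAct σ) Q.Φi x = x := by
  have key (z : H ⊗[k] (H ⊗[k] H)) (u : U) (v : V) (c : k) :
      extAct ρ (extAct Q.trivialAct σ) z (u ⊗ₜ (c ⊗ₜ v)) =
      (TensorProduct.mk k k V c).lTensor U (extAct ρ σ (Q.ε2 z) (u ⊗ₜ v)) := by
    induction z using induction3 with
    | h0 => simp
    | h2 x y hx hy => simp only [map_add, LinearMap.add_apply, hx, hy]
    | h1 a b e =>
      simp only [extAct_tmul, Q.trivialAct_apply, QuasiHopfAlgebra.ε2_tmul,
        QuasiHopfAlgebra.εL_tmul, map_smul, LinearMap.smul_apply, TensorProduct.tmul_smul,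
        ← TensorProduct.smul_tmul', LinearMap.lTensor_tmul, TensorProduct.mk_apply]
  induction x using TensorProduct.induction_on with
  | zero => simp
  | add x y hx hy => simp only [map_add, hx, hy]
  | tmul u s =>
    induction s using TensorProduct.induction_on with
    | zero => simp
    | add x y hx hy => simp only [TensorProduct.tmul_add, map_add, hx, hy]
    | tmul c v => rw [key, Q.ε2_Φi, act_one]; rfl

theorem extAct_trivialAct₁ (ρ : H →ₐ[k] Module.End k U) (σ : H →ₐ[k] Module.End k V) (x : k ⊗[k] (U ⊗[k] V)) :
    extAct Q.trivialAct (extAct ρ σ) Q.Φe x = x := by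
  have key (z : H ⊗[k] (H ⊗[k] H)) (y : U ⊗[k] V) (c : k) :
      extAct Q.trivialAct (extAct ρ σ) z (c ⊗ₜ y) = c ⊗ₜ extAct ρ σ (Q.ε1 z) y := by
    induction z using induction3 with
    | h0 => simp
    | h2 x y hx hy => simp only [map_add, LinearMap.add_apply, TensorProduct.tmul_add, hx, hy]
    | h1 a b e =>
      simp only [extAct_tmul, Q.trivialAct_apply, QuasiHopfAlgebra.ε1_tmul, map_smul,
        LinearMap.smul_apply, TensorProduct.tmul_smul, ← TensorProduct.smul_tmul']
  induction x using TensorProduct.induction_on with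
  | zero => simp
  | add x y hx hy => simp only [map_add, hx, hy]
  | tmul c y => rw [key, Q.ε1_Φe, act_one]

end

namespace ActCoact

variable {M N U V W : Type*} [AddCommGroup M] [Module k M] [AddCommGroup N] [Module k N]
  [AddCommGroup U] [Module k U] [AddCommGroup V] [Module k V] [AddCommGroup W] [Module k W]
  {X : ActCoact k H M} {Y : ActCoact k H N} {Q : QuasiHopfAlgebra k H}

theorem lid_braid_trivialAct (X : ActCoact k H M) (Q : QuasiHopfAlgebra k H) (m : M) (c : k) :
    TensorProduct.lid k M (X.braid Q.trivialAct (m ⊗ₜ c)) =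
      c • TensorProduct.lid k M (Q.ε.toLinearMap.rTensor M (X.coact m)) := by
  rw [braid_tmul]
  induction X.coact m using TensorProduct.induction_on with
  | zero => simp
  | add x y hx hy => simp only [map_add, smul_add, hx, hy]
  | tmul h m => simp [Q.trivialAct_apply, mul_smul, smul_comm c]

/-- The counit axiom in braided form: braiding with the unit object is the flip. -/
theorem IsYetterDrinfeld.braid_trivialAct (hX : X.IsYetterDrinfeld Q) (m : M) (c : k) :
    X.braid Q.trivialAct (m ⊗ₜ c) = c ⊗ₜ m := by
  apply (TensorProduct.lid k M).injective
  rw [lid_braid_trivialAct, hX.counit_coact, TensorProduct.lid_tmul]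

/-- The counit axiom holds because all constraints with the unit object are trivial. For
H-linearity, Δ(h) is moved through the chain of `tensor_braid`, alternately by quasi-coassociativity
and by linearity of the braidings of M and N. -/
theorem IsYetterDrinfeld.tensor (hX : X.IsYetterDrinfeld Q) (hY : Y.IsYetterDrinfeld Q) :
    (X.tensor Q Y).IsYetterDrinfeld Q := by
  refine isYetterDrinfeld_of_hexagon _ (fun p => hX.tensor_hexagon hY _ _ _) (fun p => ?_)
    (fun h p => ?_)
  · have e := lid_braid_trivialAct (X.tensor Q Y) Q p 1
    rw [one_smul] at e
    rw [← e, tensor_braid, extAct_trivialAct₃, extAct_trivialAct₂, extAct_trivialAct₁]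
    clear e
    induction p using TensorProduct.induction_on with
    | zero => simp
    | add x y hx hy => simp only [TensorProduct.add_tmul, map_add, hx, hy]
    | tmul m n =>
      rw [TensorProduct.assoc_tmul, LinearMap.lTensor_tmul, hY.braid_trivialAct, braid₁₂_tmul,
        hX.braid_trivialAct]
      simp
  · change extAct _ (Q.tensorAct X.act Y.act) _ _ =
      (X.tensor Q Y).braid _ (extAct (Q.tensorAct X.act Y.act) _ _ _)
    rw [tensor_braid, tensor_braid, extAct_tensorAct_right, act_act, Q.idΔ_mul_Φe, ← act_act,
      hX.Δid_braid₁₂, act_act, ← Q.Φi_mul_idΔ, ← act_act, hY.idΔ_braid₂₃, act_act, Q.idΔ_mul_Φe,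
      ← act_act, assoc_extAct_tensorAct_left]

/-- The braiding is a morphism of Yetter-Drinfeld modules. -/
theorem IsYetterDrinfeld.isHom_braid (hX : X.IsYetterDrinfeld Q) (hY : Y.IsYetterDrinfeld Q) :
    (Y.tensor Q X).IsHom (X.tensor Q Y) (Y.braid X.act) where
  map_act h p := (hY.extAct_braid X.act h p).symm
  map_coact p := by
    have hT : Intertwines (Q.tensorAct X.act (Algebra.lmul k H)) (Q.tensorAct (Algebra.lmul k H) X.act)
        (X.braid (Algebra.lmul k H)) := fun h y => (hX.extAct_braid _ h y).symm
    have e : Y.braid X.act p ⊗ₜ[k] (1 : H) = (Y.braid X.act).rTensor H (p ⊗ₜ 1) := rfl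
    -- Both coactions are braidings with H. The hexagon for Y brings each side to a braiding of Y
    -- with a tensor product of X and H, and the two agree by naturality along the braiding of X
    -- with H: the Yang-Baxter argument.
    rw [← braid_lmul_one, ← braid_lmul_one, e, tensor_braid, tensor_braid, hY.hexagon, act_act,
      Q.Φe_mul_Φi, act_one, ← Y.braid_nat hT, assoc_braid, assoc_braid, hY.hexagon, act_act,
      Q.Φi_mul_Φe, act_one]

end ActCoact

end QuasiHopf

/-! ### Twisted coactions. -/

namespace QuasiHopf

variable {k H : Type*} [Field k] [Ring H] [Algebra k H]

namespace TwistDatum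

variable {Q : QuasiHopfAlgebra k H} (D : TwistDatum Q)

/-- The image of the reassociator under the anti-automorphism. -/
def Ψ : H ⊗[k] (H ⊗[k] H) := rev₃ D.s.toLinearMap Q.Φe

/-- The inverse of `Ψ`. -/
def Ψi : H ⊗[k] (H ⊗[k] H) := rev₃ D.s.toLinearMap Q.Φi

/-- The twist as a unit. -/
def unitF : (H ⊗[k] H)ˣ := ⟨D.F, D.G, D.F_mul_G, D.G_mul_F⟩

theorem rev₃_one : rev₃ D.s.toLinearMap (1 : H ⊗[k] (H ⊗[k] H)) = 1 := by
  simp [Algebra.TensorProduct.one_def, D.s_one]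

/-- `Ψ` as a unit. -/
def unitΨ : (H ⊗[k] (H ⊗[k] H))ˣ where
  val := D.Ψ
  inv := D.Ψi
  val_inv := by rw [Ψ, Ψi, ← rev₃_mul D.s_mul, Q.Φi_mul_Φe, rev₃_one]
  inv_val := by rw [Ψ, Ψi, ← rev₃_mul D.s_mul, Q.Φe_mul_Φi, rev₃_one]

theorem reassoc_units :
    Units.map (ins23 k H : _ →* _) D.unitF * Units.map (idΔ Q.Δ : _ →* _) D.unitF * Q.Φ =
    D.unitΨ * Units.map (ins12 k H : _ →* _) D.unitF * Units.map (Δid Q.Δ : _ →* _) D.unitF :=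
  Units.ext D.reassoc

/-- The relation between F and Φ, solved below for the words that occur when twisted braidings are
composed. -/
theorem Ψ_mul_F : D.Ψ * (ins12 k H D.F * Δid Q.Δ D.F) = (1 ⊗ₜ D.F) * (idΔ Q.Δ D.F * Q.Φe) := by
  rw [← mul_assoc, ← mul_assoc, D.reassoc]; rfl

theorem G_mul_Ψ : idΔ Q.Δ D.G * ((1 ⊗ₜ D.G) * D.Ψ) = Q.Φe * (Δid Q.Δ D.G * ins12 k H D.G) := by
  have h : (Units.map (idΔ Q.Δ : _ →* _) D.unitF)⁻¹ *
      ((Units.map (ins23 k H : _ →* _) D.unitF)⁻¹ * D.unitΨ) =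
      Q.Φ * ((Units.map (Δid Q.Δ : _ →* _) D.unitF)⁻¹ *
      (Units.map (ins12 k H : _ →* _) D.unitF)⁻¹) := by
    have := D.reassoc_units
    rw [← mul_inv_eq_iff_eq_mul, ← mul_inv_eq_iff_eq_mul] at this
    rw [← this]
    group
  exact congrArg Units.val h

theorem G_mul_Ψ_mul_F : (1 ⊗ₜ D.G) * (D.Ψ * ins12 k H D.F) =
    idΔ Q.Δ D.F * (Q.Φe * Δid Q.Δ D.G) := by
  have h : (Units.map (ins23 k H : _ →* _) D.unitF)⁻¹ *
      (D.unitΨ * Units.map (ins12 k H : _ →* _) D.unitF) =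
      Units.map (idΔ Q.Δ : _ →* _) D.unitF * (Q.Φ * (Units.map (Δid Q.Δ : _ →* _) D.unitF)⁻¹) := by
    have := D.reassoc_units
    rw [← mul_inv_eq_iff_eq_mul] at this
    rw [← this]
    group
  exact congrArg Units.val h

theorem Ψ_mul_ins12 : D.Ψ * ins12 k H D.F =
    (1 ⊗ₜ D.F) * (idΔ Q.Δ D.F * (Q.Φe * Δid Q.Δ D.G)) := by
  have h : D.unitΨ * Units.map (ins12 k H : _ →* _) D.unitF =
      Units.map (ins23 k H : _ →* _) D.unitF * (Units.map (idΔ Q.Δ : _ →* _) D.unitF *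
        (Q.Φ * (Units.map (Δid Q.Δ : _ →* _) D.unitF)⁻¹)) := by
    have := D.reassoc_units
    rw [← mul_inv_eq_iff_eq_mul] at this
    rw [← this]
    group
  exact congrArg Units.val h

theorem G_mul_Ψi_mul_F : ins12 k H D.G * (D.Ψi * (1 ⊗ₜ D.F)) =
    Δid Q.Δ D.F * (Q.Φi * idΔ Q.Δ D.G) := by
  have h : (Units.map (ins12 k H : _ →* _) D.unitF)⁻¹ *
      (D.unitΨ⁻¹ * Units.map (ins23 k H : _ →* _) D.unitF) =
      Units.map (Δid Q.Δ : _ →* _) D.unitF * (Q.Φ⁻¹ * (Units.map (idΔ Q.Δ : _ →* _) D.unitF)⁻¹) := by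
    have := D.reassoc_units
    rw [← mul_inv_eq_iff_eq_mul, ← mul_inv_eq_iff_eq_mul] at this
    rw [← this]
    group
  exact congrArg Units.val h

theorem rev₂_Δ (h : H) : rev₂ D.s.toLinearMap (Q.Δ h) = D.F * Q.Δ (D.s h) * D.G := by
  rw [D.F_mul_Δ, mul_assoc, D.F_mul_G, mul_one]

theorem ε_s_symm (h : H) : Q.ε (D.s.symm h) = Q.ε h := by
  rw [← D.ε_s (D.s.symm h), D.s.apply_symm_apply]

theorem rev₂_injective : Function.Injective (rev₂ D.s.toLinearMap) := by
  apply Function.LeftInverse.injective (g := rev₂ D.s.symm.toLinearMap)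
  intro t
  induction t using TensorProduct.induction_on with
  | zero => simp
  | tmul a b => simp
  | add x y hx hy => simp only [map_add, hx, hy]

end TwistDatum

namespace ActCoact

variable {M N U V W : Type*} [AddCommGroup M] [Module k M] [AddCommGroup N] [Module k N]
  [AddCommGroup U] [Module k U] [AddCommGroup V] [Module k V] [AddCommGroup W] [Module k W]
  {X : ActCoact k H M} {Y : ActCoact k H N} {Q : QuasiHopfAlgebra k H}

variable (X) in
/-- The coaction `m ↦ F¹ (G¹ · m)₍₋₁₎ G² ⊗ F² · (G¹ · m)₍₀₎`. -/
def twist (D : TwistDatum Q) : ActCoact k H M where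
  act := X.act
  coact := extAct (Algebra.lmul k H) X.act D.F ∘ₗ X.twCoact D.G

variable (D : TwistDatum Q)

theorem twist_braid (ρ : H →ₐ[k] Module.End k U) (x : M ⊗[k] U) :
    (X.twist D).braid ρ x = extAct ρ X.act D.F (X.braid ρ (extAct X.act ρ D.G x)) := by
  induction x using TensorProduct.induction_on with
  | zero => simp
  | add x y hx hy => simp only [map_add, hx, hy]
  | tmul m u =>
    have hT := intertwines_orbit ρ u
    have e : m ⊗ₜ[k] u = (ρ.toLinearMap.flip u).lTensor M (m ⊗ₜ 1) := by simp
    rw [braid_tmul, e, ← hT.lTensor X.act, ← X.braid_nat hT, ← hT.rTensor X.act]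
    rfl

theorem twist_braid₂₃ (ρ : H →ₐ[k] Module.End k U) (σ : H →ₐ[k] Module.End k W)
    (x : W ⊗[k] (M ⊗[k] U)) :
    ((X.twist D).braid ρ).lTensor W x = extAct σ (extAct ρ X.act) (1 ⊗ₜ D.F)
      ((X.braid ρ).lTensor W (extAct σ (extAct X.act ρ) (1 ⊗ₜ D.G) x)) := by
  induction x using TensorProduct.induction_on with
  | zero => simp
  | add x y hx hy => simp only [map_add, hx, hy]
  | tmul w x => simp only [LinearMap.lTensor_tmul, twist_braid, extAct_tmul, act_one]

theorem extAct_ins12_assoc {V : Type*} [AddCommGroup V] [Module k V]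
    (ρ : H →ₐ[k] Module.End k U) (σ : H →ₐ[k] Module.End k V)
    (τ : H →ₐ[k] Module.End k W) (t : H ⊗[k] H) (x : (U ⊗[k] V) ⊗[k] W) :
    extAct ρ (extAct σ τ) (ins12 k H t) (TensorProduct.assoc k U V W x) =
      TensorProduct.assoc k U V W ((extAct ρ σ t).rTensor W x) := by
  have e : ins12 k H t = TensorProduct.assoc k H H H (t ⊗ₜ 1) := by
    induction t using TensorProduct.induction_on with
    | zero => simp
    | add x y hx hy => simp only [TensorProduct.add_tmul, map_add, hx, hy]
    | tmul a b => simp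
  rw [e, ← assoc_extAct, extAct_tmul_eq, map_one]
  rfl

theorem twist_braid₁₂ (ρ : H →ₐ[k] Module.End k U) (σ : H →ₐ[k] Module.End k W)
    (x : M ⊗[k] (U ⊗[k] W)) :
    (X.twist D).braid₁₂ ρ W x = extAct ρ (extAct X.act σ) (ins12 k H D.F)
      (X.braid₁₂ ρ W (extAct X.act (extAct ρ σ) (ins12 k H D.G) x)) := by
  obtain ⟨y, rfl⟩ := (TensorProduct.assoc k M U W).surjective x
  rw [extAct_ins12_assoc, ← assoc_braid, ← assoc_braid, extAct_ins12_assoc]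
  congr 1
  induction y using TensorProduct.induction_on with
  | zero => simp
  | add x y hx hy => simp only [map_add, hx, hy]
  | tmul s w => simp only [LinearMap.rTensor_tmul, twist_braid]

theorem assoc_twist_braid (ρ : H →ₐ[k] Module.End k U) (σ : H →ₐ[k] Module.End k W)
    (x : M ⊗[k] (U ⊗[k] W)) :
    TensorProduct.assoc k U W M ((X.twist D).braid (Q.tensorAct ρ σ) x) =
      extAct ρ (extAct σ X.act) (Δid Q.Δ D.F) (TensorProduct.assoc k U W M
        (X.braid (Q.tensorAct ρ σ) (extAct X.act (extAct ρ σ) (idΔ Q.Δ D.G) x))) := by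
  rw [twist_braid, assoc_extAct_tensorAct_left, extAct_tensorAct_right]

/-- The twisted braiding is the braiding conjugated by F and G. The relation for F replaces Ψ by Φ
inside the composite, and the remaining coproduct factors slide to the ends. Ψ is the reassociator
that appears when the axioms of the dual are transposed. -/
theorem IsYetterDrinfeld.twist_hexagon (hX : X.IsYetterDrinfeld Q)
    (ρ : H →ₐ[k] Module.End k U) (σ : H →ₐ[k] Module.End k W) (x : M ⊗[k] (U ⊗[k] W)) :
    ((X.twist D).braid σ).lTensor U (extAct ρ (extAct X.act σ) D.Ψ ((X.twist D).braid₁₂ ρ W x)) =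
      extAct ρ (extAct σ X.act) (D.Ψ * ins12 k H D.F) (TensorProduct.assoc k U W M
        ((X.twist D).braid (Q.tensorAct ρ σ)
          (extAct X.act (extAct ρ σ) ((1 ⊗ₜ D.G) * D.Ψ) x))) := by
  rw [twist_braid₂₃ D σ ρ, twist_braid₁₂ D ρ σ, assoc_twist_braid]
  simp only [act_act, mul_assoc]
  rw [D.Ψ_mul_F, D.G_mul_Ψ, D.G_mul_Ψ_mul_F, ← act_act (extAct ρ (extAct X.act σ)),
    ← act_act (extAct ρ (extAct X.act σ)), hX.Δid_braid₁₂, ← hX.idΔ_braid₂₃, hX.hexagon]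
  simp only [act_act]

theorem IsYetterDrinfeld.twist_counit (hX : X.IsYetterDrinfeld Q) (m : M) :
    TensorProduct.lid k M (Q.ε.toLinearMap.rTensor M ((X.twist D).coact m)) = m := by
  have e := lid_braid_trivialAct (X.twist D) Q m 1
  have e1 (t : H ⊗[k] H) : extAct X.act Q.trivialAct t (m ⊗ₜ 1) = X.act (Q.εR t) m ⊗ₜ 1 := by
    induction t using TensorProduct.induction_on with
    | zero => simp
    | add x y hx hy => simp only [map_add, LinearMap.add_apply, TensorProduct.add_tmul, hx, hy]
    | tmul a b =>
      simp only [extAct_tmul, Q.trivialAct_apply, QuasiHopfAlgebra.εR_tmul, map_smul,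
        LinearMap.smul_apply, TensorProduct.tmul_smul, ← TensorProduct.smul_tmul']
  have e2 (t : H ⊗[k] H) (n : M) : extAct Q.trivialAct X.act t (1 ⊗ₜ n) = 1 ⊗ₜ X.act (Q.εL t) n := by
    induction t using TensorProduct.induction_on with
    | zero => simp
    | add x y hx hy => simp only [map_add, LinearMap.add_apply, TensorProduct.tmul_add, hx, hy]
    | tmul a b =>
      simp only [extAct_tmul, Q.trivialAct_apply, QuasiHopfAlgebra.εL_tmul, map_smul,
        LinearMap.smul_apply, TensorProduct.tmul_smul, ← TensorProduct.smul_tmul']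
  rw [one_smul, twist_braid, e1, hX.braid_trivialAct, e2, act_act, D.ε_F_G, act_one,
    TensorProduct.lid_tmul, one_smul] at e
  exact e.symm

/-- F conjugates Δ(s(h)) into the reversed image of Δ(h) under s, so H-linearity of the braiding
survives in this form. -/
theorem IsYetterDrinfeld.twist_act (hX : X.IsYetterDrinfeld Q) (ρ : H →ₐ[k] Module.End k U) (h : H)
    (x : M ⊗[k] U) :
    extAct ρ X.act (rev₂ D.s.toLinearMap (Q.Δ h)) ((X.twist D).braid ρ x) =
      (X.twist D).braid ρ (extAct X.act ρ (rev₂ D.s.toLinearMap (Q.Δ h)) x) := by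
  rw [twist_braid, twist_braid, D.rev₂_Δ, act_act, mul_assoc, D.G_mul_F, mul_one, ← act_act,
    hX.extAct_braid, act_act, act_act, ← mul_assoc, ← mul_assoc, D.G_mul_F, one_mul]

end ActCoact

end QuasiHopf

/-! ### Dual Yetter-Drinfeld modules. -/

namespace QuasiHopf

variable {k H : Type*} [Field k] [Ring H] [Algebra k H]

section Evaluation

variable {A B M N : Type*} [AddCommGroup A] [Module k A] [AddCommGroup B] [Module k B]
  [AddCommGroup M] [Module k M] [AddCommGroup N] [Module k N]

variable (k A M) in
/-- `a ⊗ φ ↦ (m ↦ φ(m) a)`. -/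
def toHom : A ⊗[k] Module.Dual k M →ₗ[k] M →ₗ[k] A :=
  dualTensorHom k M A ∘ₗ (TensorProduct.comm k A (Module.Dual k M)).toLinearMap

@[simp] theorem toHom_tmul (a : A) (φ : Module.Dual k M) (m : M) :
    toHom k A M (a ⊗ₜ φ) m = φ m • a := rfl

theorem toHom_injective [FiniteDimensional k M] : Function.Injective (toHom k A M) := by
  have : (toHom k A M : _ → _) = dualTensorHomEquiv k M A ∘ TensorProduct.comm k A (Module.Dual k M) := by
    ext x : 1
    simp [toHom]
  rw [this]
  exact (dualTensorHomEquiv k M A).injective.comp (TensorProduct.comm _ _ _).injective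

variable (A) in
/-- `a ⊗ m ↦ φ(m) a`. -/
def contract (φ : Module.Dual k M) : A ⊗[k] M →ₗ[k] A :=
  (TensorProduct.rid k A).toLinearMap ∘ₗ φ.lTensor A

@[simp] theorem contract_tmul (φ : Module.Dual k M) (a : A) (m : M) :
    contract A φ (a ⊗ₜ m) = φ m • a := rfl

/-- A description of the dual coaction free of bases. As `toHom` is injective in finite dimension,
identities in H ⊗ M* may be checked by evaluating at vectors of M. -/
theorem toHom_dualCoact [FiniteDimensional k M] (s : H →ₗ[k] H) (T : M →ₗ[k] H ⊗[k] M)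
    (φ : Module.Dual k M) (m : M) :
    toHom k H M (ActCoact.dualCoact s T φ) m = s (contract H φ (T m)) := by
  have e (x : Module.Dual k M ⊗[k] H) :
      toHom k H M (TensorProduct.comm k _ _ x) = dualTensorHomEquiv k M H x := by simp [toHom]
  exact (LinearMap.congr_fun (e _) m).trans
    (LinearMap.congr_fun (LinearEquiv.apply_symm_apply (dualTensorHomEquiv k M H) _) m)

theorem toHom_rTensor (T : A →ₗ[k] B) (t : A ⊗[k] Module.Dual k M) (m : M) :
    toHom k B M (T.rTensor _ t) m = T (toHom k A M t m) := by
  induction t using TensorProduct.induction_on with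
  | zero => simp
  | add x y hx hy => simp only [map_add, LinearMap.add_apply, hx, hy]
  | tmul a φ => simp

theorem contract_rTensor (T : A →ₗ[k] B) (φ : Module.Dual k M) (x : A ⊗[k] M) :
    contract B φ (T.rTensor _ x) = T (contract A φ x) := by
  induction x using TensorProduct.induction_on with
  | zero => simp
  | add x y hx hy => simp only [map_add, hx, hy]
  | tmul a m => simp

theorem contract_rTensor_flip (φ : Module.Dual k M) (c : H) (x : H ⊗[k] M) :
    contract H φ (((Algebra.lmul k H).toLinearMap.flip c).rTensor M x) = contract H φ x * c := by
  rw [contract_rTensor]; rfl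

theorem lmul_apply_one (a : H) : Algebra.lmul k H a 1 = a := by simp

end Evaluation

namespace ActCoact

variable {M N : Type*} [AddCommGroup M] [Module k M] [FiniteDimensional k M]
  [AddCommGroup N] [Module k N] [FiniteDimensional k N]
  {X : ActCoact k H M} {Y : ActCoact k H N} {Q : QuasiHopfAlgebra k H}

variable (X) in
/-- The dual with respect to a twist datum: the action `(h · φ)(m) = φ(s(h) · m)` and the coaction
`φ ↦ ⟨φ, F² · (G¹ · mᵢ)₍₀₎⟩ s⁻¹(F¹ (G¹ · mᵢ)₍₋₁₎ G²) ⊗ mⁱ`. -/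
def dual (D : TwistDatum Q) : ActCoact k H (Module.Dual k M) where
  act := AlgHom.ofLinearMap
    ((Module.Dual.transpose (R := k) (M := M) (M' := M)) ∘ₗ X.act.toLinearMap ∘ₗ D.s.toLinearMap)
    (by ext φ v; simp [D.s_one, Module.Dual.transpose_apply])
    (by intro a b; ext φ v; simp [D.s_mul, Module.Dual.transpose_apply])
  coact := dualCoact D.s.symm.toLinearMap (X.twist D).coact

variable (D : TwistDatum Q)

@[simp] theorem dual_act (h : H) (φ : Module.Dual k M) (m : M) :
    (X.dual D).act h φ m = φ (X.act (D.s h) m) := rfl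

theorem toHom_dual_coact (φ : Module.Dual k M) (m : M) :
    toHom k H M ((X.dual D).coact φ) m = D.s.symm (contract H φ ((X.twist D).coact m)) :=
  toHom_dualCoact _ _ _ _

theorem dual_counit (hX : X.IsYetterDrinfeld Q) (φ : Module.Dual k M) :
    TensorProduct.lid k _ (Q.ε.toLinearMap.rTensor _ ((X.dual D).coact φ)) = φ := by
  ext m
  have e1 (t : H ⊗[k] Module.Dual k M) :
      TensorProduct.lid k _ (Q.ε.toLinearMap.rTensor _ t) m = Q.ε (toHom k H M t m) := by
    induction t using TensorProduct.induction_on with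
    | zero => simp
    | add x y hx hy => simp only [map_add, LinearMap.add_apply, hx, hy]
    | tmul a φ => simp [mul_comm]
  have e2 (x : H ⊗[k] M) :
      φ (TensorProduct.lid k _ (Q.ε.toLinearMap.rTensor _ x)) = Q.ε (contract H φ x) := by
    induction x using TensorProduct.induction_on with
    | zero => simp
    | add x y hx hy => simp only [map_add, hx, hy]
    | tmul a m => simp [mul_comm]
  rw [e1, toHom_dual_coact, D.ε_s_symm, ← e2, hX.twist_counit]

/-- After evaluating at m and applying s, left multiplication by a becomes right multiplication by
s(a), and b acting on the functional becomes s(b) acting on m before the coaction. An operation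
after the dual coaction thus turns into one before the twisted coaction; `s_toHom_braid_dual` is the
opposite case. -/
theorem s_toHom_extAct_dual (z : H ⊗[k] H) (φ : Module.Dual k M) (m : M) :
    D.s (toHom k H M (extAct (Algebra.lmul k H) (X.dual D).act z ((X.dual D).coact φ)) m) =
      contract H φ ((X.twist D).braid (Algebra.lmul k H)
        (extAct X.act (Algebra.lmul k H) (rev₂ D.s.toLinearMap z) (m ⊗ₜ 1))) := by
  induction z using TensorProduct.induction_on with
  | zero => simp
  | add x y hx hy => simp only [map_add, LinearMap.add_apply, hx, hy]
  | tmul a b =>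
    have e (t : H ⊗[k] Module.Dual k M) :
        toHom k H M (extAct (Algebra.lmul k H) (X.dual D).act (a ⊗ₜ b) t) m =
        a * toHom k H M t (X.act (D.s b) m) := by
      induction t using TensorProduct.induction_on with
      | zero => simp
      | add x y hx hy => simp only [map_add, LinearMap.add_apply, mul_add, hx, hy]
      | tmul h ψ => simp
    rw [e, D.s_mul, toHom_dual_coact, D.s.apply_symm_apply, rev₂_tmul, extAct_tmul, braid_tmul,
      contract_rTensor_flip]
    simp

theorem s_toHom_braid_dual (z : H ⊗[k] H) (φ : Module.Dual k M) (m : M) :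
    D.s (toHom k H M ((X.dual D).braid (Algebra.lmul k H)
      (extAct (X.dual D).act (Algebra.lmul k H) z (φ ⊗ₜ 1))) m) =
      contract H φ (extAct (Algebra.lmul k H) X.act (rev₂ D.s.toLinearMap z)
        ((X.twist D).coact m)) := by
  induction z using TensorProduct.induction_on with
  | zero => simp
  | add x y hx hy => simp only [map_add, LinearMap.add_apply, hx, hy]
  | tmul a b =>
    have e (x : H ⊗[k] M) : contract H φ (extAct (Algebra.lmul k H) X.act
        (D.s b ⊗ₜ D.s a) x) = D.s b * contract H ((X.dual D).act a φ) x := by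
      induction x using TensorProduct.induction_on with
      | zero => simp
      | add x y hx hy => simp only [map_add, mul_add, hx, hy]
      | tmul h m => simp
    rw [extAct_tmul, braid_tmul, toHom_rTensor, toHom_dual_coact, rev₂_tmul]
    simp only [LinearEquiv.coe_coe]
    rw [e]
    simp [D.s_mul]

/-- The same transposition for the iterated coaction: two successive coactions of the dual become
two successive twisted coactions on M, with the legs of z reversed. -/
theorem contract₃_braid_twist (z : H ⊗[k] (H ⊗[k] H)) (φ : Module.Dual k M) (m : M) :
    rev₂ D.s.toLinearMap ((LinearMap.lTensor H ((toHom k H M).flip m))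
      (((X.dual D).braid (Algebra.lmul k H)).lTensor H
        (extAct (Algebra.lmul k H) (extAct (X.dual D).act (Algebra.lmul k H)) z
          (TensorProduct.assoc k H _ H ((X.dual D).coact φ ⊗ₜ 1))))) =
      (contract H φ).lTensor H (((X.twist D).braid (Algebra.lmul k H)).lTensor H
        (extAct (Algebra.lmul k H) (extAct X.act (Algebra.lmul k H)) (rev₃ D.s.toLinearMap z)
          (TensorProduct.assoc k H M H ((X.twist D).coact m ⊗ₜ 1)))) := by
  induction z using induction3 with
  | h0 => simp
  | h2 x y hx hy => simp only [map_add, LinearMap.add_apply, hx, hy]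
  | h1 a b c =>
    have e1 (t : H ⊗[k] Module.Dual k M) :
        rev₂ D.s.toLinearMap ((LinearMap.lTensor H ((toHom k H M).flip m))
      (((X.dual D).braid (Algebra.lmul k H)).lTensor H
        (extAct (Algebra.lmul k H) (extAct (X.dual D).act (Algebra.lmul k H)) (a ⊗ₜ (b ⊗ₜ c))
          (TensorProduct.assoc k H _ H (t ⊗ₜ 1))))) =
        TensorProduct.map (Algebra.lmul k H (D.s c)) ((Algebra.lmul k H).toLinearMap.flip (D.s a) ∘ₗ
          D.s.toLinearMap ∘ₗ toHom k H M t ∘ₗ X.act (D.s b)) ((X.twist D).coact m) := by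
      induction t using TensorProduct.induction_on with
      | zero => simp
      | add x y hx hy =>
        simp only [TensorProduct.add_tmul, map_add, LinearMap.add_comp, LinearMap.comp_add,
          TensorProduct.map_add_right, LinearMap.add_apply, hx, hy]
      | tmul h ψ =>
        have e2 (x : H ⊗[k] M) : TensorProduct.map (Algebra.lmul k H (D.s c))
            ((Algebra.lmul k H).toLinearMap.flip (D.s a) ∘ₗ
            D.s.toLinearMap ∘ₗ toHom k H M (h ⊗ₜ ψ) ∘ₗ X.act (D.s b)) x =
            (D.s c * contract H ((X.dual D).act b ψ) x) ⊗ₜ (D.s h * D.s a) := by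
          induction x using TensorProduct.induction_on with
          | zero => simp
          | add x y hx hy => simp only [map_add, mul_add, TensorProduct.add_tmul, hx, hy]
          | tmul u m => simp [TensorProduct.smul_tmul']
        rw [e2, TensorProduct.assoc_tmul, extAct_tmul, extAct_tmul, LinearMap.lTensor_tmul,
          LinearMap.lTensor_tmul, braid_tmul, LinearMap.flip_apply, toHom_rTensor,
          toHom_dual_coact, rev₂_tmul]
        simp [D.s_mul]
    have e3 (x : H ⊗[k] M) : (contract H φ).lTensor H
        (((X.twist D).braid (Algebra.lmul k H)).lTensor H
        (extAct (Algebra.lmul k H) (extAct X.act (Algebra.lmul k H)) (D.s c ⊗ₜ (D.s b ⊗ₜ D.s a))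
          (TensorProduct.assoc k H M H (x ⊗ₜ 1)))) =
        TensorProduct.map (Algebra.lmul k H (D.s c)) ((Algebra.lmul k H).toLinearMap.flip (D.s a) ∘ₗ
          D.s.toLinearMap ∘ₗ toHom k H M ((X.dual D).coact φ) ∘ₗ X.act (D.s b)) x := by
      induction x using TensorProduct.induction_on with
      | zero => simp
      | add x y hx hy => simp only [TensorProduct.add_tmul, map_add, hx, hy]
      | tmul u m =>
        simp only [TensorProduct.assoc_tmul, extAct_tmul, LinearMap.lTensor_tmul, braid_tmul,
          contract_rTensor, TensorProduct.map_tmul, LinearMap.comp_apply, toHom_dual_coact,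
          LinearEquiv.coe_coe, D.s.apply_symm_apply]
        simp
    rw [e1, rev₃_tmul]
    exact (e3 _).symm

theorem contract₃_assoc {W : Type*} [AddCommGroup W] [Module k W] (φ : Module.Dual k W)
    (t : H ⊗[k] H) (w : W) :
    (contract H φ).lTensor H (TensorProduct.assoc k H H W (t ⊗ₜ w)) = φ w • t := by
  induction t using TensorProduct.induction_on with
  | zero => simp
  | add x y hx hy => simp only [TensorProduct.add_tmul, smul_add, map_add, hx, hy]
  | tmul a b => simp

theorem toHom₃_assoc {W : Type*} [AddCommGroup W] [Module k W] (φ : Module.Dual k W)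
    (t : H ⊗[k] H) (w : W) :
    LinearMap.lTensor H ((toHom k H W).flip w) (TensorProduct.assoc k H H _ (t ⊗ₜ φ)) =
      φ w • t := by
  induction t using TensorProduct.induction_on with
  | zero => simp
  | add x y hx hy => simp only [TensorProduct.add_tmul, smul_add, map_add, hx, hy]
  | tmul a b => simp

theorem extAct_lmul_apply (s t : H ⊗[k] H) :
    extAct (Algebra.lmul k H) (Algebra.lmul k H) s t = s * t := by
  induction s using TensorProduct.induction_on with
  | zero => simp
  | add x y hx hy => simp only [map_add, LinearMap.add_apply, add_mul, hx, hy]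
  | tmul a b =>
    induction t using TensorProduct.induction_on with
    | zero => simp
    | add x y hx hy => simp only [map_add, mul_add, hx, hy]
    | tmul c d => simp

/-- Here the coproduct of a coefficient is transposed as well. Reversing Δ(h) with s gives F Δ(s(h))
G; twisting the braiding with H ⊗ H accounts for only part of this, hence the extra factors F and G
on the right. -/
theorem contract₃_braid_tensorAct (z w : H ⊗[k] (H ⊗[k] H)) (φ : Module.Dual k M) (m : M) :
    rev₂ D.s.toLinearMap ((LinearMap.lTensor H ((toHom k H M).flip m))
      (extAct (Algebra.lmul k H) (extAct (Algebra.lmul k H) (X.dual D).act) z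
        (TensorProduct.assoc k H H _ ((X.dual D).braid
          (Q.tensorAct (Algebra.lmul k H) (Algebra.lmul k H))
          (extAct (X.dual D).act (extAct (Algebra.lmul k H) (Algebra.lmul k H)) w
            (φ ⊗ₜ (1 ⊗ₜ 1))))))) =
      (contract H φ).lTensor H (extAct (Algebra.lmul k H) (extAct (Algebra.lmul k H) X.act)
        (rev₃ D.s.toLinearMap w * ins12 k H D.F)
        (TensorProduct.assoc k H H _ ((X.twist D).braid
          (Q.tensorAct (Algebra.lmul k H) (Algebra.lmul k H))
          (extAct X.act (extAct (Algebra.lmul k H) (Algebra.lmul k H))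
            ((1 ⊗ₜ D.G) * rev₃ D.s.toLinearMap z) (m ⊗ₜ (1 ⊗ₜ 1)))))) := by
  induction z using induction3 with
  | h0 => simp
  | h2 x y hx hy => simp only [map_add, LinearMap.add_apply, mul_add, hx, hy]
  | h1 x y v =>
  induction w using induction3 with
  | h0 => simp
  | h2 x y hx hy => simp only [map_add, LinearMap.add_apply, add_mul, hx, hy]
  | h1 a b c =>
    have e1 (t : H ⊗[k] Module.Dual k M) :
        (LinearMap.lTensor H ((toHom k H M).flip m))
        (extAct (Algebra.lmul k H) (extAct (Algebra.lmul k H) (X.dual D).act) (x ⊗ₜ (y ⊗ₜ v))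
        (TensorProduct.assoc k H H _
          (((Q.tensorAct (Algebra.lmul k H) (Algebra.lmul k H)).toLinearMap.flip (b ⊗ₜ c)).rTensor _
          t))) = (x ⊗ₜ y) * Q.Δ (toHom k H M t (X.act (D.s v) m)) * (b ⊗ₜ c) := by
      induction t using TensorProduct.induction_on with
      | zero => simp
      | add x y hx hy => simp only [map_add, LinearMap.add_apply, mul_add, add_mul, hx, hy]
      | tmul h ψ =>
        have e : x ⊗ₜ[k] (y ⊗ₜ[k] v) = TensorProduct.assoc k H H H ((x ⊗ₜ y) ⊗ₜ v) := rfl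
        rw [e, ← assoc_extAct, LinearMap.rTensor_tmul, extAct_tmul, toHom₃_assoc,
          extAct_lmul_apply]
        simp only [LinearMap.flip_apply, AlgHom.toLinearMap_apply, toHom_tmul, map_smul,
          mul_smul_comm, smul_mul_assoc, QuasiHopfAlgebra.tensorAct, AlgHom.comp_apply,
          extAct_lmul_apply, mul_assoc, dual_act]
    have e2 (p : H ⊗[k] M) (r : H ⊗[k] H) :
        (contract H φ).lTensor H (extAct (Algebra.lmul k H) (extAct (Algebra.lmul k H) X.act)
        (D.s c ⊗ₜ (D.s b ⊗ₜ D.s a))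
        (extAct (Algebra.lmul k H) (extAct (Algebra.lmul k H) X.act) (ins12 k H D.F)
        (TensorProduct.assoc k H H _
          (((Q.tensorAct (Algebra.lmul k H) (Algebra.lmul k H)).toLinearMap.flip r).rTensor _
          p)))) = (D.s c ⊗ₜ D.s b) * (D.F * Q.Δ (contract H ((X.dual D).act a φ) p) * r) := by
      induction p using TensorProduct.induction_on with
      | zero => simp
      | add x y hx hy => simp only [map_add, mul_add, add_mul, hx, hy]
      | tmul u n =>
        have e : D.s c ⊗ₜ[k] (D.s b ⊗ₜ[k] D.s a) =
          TensorProduct.assoc k H H H ((D.s c ⊗ₜ D.s b) ⊗ₜ D.s a) := rfl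
        rw [extAct_ins12_assoc, e, ← assoc_extAct, LinearMap.rTensor_tmul, LinearMap.rTensor_tmul,
          extAct_tmul, contract₃_assoc, extAct_lmul_apply, extAct_lmul_apply]
        simp only [LinearMap.flip_apply, AlgHom.toLinearMap_apply, contract_tmul, map_smul,
          mul_smul_comm, smul_mul_assoc, QuasiHopfAlgebra.tensorAct, AlgHom.comp_apply,
          extAct_lmul_apply, mul_assoc, dual_act]
    have e3 : rev₂ D.s.toLinearMap (x ⊗ₜ y) = D.s y ⊗ₜ D.s x := by simp
    rw [extAct_tmul, braid_tmul]
    simp only [extAct_tmul, map_mul, Module.End.mul_apply, rev₃_tmul, LinearEquiv.coe_coe,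
      lmul_apply_one, act_one]
    rw [e1, braid_tmul, e2, rev₂_mul D.s_mul, rev₂_mul D.s_mul, toHom_dual_coact,
      D.rev₂_Δ, D.s.apply_symm_apply]
    simp only [rev₂_tmul, extAct_lmul_apply, LinearEquiv.coe_coe, mul_assoc]

theorem toHom₃_injective {t t' : H ⊗[k] (H ⊗[k] Module.Dual k M)}
    (h : ∀ m, (LinearMap.lTensor H ((toHom k H M).flip m)) t =
      (LinearMap.lTensor H ((toHom k H M).flip m)) t') : t = t' := by
  apply (TensorProduct.assoc k H H _).symm.injective
  apply toHom_injective
  ext1 m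
  have e (x : H ⊗[k] (H ⊗[k] Module.Dual k M)) :
      toHom k (H ⊗[k] H) M ((TensorProduct.assoc k H H _).symm x) m =
      (LinearMap.lTensor H ((toHom k H M).flip m)) x := by
    obtain ⟨y, rfl⟩ := (TensorProduct.assoc k H H _).surjective x
    rw [LinearEquiv.symm_apply_apply]
    induction y using TensorProduct.induction_on with
    | zero => simp
    | add x y hx hy => simp only [map_add, LinearMap.add_apply, hx, hy]
    | tmul t φ => rw [toHom₃_assoc, toHom_tmul]
  rw [e, e, h]

/-- Transposed to M, the first axiom is `twist_hexagon`, the second is the counit property of the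
twisted coaction, and the third is `twist_act`. -/
theorem IsYetterDrinfeld.dual (hX : X.IsYetterDrinfeld Q) : (X.dual D).IsYetterDrinfeld Q where
  coact_coact φ := by
    apply toHom₃_injective
    intro m
    apply D.rev₂_injective
    have h := hX.twist_hexagon D (Algebra.lmul k H) (Algebra.lmul k H) (m ⊗ₜ (1 ⊗ₜ 1))
    rw [braid₁₂_tmul, braid_lmul_one] at h
    rw [contract₃_braid_twist, contract₃_braid_tensorAct]
    exact congrArg _ h
  counit_coact φ := dual_counit D hX φ
  act_coact h φ := by
    apply toHom_injective
    ext1 m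
    apply D.s.injective
    rw [s_toHom_extAct_dual, ← hX.twist_act, braid_lmul_one]
    exact (s_toHom_braid_dual D (Q.Δ h) φ m).symm

end ActCoact

end QuasiHopf

/-! ### The canonical map on duals is a morphism. -/

namespace QuasiHopf

variable {k H : Type*} [Field k] [Ring H] [Algebra k H]

namespace ActCoact

variable {M N P U : Type*} [AddCommGroup M] [Module k M]
  [AddCommGroup N] [Module k N] [AddCommGroup P] [Module k P] [AddCommGroup U] [Module k U]
  {X : ActCoact k H M} {Y : ActCoact k H N} {Z : ActCoact k H P} {Q : QuasiHopfAlgebra k H}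
  (D : TwistDatum Q)

theorem IsHom.comp {R : N →ₗ[k] P} {T : M →ₗ[k] N} (hR : Y.IsHom Z R) (hT : X.IsHom Y T) :
    X.IsHom Z (R ∘ₗ T) where
  map_act h m := by simp only [LinearMap.comp_apply, hT.map_act, hR.map_act]
  map_coact m := by
    rw [LinearMap.lTensor_comp, LinearMap.comp_apply, hT.map_coact, hR.map_coact]
    rfl

theorem IsHom.symm {e : M ≃ₗ[k] N} (he : X.IsHom Y e.toLinearMap) :
    Y.IsHom X e.symm.toLinearMap where
  map_act h n := by
    apply e.injective
    have := he.map_act h (e.symm n)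
    simp only [LinearEquiv.coe_coe, LinearEquiv.apply_symm_apply] at this ⊢
    exact this.symm
  map_coact n := by
    have := he.map_coact (e.symm n)
    rw [LinearEquiv.coe_coe, LinearEquiv.apply_symm_apply] at this
    rw [← this, ← LinearMap.comp_apply, ← LinearMap.lTensor_comp]
    simp

variable [FiniteDimensional k M] [FiniteDimensional k N]

variable (X Y) in
/-- The map `M* ⊗ N* → (N ⊗ M)*`, `μ ⊗ ν ↦ (n ⊗ m ↦ ν(F¹ · n) μ(F² · m))`. -/
def dualTensor : Module.Dual k M ⊗[k] Module.Dual k N →ₗ[k] Module.Dual k (N ⊗[k] M) :=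
  (extAct Y.act X.act D.F).dualMap ∘ₗ TensorProduct.dualDistrib k N M ∘ₗ
    (TensorProduct.comm k _ _).toLinearMap

omit [FiniteDimensional k M] [FiniteDimensional k N] in
theorem dualTensor_tmul (μ : Module.Dual k M) (ν : Module.Dual k N) (p : N ⊗[k] M) :
    X.dualTensor Y D (μ ⊗ₜ ν) p =
      TensorProduct.dualDistrib k N M (ν ⊗ₜ μ) (extAct Y.act X.act D.F p) := rfl

theorem dualTensor_extAct (z : H ⊗[k] H) (t : Module.Dual k M ⊗[k] Module.Dual k N)
    (p : N ⊗[k] M) :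
    TensorProduct.dualDistrib k N M
      (TensorProduct.comm k _ _ (extAct (X.dual D).act (Y.dual D).act z t)) p =
    TensorProduct.dualDistrib k N M (TensorProduct.comm k _ _ t)
      (extAct Y.act X.act (rev₂ D.s.toLinearMap z) p) := by
  induction z using TensorProduct.induction_on with
  | zero => simp
  | add x y hx hy => simp only [map_add, LinearMap.add_apply, hx, hy]
  | tmul a b =>
    induction t using TensorProduct.induction_on with
    | zero => simp
    | add x y hx hy => simp only [map_add, LinearMap.add_apply, hx, hy]
    | tmul μ ν =>
      induction p using TensorProduct.induction_on with
      | zero => simp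
      | add x y hx hy => simp only [map_add, hx, hy]
      | tmul n m => simp

/-- `h ⊗ (μ ⊗ ν) ↦ μ(m) ν(n) h`. -/
def eval₃ (n : N) (m : M) : H ⊗[k] (Module.Dual k M ⊗[k] Module.Dual k N) →ₗ[k] H :=
  (TensorProduct.rid k H).toLinearMap ∘ₗ LinearMap.lTensor H
    ((TensorProduct.dualDistrib k N M).flip (n ⊗ₜ m) ∘ₗ (TensorProduct.comm k _ _).toLinearMap)

omit [FiniteDimensional k M] [FiniteDimensional k N] in
@[simp] theorem eval₃_tmul (n : N) (m : M) (h : H) (μ : Module.Dual k M) (ν : Module.Dual k N) :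
    eval₃ n m (h ⊗ₜ (μ ⊗ₜ ν)) = (ν n * μ m) • h := rfl

theorem eval₃_extAct (n : N) (m : M) (a b c : H)
    (t : H ⊗[k] (Module.Dual k M ⊗[k] Module.Dual k N)) :
    eval₃ n m (extAct (Algebra.lmul k H) (extAct (X.dual D).act (Y.dual D).act)
      (a ⊗ₜ (b ⊗ₜ c)) t) =
    a * eval₃ (Y.act (D.s c) n) (X.act (D.s b) m) t := by
  induction t using TensorProduct.induction_on with
  | zero => simp
  | add x y hx hy => simp only [map_add, mul_add, hx, hy]
  | tmul h t =>
    induction t using TensorProduct.induction_on with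
    | zero => simp
    | add x y hx hy => simp only [TensorProduct.tmul_add, map_add, mul_add, hx, hy]
    | tmul μ ν => simp

omit [FiniteDimensional k N] in
theorem eval₃_braid₁₂ (n : N) (m : M) (μ : Module.Dual k M) (h : H) (ν : Module.Dual k N) :
    eval₃ n m ((X.dual D).braid₁₂ (Algebra.lmul k H) _ (μ ⊗ₜ (h ⊗ₜ ν))) =
      ν n • (D.s.symm (contract H μ ((X.twist D).coact m)) * h) := by
  rw [braid₁₂_tmul, braid_tmul, ← toHom_dual_coact]
  induction (X.dual D).coact μ using TensorProduct.induction_on with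
  | zero => simp
  | add x y hx hy =>
    simp only [map_add, TensorProduct.add_tmul, LinearMap.add_apply, add_mul, smul_add, hx, hy]
  | tmul a μ => simp [mul_smul]

/-- Transposition of the coaction formula on M* ⊗ N*. The order of the steps is reversed, so the
expression becomes the analogous formula on N ⊗ M with twisted braidings, with z, w, v reversed and
traversed from the other end. -/
theorem s_eval₃_tensor (z w v : H ⊗[k] (H ⊗[k] H)) (n : N) (m : M) (μ : Module.Dual k M)
    (ν : Module.Dual k N) :
    D.s (eval₃ n m
      (extAct (Algebra.lmul k H) (extAct (X.dual D).act (Y.dual D).act) z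
        ((X.dual D).braid₁₂ (Algebra.lmul k H) _
          (extAct (X.dual D).act (extAct (Algebra.lmul k H) (Y.dual D).act) w
            (((Y.dual D).braid (Algebra.lmul k H)).lTensor _
              (extAct (X.dual D).act (extAct (Y.dual D).act (Algebra.lmul k H)) v
                (μ ⊗ₜ (ν ⊗ₜ 1)))))))) =
      contract H (TensorProduct.dualDistrib k N M (ν ⊗ₜ μ))
        (extAct (Algebra.lmul k H) (extAct Y.act X.act) (rev₃ D.s.toLinearMap v)
          ((Y.twist D).braid₁₂ (Algebra.lmul k H) _
            (extAct Y.act (extAct (Algebra.lmul k H) X.act) (rev₃ D.s.toLinearMap w)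
              (((X.twist D).braid (Algebra.lmul k H)).lTensor _
                (extAct Y.act (extAct X.act (Algebra.lmul k H)) (rev₃ D.s.toLinearMap z)
                  (n ⊗ₜ (m ⊗ₜ 1))))))) := by
  induction z using induction3 with
  | h0 => simp
  | h2 x y hx hy => simp only [map_add, LinearMap.add_apply, hx, hy]
  | h1 a b c =>
  induction w using induction3 with
  | h0 => simp
  | h2 x y hx hy => simp only [map_add, LinearMap.add_apply, hx, hy]
  | h1 d e f =>
  induction v using induction3 with
  | h0 => simp
  | h2 x y hx hy => simp only [map_add, LinearMap.add_apply, hx, hy]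
  | h1 p q r =>
    have hl (t : H ⊗[k] Module.Dual k N) : D.s (eval₃ n m
      (extAct (Algebra.lmul k H) (extAct (X.dual D).act (Y.dual D).act) (a ⊗ₜ (b ⊗ₜ c))
        ((X.dual D).braid₁₂ (Algebra.lmul k H) _
          ((X.dual D).act d ((X.dual D).act p μ) ⊗ₜ
            extAct (Algebra.lmul k H) (Y.dual D).act (e ⊗ₜ f)
              (((Algebra.lmul k H).toLinearMap.flip r).rTensor _ t))))) =
        D.s r * D.s (toHom k H N t (Y.act (D.s f) (Y.act (D.s c) n))) * D.s e *
        contract H ((X.dual D).act d ((X.dual D).act p μ))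
          ((X.twist D).coact (X.act (D.s b) m)) * D.s a := by
      induction t using TensorProduct.induction_on with
      | zero => simp
      | add x y hx hy =>
        simp only [map_add, TensorProduct.tmul_add, LinearMap.add_apply, mul_add, add_mul, hx, hy]
      | tmul h ν' =>
        rw [LinearMap.rTensor_tmul, extAct_tmul, eval₃_extAct, eval₃_braid₁₂]
        simp only [toHom_tmul, map_smul, D.s_mul, D.s.apply_symm_apply, dual_act,
          mul_smul_comm, smul_mul_assoc, LinearMap.flip_apply, AlgHom.toLinearMap_apply,
          Algebra.coe_lmul_eq_mul, LinearMap.mul_apply', mul_assoc]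
    have hr (x : H ⊗[k] N) (h : H) (m' : M) :
        contract H (TensorProduct.dualDistrib k N M (ν ⊗ₜ μ))
        (extAct (Algebra.lmul k H) (extAct Y.act X.act) (D.s r ⊗ₜ (D.s q ⊗ₜ D.s p))
          (TensorProduct.assoc k H N M
            ((((Algebra.lmul k H).toLinearMap.flip h).rTensor _ x) ⊗ₜ m'))) =
        μ (X.act (D.s p) m') • (D.s r * contract H ((Y.dual D).act q ν) x * h) := by
      induction x using TensorProduct.induction_on with
      | zero => simp
      | add x y hx hy =>
        simp only [map_add, TensorProduct.add_tmul, mul_add, add_mul, smul_add, hx, hy]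
      | tmul u n' => simp [mul_smul, mul_assoc, smul_comm (μ _)]
    have hr' (y : H ⊗[k] M) :
        contract H (TensorProduct.dualDistrib k N M (ν ⊗ₜ μ))
        (extAct (Algebra.lmul k H) (extAct Y.act X.act) (D.s r ⊗ₜ (D.s q ⊗ₜ D.s p))
          ((Y.twist D).braid₁₂ (Algebra.lmul k H) _
            (Y.act (D.s f) (Y.act (D.s c) n) ⊗ₜ extAct (Algebra.lmul k H) X.act (D.s e ⊗ₜ D.s d)
              (((Algebra.lmul k H).toLinearMap.flip (D.s a)).rTensor _ y)))) =
        D.s r * contract H ((Y.dual D).act q ν)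
          ((Y.twist D).coact (Y.act (D.s f) (Y.act (D.s c) n))) * D.s e *
        contract H ((X.dual D).act d ((X.dual D).act p μ)) y * D.s a := by
      induction y using TensorProduct.induction_on with
      | zero => simp
      | add x y hx hy =>
        simp only [map_add, TensorProduct.tmul_add, mul_add, add_mul, hx, hy]
      | tmul u m' =>
        rw [LinearMap.rTensor_tmul, extAct_tmul, braid₁₂_tmul, braid_tmul, hr]
        simp [mul_assoc]
    simp only [extAct_tmul, LinearMap.lTensor_tmul, rev₃_tmul, LinearEquiv.coe_coe, lmul_apply_one,
      braid_tmul]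
    rw [hl, hr', toHom_dual_coact, D.s.apply_symm_apply]

omit [FiniteDimensional k M] [FiniteDimensional k N] in
-- Twisting the coaction of N ⊗ M agrees, up to the action of F on the two modules, with composing
-- the twisted coactions of N and M by the tensor product formula with Ψ for Φ. All inner factors F
-- and G cancel in pairs.
theorem twist_tensor_braid (hX : X.IsYetterDrinfeld Q) (hY : Y.IsYetterDrinfeld Q)
    (ρ : H →ₐ[k] Module.End k U) (x : (N ⊗[k] M) ⊗[k] U) :
    extAct ρ (extAct Y.act X.act) (1 ⊗ₜ D.F) (((Y.tensor Q X).twist D).braid ρ x) =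
      extAct ρ (extAct Y.act X.act) D.Ψ ((Y.twist D).braid₁₂ ρ M
        (extAct Y.act (extAct ρ X.act) D.Ψi (((X.twist D).braid ρ).lTensor N
          (extAct Y.act (extAct X.act ρ) D.Ψ (TensorProduct.assoc k N M U
            ((extAct Y.act X.act D.F).rTensor U x)))))) := by
  have hP : (Y.tensor Q X).act = Q.tensorAct Y.act X.act := rfl
  rw [twist_braid, hP, extAct_tensorAct_right, tensor_braid, assoc_extAct_tensorAct_left,
    ← extAct_ins12_assoc Y.act X.act ρ, twist_braid₂₃ D ρ Y.act, twist_braid₁₂ D ρ X.act]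
  simp only [act_act]
  have e1 : (1 ⊗ₜ D.G) * ((1 ⊗ₜ D.F) * (idΔ Q.Δ D.F * (Q.Φe * Δid Q.Δ D.G))) =
      idΔ Q.Δ D.F * (Q.Φe * Δid Q.Δ D.G) := by
    rw [← mul_assoc, Algebra.TensorProduct.tmul_mul_tmul, D.G_mul_F, one_mul,
      ← Algebra.TensorProduct.one_def, one_mul]
  have e2 : (1 ⊗ₜ D.F) * (idΔ Q.Δ D.F * (Q.Φe * Δid Q.Δ D.G)) =
      (1 ⊗ₜ D.F) * (idΔ Q.Δ D.F * Q.Φe) * Δid Q.Δ D.G := by simp only [mul_assoc]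
  have e3 : Δid Q.Δ D.G * (Δid Q.Δ D.F * (Q.Φi * idΔ Q.Δ D.G)) = Q.Φi * idΔ Q.Δ D.G := by
    rw [← mul_assoc, ← map_mul, D.G_mul_F, map_one, one_mul]
  have e4 : idΔ Q.Δ D.G * (idΔ Q.Δ D.F * (Q.Φe * Δid Q.Δ D.G)) = Q.Φe * Δid Q.Δ D.G := by
    rw [← mul_assoc, ← map_mul, D.G_mul_F, map_one, one_mul]
  rw [D.Ψ_mul_ins12, D.G_mul_Ψi_mul_F, e1, e2,
    ← act_act (extAct ρ (extAct Y.act X.act)) _ (Δid Q.Δ D.G), hY.Δid_braid₁₂,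
    act_act, e3, ← act_act (extAct Y.act (extAct ρ X.act)) _ (idΔ Q.Δ D.G), hX.idΔ_braid₂₃, act_act, e4]

/-- H-linearity is the relation F Δ(s(h)) = (reversed s-image of Δ(h)) F. For the coaction,
evaluation and s reduce the claim to `twist_tensor_braid` on one side and `s_eval₃_tensor` on the
other. -/
theorem isHom_dualTensor (hX : X.IsYetterDrinfeld Q) (hY : Y.IsYetterDrinfeld Q) :
    ((X.dual D).tensor Q (Y.dual D)).IsHom ((Y.tensor Q X).dual D) (X.dualTensor Y D) where
  map_act h t := by
    ext n m
    have := dualTensor_extAct (X := X) (Y := Y) D (Q.Δ h) t (extAct Y.act X.act D.F (n ⊗ₜ m))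
    rw [act_act, ← D.F_mul_Δ, ← act_act] at this
    exact this
  map_coact t := by
    induction t using TensorProduct.induction_on with
    | zero => simp
    | add x y hx hy => simp only [map_add, hx, hy]
    | tmul μ ν =>
      apply toHom_injective
      refine LinearMap.ext fun p => ?_
      apply D.s.injective
      -- F acts invertibly, so the test vector may be taken in the form G·q; the F built into
      -- `dualTensor` then cancels.
      obtain ⟨p, rfl⟩ : ∃ q, p = extAct Y.act X.act D.G q :=
        ⟨extAct Y.act X.act D.F p, by rw [act_act, D.G_mul_F, act_one]⟩
      rw [toHom_dual_coact, D.s.apply_symm_apply]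
      have e1 (t : H ⊗[k] (Module.Dual k M ⊗[k] Module.Dual k N)) (n : N) (m : M) :
          toHom k H _ ((X.dualTensor Y D).lTensor H t) (extAct Y.act X.act D.G (n ⊗ₜ m)) =
          eval₃ n m t := by
        induction t using TensorProduct.induction_on with
        | zero => simp
        | add x y hx hy => simp only [map_add, LinearMap.add_apply, hx, hy]
        | tmul h t =>
          rw [LinearMap.lTensor_tmul, toHom_tmul]
          change TensorProduct.dualDistrib k N M _ (extAct _ _ D.F (extAct _ _ D.G _)) • h = _
          rw [act_act, D.F_mul_G, act_one]
          rfl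
      have e2 (x : H ⊗[k] (N ⊗[k] M)) : contract H (X.dualTensor Y D (μ ⊗ₜ ν)) x =
          contract H (TensorProduct.dualDistrib k N M (ν ⊗ₜ μ))
            (extAct (Algebra.lmul k H) (extAct Y.act X.act) (1 ⊗ₜ D.F) x) := by
        induction x using TensorProduct.induction_on with
        | zero => simp
        | add x y hx hy => simp only [map_add, hx, hy]
        | tmul h p => simp [dualTensor_tmul]
      rw [e2, ← braid_lmul_one ((Y.tensor Q X).twist D), twist_tensor_braid D hX hY, LinearMap.rTensor_tmul, act_act,
        D.F_mul_G, act_one]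
      induction p using TensorProduct.induction_on with
      | zero => simp
      | add x y hx hy =>
        simp only [TensorProduct.add_tmul, map_add, hx, hy]
      | tmul n m =>
        rw [e1, TensorProduct.assoc_tmul]
        exact s_eval₃_tensor D Q.Φe Q.Φi Q.Φe n m μ ν

end ActCoact

end QuasiHopf

/-! ### The canonical maps φ* and *φ in closed form. -/

namespace QuasiHopf

variable {k H : Type*} [Field k] [Ring H] [Algebra k H]

namespace QuasiHopfAlgebra

variable (Q : QuasiHopfAlgebra k H)

/-- This is the definition of f with x¹ ⊗ x² β S(x³) read as p_R. -/
theorem sandwich_SSΔop_γ_pR : sandwich Q.SSΔop Q.γ Q.Δ.toLinearMap Q.pR = Q.f := by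
  have h (z : H ⊗[k] (H ⊗[k] H)) : sandwich Q.SSΔop Q.γ Q.Δ.toLinearMap (Q.pForm z) =
      lift3 (k := k) (fun x₁ x₂ x₃ : H => Q.SSΔop x₁ * Q.γ * Q.Δ (x₂ * Q.β * Q.S x₃))
        (by refine ⟨?_, ?_, ?_⟩ <;> intros <;> constructor <;> intros <;>
              simp [mul_add, add_mul]) z := by
    induction z using induction3 with
    | h0 => simp
    | h1 a b c => simp [pForm_tmul]
    | h2 x y hx hy => simp only [map_add, hx, hy]
  rw [pR_def, h]
  rfl

/-- Substitute γ = f Δ(α) and move the reversed f to the left. What remains is Δ of S⁻¹(X¹ β S(X²) α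
X³) = 1. -/
theorem flipSInv_γ_pL : sandwich (Q.flipSInv ∘ₗ Q.Δ.toLinearMap) (Q.flipSInv Q.γ) Q.Δ.toLinearMap
    (TensorProduct.comm k H H Q.pL) = Q.flipSInv Q.f := by
  have h (z : H ⊗[k] (H ⊗[k] H)) : sandwich (Q.flipSInv ∘ₗ Q.Δ.toLinearMap) (Q.flipSInv Q.γ)
      Q.Δ.toLinearMap (TensorProduct.comm k H H (Q.pLForm z)) =
      Q.flipSInv Q.f * Q.Δ (Q.S.symm (lift3 (k := k)
        (fun X₁ X₂ X₃ : H => X₁ * Q.β * Q.S X₂ * Q.α * X₃)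
        (by refine ⟨?_, ?_, ?_⟩ <;> intros <;> constructor <;> intros <;>
              simp [mul_add, add_mul]) z)) := by
    induction z using induction3 with
    | h0 => simp
    | h2 x y hx hy => simp only [map_add, mul_add, hx, hy]
    | h1 a b c =>
      rw [pLForm_tmul, TensorProduct.comm_tmul, sandwich_tmul, ← f_mul_Δα, flipSInv_mul,
        LinearMap.comp_apply, AlgHom.toLinearMap_apply, AlgHom.toLinearMap_apply, ← mul_assoc,
        ← Q.flipSInv_mul (Q.Δ Q.α), ← map_mul Q.Δ, ← flipSInv_f_mul_Δ, mul_assoc, ← map_mul Q.Δ,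
        lift3_tmul]
      simp [Q.antipode_symm_mul, mul_assoc]
  rw [pL_def, h, show Q.Φe = (Q.Φ : H ⊗[k] (H ⊗[k] H)) from rfl, Q.antipode_Φ,
    Q.antipode_symm_one, map_one, mul_one]

section

variable {V T : Type*} [AddCommGroup V] [Module k V] [FiniteDimensional k V]
  [AddCommGroup T] [Module k T]

theorem toHom_coevaluation (v : V) : toHom k V V (coevaluation k V 1) v = v := by
  rw [coevaluation_apply_one]
  simp only [map_sum, LinearMap.sum_apply, toHom_tmul]
  exact (Module.Basis.ofVectorSpace k V).sum_repr v

/-- Inserting a coevaluation on the right of a pairing. -/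
theorem coev_pairing (τ₁ : H →ₐ[k] Module.End k T) (τ : H →ₐ[k] Module.End k V)
    (L : T ⊗[k] V →ₗ[k] k) (t : T) (v : V) :
    TensorProduct.lid k _ (L.rTensor (Module.Dual k V)
      (Q.assocInv τ₁ τ (Q.leftDualAct τ) ((Q.coev τ).lTensor T (t ⊗ₜ 1)))) v =
      L (extAct τ₁ τ Q.pR (t ⊗ₜ v)) := by
  rw [pR_def]
  simp only [assocInv, coev, LinearMap.comp_apply, LinearMap.lTensor_tmul, LinearEquiv.coe_coe]
  have key (z : H ⊗[k] (H ⊗[k] H)) (e : V ⊗[k] Module.Dual k V)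
      (he : ∀ v, toHom k V V e v = v) :
      TensorProduct.lid k _ (L.rTensor (Module.Dual k V)
        ((TensorProduct.assoc k T V _).symm (extAct τ₁ (extAct τ (Q.leftDualAct τ)) z
          (t ⊗ₜ (τ Q.β).rTensor _ e)))) v = L (extAct τ₁ τ (Q.pForm z) (t ⊗ₜ v)) := by
    induction z using induction3 with
    | h0 => simp
    | h2 x y hx hy => simp only [map_add, LinearMap.add_apply, hx, hy]
    | h1 a b c =>
      have e1 : TensorProduct.lid k _ (L.rTensor (Module.Dual k V)
          ((TensorProduct.assoc k T V _).symm (extAct τ₁ (extAct τ (Q.leftDualAct τ))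
            (a ⊗ₜ (b ⊗ₜ c)) (t ⊗ₜ (τ Q.β).rTensor _ e)))) v =
          L (τ₁ a t ⊗ₜ τ b (τ Q.β (toHom k V V e (τ (Q.S c) v)))) := by
        -- e1 is linear in e and holds for every tensor, so induction on e is possible without `he`;
        -- the defining property of the coevaluation is used only afterwards.
        clear he
        induction e using TensorProduct.induction_on with
        | zero => simp
        | add x y hx hy =>
          simp only [map_add, TensorProduct.tmul_add, LinearMap.add_apply, hx, hy]
        | tmul v φ => simp [leftDualAct, Module.Dual.transpose_apply, mul_comm]
      rw [e1, he, pForm_tmul]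
      simp
  exact key Q.Φi _ toHom_coevaluation

/-- Inserting a coevaluation on the left of a pairing. -/
theorem coev'_pairing (τ₁ : H →ₐ[k] Module.End k T) (τ : H →ₐ[k] Module.End k V)
    (L : V ⊗[k] T →ₗ[k] k) (t : T) (v : V) :
    TensorProduct.rid k _ (L.lTensor (Module.Dual k V)
      (Q.assocMap (Q.rightDualAct τ) τ τ₁ ((Q.coev' τ).rTensor T (1 ⊗ₜ t)))) v =
      L (extAct τ τ₁ Q.pL (v ⊗ₜ t)) := by
  rw [pL_def]
  simp only [assocMap, coev', LinearMap.comp_apply, LinearMap.rTensor_tmul, LinearEquiv.coe_coe]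
  have key (z : H ⊗[k] (H ⊗[k] H)) (e : V ⊗[k] Module.Dual k V)
      (he : ∀ v, toHom k V V e v = v) :
      TensorProduct.rid k _ (L.lTensor (Module.Dual k V)
        (extAct (Q.rightDualAct τ) (extAct τ τ₁) z (TensorProduct.assoc k _ V T
          (TensorProduct.comm k V _ ((τ (Q.S.symm Q.β)).rTensor _ e) ⊗ₜ t)))) v =
      L (extAct τ τ₁ (Q.pLForm z) (v ⊗ₜ t)) := by
    induction z using induction3 with
    | h0 => simp
    | h2 x y hx hy => simp only [map_add, LinearMap.add_apply, hx, hy]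
    | h1 a b c =>
      have e1 : TensorProduct.rid k _ (L.lTensor (Module.Dual k V)
        (extAct (Q.rightDualAct τ) (extAct τ τ₁) (a ⊗ₜ (b ⊗ₜ c)) (TensorProduct.assoc k _ V T
          (TensorProduct.comm k V _ ((τ (Q.S.symm Q.β)).rTensor _ e) ⊗ₜ t)))) v =
          L (τ b (τ (Q.S.symm Q.β) (toHom k V V e (τ (Q.S.symm a) v))) ⊗ₜ τ₁ c t) := by
        clear he
        induction e using TensorProduct.induction_on with
        | zero => simp
        | add x y hx hy =>
          simp only [map_add, TensorProduct.add_tmul, LinearMap.add_apply, hx, hy]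
        | tmul v φ =>
          simp [rightDualAct, Module.Dual.transpose_apply, mul_comm, ← TensorProduct.smul_tmul']
      rw [e1, he, pLForm_tmul]
      simp [Q.antipode_symm_mul]
  exact key Q.Φe _ toHom_coevaluation

end

section

variable {M N : Type*} [AddCommGroup M] [Module k M] [FiniteDimensional k M]
  [AddCommGroup N] [Module k N] [FiniteDimensional k N]

/-- The nested evaluation `(N* ⊗ M*) ⊗ (M ⊗ N) → k`. -/
def evalLeft (ρ : H →ₐ[k] Module.End k M) (σ : H →ₐ[k] Module.End k N) :
    (Module.Dual k N ⊗[k] Module.Dual k M) ⊗[k] (M ⊗[k] N) →ₗ[k] k :=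
  Q.ev σ ∘ₗ ((TensorProduct.lid k N).toLinearMap ∘ₗ (Q.ev ρ).rTensor N).lTensor
    (Module.Dual k N) ∘ₗ (Q.assocInv (Q.leftDualAct ρ) ρ σ).lTensor (Module.Dual k N) ∘ₗ
    Q.assocMap (Q.leftDualAct σ) (Q.leftDualAct ρ) (Q.tensorAct ρ σ)

omit [FiniteDimensional k M] [FiniteDimensional k N] in
-- The two constraints and the two evaluations assemble exactly the expression `γ_eq` for γ.
theorem evalLeft_tmul (ρ : H →ₐ[k] Module.End k M) (σ : H →ₐ[k] Module.End k N)
    (ν : Module.Dual k N) (μ : Module.Dual k M) (m : M) (n : N) :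
    Q.evalLeft ρ σ ((ν ⊗ₜ μ) ⊗ₜ (m ⊗ₜ n)) =
      TensorProduct.dualDistrib k M N (μ ⊗ₜ ν) (extAct ρ σ Q.γ (m ⊗ₜ n)) := by
  rw [γ_eq]
  simp only [evalLeft, assocMap, assocInv, LinearMap.comp_apply, LinearEquiv.coe_coe,
    TensorProduct.assoc_tmul]
  generalize Q.Φe = w
  generalize Q.Φi = z
  induction w using induction3 with
  | h0 => simp
  | h2 x y hx hy => simp only [map_add, mul_add, LinearMap.add_apply, hx, hy]
  | h1 a b c =>
    rw [ididΔ_tmul, extAct_tmul, extAct_tmul]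
    simp only [tensorAct, AlgHom.comp_apply]
    generalize Q.Δ c = t
    induction t using TensorProduct.induction_on with
    | zero => simp
    | add x y hx hy =>
      simp only [map_add, mul_add, LinearMap.add_apply, TensorProduct.tmul_add, hx, hy]
    | tmul d e =>
      induction z using induction3 with
      | h0 => simp
      | h2 x y hx hy =>
        simp only [LinearMap.lTensor_tmul, LinearMap.comp_apply, map_add, add_mul,
          LinearMap.add_apply, TensorProduct.tmul_add] at hx hy ⊢
        rw [hx, hy]
      | h1 x y v =>
        simp [γForm_tmul, ev, leftDualAct, Module.Dual.transpose_apply, Q.antipode_mul]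

/-- Inserting the coevaluation makes p_R act on the pairing, and the nested evaluation contributes
γ; together they give (S ⊗ S)Δᵒᵖ(p¹) γ Δ(p²) = f. -/
theorem phiLeft_eq (X : ActCoact k H M) (Y : ActCoact k H N) :
    Q.phiLeft X.act Y.act = Y.dualTensor X Q.leftTwist := by
  have h : Q.phiLeft X.act Y.act = (TensorProduct.lid k _).toLinearMap ∘ₗ
      (Q.evalLeft X.act Y.act).rTensor _ ∘ₗ
      Q.assocInv (Q.tensorAct (Q.leftDualAct Y.act) (Q.leftDualAct X.act))
        (Q.tensorAct X.act Y.act) (Q.leftDualAct (Q.tensorAct X.act Y.act)) ∘ₗ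
      (Q.coev (Q.tensorAct X.act Y.act)).lTensor (Module.Dual k N ⊗[k] Module.Dual k M) ∘ₗ
      (TensorProduct.rid k (Module.Dual k N ⊗[k] Module.Dual k M)).symm.toLinearMap := by
    simp only [phiLeft, evalLeft, LinearMap.rTensor_comp, LinearMap.comp_assoc]
  have hL (t : Module.Dual k N ⊗[k] Module.Dual k M) (p : M ⊗[k] N) :
      Q.evalLeft X.act Y.act (t ⊗ₜ p) = TensorProduct.dualDistrib k M N
        (TensorProduct.comm k _ _ t) (extAct X.act Y.act Q.γ p) := by
    induction t using TensorProduct.induction_on with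
    | zero => simp
    | add x y hx hy => simp only [map_add, TensorProduct.add_tmul, LinearMap.add_apply, hx, hy]
    | tmul ν μ =>
      induction p using TensorProduct.induction_on with
      | zero => simp
      | add x y hx hy => simp only [map_add, TensorProduct.tmul_add, hx, hy]
      | tmul m n => exact Q.evalLeft_tmul X.act Y.act ν μ m n
  refine LinearMap.ext fun t => LinearMap.ext fun p => ?_
  rw [h]
  refine (Q.coev_pairing _ _ _ t p).trans ?_
  have hz (z : H ⊗[k] H) : Q.evalLeft X.act Y.act (extAct (Q.tensorAct (Q.leftDualAct Y.act)
      (Q.leftDualAct X.act)) (Q.tensorAct X.act Y.act) z (t ⊗ₜ p)) =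
      TensorProduct.dualDistrib k M N (TensorProduct.comm k _ _ t)
        (extAct X.act Y.act (sandwich Q.SSΔop Q.γ Q.Δ.toLinearMap z) p) := by
    induction z using TensorProduct.induction_on with
    | zero => simp
    | add x y hx hy => simp only [map_add, LinearMap.add_apply, hx, hy]
    | tmul a b =>
      rw [extAct_tmul, hL]
      refine (ActCoact.dualTensor_extAct (X := Y) (Y := X) Q.leftTwist (Q.Δ a) t _).trans ?_
      rw [sandwich_tmul, tensorAct, AlgHom.comp_apply, act_act, act_act]
      rfl
  rw [hz, sandwich_SSΔop_γ_pR]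
  rfl

/-- The nested evaluation `(M ⊗ N) ⊗ (*N ⊗ *M) → k`. -/
def evalRight (ρ : H →ₐ[k] Module.End k M) (σ : H →ₐ[k] Module.End k N) :
    (M ⊗[k] N) ⊗[k] (Module.Dual k N ⊗[k] Module.Dual k M) →ₗ[k] k :=
  Q.ev' ρ ∘ₗ ((TensorProduct.lid k (Module.Dual k M)).toLinearMap ∘ₗ
    (Q.ev' σ).rTensor (Module.Dual k M)).lTensor M ∘ₗ
    (Q.assocInv σ (Q.rightDualAct σ) (Q.rightDualAct ρ)).lTensor M ∘ₗ
    Q.assocMap ρ σ (Q.tensorAct (Q.rightDualAct σ) (Q.rightDualAct ρ))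

omit [FiniteDimensional k M] [FiniteDimensional k N] in
theorem evalRight_tmul (ρ : H →ₐ[k] Module.End k M) (σ : H →ₐ[k] Module.End k N)
    (ν : Module.Dual k N) (μ : Module.Dual k M) (m : M) (n : N) :
    Q.evalRight ρ σ ((m ⊗ₜ n) ⊗ₜ (ν ⊗ₜ μ)) =
      TensorProduct.dualDistrib k M N (μ ⊗ₜ ν) (extAct ρ σ (Q.flipSInv Q.γ) (m ⊗ₜ n)) := by
  rw [γ_eq]
  simp only [evalRight, assocMap, assocInv, LinearMap.comp_apply, LinearEquiv.coe_coe,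
    TensorProduct.assoc_tmul]
  generalize Q.Φe = w
  generalize Q.Φi = z
  induction w using induction3 with
  | h0 => simp
  | h2 x y hx hy => simp only [map_add, mul_add, LinearMap.add_apply, hx, hy]
  | h1 a b c =>
    rw [ididΔ_tmul, extAct_tmul, extAct_tmul]
    simp only [tensorAct, AlgHom.comp_apply]
    generalize Q.Δ c = t
    induction t using TensorProduct.induction_on with
    | zero => simp
    | add x y hx hy =>
      simp only [map_add, mul_add, LinearMap.add_apply, TensorProduct.tmul_add, hx, hy]
    | tmul d e =>
      induction z using induction3 with
      | h0 => simp
      | h2 x y hx hy =>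
        simp only [LinearMap.lTensor_tmul, LinearMap.comp_apply, map_add, add_mul,
          LinearMap.add_apply, TensorProduct.tmul_add] at hx hy ⊢
        rw [hx, hy]
      | h1 x y v =>
        simp [γForm_tmul, ev', rightDualAct, Module.Dual.transpose_apply, Q.antipode_symm_mul,
          mul_comm (ν _)]

/-- The mirror image: the coevaluation contributes p_L, the evaluations the reversed γ, and
`flipSInv_γ_pL` combines them. -/
theorem phiRight_eq (X : ActCoact k H M) (Y : ActCoact k H N) :
    Q.phiRight X.act Y.act = Y.dualTensor X Q.rightTwist := by
  have h : Q.phiRight X.act Y.act = (TensorProduct.rid k _).toLinearMap ∘ₗ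
      (Q.evalRight X.act Y.act).lTensor _ ∘ₗ
      Q.assocMap (Q.rightDualAct (Q.tensorAct X.act Y.act)) (Q.tensorAct X.act Y.act)
        (Q.tensorAct (Q.rightDualAct Y.act) (Q.rightDualAct X.act)) ∘ₗ
      (Q.coev' (Q.tensorAct X.act Y.act)).rTensor (Module.Dual k N ⊗[k] Module.Dual k M) ∘ₗ
      (TensorProduct.lid k (Module.Dual k N ⊗[k] Module.Dual k M)).symm.toLinearMap := by
    simp only [phiRight, evalRight, LinearMap.lTensor_comp, LinearMap.comp_assoc]
  have hL (t : Module.Dual k N ⊗[k] Module.Dual k M) (p : M ⊗[k] N) :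
      Q.evalRight X.act Y.act (p ⊗ₜ t) = TensorProduct.dualDistrib k M N
        (TensorProduct.comm k _ _ t) (extAct X.act Y.act (Q.flipSInv Q.γ) p) := by
    induction t using TensorProduct.induction_on with
    | zero => simp
    | add x y hx hy => simp only [map_add, TensorProduct.tmul_add, LinearMap.add_apply, hx, hy]
    | tmul ν μ =>
      induction p using TensorProduct.induction_on with
      | zero => simp
      | add x y hx hy => simp only [map_add, TensorProduct.add_tmul, hx, hy]
      | tmul m n => exact Q.evalRight_tmul X.act Y.act ν μ m n
  refine LinearMap.ext fun t => LinearMap.ext fun p => ?_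
  rw [h]
  refine (Q.coev'_pairing _ _ _ t p).trans ?_
  have hz (z : H ⊗[k] H) : Q.evalRight X.act Y.act (extAct (Q.tensorAct X.act Y.act)
      (Q.tensorAct (Q.rightDualAct Y.act) (Q.rightDualAct X.act)) z (p ⊗ₜ t)) =
      TensorProduct.dualDistrib k M N (TensorProduct.comm k _ _ t)
        (extAct X.act Y.act (sandwich (Q.flipSInv ∘ₗ Q.Δ.toLinearMap) (Q.flipSInv Q.γ)
          Q.Δ.toLinearMap (TensorProduct.comm k H H z)) p) := by
    induction z using TensorProduct.induction_on with
    | zero => simp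
    | add x y hx hy => simp only [map_add, LinearMap.add_apply, hx, hy]
    | tmul a b =>
      rw [extAct_tmul, hL]
      refine (ActCoact.dualTensor_extAct (X := Y) (Y := X) Q.rightTwist (Q.Δ b) t _).trans ?_
      rw [TensorProduct.comm_tmul, sandwich_tmul, tensorAct, AlgHom.comp_apply, act_act, act_act]
      rfl
  rw [hz, flipSInv_γ_pL]
  rfl

end

end QuasiHopfAlgebra

end QuasiHopf

/-! ### A one-sided inverse of the braiding. -/

namespace QuasiHopf

variable {k H : Type*} [Field k] [Ring H] [Algebra k H]

namespace QuasiHopfAlgebra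

variable (Q : QuasiHopfAlgebra k H)

/-- S⁻¹ in the first leg turns the zigzag S(a) α b β S(c) ⊗ d into this expression, so it reduces to
`zigzag₁_eq_one`. -/
theorem pLForm_idΔ_qL_mul_Φe : Q.pLForm (idΔ Q.Δ Q.qL * Q.Φe) = 1 := by
  have h (x y : H ⊗[k] (H ⊗[k] H)) : Q.pLForm (idΔ Q.Δ (Q.qForm x) * y) =
      Q.S.symm.toLinearMap.rTensor H (Q.zigzag₁ (ididΔ Q.Δ x * oneTensor k H y)) := by
    induction x using induction3 with
    | h0 => simp
    | h2 x y hx hy => simp only [map_add, add_mul, hx, hy]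
    | h1 a b c =>
      rw [show Q.qForm (a ⊗ₜ (b ⊗ₜ c)) = (Q.S a * Q.α * b) ⊗ₜ c by simp [qForm_tmul], idΔ_tmul,
        ididΔ_tmul]
      generalize Q.Δ c = t
      induction t using TensorProduct.induction_on with
      | zero => simp
      | add x y hx hy => simp only [TensorProduct.tmul_add, add_mul, map_add, hx, hy]
      | tmul d e =>
        induction y using induction3 with
        | h0 => simp
        | h2 x y hx hy => simp only [map_add, mul_add, hx, hy]
        | h1 x y z => simp [pLForm_tmul, zigzag₁, Q.antipode_mul, Q.antipode_symm_mul, mul_assoc]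
  rw [qL_def, h, zigzag₁_eq_one, Algebra.TensorProduct.one_def, LinearMap.rTensor_tmul]
  simp [Q.antipode_symm_one]

/-- `a ⊗ b ⊗ c ↦ a ⊗ b S(c) ⊗ 1`. -/
def foldLast : H ⊗[k] (H ⊗[k] H) →ₗ[k] H ⊗[k] (H ⊗[k] H) :=
  ((TensorProduct.mk k H H).flip 1 ∘ₗ LinearMap.mul' k H ∘ₗ
    Q.S.toLinearMap.lTensor H).lTensor H

@[simp] theorem foldLast_tmul (a b c : H) :
    Q.foldLast (a ⊗ₜ (b ⊗ₜ c)) = a ⊗ₜ ((b * Q.S c) ⊗ₜ 1) := rfl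

/-- Folding the third leg of Φ into the second multiplies Φ with the Φ⁻¹ hidden in p_R; only the β
of p_R survives. -/
theorem foldLast_Φe_mul_pR : Q.foldLast (Q.Φe * ins12 k H Q.pR) = 1 ⊗ₜ (Q.β ⊗ₜ 1) := by
  have h (x y : H ⊗[k] (H ⊗[k] H)) :
      Q.foldLast (x * ins12 k H (Q.pForm y)) = ins12 k H (Q.pForm (x * y)) := by
    induction x using induction3 with
    | h0 => simp
    | h2 x y hx hy => simp only [map_add, add_mul, hx, hy]
    | h1 a b c =>
      induction y using induction3 with
      | h0 => simp
      | h2 x y hx hy => simp only [map_add, mul_add, hx, hy]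
      | h1 x y z => simp [pForm_tmul, Q.antipode_mul, mul_assoc]
  rw [pR_def, h, Φe_mul_Φi, Algebra.TensorProduct.one_def, Algebra.TensorProduct.one_def,
    pForm_tmul]
  simp [Q.antipode_one]

end QuasiHopfAlgebra

namespace ActCoact

variable {M N : Type*} [AddCommGroup M] [Module k M] [AddCommGroup N] [Module k N]
  {X : ActCoact k H M} {Y : ActCoact k H N} {Q : QuasiHopfAlgebra k H}

theorem insertAct_twCoact (t : H ⊗[k] H) (m : M) (n : N) :
    X.insertAct (Y.twCoact t) (m ⊗ₜ n) = Y.braid X.act (extAct Y.act X.act t (n ⊗ₜ m)) := by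
  have hT := intertwines_orbit X.act m
  have e : n ⊗ₜ[k] m = (X.act.toLinearMap.flip m).lTensor N (n ⊗ₜ 1) := by simp
  rw [e, ← hT.lTensor Y.act, ← Y.braid_nat hT]
  rfl

theorem insertAct_extAct (t : N →ₗ[k] H ⊗[k] N) (z : H ⊗[k] H) (m : M) (n : N) :
    X.insertAct (extAct (Algebra.lmul k H) Y.act z ∘ₗ t) (m ⊗ₜ n) =
      extAct X.act Y.act z (X.insertAct t (m ⊗ₜ n)) :=
  (intertwines_orbit X.act m).rTensor Y.act z (t n)

variable (N) in
/-- `a ⊗ n ⊗ b ↦ n ⊗ b S⁻¹(a)`. -/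
def foldSInv (Q : QuasiHopfAlgebra k H) : H ⊗[k] (N ⊗[k] H) →ₗ[k] N ⊗[k] H :=
  lift2 (fun a x => ((Algebra.lmul k H).toLinearMap.flip (Q.S.symm a)).lTensor N x)
    (by constructor <;> intros <;> constructor <;> intros <;>
          simp [LinearMap.lTensor_add, LinearMap.lTensor_smul])

variable (N) in
/-- `a ⊗ b ⊗ n ↦ b S⁻¹(a) ⊗ n`. -/
def foldSInv' (Q : QuasiHopfAlgebra k H) : H ⊗[k] (H ⊗[k] N) →ₗ[k] H ⊗[k] N :=
  lift2 (fun a x => ((Algebra.lmul k H).toLinearMap.flip (Q.S.symm a)).rTensor N x)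
    (by constructor <;> intros <;> constructor <;> intros <;>
          simp [LinearMap.rTensor_add, LinearMap.rTensor_smul])

theorem braid_foldSInv (x : H ⊗[k] (N ⊗[k] H)) :
    Y.braid (Algebra.lmul k H) (foldSInv N Q x) =
      foldSInv' N Q ((Y.braid (Algebra.lmul k H)).lTensor H x) := by
  induction x using TensorProduct.induction_on with
  | zero => simp
  | add x y hx hy => simp only [map_add, hx, hy]
  | tmul a x => exact (Y.braid_nat (intertwines_orbit (Algebra.lmul k H) (Q.S.symm a)) x).symm

theorem foldSInv_extAct (z : H ⊗[k] H) (x : H ⊗[k] (N ⊗[k] H)) :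
    foldSInv N Q (extAct (Algebra.lmul k H) (extAct Y.act (Algebra.lmul k H)) (1 ⊗ₜ z) x) =
      extAct Y.act (Algebra.lmul k H) z (foldSInv N Q x) := by
  induction x using TensorProduct.induction_on with
  | zero => simp
  | add x y hx hy => simp only [map_add, hx, hy]
  | tmul a x =>
    rw [extAct_tmul, act_one]
    exact (intertwines_orbit (Algebra.lmul k H) (Q.S.symm a)).lTensor Y.act z x

variable (N) in
/-- `(b ⊗ c) ⊗ n ↦ b S(c) ⊗ n`. -/
def foldS (Q : QuasiHopfAlgebra k H) : (H ⊗[k] H) ⊗[k] N →ₗ[k] H ⊗[k] N :=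
  (LinearMap.mul' k H ∘ₗ Q.S.toLinearMap.lTensor H).rTensor N

theorem foldSInv'_assoc (a b c : H) (x : (H ⊗[k] H) ⊗[k] N) :
    foldSInv' N Q (extAct (Algebra.lmul k H) (extAct (Algebra.lmul k H) Y.act) (a ⊗ₜ (b ⊗ₜ c))
      (TensorProduct.assoc k H H N x)) =
      TensorProduct.map (Algebra.lmul k H b ∘ₗ Q.S.symm.toLinearMap ∘ₗ Algebra.lmul k H a)
        (Y.act c) (foldS N Q x) := by
  induction x using TensorProduct.induction_on with
  | zero => simp
  | add x y hx hy => simp only [map_add, hx, hy]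
  | tmul t n =>
    induction t using TensorProduct.induction_on with
    | zero => simp
    | add x y hx hy => simp only [TensorProduct.add_tmul, map_add, hx, hy]
    | tmul u v => simp [foldSInv', foldS, Q.antipode_symm_mul, mul_assoc]

/-- Under the diagonal action (h₁ b) S(h₂ c) = h₁ b S(c) S(h₂), so b and c matter only through b
S(c). -/
theorem foldS_braid (z : H ⊗[k] (H ⊗[k] H)) (n : N) :
    foldS N Q (Y.braid (Q.tensorAct (Algebra.lmul k H) (Algebra.lmul k H))
      (extAct Y.act (extAct (Algebra.lmul k H) (Algebra.lmul k H)) z (n ⊗ₜ (1 ⊗ₜ 1)))) =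
    foldS N Q (Y.braid (Q.tensorAct (Algebra.lmul k H) (Algebra.lmul k H))
      (extAct Y.act (extAct (Algebra.lmul k H) (Algebra.lmul k H)) (Q.foldLast z)
        (n ⊗ₜ (1 ⊗ₜ 1)))) := by
  induction z using induction3 with
  | h0 => simp
  | h2 x y hx hy => simp only [map_add, LinearMap.add_apply, hx, hy]
  | h1 a b c =>
    simp only [QuasiHopfAlgebra.foldLast_tmul, extAct_tmul, lmul_apply_one, braid_tmul, foldS]
    rw [← LinearMap.rTensor_comp_apply, ← LinearMap.rTensor_comp_apply]
    congr 2
    ext h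
    simp only [LinearMap.comp_apply, LinearMap.flip_apply, AlgHom.toLinearMap_apply,
      QuasiHopfAlgebra.tensorAct, AlgHom.comp_apply]
    induction Q.Δ h using TensorProduct.induction_on with
    | zero => simp
    | add x y hx hy => simp only [map_add, LinearMap.add_apply, hx, hy]
    | tmul u v => simp [Q.antipode_mul, mul_assoc]

/-- The identity h₁ β S(h₂) = ε(h) β followed by the counit axiom of the coaction. -/
theorem IsYetterDrinfeld.foldS_braid_β (hY : Y.IsYetterDrinfeld Q) (n : N) :
    foldS N Q (Y.braid (Q.tensorAct (Algebra.lmul k H) (Algebra.lmul k H))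
      (n ⊗ₜ (Q.β ⊗ₜ 1))) = Q.β ⊗ₜ n := by
  rw [braid_tmul, foldS, ← LinearMap.comp_apply, ← LinearMap.rTensor_comp]
  have e : (LinearMap.mul' k H ∘ₗ Q.S.toLinearMap.lTensor H) ∘ₗ
      (Q.tensorAct (Algebra.lmul k H) (Algebra.lmul k H)).toLinearMap.flip (Q.β ⊗ₜ 1) =
      LinearMap.toSpanSingleton k H Q.β ∘ₗ Q.ε.toLinearMap := by
    ext h
    have := Q.antipode_right h
    simp only [LinearMap.comp_apply, LinearMap.flip_apply, AlgHom.toLinearMap_apply,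
      QuasiHopfAlgebra.tensorAct, AlgHom.comp_apply, LinearMap.toSpanSingleton_apply]
    rw [← this]
    induction Q.Δ h using TensorProduct.induction_on with
    | zero => simp
    | add x y hx hy => simp only [map_add, LinearMap.add_apply, hx, hy]
    | tmul u v => simp
  rw [e, LinearMap.rTensor_comp, LinearMap.comp_apply]
  conv_rhs => rw [← hY.counit_coact n]
  induction Q.ε.toLinearMap.rTensor N (Y.coact n) using TensorProduct.induction_on with
  | zero => simp
  | add x y hx hy => simp only [map_add, TensorProduct.tmul_add, hx, hy]
  | tmul c n => simp [TensorProduct.smul_tmul]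

variable (Y Q) in
/-- `n ↦ q̃²₁ X² · (p¹ · n)₍₀₎ ⊗ q̃²₂ X³ S⁻¹(q̃¹ X¹ (p¹ · n)₍₋₁₎ p²)`. -/
def unbraid (n : N) : N ⊗[k] H :=
  foldSInv N Q (extAct (Algebra.lmul k H) (extAct Y.act (Algebra.lmul k H))
    (idΔ Q.Δ Q.qL * Q.Φe) (TensorProduct.assoc k H N H (Y.twCoact Q.pR n ⊗ₜ 1)))

/-- The hexagon merges the two successive braidings into one with H ⊗ H. There the antipode folds Φ
and p_R to β and the coaction collapses; the remaining coefficient is `pLForm` of (id ⊗ Δ)(q_L)Φ,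
which is 1. Only this composite is needed, since finite dimension supplies the other one. -/
theorem IsYetterDrinfeld.braid_unbraid (hY : Y.IsYetterDrinfeld Q) (n : N) :
    Y.braid (Algebra.lmul k H) (Y.unbraid Q n) = 1 ⊗ₜ n := by
  have e1 : TensorProduct.assoc k H N H (Y.twCoact Q.pR n ⊗ₜ 1) =
      Y.braid₁₂ (Algebra.lmul k H) H (extAct Y.act (extAct (Algebra.lmul k H) (Algebra.lmul k H))
        (ins12 k H Q.pR) (n ⊗ₜ (1 ⊗ₜ 1))) := by
    have := extAct_ins12_assoc Y.act (Algebra.lmul k H) (Algebra.lmul k H) Q.pR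
      ((n ⊗ₜ (1 : H)) ⊗ₜ (1 : H))
    rw [TensorProduct.assoc_tmul] at this
    rw [this, ← assoc_braid]
    rfl
  have e2 (z : H ⊗[k] (H ⊗[k] H)) : foldSInv' N Q (extAct (Algebra.lmul k H)
      (extAct (Algebra.lmul k H) Y.act) z (TensorProduct.assoc k H H N
        (Y.braid (Q.tensorAct (Algebra.lmul k H) (Algebra.lmul k H))
          (extAct Y.act (extAct (Algebra.lmul k H) (Algebra.lmul k H))
            (Q.Φe * ins12 k H Q.pR) (n ⊗ₜ (1 ⊗ₜ 1)))))) =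
      extAct (Algebra.lmul k H) Y.act (Q.pLForm z) (1 ⊗ₜ n) := by
    induction z using induction3 with
    | h0 => simp
    | h2 x y hx hy => simp only [map_add, LinearMap.add_apply, hx, hy]
    | h1 a b c =>
      rw [foldSInv'_assoc, foldS_braid, Q.foldLast_Φe_mul_pR, extAct_tmul, extAct_tmul,
        lmul_apply_one, lmul_apply_one, act_one, hY.foldS_braid_β]
      simp [QuasiHopfAlgebra.pLForm_tmul]
  rw [unbraid, braid_foldSInv, e1, ← act_act, ← hY.idΔ_braid₂₃, hY.hexagon, act_act, act_act, e2,
    Q.pLForm_idΔ_qL_mul_Φe, act_one]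

end ActCoact

end QuasiHopf

/-! ### The map σ as a transpose. -/

namespace QuasiHopf

variable {k H : Type*} [Field k] [Ring H] [Algebra k H]

namespace ActCoact

variable {M N : Type*} [AddCommGroup M] [Module k M] [AddCommGroup N] [Module k N]
  {X : ActCoact k H M} {Y : ActCoact k H N} {Q : QuasiHopfAlgebra k H} (D : TwistDatum Q)

theorem insertAct_comm_extAct (t : N →ₗ[k] H ⊗[k] N) (y : N ⊗[k] H) (m : M) (n : N)
    (ht : t n = TensorProduct.comm k N H (extAct Y.act (Algebra.lmul k H) D.F y)) :
    X.insertAct t (m ⊗ₜ n) = TensorProduct.comm k N M (extAct Y.act X.act D.F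
      ((X.act.toLinearMap.flip m).lTensor N y)) := by
  rw [← (intertwines_orbit X.act m).lTensor Y.act]
  change (X.act.toLinearMap.flip m).rTensor N (t n) = _
  rw [ht]
  induction extAct Y.act (Algebra.lmul k H) D.F y using TensorProduct.induction_on with
  | zero => simp
  | add x y hx hy => simp only [map_add, hx, hy]
  | tmul n a => simp

theorem insertAct_comm (t : H ⊗[k] H) (p : N ⊗[k] M) :
    X.insertAct (Y.twCoact t) (TensorProduct.comm k N M p) =
      Y.braid X.act (extAct Y.act X.act t p) := by
  induction p using TensorProduct.induction_on with
  | zero => simp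
  | add x y hx hy => simp only [map_add, hx, hy]
  | tmul n m => rw [TensorProduct.comm_tmul, insertAct_twCoact]

/-- The first map unbraids and acts by F, the second acts by G and braids: F and G cancel, and
unbraiding followed by braiding is the identity. -/
theorem IsYetterDrinfeld.insertAct_comp (hY : Y.IsYetterDrinfeld Q) {t : N →ₗ[k] H ⊗[k] N}
    (ht : ∀ n, t n = TensorProduct.comm k N H
      (extAct Y.act (Algebra.lmul k H) D.F (Y.unbraid Q n))) :
    X.insertAct (Y.twCoact D.G) ∘ₗ X.insertAct t = LinearMap.id := by
  ext m n
  change X.insertAct (Y.twCoact D.G) (X.insertAct t (m ⊗ₜ n)) = m ⊗ₜ n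
  rw [insertAct_comm_extAct D t _ m n (ht n), insertAct_comm, act_act, D.G_mul_F, act_one,
    ← Y.braid_nat (intertwines_orbit X.act m), hY.braid_unbraid]
  simp

variable [FiniteDimensional k M] [FiniteDimensional k N]

/-- The coaction of N* is the transpose of the twisted coaction F·(coaction)·G, and its outer F is
the one in the definition of `dualTensor`. What remains is braiding after G, acting by
transposition. -/
theorem dualDistrib_braid_dual (z : Module.Dual k N ⊗[k] Module.Dual k M) :
    TensorProduct.dualDistrib k M N ((Y.dual D).braid (X.dual D).act z) =
      (X.insertAct (Y.twCoact D.G)).dualMap (Y.dualTensor X D z) := by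
  induction z using TensorProduct.induction_on with
  | zero => simp
  | add x y hx hy => simp only [map_add, hx, hy]
  | tmul ν μ =>
    refine TensorProduct.ext' fun m n => ?_
    have e1 (x : H ⊗[k] Module.Dual k N) : TensorProduct.dualDistrib k M N
        (((X.dual D).act.toLinearMap.flip μ).rTensor _ x) (m ⊗ₜ n) =
        μ (X.act (D.s (toHom k H N x n)) m) := by
      induction x using TensorProduct.induction_on with
      | zero => simp
      | add x y hx hy => simp only [map_add, LinearMap.add_apply, hx, hy]
      | tmul h ν' => simp [mul_comm]
    have e2 (x : H ⊗[k] N) : TensorProduct.dualDistrib k M N (μ ⊗ₜ ν)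
        ((X.act.toLinearMap.flip m).rTensor N x) = μ (X.act (contract H ν x) m) := by
      induction x using TensorProduct.induction_on with
      | zero => simp
      | add x y hx hy => simp only [map_add, LinearMap.add_apply, hx, hy]
      | tmul h n' => simp [mul_comm]
    rw [braid_tmul, e1, toHom_dual_coact, D.s.apply_symm_apply, ← e2, LinearMap.dualMap_apply,
      dualTensor_tmul, ← insertAct_extAct]
    rfl

theorem exists_dualTensor_equiv :
    ∃ e : Module.Dual k N ⊗[k] Module.Dual k M ≃ₗ[k] Module.Dual k (M ⊗[k] N),
      e.toLinearMap = Y.dualTensor X D := by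
  let u : M ⊗[k] N ≃ₗ[k] M ⊗[k] N := LinearEquiv.ofLinearMap (extAct X.act Y.act D.F)
    (extAct X.act Y.act D.G)
    (LinearMap.ext fun x => by simp [act_act, D.F_mul_G])
    (LinearMap.ext fun x => by simp [act_act, D.G_mul_F])
  exact ⟨TensorProduct.comm k _ _ ≪≫ₗ TensorProduct.dualDistribEquiv k M N ≪≫ₗ u.dualMap, rfl⟩

omit [Ring H] [Algebra k H] in
theorem dualDistribEquiv_sum_coord {ι κ : Type*} [Fintype ι] [Fintype κ]
    (bM : Module.Basis ι k M) (bN : Module.Basis κ k N) (ν : Module.Dual k (M ⊗[k] N)) :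
    TensorProduct.dualDistribEquiv k M N
      (∑ i, ∑ j, ν (bM i ⊗ₜ[k] bN j) • (bM.coord i ⊗ₜ[k] bN.coord j)) = ν := by
  classical
  refine (bM.tensorProduct bN).ext fun p => ?_
  rw [Module.Basis.tensorProduct_apply']
  change TensorProduct.dualDistrib k M N _ _ = _
  simp [LinearMap.sum_apply, Finsupp.single_apply]

omit [Ring H] [Algebra k H] in
theorem dualDistribEquiv_symm_apply {ι κ : Type*} [Fintype ι] [Fintype κ]
    (bM : Module.Basis ι k M) (bN : Module.Basis κ k N) (ν : Module.Dual k (M ⊗[k] N)) :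
    (TensorProduct.dualDistribEquiv k M N).symm ν =
      ∑ i, ∑ j, ν (bM i ⊗ₜ[k] bN j) • (bM.coord i ⊗ₜ[k] bN.coord j) := by
  rw [LinearEquiv.symm_apply_eq, dualDistribEquiv_sum_coord]

/-- The transpose of `m ⊗ n ↦ t(n)₍₋₁₎ · m ⊗ t(n)₍₀₎` is an isomorphism of Yetter-Drinfeld modules
`M* ⊗ N* → (M ⊗ N)*`, and it is the composition of `N* ⊗ M* → (M ⊗ N)*` with the inverse braiding. -/
theorem IsYetterDrinfeld.exists_sigma_equiv (hX : X.IsYetterDrinfeld Q) (hY : Y.IsYetterDrinfeld Q)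
    {ι κ : Type*} [Fintype ι] [Fintype κ] (bM : Module.Basis ι k M) (bN : Module.Basis κ k N)
    {t : N →ₗ[k] H ⊗[k] N} (ht : ∀ n, t n = TensorProduct.comm k N H
      (extAct Y.act (Algebra.lmul k H) D.F (Y.unbraid Q n))) :
    ((X.dual D).tensor Q (Y.dual D)).IsYetterDrinfeld Q ∧
      ((X.tensor Q Y).dual D).IsYetterDrinfeld Q ∧
      ∃ e : Module.Dual k M ⊗[k] Module.Dual k N ≃ₗ[k] Module.Dual k (M ⊗[k] N),
        e.toLinearMap = (X.insertAct t).dualMap ∘ₗ TensorProduct.dualDistrib k M N ∧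
        ((X.dual D).tensor Q (Y.dual D)).IsHom ((X.tensor Q Y).dual D) e.toLinearMap ∧
        (∀ μ : Module.Dual k (M ⊗[k] N),
          e.symm μ = ∑ i, ∑ j, μ (X.insertAct (Y.twCoact D.G) (bM i ⊗ₜ[k] bN j)) •
            (bM.coord i ⊗ₜ[k] bN.coord j)) ∧
        ∃ c : Module.Dual k N ⊗[k] Module.Dual k M ≃ₗ[k] Module.Dual k M ⊗[k] Module.Dual k N,
          c.toLinearMap = (Y.dual D).braid (X.dual D).act ∧
          e.toLinearMap = Y.dualTensor X D ∘ₗ c.symm.toLinearMap := by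
  have hEK := hY.insertAct_comp (X := X) D ht
  -- In the endomorphism ring of the finite-dimensional space M ⊗ N a one-sided inverse is
  -- two-sided.
  have hKE : X.insertAct t ∘ₗ X.insertAct (Y.twCoact D.G) = LinearMap.id :=
    mul_eq_one_comm (M := Module.End k (M ⊗[k] N)).mp hEK
  let K : M ⊗[k] N ≃ₗ[k] M ⊗[k] N :=
    LinearEquiv.ofLinearMap (X.insertAct t) (X.insertAct (Y.twCoact D.G)) hKE hEK
  let e := TensorProduct.dualDistribEquiv k M N ≪≫ₗ K.dualMap
  obtain ⟨φ, hφ⟩ := exists_dualTensor_equiv (X := X) (Y := Y) D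
  -- c is defined as σ⁻¹ ∘ φ and then recognised as the braiding, so its bijectivity needs no
  -- formula for the inverse braiding on the duals.
  let c := φ ≪≫ₗ e.symm
  have hc : c.toLinearMap = (Y.dual D).braid (X.dual D).act := by
    refine LinearMap.ext fun z => (TensorProduct.dualDistribEquiv k M N).injective ?_
    refine Eq.trans ?_ (dualDistrib_braid_dual D z).symm
    rw [← hφ]
    exact (TensorProduct.dualDistribEquiv k M N).apply_symm_apply _
  have he : e.toLinearMap = Y.dualTensor X D ∘ₗ c.symm.toLinearMap := by
    rw [← hφ]
    exact LinearMap.ext fun z => (φ.apply_symm_apply (e z)).symm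
  refine ⟨(hX.dual D).tensor (hY.dual D), (hX.tensor hY).dual D, e, rfl, ?_, fun μ => ?_,
    c, hc, he⟩
  · rw [he]
    refine (isHom_dualTensor D hY hX).comp (IsHom.symm ?_)
    rw [hc]
    exact (hX.dual D).isHom_braid (hY.dual D)
  · exact dualDistribEquiv_symm_apply bM bN _

end ActCoact

end QuasiHopf

/-! ### Comparison of the formulas with `unbraid`. -/

namespace QuasiHopf

variable {k H : Type*} [Field k] [Ring H] [Algebra k H]

namespace QuasiHopfAlgebra

variable (Q : QuasiHopfAlgebra k H)

/-- The identity behind the agreement of the p_L form of *σ with the p_R, q_L form of the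
unbraiding. After multiplication by Φ, the formula for Φ (Δ ⊗ id)(p_R)(p_R ⊗ 1) produces nested
sandwiches in which Φ and Φ⁻¹ cancel; the rest is (id ⊗ Δ) of `Δ_qL_pR_eq`. -/
theorem Δ_pR_qL : sandwich ((Δid Q.Δ).toLinearMap ∘ₗ Q.Δ.toLinearMap)
    (Δid Q.Δ Q.pR * ins12 k H Q.pR) ((ins23 k H).toLinearMap ∘ₗ Q.flipS)
      (idΔ Q.Δ Q.qL * Q.Φe) * (1 ⊗ₜ Q.f) = Q.Φi * idΔ Q.Δ (Q.pLTwist Q.f) := by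
  have e1 (w z : H ⊗[k] (H ⊗[k] H)) : sandwich ((idΔ Q.Δ).toLinearMap ∘ₗ Q.Δ.toLinearMap)
      (sandwich ((idΔ Q.Δ).toLinearMap ∘ₗ Q.Δ.toLinearMap) (idΔ Q.Δ Q.pR * (1 ⊗ₜ Q.g))
        ((ins23 k H).toLinearMap ∘ₗ Q.flipS) z) ((ins23 k H).toLinearMap ∘ₗ Q.flipS) w =
      sandwich ((idΔ Q.Δ).toLinearMap ∘ₗ Q.Δ.toLinearMap) (idΔ Q.Δ Q.pR * (1 ⊗ₜ Q.g))
        ((ins23 k H).toLinearMap ∘ₗ Q.flipS) (w * z) := by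
    induction w using TensorProduct.induction_on with
    | zero => simp
    | add x y hx hy => simp only [map_add, add_mul, hx, hy]
    | tmul a s =>
      induction z using TensorProduct.induction_on with
      | zero => simp [sandwich]
      | add x y hx hy =>
        simp only [sandwich_tmul, map_add, mul_add, add_mul] at hx hy ⊢
        rw [hx, hy]
      | tmul b t => simp [flipS_mul, mul_assoc]
  have e2 (w : H ⊗[k] (H ⊗[k] H)) : Q.Φe * sandwich ((Δid Q.Δ).toLinearMap ∘ₗ Q.Δ.toLinearMap)
      (Δid Q.Δ Q.pR * ins12 k H Q.pR) ((ins23 k H).toLinearMap ∘ₗ Q.flipS) w =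
      sandwich ((idΔ Q.Δ).toLinearMap ∘ₗ Q.Δ.toLinearMap)
        (Q.Φe * Δid Q.Δ Q.pR * ins12 k H Q.pR) ((ins23 k H).toLinearMap ∘ₗ Q.flipS) w := by
    induction w using TensorProduct.induction_on with
    | zero => simp
    | add x y hx hy => simp only [map_add, mul_add, hx, hy]
    | tmul a s =>
      simp only [sandwich_tmul, LinearMap.comp_apply, AlgHom.toLinearMap_apply]
      simp only [← mul_assoc, idΔ_mul_Φe]
  have e3 (w : H ⊗[k] H) : sandwich ((idΔ Q.Δ).toLinearMap ∘ₗ Q.Δ.toLinearMap)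
      (idΔ Q.Δ Q.pR * (1 ⊗ₜ Q.g)) ((ins23 k H).toLinearMap ∘ₗ Q.flipS) (idΔ Q.Δ w) *
        (1 ⊗ₜ Q.f) = idΔ Q.Δ (sandwich Q.Δ.toLinearMap Q.pR Q.Sr w) := by
    induction w using TensorProduct.induction_on with
    | zero => simp
    | add x y hx hy => simp only [map_add, add_mul, hx, hy]
    | tmul a b =>
      have h : (1 : H) ⊗ₜ[k] Q.g * (ins23 k H (Q.flipS (Q.Δ b)) * (1 ⊗ₜ Q.f)) =
          idΔ Q.Δ (Q.Sr b) := by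
        change (1 : H) ⊗ₜ[k] Q.g * ((1 ⊗ₜ Q.flipS (Q.Δ b)) * (1 ⊗ₜ Q.f)) = 1 ⊗ₜ Q.Δ (Q.S b)
        simp only [Algebra.TensorProduct.tmul_mul_tmul, one_mul]
        rw [← SSΔop_apply, ← mul_assoc, g_mul_SSΔop, mul_assoc, g_mul_f, mul_one]
      rw [idΔ_tmul, sandwich_tmul, sandwich_tmul, map_mul, map_mul, ← h]
      simp [mul_assoc]
  rw [← one_mul (sandwich _ _ _ _ * _), ← Φi_mul_Φe, mul_assoc, ← mul_assoc Q.Φe, e2,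
    Φe_mul_Δ_pR_mul_pR, e1, mul_assoc (idΔ _ _), Φe_mul_Φi, mul_one, e3, Δ_qL_pR_eq]

end QuasiHopfAlgebra

namespace ActCoact

variable {N : Type*} [AddCommGroup N] [Module k N]
  {Y : ActCoact k H N} {Q : QuasiHopfAlgebra k H}

theorem sigmaLeftInsert_eq (n : N) : Y.sigmaLeftInsert Q n =
    TensorProduct.comm k N H (extAct Y.act (Algebra.lmul k H) Q.f (Y.unbraid Q n)) := by
  have e (w : H ⊗[k] (H ⊗[k] H)) (x : H ⊗[k] N) : lift3 (k := k)
      (fun w₁ w₂ w₃ : H =>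
        TensorProduct.map (Algebra.lmul k H w₃ ∘ₗ Q.S.symm.toLinearMap ∘ₗ Algebra.lmul k H w₁)
          (Y.act w₂))
      (by
        refine ⟨?_, ?_, ?_⟩ <;> intros <;> constructor <;> intros <;>
          ext <;> simp [TensorProduct.add_tmul, TensorProduct.tmul_add, mul_add,
            ← TensorProduct.smul_tmul']) w x =
      TensorProduct.comm k N H (foldSInv N Q (extAct (Algebra.lmul k H)
        (extAct Y.act (Algebra.lmul k H)) w (TensorProduct.assoc k H N H (x ⊗ₜ 1)))) := by
    induction w using induction3 with
    | h0 => simp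
    | h2 x y hx hy => simp only [map_add, LinearMap.add_apply, hx, hy]
    | h1 a b c =>
      induction x using TensorProduct.induction_on with
      | zero => simp
      | add x y hx hy => simp only [map_add, TensorProduct.add_tmul, hx, hy]
      | tmul h n => simp [foldSInv]
  rw [unbraid, ← foldSInv_extAct, act_act, ← mul_assoc, ← e]
  rw [sigmaLeftInsert]
  generalize (1 : H) ⊗ₜ[k] Q.f * idΔ Q.Δ Q.qL * Q.Φe = w
  induction w using induction3 with
  | h0 => simp
  | h2 x y hx hy => simp only [map_add, LinearMap.add_apply, hx, hy]
  | h1 a b c => simp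

variable (Y Q) in
/-- `a ⊗ b ⊗ c ↦ q¹ (a · n)₍₋₁₎ b ⊗ S⁻¹(c) q² · (a · n)₍₀₎`. -/
def qRCoact (n : N) : H ⊗[k] (H ⊗[k] H) →ₗ[k] H ⊗[k] N :=
  lift3 (fun a b c => extAct (Algebra.lmul k H) Y.act ((1 ⊗ₜ Q.S.symm c) * Q.qR)
      (Y.twCoact (a ⊗ₜ b) n))
    (by
      refine ⟨?_, ?_, ?_⟩ <;> intros <;> constructor <;> intros <;>
        simp [twCoact, TensorProduct.add_tmul, TensorProduct.tmul_add, add_mul,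
          ← TensorProduct.smul_tmul'])

theorem qRCoact_tmul (n : N) (t : H ⊗[k] H) (c : H) :
    Y.qRCoact Q n (TensorProduct.assoc k H H H (t ⊗ₜ c)) =
      extAct (Algebra.lmul k H) Y.act ((1 ⊗ₜ Q.S.symm c) * Q.qR) (Y.twCoact t n) := by
  induction t using TensorProduct.induction_on with
  | zero => simp [twCoact]
  | add x y hx hy =>
    simp only [TensorProduct.add_tmul, map_add, hx, hy, twCoact, LinearMap.comp_apply,
      LinearMap.add_apply]
  | tmul a b => rfl

theorem IsYetterDrinfeld.extAct_twCoact (hY : Y.IsYetterDrinfeld Q) (h : H) (t : H ⊗[k] H)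
    (n : N) : extAct (Algebra.lmul k H) Y.act (Q.Δ h) (Y.twCoact t n) =
      Y.twCoact (Q.Δ h * t) n := by
  simp only [twCoact, LinearMap.comp_apply]
  rw [hY.extAct_braid, act_act]

theorem twCoact_act (t : H ⊗[k] H) (a : H) (n : N) :
    Y.twCoact t (Y.act a n) = Y.twCoact (t * (a ⊗ₜ 1)) n := by
  simp only [twCoact, LinearMap.comp_apply, LinearMap.flip_apply, TensorProduct.mk_apply]
  rw [← act_act, extAct_tmul, act_one]

theorem rTensor_twCoact (t : H ⊗[k] H) (u : H) (n : N) :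
    ((Algebra.lmul k H).toLinearMap.flip u).rTensor N (Y.twCoact t n) =
      Y.twCoact (t * (1 ⊗ₜ u)) n := by
  have hT := intertwines_orbit (Algebra.lmul k H) u
  simp only [twCoact, LinearMap.comp_apply, LinearMap.flip_apply, TensorProduct.mk_apply]
  rw [Y.braid_nat hT, hT.lTensor Y.act, ← act_act, extAct_tmul, act_one, lmul_apply_one]
  simp

/-- Linearity of the coaction carries a coproduct from before it to after it, where it meets q_R and
forms `qRConj`. -/
theorem IsYetterDrinfeld.qRCoact_Δid_mul (hY : Y.IsYetterDrinfeld Q) (t s : H ⊗[k] H) (c : H)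
    (n : N) : Y.qRCoact Q n (Δid Q.Δ t * TensorProduct.assoc k H H H (s ⊗ₜ c)) =
      extAct (Algebra.lmul k H) Y.act ((1 ⊗ₜ Q.S.symm c) * Q.qRConj t) (Y.twCoact s n) := by
  induction t using TensorProduct.induction_on with
  | zero => simp
  | add x y hx hy => simp only [map_add, add_mul, mul_add, LinearMap.add_apply, hx, hy]
  | tmul u v =>
    have e : Δid Q.Δ (u ⊗ₜ v) * TensorProduct.assoc k H H H (s ⊗ₜ c) =
        TensorProduct.assoc k H H H ((Q.Δ u * s) ⊗ₜ (v * c)) :=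
      (map_mul (Algebra.TensorProduct.assoc k k k H H H) (Q.Δ u ⊗ₜ v) (s ⊗ₜ c)).symm.trans
        (by rw [Algebra.TensorProduct.tmul_mul_tmul]; rfl)
    rw [e, qRCoact_tmul, ← hY.extAct_twCoact, act_act, QuasiHopfAlgebra.qRConj_tmul,
      Q.antipode_symm_mul]
    simp only [← mul_assoc, Algebra.TensorProduct.tmul_mul_tmul, one_mul]

/-- By naturality of q_R a left factor b is the same as (Δ ⊗ id)Δ(b) inside. This lets both legs of
f be moved into the argument of `qRCoact`. -/
theorem IsYetterDrinfeld.rTensor_qRCoact (hY : Y.IsYetterDrinfeld Q) (z : H ⊗[k] (H ⊗[k] H))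
    (a b : H) (n : N) :
    (Algebra.lmul k H b).rTensor N (Y.qRCoact Q (Y.act a n) z) =
      Y.qRCoact Q n (Δid Q.Δ (Q.Δ b) * z * (a ⊗ₜ 1)) := by
  induction z using induction3 with
  | h0 => simp
  | h2 x y hx hy => simp only [map_add, add_mul, mul_add, hx, hy]
  | h1 u v w =>
    have e1 : Δid Q.Δ (Q.Δ b) * (u ⊗ₜ (v ⊗ₜ w)) * (a ⊗ₜ 1) =
        Δid Q.Δ (Q.Δ b) * TensorProduct.assoc k H H H (((u ⊗ₜ v) * (a ⊗ₜ 1)) ⊗ₜ w) := by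
      rw [mul_assoc]
      simp
    have e2 (x : H ⊗[k] N) : (Algebra.lmul k H b).rTensor N x =
        extAct (Algebra.lmul k H) Y.act (b ⊗ₜ 1) x := by
      rw [extAct_tmul_eq, map_one]
      rfl
    rw [e1, hY.qRCoact_Δid_mul, Q.qR_nat, ← twCoact_act, e2]
    change extAct (Algebra.lmul k H) Y.act (b ⊗ₜ 1) (extAct (Algebra.lmul k H) Y.act
      ((1 ⊗ₜ Q.S.symm w) * Q.qR) (Y.twCoact (u ⊗ₜ v) (Y.act a n))) = _
    rw [act_act]
    simp only [← mul_assoc, Algebra.TensorProduct.tmul_mul_tmul, one_mul, mul_one]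

theorem IsYetterDrinfeld.sigmaRightInsert_apply (hY : Y.IsYetterDrinfeld Q) (n : N) :
    Y.sigmaRightInsert Q n = Q.S.symm.toLinearMap.rTensor N
      (Y.qRCoact Q n (Q.Φi * idΔ Q.Δ (Q.pLTwist Q.f))) := by
  have e (z : H ⊗[k] (H ⊗[k] H)) (n : N) : lift3 (k := k)
      (fun w₁ w₂ w₃ : H =>
        (Y.act (Q.S.symm w₃)).lTensor H ∘ₗ extAct (Algebra.lmul k H) Y.act Q.qR ∘ₗ
          Y.twCoact (w₁ ⊗ₜ[k] w₂))
      (by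
        refine ⟨?_, ?_, ?_⟩ <;> intros <;> constructor <;> intros <;>
          ext n <;>
          simp [twCoact, TensorProduct.add_tmul, TensorProduct.tmul_add, ← TensorProduct.smul_tmul',
            LinearMap.lTensor_add, LinearMap.lTensor_smul]) z n = Y.qRCoact Q n z := by
    induction z using induction3 with
    | h0 => simp
    | h2 x y hx hy => simp only [map_add, LinearMap.add_apply, hx, hy]
    | h1 a b c =>
      have e2 (x : H ⊗[k] N) : (Y.act (Q.S.symm c)).lTensor H x =
          extAct (Algebra.lmul k H) Y.act (1 ⊗ₜ Q.S.symm c) x := by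
        rw [extAct_tmul_eq, map_one]
        rfl
      rw [lift3_tmul, LinearMap.comp_apply, LinearMap.comp_apply, e2, act_act]
      rfl
  rw [sigmaRightInsert]
  induction Q.f using TensorProduct.induction_on with
  | zero => simp
  | add x y hx hy => simp only [map_add, mul_add, LinearMap.add_apply, hx, hy]
  | tmul a b =>
    rw [lift2_tmul, LinearMap.comp_apply, LinearMap.comp_apply, e, LinearMap.rTensor_comp_apply,
      hY.rTensor_qRCoact, ← mul_assoc, ← Q.Φi_mul_idΔ, QuasiHopfAlgebra.pLTwist_tmul,
      map_mul (idΔ Q.Δ), map_mul (idΔ Q.Δ), idΔ_tmul, map_one]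
    simp only [mul_assoc]

/-- A further p_R is introduced by means of (1 ⊗ S⁻¹(p²)) q_R Δ(p¹) = 1. This makes q_R appear and
brings the unbraiding into the shape that `Δ_pR_qL` treats. -/
theorem IsYetterDrinfeld.comm_unbraid (hY : Y.IsYetterDrinfeld Q) (n : N) :
    TensorProduct.comm k N H (extAct Y.act (Algebra.lmul k H) (Q.flipSInv Q.f) (Y.unbraid Q n)) =
      Q.S.symm.toLinearMap.rTensor N (Y.qRCoact Q n
        (sandwich ((Δid Q.Δ).toLinearMap ∘ₗ Q.Δ.toLinearMap)
          (Δid Q.Δ Q.pR * ins12 k H Q.pR) ((ins23 k H).toLinearMap ∘ₗ Q.flipS)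
            (idΔ Q.Δ Q.qL * Q.Φe) * (1 ⊗ₜ Q.f))) := by
  rw [unbraid]
  generalize idΔ Q.Δ Q.qL * Q.Φe = w
  induction Q.f using TensorProduct.induction_on with
  | zero => simp
  | add x y hx hy =>
    simp only [map_add, mul_add, LinearMap.add_apply, TensorProduct.tmul_add, hx, hy]
  | tmul c d =>
  induction w using induction3 with
  | h0 => simp
  | h2 x y hx hy => simp only [map_add, add_mul, LinearMap.add_apply, hx, hy]
  | h1 u v w =>
    have e1 (x : H ⊗[k] N) : TensorProduct.comm k N H (extAct Y.act (Algebra.lmul k H)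
        (Q.flipSInv (c ⊗ₜ d)) (foldSInv N Q (extAct (Algebra.lmul k H)
          (extAct Y.act (Algebra.lmul k H)) (u ⊗ₜ (v ⊗ₜ w))
            (TensorProduct.assoc k H N H (x ⊗ₜ 1))))) =
        Q.S.symm.toLinearMap.rTensor N (extAct (Algebra.lmul k H) Y.act
          (u ⊗ₜ Q.S.symm (Q.S v * d))
          (((Algebra.lmul k H).toLinearMap.flip (Q.S w * c)).rTensor N x)) := by
      induction x using TensorProduct.induction_on with
      | zero => simp
      | add x y hx hy => simp only [map_add, TensorProduct.add_tmul, hx, hy]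
      | tmul h n => simp [foldSInv, Q.antipode_symm_mul, mul_assoc]
    have e2 (t : H ⊗[k] H) (a b : H) : ins12 k H t * (1 ⊗ₜ (a ⊗ₜ b)) =
        TensorProduct.assoc k H H H ((t * (1 ⊗ₜ a)) ⊗ₜ b) := by
      induction t using TensorProduct.induction_on with
      | zero => simp
      | add x y hx hy => simp only [map_add, add_mul, TensorProduct.add_tmul, hx, hy]
      | tmul x y => simp
    have e3 (t : H ⊗[k] H) : Q.qRConj (Q.Δ u * t) = (u ⊗ₜ 1) * Q.qRConj t := by
      have e4 (a b : H) (s : H ⊗[k] H) : Q.qRConj (s * (a ⊗ₜ b)) =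
          (1 ⊗ₜ Q.S.symm b) * Q.qRConj s * Q.Δ a := by
        induction s using TensorProduct.induction_on with
        | zero => simp
        | add x y hx hy => simp only [map_add, add_mul, mul_add, hx, hy]
        | tmul x y =>
          rw [Algebra.TensorProduct.tmul_mul_tmul, QuasiHopfAlgebra.qRConj_tmul,
            QuasiHopfAlgebra.qRConj_tmul, map_mul Q.Δ, Q.antipode_symm_mul]
          simp only [← mul_assoc, Algebra.TensorProduct.tmul_mul_tmul, one_mul]
      induction t using TensorProduct.induction_on with
      | zero => simp
      | add x y hx hy => simp only [map_add, mul_add, hx, hy]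
      | tmul a b =>
        rw [e4, Q.qR_nat, QuasiHopfAlgebra.qRConj_tmul]
        simp only [← mul_assoc, Algebra.TensorProduct.tmul_mul_tmul, one_mul, mul_one]
    rw [e1, rTensor_twCoact, sandwich_tmul]
    simp only [LinearMap.comp_apply, AlgHom.toLinearMap_apply, ins23_apply,
      QuasiHopfAlgebra.flipS_tmul]
    rw [mul_assoc, Algebra.TensorProduct.tmul_mul_tmul, Algebra.TensorProduct.tmul_mul_tmul,
      one_mul, mul_assoc (_ : H ⊗[k] (H ⊗[k] H)), mul_assoc, e2, ← mul_assoc, ← map_mul,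
      hY.qRCoact_Δid_mul, e3, Q.qRConj_pR, mul_one, Algebra.TensorProduct.tmul_mul_tmul,
      one_mul, mul_one]

theorem IsYetterDrinfeld.sigmaRightInsert_eq (hY : Y.IsYetterDrinfeld Q) (n : N) :
    Y.sigmaRightInsert Q n = TensorProduct.comm k N H
      (extAct Y.act (Algebra.lmul k H) (Q.flipSInv Q.f) (Y.unbraid Q n)) := by
  rw [hY.comm_unbraid, hY.sigmaRightInsert_apply, Q.Δ_pR_qL]

end ActCoact

end QuasiHopf

end

/-! ### The theorem, as two instances of the statement for twist data. -/

theorem proposition4 {k H M N : Type*} [Field k] [Ring H] [Algebra k H]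
    (Q : QuasiHopf.QuasiHopfAlgebra k H)
    [AddCommGroup M] [Module k M] [FiniteDimensional k M]
    [AddCommGroup N] [Module k N] [FiniteDimensional k N]
    (X : QuasiHopf.ActCoact k H M) (hX : X.IsYetterDrinfeld Q)
    (Y : QuasiHopf.ActCoact k H N) (hY : Y.IsYetterDrinfeld Q)
    {ι κ : Type*} [Fintype ι] [Fintype κ] (bM : Module.Basis ι k M) (bN : Module.Basis κ k N) :
    -- the map `σ* : M* ⊗ N* → (M ⊗ N)*`
    (((X.leftDual Q).tensor Q (Y.leftDual Q)).IsYetterDrinfeld Q ∧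
      ((X.tensor Q Y).leftDual Q).IsYetterDrinfeld Q ∧
      ∃ e : Module.Dual k M ⊗[k] Module.Dual k N ≃ₗ[k] Module.Dual k (M ⊗[k] N),
        -- `σ*` is bijective and a morphism of Yetter-Drinfeld modules
        e.toLinearMap = X.sigmaLeft Q Y ∧
        ((X.leftDual Q).tensor Q (Y.leftDual Q)).IsHom ((X.tensor Q Y).leftDual Q)
          e.toLinearMap ∧
        -- `σ*⁻¹(μ) = ⟨μ, (g¹ · nⱼ)₍₋₁₎ g² · mᵢ ⊗ (g¹ · nⱼ)₍₀₎⟩ mⁱ ⊗ nʲ`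
        (∀ μ : Module.Dual k (M ⊗[k] N),
          e.symm μ = ∑ i, ∑ j, μ (X.insertAct (Y.twCoact Q.g) (bM i ⊗ₜ[k] bN j)) •
            (bM.coord i ⊗ₜ[k] bN.coord j)) ∧
        -- `σ* = φ*_{N,M} ∘ c⁻¹_{N*,M*}`
        ∃ c : Module.Dual k N ⊗[k] Module.Dual k M ≃ₗ[k] Module.Dual k M ⊗[k] Module.Dual k N,
          c.toLinearMap = (Y.leftDual Q).braid (X.leftDual Q).act ∧
          e.toLinearMap = Q.phiLeft X.act Y.act ∘ₗ c.symm.toLinearMap) ∧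
    -- the map `*σ : *M ⊗ *N → *(M ⊗ N)`
    (((X.rightDual Q).tensor Q (Y.rightDual Q)).IsYetterDrinfeld Q ∧
      ((X.tensor Q Y).rightDual Q).IsYetterDrinfeld Q ∧
      ∃ e : Module.Dual k M ⊗[k] Module.Dual k N ≃ₗ[k] Module.Dual k (M ⊗[k] N),
        -- `*σ` is bijective and a morphism of Yetter-Drinfeld modules
        e.toLinearMap = X.sigmaRight Q Y ∧
        ((X.rightDual Q).tensor Q (Y.rightDual Q)).IsHom ((X.tensor Q Y).rightDual Q)
          e.toLinearMap ∧
        -- `*σ⁻¹(ν) = ⟨ν, (S⁻¹(g²) · nⱼ)₍₋₁₎ S⁻¹(g¹) · mᵢ ⊗ (S⁻¹(g²) · nⱼ)₍₀₎⟩ mⁱ ⊗ nʲ`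
        (∀ ν : Module.Dual k (M ⊗[k] N),
          e.symm ν = ∑ i, ∑ j, ν (X.insertAct (Y.twCoact (Q.flipSInv Q.g))
            (bM i ⊗ₜ[k] bN j)) • (bM.coord i ⊗ₜ[k] bN.coord j)) ∧
        -- `*σ = *φ_{N,M} ∘ c⁻¹_{*N,*M}`
        ∃ c : Module.Dual k N ⊗[k] Module.Dual k M ≃ₗ[k] Module.Dual k M ⊗[k] Module.Dual k N,
          c.toLinearMap = (Y.rightDual Q).braid (X.rightDual Q).act ∧
          e.toLinearMap = Q.phiRight X.act Y.act ∘ₗ c.symm.toLinearMap) := by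
  constructor
  -- `leftDual` and `sigmaLeft` unfold to the general construction for `leftTwist`; only φ* and the
  -- formula for the insertion need lemmas. The second half is the same with `rightTwist`.
  · rw [Q.phiLeft_eq X Y]
    exact hX.exists_sigma_equiv Q.leftTwist hY bM bN fun n => Y.sigmaLeftInsert_eq n
  · rw [Q.phiRight_eq X Y]
    exact hX.exists_sigma_equiv Q.rightTwist hY bM bN fun n => hY.sigmaRightInsert_eq n
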